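/- Let $B_0>0$, $0<\varepsilon<1$, $\gamma\in\mathbb N$, $J=\begin{pmatrix}0&1\\-1&0\end{pmatrix}$, $A_0(x)=\frac{B_0}{2}Jx$, and let $H_0=(-i\nabla-A_0)^2$ be the Landau Hamiltonian on $L^2(\mathbb R^2)$. Let $P_l$ be the orthogonal projection onto the eigenspace of $H_0$ with eigenvalue $B_0(2l+1)$, $l\in\mathbb N=\{0,1,\dots\}$. For cofinite $I\subset\mathbb N$ and $\zeta\in\mathbb C\setminus B_0(2I+1)$ let $$M_{I,\zeta}=\sum_{l\in I}\frac{P_l}{B_0(2l+1)-\zeta}.$$ For $\rho\ge 0$ let $W^{\gamma,\infty}_{(\rho)}$ be the space of real functions $f$ on $\mathbb R^2$ whose weak derivatives up to order $\gamma$ exist and for which $\|f\|_{\gamma,\rho}=\sum_{j\le\gamma}\operatorname{ess\,sup}_x(1+\|x\|)^{\rho}\|\nabla^{\otimes j}f(x)\|$ is finite. A pair $(B_\varepsilon,V_\varepsilon)$ is $(\gamma,\varepsilon)$ tame if $V_\varepsilon\in W^{\gamma,\infty}_{(\varepsilon)}$ and $B_\varepsilon\in W^{\gamma,\infty}_{(1+\varepsilon)}$.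 For such a pair put $$A_\varepsilon=B_\varepsilon*\frac{J\,\cdot}{2\pi\|\cdot\|^2},\qquad W_\varepsilon=\|A_\varepsilon\|^2+V_\varepsilon,\qquad H=(-i\nabla-A_0+A_\varepsilon)^2+V_\varepsilon,\qquad H_\varepsilon=H-H_0.$$ For $x_0\in\mathbb R^2$, $d\le\gamma$ and $\kappa\in\mathbb R$ put $$A^{(d)}_{\varepsilon,x_0}=\big((-i)^d\nabla^{\otimes d}B_\varepsilon\big)(\cdot+x_0)*\frac{J\,\cdot}{2\pi\|\cdot\|^2},\qquad W^{(d)}_{\varepsilon,x_0}=\big((-i)^d\nabla^{\otimes d}W_\varepsilon\big)(\cdot+x_0),$$ $$H^{(d)}_{\varepsilon,x_0}=\kappa\,A^{(d)}_{\varepsilon,x_0}\cdot(-i\nabla-A_0)+W^{(d)}_{\varepsilon,x_0},$$ where the scalar product contracts the last tensor component of $A^{(d)}_{\varepsilon,x_0}$, so that $H^{(d)}_{\varepsilon,x_0}$ maps complex valued functions to $\mathbb C^{2^d}$-valued functions. Let $b_1(x,y)=\|x-y\|^{-1}$ if $\|x-y\|<1/\sqrt{B_0}$ and $b_1(x,y)=0$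 otherwise, and let $n_0$ be the smallest integer with $2n_0\varepsilon>1$. **Lemma.** Let $\gamma,\varepsilon,B_0,\kappa$ and a cofinite set $I\subset\mathbb N$ be given, and let $R\ge0$. There are a measurable function $F\colon\mathbb C\to\mathbb R$ that is bounded on every compact subset of $\mathbb C\setminus B_0(2I+1)$ and a real number $\lambda>0$ such that for every $(\gamma,\varepsilon)$ tame pair with $\|B_\varepsilon\|_{\gamma,1+\varepsilon}\le R$ and $\|V_\varepsilon\|_{\gamma,\varepsilon}\le R$ and every $\zeta\in\mathbb C\setminus B_0(2I+1)$, the series defining $M_{I,\zeta}$ converges unconditionally in operator norm and the following holds. 1. For all $d\le\gamma$ and $x_0\in\mathbb R^2$, $H^{(d)}_{\varepsilon,x_0}M_{I,\zeta}$ is a bounded operator from $L^2(\mathbb R^2)$ to $L^2(\mathbb R^2,\mathbb C^{2^d})$ with operator norm at most $F(\zeta)$ (so bounded independently of $x_0$). It has an integral kernel $t$ that satisfies $$\|t(x,y)\|\le F(\zeta)\,\frac{b_1(x,y)+e^{-\lambda\|x-y\|^2}}{(1+\|x+x_0\|)^{\varepsilon}}\qquad\text{for all }x\ne y,$$ and that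 is nice: $t(x,\cdot)$ and $t(\cdot,x)$ are in $L^1(\mathbb R^2)$ for every $x$, with norms bounded independently of $x$. 2. $H_\varepsilon M_{I,\zeta}$ is a bounded operator on $L^2(\mathbb R^2)$ in the $4n_0$-Schatten class, and its $4n_0$-Schatten norm satisfies $\|H_\varepsilon M_{I,\zeta}\|_{4n_0}\le F(\zeta)$. -/

import Mathlib

open MeasureTheory
open scoped ENNReal ComplexConjugate

noncomputable section

namespace Landau

/-- The Euclidean plane. -/
abbrev Plane : Type := EuclideanSpace ℝ (Fin 2)

/-- Square integrable functions on the plane with values in `F`. -/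
abbrev L2 (F : Type) [NormedAddCommGroup F] : Type := Lp F 2 (volume : Measure Plane)

/-- The tensors `(ℂ²)^{⊗ d} = ℂ^{2^d}`, with components indexed by `{1,2}^d` and the 2-norm. -/
abbrev Tens (d : ℕ) : Type := EuclideanSpace ℂ (Fin d → Fin 2)

/-- The `k`-th standard unit vector. -/
def e (k : Fin 2) : Plane := EuclideanSpace.single k 1

/-- The rotation `J = ((0, 1), (-1, 0))`. -/
def J (x : Plane) : Plane := !₂[x 1, -x 0]

/-- Test functions: smooth with compact support. -/
def IsTest {F : Type} [NormedAddCommGroup F] [NormedSpace ℝ F] (φ : Plane → F) : Prop :=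
  ContDiff ℝ ((⊤ : ℕ∞) : WithTop ℕ∞) φ ∧ HasCompactSupport φ

/-! ### Weak derivatives and weighted Sobolev spaces -/

/-- `g` is the weak derivative `∂_{θ_1} ⋯ ∂_{θ_j} f`. -/
def IsWeakDeriv {j : ℕ} (θ : Fin j → Fin 2) (f g : Plane → ℝ) : Prop :=
  LocallyIntegrable f volume ∧ LocallyIntegrable g volume ∧
    ∀ φ : Plane → ℝ, IsTest φ →
      ∫ x, f x * iteratedFDeriv ℝ j φ x (fun i => e (θ i)) = (-1) ^ j * ∫ x, g x * φ x

open Classical in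
/-- The weak derivative `∂_{θ_1} ⋯ ∂_{θ_j} f` (unique almost everywhere), if it exists. -/
def weakDeriv {j : ℕ} (θ : Fin j → Fin 2) (f : Plane → ℝ) : Plane → ℝ :=
  if h : ∃ g, IsWeakDeriv θ f g then h.choose else 0

/-- The norm of `W^{γ,∞}_{(ρ)}(ℝ², ℝ)`: the sum over `j ≤ γ` of the essential suprema of
`(1 + ‖x‖)^ρ ‖∇^{⊗ j} f (x)‖`. -/
def weightedNorm (γ : ℕ) (ρ : ℝ) (f : Plane → ℝ) : ℝ≥0∞ :=
  ∑ j ∈ Finset.range (γ + 1),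
    eLpNorm (fun x : Plane => (1 + ‖x‖) ^ ρ •
      (WithLp.toLp 2 (fun θ : Fin j → Fin 2 => weakDeriv θ f x) :
        EuclideanSpace ℝ (Fin j → Fin 2))) ⊤ volume

/-- Membership in `W^{γ,∞}_{(ρ)}(ℝ², ℝ)`. -/
def MemWeighted (γ : ℕ) (ρ : ℝ) (f : Plane → ℝ) : Prop :=
  (∀ j ≤ γ, ∀ θ : Fin j → Fin 2, ∃ g, IsWeakDeriv θ f g) ∧ weightedNorm γ ρ f < ⊤

/-- The magnetic field `B` and the potential `V` are `(γ, ε)` tame. -/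
def Tame (γ : ℕ) (ε : ℝ) (B V : Plane → ℝ) : Prop :=
  MemWeighted γ ε V ∧ MemWeighted γ (1 + ε) B

/-! ### Vector potentials and magnetic Schrödinger operators -/

/-- The gauge `A₀ (x) = (B₀ / 2) J x` of the constant magnetic field. -/
def gauge0 (B₀ : ℝ) (x : Plane) : Plane := (B₀ / 2) • J x

/-- The vector field `J y / (2 π ‖y‖²)`. -/
def biotSavart (y : Plane) : Plane := (2 * Real.pi * ‖y‖ ^ 2)⁻¹ • J y

/-- The gauge `A_ε` of the magnetic field `B`, the convolution of `B` with `J y / (2 π ‖y‖²)`. -/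
def gauge (B : Plane → ℝ) (x : Plane) : Plane :=
  WithLp.toLp 2 (fun k => ∫ y, B (x - y) * biotSavart y k)

/-- The operator `-i ∂_k - a_k` on differentiable functions. -/
def covDeriv (a : Plane → Plane) (k : Fin 2) (φ : Plane → ℂ) (x : Plane) : ℂ :=
  -Complex.I * fderiv ℝ φ x (e k) - (a x k : ℂ) * φ x

/-- `u` and its weak magnetic gradient `v = (-i ∇ - a) u` are square integrable. -/
def IsMagGrad (a : Plane → Plane) (u : L2 ℂ) (v : Fin 2 → L2 ℂ) : Prop :=
  ∀ k, ∀ φ : Plane → ℂ, IsTest φ →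
    ∫ x, v k x * conj (φ x) = ∫ x, u x * conj (covDeriv a k φ x)

/-- `u` is in the domain of the self-adjoint operator `(-i ∇ - a)² + V`, defined through its
quadratic form, and this operator maps `u` to `g`. -/
def IsSchrodinger (a : Plane → Plane) (V : Plane → ℝ) (u g : L2 ℂ) : Prop :=
  ∃ v : Fin 2 → L2 ℂ, IsMagGrad a u v ∧ ∀ φ : Plane → ℂ, IsTest φ →
    (∑ k, ∫ x, v k x * conj (covDeriv a k φ x)) + ∫ x, (V x : ℂ) * u x * conj (φ x)
      = ∫ x, g x * conj (φ x)

/-- The Landau Hamiltonian: `H₀ u = g`. -/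
def IsH0 (B₀ : ℝ) (u g : L2 ℂ) : Prop := IsSchrodinger (gauge0 B₀) 0 u g

/-- The perturbed Hamiltonian `H = (-i ∇ - A)² + V` with `A = A₀ - A_ε`: `H u = g`. -/
def IsH (B₀ : ℝ) (B V : Plane → ℝ) (u g : L2 ℂ) : Prop :=
  IsSchrodinger (fun x => gauge0 B₀ x - gauge B x) V u g

/-- The difference `H_ε = H - H₀`: `u` is in both domains and `H_ε u = g`. -/
def IsHeps (B₀ : ℝ) (B V : Plane → ℝ) (u g : L2 ℂ) : Prop :=
  ∃ g₁ g₀ : L2 ℂ, IsH B₀ B V u g₁ ∧ IsH0 B₀ u g₀ ∧ g = g₁ - g₀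

/-! ### Landau levels and the operators `M_{I,ζ}` -/

lemma integrable_mul_conj (u : L2 ℂ) {ψ : Plane → ℂ} (hψ : Continuous ψ)
    (hs : HasCompactSupport ψ) : Integrable (fun x => u x * conj (ψ x)) volume := by
  have h1 : MemLp (fun x => conj (ψ x)) 2 (volume : Measure Plane) :=
    (Complex.continuous_conj.comp hψ).memLp_of_hasCompactSupport
      (hs.comp_left (g := fun z : ℂ => conj z) (map_zero _))
  exact (Lp.memLp u).integrable_mul h1

lemma continuous_gauge0 (B₀ : ℝ) : Continuous (gauge0 B₀) := by
  have : Continuous J := by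
    unfold J
    refine (PiLp.continuous_toLp 2 _).comp (continuous_pi fun k => ?_)
    fin_cases k <;> simp <;> fun_prop
  unfold gauge0
  fun_prop

lemma continuous_covDeriv {a : Plane → Plane} (ha : Continuous a) (k : Fin 2)
    {φ : Plane → ℂ} (hφ : IsTest φ) : Continuous (covDeriv a k φ) := by
  have h1 : Continuous (fderiv ℝ φ) := hφ.1.continuous_fderiv (by simp)
  have h2 : Continuous φ := hφ.1.continuous
  unfold covDeriv
  fun_prop

lemma hasCompactSupport_covDeriv (a : Plane → Plane) (k : Fin 2)
    {φ : Plane → ℂ} (hφ : IsTest φ) : HasCompactSupport (covDeriv a k φ) := by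
  have h1 : HasCompactSupport (fun x => -Complex.I * fderiv ℝ φ x (e k)) :=
    HasCompactSupport.mul_left (hφ.2.fderiv_apply ℝ (e k))
  have h2 : HasCompactSupport (fun x => (a x k : ℂ) * φ x) := HasCompactSupport.mul_left hφ.2
  exact h1.sub h2

lemma integral_add_mul_conj (u w : L2 ℂ) {ψ : Plane → ℂ} (hψ : Continuous ψ)
    (hs : HasCompactSupport ψ) :
    ∫ x, (u + w) x * conj (ψ x) = (∫ x, u x * conj (ψ x)) + ∫ x, w x * conj (ψ x) := by
  rw [← integral_add (integrable_mul_conj u hψ hs) (integrable_mul_conj w hψ hs)]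
  refine integral_congr_ae ?_
  filter_upwards [Lp.coeFn_add u w] with x hx
  rw [hx, Pi.add_apply, add_mul]

lemma integral_smul_mul_conj (c : ℂ) (u : L2 ℂ) (ψ : Plane → ℂ) :
    ∫ x, (c • u) x * conj (ψ x) = c * ∫ x, u x * conj (ψ x) := by
  rw [← integral_const_mul]
  refine integral_congr_ae ?_
  filter_upwards [Lp.coeFn_smul c u] with x hx
  rw [hx, Pi.smul_apply, smul_eq_mul, mul_assoc]

lemma IsH0.add {B₀ : ℝ} {u w g h : L2 ℂ} (hu : IsH0 B₀ u g) (hw : IsH0 B₀ w h) :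
    IsH0 B₀ (u + w) (g + h) := by
  obtain ⟨v, hv, hv'⟩ := hu
  obtain ⟨z, hz, hz'⟩ := hw
  have hc := continuous_gauge0 B₀
  refine ⟨v + z, fun k φ hφ => ?_, fun φ hφ => ?_⟩
  · rw [Pi.add_apply, integral_add_mul_conj _ _ hφ.1.continuous hφ.2,
      integral_add_mul_conj _ _ (continuous_covDeriv hc k hφ) (hasCompactSupport_covDeriv _ k hφ),
      hv k φ hφ, hz k φ hφ]
  · have h1 := hv' φ hφ
    have h2 := hz' φ hφ
    simp only [Pi.zero_apply, Complex.ofReal_zero, zero_mul, integral_zero, add_zero] at h1 h2 ⊢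
    rw [integral_add_mul_conj _ _ hφ.1.continuous hφ.2, ← h1, ← h2, ← Finset.sum_add_distrib]
    refine Finset.sum_congr rfl fun k _ => ?_
    rw [Pi.add_apply, integral_add_mul_conj _ _ (continuous_covDeriv hc k hφ)
      (hasCompactSupport_covDeriv _ k hφ)]

lemma IsH0.smul {B₀ : ℝ} {u g : L2 ℂ} (c : ℂ) (hu : IsH0 B₀ u g) :
    IsH0 B₀ (c • u) (c • g) := by
  obtain ⟨v, hv, hv'⟩ := hu
  refine ⟨c • v, fun k φ hφ => ?_, fun φ hφ => ?_⟩
  · rw [Pi.smul_apply, integral_smul_mul_conj, integral_smul_mul_conj, hv k φ hφ]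
  · have h1 := hv' φ hφ
    simp only [Pi.zero_apply, Complex.ofReal_zero, zero_mul, integral_zero, add_zero] at h1 ⊢
    rw [integral_smul_mul_conj, ← h1, Finset.mul_sum]
    refine Finset.sum_congr rfl fun k _ => ?_
    rw [Pi.smul_apply, integral_smul_mul_conj]

lemma IsH0.zero (B₀ : ℝ) : IsH0 B₀ 0 0 := by
  have h0 : ∀ ψ : Plane → ℂ, ∫ x, (0 : L2 ℂ) x * conj (ψ x) = 0 := fun ψ => by
    simpa only [zero_smul, zero_mul] using integral_smul_mul_conj 0 (0 : L2 ℂ) ψ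
  refine ⟨0, fun k φ hφ => ?_, fun φ hφ => ?_⟩
  · rw [Pi.zero_apply, h0, h0]
  · simp only [Pi.zero_apply, Complex.ofReal_zero, zero_mul, integral_zero, h0, add_zero,
      Finset.sum_const_zero]

/-- The eigenvalue `B₀ (2 l + 1)` of `H₀`. -/
def level (B₀ : ℝ) (l : ℕ) : ℂ := ((B₀ * (2 * l + 1) : ℝ) : ℂ)

/-- The eigenspace of `H₀` with eigenvalue `B₀ (2 l + 1)`. -/
def eigenspace (B₀ : ℝ) (l : ℕ) : Submodule ℂ (L2 ℂ) where
  carrier := {u | IsH0 B₀ u (level B₀ l • u)}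
  add_mem' {u w} hu hw := by
    simpa only [Set.mem_ofPred_eq, smul_add] using IsH0.add hu hw
  zero_mem' := by
    simpa only [Set.mem_ofPred_eq, smul_zero] using IsH0.zero B₀
  smul_mem' c u hu := by
    simpa only [Set.mem_ofPred_eq, smul_comm c] using IsH0.smul c hu

/-- The orthogonal projection `P_l` onto the eigenspace of `H₀` with eigenvalue `B₀ (2 l + 1)`.
As `H₀` is a closed operator, its eigenspaces are closed; taking the closure here only
spares a proof of this fact. -/
def landauProj (B₀ : ℝ) (l : ℕ) : L2 ℂ →L[ℂ] L2 ℂ :=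
  (eigenspace B₀ l).topologicalClosure.starProjection

/-- The set `B₀ (2 I + 1)`. -/
def levels (B₀ : ℝ) (I : Set ℕ) : Set ℂ := level B₀ '' I

/-- The summands `P_l / (B₀ (2 l + 1) - ζ)`, `l ∈ I`. -/
def resolventTerm (B₀ : ℝ) (I : Set ℕ) (ζ : ℂ) (l : I) : L2 ℂ →L[ℂ] L2 ℂ :=
  (level B₀ l - ζ)⁻¹ • landauProj B₀ l

/-- The bounded operator `M_{I,ζ} = ∑_{l ∈ I} P_l / (B₀ (2 l + 1) - ζ)`. -/
def M (B₀ : ℝ) (I : Set ℕ) (ζ : ℂ) : L2 ℂ →L[ℂ] L2 ℂ :=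
  ∑' l : I, resolventTerm B₀ I ζ l

/-! ### The operators `H_{ε,x₀}^{(d)}` -/

/-- The component `θ` of `B_ε^{(d)} (x) = (-i)^d ∇^{⊗ d} B_ε (x)`. -/
def fieldDeriv {d : ℕ} (B : Plane → ℝ) (θ : Fin d → Fin 2) (x : Plane) : ℂ :=
  (-Complex.I) ^ d * (weakDeriv θ B x : ℂ)

/-- The component `(θ, k)` of `A_{ε,x₀}^{(d)}`, the convolution of `B_ε^{(d)} (· + x₀)` with
`J y / (2 π ‖y‖²)`. -/
def gaugeDeriv {d : ℕ} (B : Plane → ℝ) (x₀ : Plane) (θ : Fin d → Fin 2) (k : Fin 2)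
    (x : Plane) : ℂ :=
  ∫ y, fieldDeriv B θ (x - y + x₀) * (biotSavart y k : ℂ)

/-- The pseudo potential `W_ε = A_ε² + V_ε`. -/
def pseudoPot (B V : Plane → ℝ) (x : Plane) : ℝ := ‖gauge B x‖ ^ 2 + V x

/-- The component `θ` of `W_{ε,x₀}^{(d)} (x) = (-i)^d ∇^{⊗ d} W_ε (x + x₀)`. -/
def potDeriv {d : ℕ} (B V : Plane → ℝ) (x₀ : Plane) (θ : Fin d → Fin 2) (x : Plane) : ℂ :=
  (-Complex.I) ^ d * (weakDeriv θ (pseudoPot B V) (x + x₀) : ℂ)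

/-- `H_{ε,x₀}^{(d)} u = g`, where
`H_{ε,x₀}^{(d)} = κ A_{ε,x₀}^{(d)} · (-i ∇ - A₀) + W_{ε,x₀}^{(d)}`, and the scalar product
contracts the last component of `A_{ε,x₀}^{(d)}`. -/
def IsHepsDeriv (κ B₀ : ℝ) (B V : Plane → ℝ) (x₀ : Plane) (d : ℕ) (u : L2 ℂ)
    (g : L2 (Tens d)) : Prop :=
  ∃ v : Fin 2 → L2 ℂ, IsMagGrad (gauge0 B₀) u v ∧
    ∀ᵐ x : Plane, ∀ θ : Fin d → Fin 2,
      g x θ = κ * ∑ k, gaugeDeriv B x₀ θ k x * v k x + potDeriv B V x₀ θ x * u x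

/-! ### Integral kernels -/

/-- `T` has the integral kernel `t`. -/
def HasKernel {d : ℕ} (T : L2 ℂ →L[ℂ] L2 (Tens d)) (t : Plane → Plane → Tens d) : Prop :=
  AEStronglyMeasurable (Function.uncurry t)
      ((volume : Measure Plane).prod (volume : Measure Plane)) ∧
    ∀ (f : Plane → ℂ) (hf : Continuous f) (hs : HasCompactSupport f), ∀ᵐ x : Plane,
      Integrable (fun y => f y • t x y) volume ∧
        T ((hf.memLp_of_hasCompactSupport hs).toLp f) x = ∫ y, f y • t x y

/-- The kernel `t` is nice: `t (x, ·)` and `t (·, x)` are integrable, with norms bounded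
independently of `x`. -/
def IsNice {d : ℕ} (t : Plane → Plane → Tens d) : Prop :=
  ∃ C : ℝ, ∀ x : Plane,
    Integrable (fun y => t x y) volume ∧ Integrable (fun y => t y x) volume ∧
      ∫ y, ‖t x y‖ ≤ C ∧ ∫ y, ‖t y x‖ ≤ C

open Classical in
/-- The function `b_s` with `s = 1`: `1 / ‖x - y‖` for `‖x - y‖ < 1 / √B₀`, otherwise `0`. -/
def b1 (B₀ : ℝ) (x y : Plane) : ℝ :=
  if ‖x - y‖ < 1 / √B₀ then 1 / ‖x - y‖ else 0

/-! ### Schatten classes -/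

section Schatten

variable {H₁ H₂ : Type*} [NormedAddCommGroup H₁] [InnerProductSpace ℂ H₁] [CompleteSpace H₁]
  [NormedAddCommGroup H₂] [InnerProductSpace ℂ H₂] [CompleteSpace H₂]

/-- The multiplicity of `s > 0` as a singular value of `S`: the dimension of the eigenspace
of `S* S` with eigenvalue `s²`. It is finite for compact `S`. -/
def singularMult (S : H₁ →L[ℂ] H₂) (s : ℝ) : ℕ :=
  Module.finrank ℂ (Module.End.eigenspace
    ((ContinuousLinearMap.adjoint S ∘L S : H₁ →L[ℂ] H₁) : H₁ →ₗ[ℂ] H₁) ((s ^ 2 : ℝ) : ℂ))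

/-- The `p`-Schatten norm of a compact operator `S`: the `p`-th root of the sum of the `p`-th
powers of the nonzero singular values, counted with multiplicity. -/
def schattenNorm (p : ℝ) (S : H₁ →L[ℂ] H₂) : ℝ≥0∞ :=
  (∑' s : {s : ℝ // 0 < s}, (singularMult S s : ℝ≥0∞) * ENNReal.ofReal ((s : ℝ) ^ p)) ^ (1 / p)

/-- `S` is in the `p`-Schatten class. -/
def MemSchatten (p : ℝ) (S : H₁ →L[ℂ] H₂) : Prop :=
  IsCompactOperator S ∧ schattenNorm p S < ⊤

end Schatten

/-- `F` is measurable, and bounded on every compact subset of `U`. -/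
def IsLocBdd (U : Set ℂ) (F : ℂ → ℝ) : Prop :=
  Measurable F ∧ ∀ K : Set ℂ, IsCompact K → K ⊆ U → ∃ C : ℝ, ∀ ζ ∈ K, |F ζ| ≤ C

end Landau

end

noncomputable section

namespace Landau



/-! ### The Schur test for kernels dominated by convolution kernels -/

/-! The kernel of `M` is explicit enough that everything reduces to pointwise bounds. Each
projection `P_l` is a twisted convolution with a Laguerre function times a Gaussian, and covariant
derivatives pass through the twist (`covDeriv_twKer`), so the derivatives of such an operator are
read off from its profile. Split `M = ∫_0^1 exp(t(ζ - H₀)) dt + ∑ a_l P_l`. The heat integral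
carries the singularity: by Mehler's formula (`hasSum_heatFun`) its profile and the magnetic
gradient of the profile are bounded by a multiple of `(1 + 1/‖w‖) exp(-b‖w‖²)`. The `a_l` decay like
`exp(-2 B₀ l)` (`exists_norm_tailCoeff_le`), which beats the growth in `l` of the Laguerre functions
obtained from Cauchy's estimate for their generating function (`abs_lag_le`), so the series obeys a
bound of the same type. The outcome is `exists_kernel_M`, with a constant proportional to `growth`.

The spectral theory comes from the same kernels. The operator `landauOp` maps into the eigenspace by
Laguerre's equation, is symmetric and kills the other eigenspaces; the heat kernel, a superposition
of these operators, tends weakly to the identity as `t → 0`. Hence `landauOp` is the orthogonal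
projection (`landauProj_eq`), and the levels are total (`clm_ext_of_landauOp`), so identities
between bounded operators can be checked on one level at a time.

Convolution with the Biot-Savart kernel turns the weight of order `1 + ε` into the weight of order
`ε` (`exists_abs_bsConv_le`) and commutes with weak derivatives; with the Leibniz rule, `W_ε` and
its derivatives also decay with order `ε` (`exists_sobBdd_pseudoPot`). Thus `H^{(d)} M` has a kernel
dominated by a weight times a singular Gaussian, and the Schur test (`exists_hasKer`) bounds it.
Since `A_ε` is divergence free (`divFree_bsConv`), expanding the square gives `H_ε = 2 A_ε · (-i∇ -
A₀) + W_ε`. Domains are defined by weak identities, so the derivative relation is carried in the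
weak form `MG`, which tolerates divergence free weights and survives superposition (`MG.integral`).

For the Schatten norm let `S = H_ε M`. In `(S* S)^n` the `2n` weights can all be moved to the output
variable, because Gaussians absorb polynomial factors, and the remaining iterated convolutions map
`L²` to `L^∞`. Hence `|(S* S)^n f(x)|` is at most a constant times `(1 + ‖x‖)^{-2nε} ‖f‖`
(`exists_norm_starPow_le`). The right side is in `L²` because `2nε > 1`, so `(S* S)^n` is
Hilbert-Schmidt. As `‖S u‖^{2n} ≤ ‖(S* S)^n u‖` for unit vectors, the sum of `‖S v_i‖^{4n}` is
bounded over all orthonormal families, which gives compactness and the bound on the Schatten norm.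
-/

lemma sq_lintegral_mul_le {α : Type*} [MeasurableSpace α] (μ : Measure α) {f g : α → ℝ≥0∞}
    (hf : AEMeasurable f μ) (hg : AEMeasurable g μ) :
    (∫⁻ a, f a * g a ∂μ) ^ 2 ≤ (∫⁻ a, f a ^ 2 ∂μ) * ∫⁻ a, g a ^ 2 ∂μ := by
  have h := ENNReal.lintegral_mul_le_Lp_mul_Lq μ Real.HolderConjugate.two_two hf hg
  have h2 := pow_le_pow_left₀ (zero_le) h 2
  refine h2.trans (le_of_eq ?_)
  have e : ∀ x : ℝ≥0∞, (x ^ (1 / (2 : ℝ))) ^ 2 = x := fun x => by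
    rw [← ENNReal.rpow_natCast, ← ENNReal.rpow_mul]; norm_num
  rw [mul_pow, e, e]
  simp only [ENNReal.rpow_ofNat]

/-- Cauchy-Schwarz for the splitting `k f = k^{1/2} · (k^{1/2} f)`, the core of the Schur test. -/
lemma sq_lintegral_mul_le' {α : Type*} [MeasurableSpace α] (μ : Measure α) {k f : α → ℝ≥0∞}
    (hk : AEMeasurable k μ) (hf : AEMeasurable f μ) :
    (∫⁻ a, k a * f a ∂μ) ^ 2 ≤ (∫⁻ a, k a ∂μ) * ∫⁻ a, k a * f a ^ 2 ∂μ := by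
  have e : ∀ x : ℝ≥0∞, (x ^ (1 / (2 : ℝ))) ^ 2 = x := fun x => by
    rw [← ENNReal.rpow_natCast, ← ENNReal.rpow_mul]; norm_num
  have h := sq_lintegral_mul_le μ (f := fun a => k a ^ (1 / (2 : ℝ)))
    (g := fun a => k a ^ (1 / (2 : ℝ)) * f a) (hk.pow_const _) ((hk.pow_const _).mul hf)
  simp only [mul_pow, e, ← mul_assoc] at h
  simp only [← pow_two, e] at h
  exact h

/-- The case `L¹ * L² ⊂ L²` of Young's inequality. Working with extended nonnegative values makes it
usable before any integrability is known. -/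
lemma lintegral_conv_sq_le {k f : Plane → ℝ≥0∞} (hk : Measurable k) (hf : Measurable f) :
    ∫⁻ x, (∫⁻ y, k (x - y) * f y) ^ 2 ≤ (∫⁻ x, k x) ^ 2 * ∫⁻ x, f x ^ 2 := by
  calc ∫⁻ x, (∫⁻ y, k (x - y) * f y) ^ 2
      ≤ ∫⁻ x, (∫⁻ y, k y) * ∫⁻ y, k (x - y) * f y ^ 2 := by
        refine lintegral_mono fun x => ?_
        have := sq_lintegral_mul_le' (volume : Measure Plane) (k := fun y => k (x - y)) (f := f)
          (by fun_prop) hf.aemeasurable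
        rwa [lintegral_sub_left_eq_self (fun y => k y) x] at this
    _ = (∫⁻ y, k y) * ∫⁻ x, ∫⁻ y, k (x - y) * f y ^ 2 := by
        rw [lintegral_const_mul]
        exact Measurable.lintegral_prod_right' (f := fun p : Plane × Plane => k (p.1 - p.2) * f p.2 ^ 2)
          (by fun_prop)
    _ = (∫⁻ y, k y) * ∫⁻ y, ∫⁻ x, k (x - y) * f y ^ 2 := by
        rw [lintegral_lintegral_swap]
        exact Measurable.aemeasurable
          (f := fun p : Plane × Plane => k (p.1 - p.2) * f p.2 ^ 2) (by fun_prop)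
    _ = (∫⁻ x, k x) ^ 2 * ∫⁻ x, f x ^ 2 := by
        have : ∀ y, ∫⁻ x, k (x - y) * f y ^ 2 = (∫⁻ x, k x) * f y ^ 2 := fun y => by
          rw [lintegral_mul_const _ (by fun_prop), lintegral_sub_right_eq_self (fun x => k x) y]
        simp_rw [this]
        rw [lintegral_const_mul _ (by fun_prop), ← mul_assoc, pow_two]

/-- `T` is the integral operator with kernel `K` on all of `L²`. -/
def HasKer {F : Type} [NormedAddCommGroup F] [NormedSpace ℂ F]
    (T : L2 ℂ →L[ℂ] L2 F) (K : Plane → Plane → F) : Prop :=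
  ∀ f : L2 ℂ, ∀ᵐ x : Plane, Integrable (fun y => f y • K x y) volume ∧ T f x = ∫ y, f y • K x y

lemma eLpNorm_two_eq {F : Type*} [NormedAddCommGroup F] {α : Type*} [MeasurableSpace α]
    (μ : Measure α) (f : α → F) :
    eLpNorm f 2 μ = (∫⁻ x, ‖f x‖ₑ ^ 2 ∂μ) ^ (1 / (2 : ℝ)) := by
  rw [eLpNorm_eq_lintegral_rpow_enorm_toReal (by norm_num) (by norm_num)]
  simp

lemma lintegral_enorm_sq {F : Type} [NormedAddCommGroup F] (f : L2 F) :
    ∫⁻ x, ‖f x‖ₑ ^ 2 = ‖f‖ₑ ^ 2 := by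
  rw [Lp.enorm_def, eLpNorm_two_eq, ← ENNReal.rpow_natCast, ← ENNReal.rpow_mul]
  norm_num

/-- The Schur test constructs the operator: finiteness of the dominating convolution in `L²` yields
almost everywhere convergence of the integrals, and with it linearity. -/
lemma exists_hasKer {F : Type} [NormedAddCommGroup F] [NormedSpace ℂ F] [CompleteSpace F]
    {K : Plane → Plane → F} {k : Plane → ℝ} (hK : StronglyMeasurable (Function.uncurry K))
    (hkm : Measurable k) (hk : Integrable k volume) (hKk : ∀ x y, ‖K x y‖ ≤ k (x - y)) :
    ∃ T : L2 ℂ →L[ℂ] L2 F, HasKer T K ∧ ‖T‖ ≤ ∫ w, k w := by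
  have hk0 : ∀ w, 0 ≤ k w := fun w => by simpa using (norm_nonneg _).trans (hKk w 0)
  set κ : Plane → ℝ≥0∞ := fun w => ENNReal.ofReal (k w) with hκ
  have hκm : Measurable κ := by fun_prop
  have hκi : ∫⁻ w, κ w = ENNReal.ofReal (∫ w, k w) :=
    (ofReal_integral_eq_lintegral_ofReal hk (ae_of_all _ hk0)).symm
  have hC0 : 0 ≤ ∫ w, k w := integral_nonneg hk0
  have hbd : ∀ (f : Plane → ℂ) (x y : Plane), ‖f y • K x y‖ₑ ≤ κ (x - y) * ‖f y‖ₑ := fun f x y => by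
    rw [enorm_smul, mul_comm]
    gcongr
    rw [← ofReal_norm]
    exact ENNReal.ofReal_le_ofReal (hKk x y)
  have hfm : ∀ f : L2 ℂ, Measurable fun y => ‖f y‖ₑ := fun f =>
    (Lp.stronglyMeasurable f).measurable.enorm
  have hsq : ∀ f : L2 ℂ, ∫⁻ x, (∫⁻ y, κ (x - y) * ‖f y‖ₑ) ^ 2
      ≤ (ENNReal.ofReal (∫ w, k w)) ^ 2 * ‖f‖ₑ ^ 2 := fun f => by
    rw [← lintegral_enorm_sq, ← hκi]
    exact lintegral_conv_sq_le hκm (hfm f)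
  have hjm : ∀ f : L2 ℂ, StronglyMeasurable (Function.uncurry fun x y => f y • K x y) := fun f =>
    ((Lp.stronglyMeasurable f).comp_measurable measurable_snd).smul hK
  have hint : ∀ f : L2 ℂ, ∀ᵐ x : Plane, Integrable (fun y => f y • K x y) volume := fun f => by
    have h1 : ∀ᵐ x : Plane, (∫⁻ y, κ (x - y) * ‖f y‖ₑ) ^ 2 < ⊤ := by
      have hm1 : Measurable fun x => ∫⁻ y, κ (x - y) * ‖f y‖ₑ :=
        Measurable.lintegral_prod_right' (f := fun p : Plane × Plane => κ (p.1 - p.2) * ‖f p.2‖ₑ)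
          ((hκm.comp (measurable_fst.sub measurable_snd)).mul ((hfm f).comp measurable_snd))
      refine ae_lt_top (hm1.pow_const 2) ((hsq f).trans_lt ?_).ne
      exact ENNReal.mul_lt_top (ENNReal.pow_lt_top ENNReal.ofReal_lt_top)
        (ENNReal.pow_lt_top enorm_lt_top)
    filter_upwards [h1] with x hx
    refine ⟨((hjm f).comp_measurable measurable_prodMk_left).aestronglyMeasurable, ?_⟩
    refine (lintegral_mono (hbd f x)).trans_lt ?_
    by_contra h
    rw [not_lt, top_le_iff] at h
    rw [h] at hx
    simp at hx
  have hsm : ∀ f : L2 ℂ, StronglyMeasurable fun x => ∫ y, f y • K x y := fun f =>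
    (hjm f).integral_prod_right
  have hbound : ∀ f : L2 ℂ, eLpNorm (fun x => ∫ y, f y • K x y) 2 volume
      ≤ ENNReal.ofReal (∫ w, k w) * ‖f‖ₑ := fun f => by
    rw [eLpNorm_two_eq]
    calc (∫⁻ x, ‖∫ y, f y • K x y‖ₑ ^ 2) ^ (1 / (2 : ℝ))
        ≤ ((ENNReal.ofReal (∫ w, k w)) ^ 2 * ‖f‖ₑ ^ 2) ^ (1 / (2 : ℝ)) := by
          gcongr
          refine (lintegral_mono fun x => ?_).trans (hsq f)
          gcongr
          exact (enorm_integral_le_lintegral_enorm _).trans (lintegral_mono (hbd f x))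
      _ = _ := by
          rw [← mul_pow, ← ENNReal.rpow_natCast, ← ENNReal.rpow_mul]; norm_num
  have hmem : ∀ f : L2 ℂ, MemLp (fun x => ∫ y, f y • K x y) 2 volume := fun f =>
    ⟨(hsm f).aestronglyMeasurable, (hbound f).trans_lt
      (ENNReal.mul_lt_top ENNReal.ofReal_lt_top enorm_lt_top)⟩
  let L : L2 ℂ →ₗ[ℂ] L2 F :=
    { toFun := fun f => (hmem f).toLp
      map_add' := fun f g => by
        apply Lp.ext
        filter_upwards [(hmem (f + g)).coeFn_toLp, (hmem f).coeFn_toLp, (hmem g).coeFn_toLp,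
          Lp.coeFn_add (hmem f).toLp (hmem g).toLp, hint f, hint g] with x h1 h2 h3 h4 h5 h6
        rw [h1, h4, Pi.add_apply, h2, h3, ← integral_add h5 h6]
        refine integral_congr_ae ?_
        filter_upwards [Lp.coeFn_add f g] with y hy
        rw [hy, Pi.add_apply, add_smul]
      map_smul' := fun c f => by
        apply Lp.ext
        filter_upwards [(hmem (c • f)).coeFn_toLp, (hmem f).coeFn_toLp,
          Lp.coeFn_smul c (hmem f).toLp] with x h1 h2 h3
        rw [h1, RingHom.id_apply, h3, Pi.smul_apply, h2, ← integral_smul]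
        refine integral_congr_ae ?_
        filter_upwards [Lp.coeFn_smul c f] with y hy
        rw [hy, Pi.smul_apply, smul_eq_mul, mul_smul] }
  have hL : ∀ f, ‖L f‖ ≤ (∫ w, k w) * ‖f‖ := fun f => by
    change ‖(hmem f).toLp‖ ≤ _
    rw [Lp.norm_toLp]
    refine ENNReal.toReal_le_of_le_ofReal (by positivity) ((hbound f).trans (le_of_eq ?_))
    rw [ENNReal.ofReal_mul hC0, ofReal_norm]
  refine ⟨L.mkContinuous _ hL, fun f => ?_, L.mkContinuous_norm_le hC0 hL⟩
  filter_upwards [hint f, (hmem f).coeFn_toLp] with x h1 h2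
  exact ⟨h1, h2⟩

/-! ### Twisted convolutions -/

/-- The symplectic form on the plane. -/
def wedge (x y : Plane) : ℝ := x 0 * y 1 - x 1 * y 0

/-- The phase of the magnetic translations. -/
def phase (B₀ : ℝ) (x y : Plane) : ℂ := Complex.exp (((B₀ / 2 * wedge x y : ℝ) : ℂ) * Complex.I)

lemma norm_phase (B₀ : ℝ) (x y : Plane) : ‖phase B₀ x y‖ = 1 := Complex.norm_exp_ofReal_mul_I _

lemma continuous_wedge : Continuous fun p : Plane × Plane => wedge p.1 p.2 := by
  unfold wedge; fun_prop

lemma continuous_phase (B₀ : ℝ) : Continuous fun p : Plane × Plane => phase B₀ p.1 p.2 := by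
  have := continuous_wedge
  unfold phase; fun_prop

lemma wedge_add_self (w y : Plane) : wedge (w + y) y = wedge w y := by
  simp only [wedge, PiLp.add_apply]; ring

lemma phase_add_self (B₀ : ℝ) (w y : Plane) : phase B₀ (w + y) y = phase B₀ w y := by
  simp only [phase, wedge_add_self]

lemma conj_phase (B₀ : ℝ) (x y : Plane) : conj (phase B₀ x y) = phase B₀ y x := by
  rw [phase, phase, ← Complex.exp_conj]
  congr 1
  simp only [map_mul, Complex.conj_I, Complex.conj_ofReal, wedge]
  push_cast
  ring

/-- The twisted convolution kernel given by `h`. -/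
def twKer (B₀ : ℝ) (h : Plane → ℂ) (x y : Plane) : ℂ := phase B₀ x y * h (x - y)

/-- The twisted correlation of two square integrable functions. -/
def corr (B₀ : ℝ) (f ψ : Plane → ℂ) (w : Plane) : ℂ :=
  ∫ y, f y * phase B₀ w y * conj (ψ (y + w))

lemma corr_congr (B₀ : ℝ) (f : Plane → ℂ) {ψ χ : Plane → ℂ} (h : ψ =ᵐ[volume] χ) (w : Plane) :
    corr B₀ f ψ w = corr B₀ f χ w := by
  refine integral_congr_ae ?_
  have := (measurePreserving_add_right (volume : Measure Plane) w).quasiMeasurePreserving.ae_eq h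
  filter_upwards [this] with y hy
  simp only [Function.comp_apply] at hy
  rw [hy]

lemma memLp_comp_add_right {F : Type*} [NormedAddCommGroup F] {p : ℝ≥0∞} {ψ : Plane → F}
    (h : MemLp ψ p volume) (w : Plane) : MemLp (fun y => ψ (y + w)) p volume :=
  h.comp_measurePreserving (measurePreserving_add_right volume w)

lemma memLp_conj {p : ℝ≥0∞} {ψ : Plane → ℂ}
    (h : MemLp ψ p (volume : Measure Plane)) : MemLp (fun y => conj (ψ y)) p volume :=
  h.star

lemma integrable_corr (B₀ : ℝ) (f ψ : L2 ℂ) (w : Plane) :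
    Integrable (fun y => f y * phase B₀ w y * conj (ψ (y + w))) volume := by
  have h1 : MemLp (fun y => f y * phase B₀ w y) 2 volume := by
    have hc : Continuous fun y => phase B₀ w y := (continuous_phase B₀).comp (Continuous.prodMk_right w)
    refine (Lp.memLp f).of_le
      ((Lp.aestronglyMeasurable f).mul hc.aestronglyMeasurable) (ae_of_all _ fun y => ?_)
    rw [norm_mul, norm_phase, mul_one]
  exact h1.integrable_mul (memLp_conj (memLp_comp_add_right (Lp.memLp ψ) w))

lemma integral_norm_corr_le (B₀ : ℝ) (f ψ : L2 ℂ) (w : Plane) :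
    ∫ y, ‖f y * phase B₀ w y * conj (ψ (y + w))‖ ≤ ‖f‖ * ‖ψ‖ := by
  have hi := (integrable_corr B₀ f ψ w).norm
  refine (ENNReal.ofReal_le_ofReal_iff (by positivity)).1 ?_
  rw [ofReal_integral_eq_lintegral_ofReal hi (ae_of_all _ fun _ => norm_nonneg _)]
  have h := sq_lintegral_mul_le (volume : Measure Plane) (f := fun y => ‖f y‖ₑ)
    (g := fun y => ‖ψ (y + w)‖ₑ) (Lp.stronglyMeasurable f).measurable.enorm.aemeasurable
    ((Lp.stronglyMeasurable ψ).measurable.comp (measurable_add_const w)).enorm.aemeasurable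
  rw [lintegral_add_right_eq_self (fun y => ‖ψ y‖ₑ ^ 2) w, lintegral_enorm_sq,
    lintegral_enorm_sq, ← mul_pow] at h
  have h' := (ENNReal.pow_le_pow_left_iff (by norm_num : (2 : ℕ) ≠ 0)).1 h
  rw [ENNReal.ofReal_mul (norm_nonneg _), ofReal_norm, ofReal_norm]
  refine le_trans (le_of_eq (lintegral_congr fun y => ?_)) h'
  rw [norm_mul, norm_mul, norm_phase, mul_one, RCLike.norm_conj,
    ENNReal.ofReal_mul (norm_nonneg _), ofReal_norm, ofReal_norm]

lemma norm_corr_le (B₀ : ℝ) (f ψ : L2 ℂ) (w : Plane) : ‖corr B₀ f ψ w‖ ≤ ‖f‖ * ‖ψ‖ :=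
  (norm_integral_le_integral_norm _).trans (integral_norm_corr_le B₀ f ψ w)

lemma stronglyMeasurable_corr_integrand (B₀ : ℝ) (f ψ : L2 ℂ) :
    StronglyMeasurable fun p : Plane × Plane => f p.2 * phase B₀ p.1 p.2 * conj (ψ (p.2 + p.1)) :=
  (((Lp.stronglyMeasurable f).comp_measurable measurable_snd).mul
    (continuous_phase B₀).stronglyMeasurable).mul
    (Complex.continuous_conj.comp_stronglyMeasurable
      ((Lp.stronglyMeasurable ψ).comp_measurable (measurable_snd.add measurable_fst)))

lemma stronglyMeasurable_corr (B₀ : ℝ) (f ψ : L2 ℂ) : StronglyMeasurable (corr B₀ f ψ) :=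
  (stronglyMeasurable_corr_integrand B₀ f ψ).integral_prod_right'

lemma integrable_twKer_prod {B₀ : ℝ} {h : Plane → ℂ} (hh : Integrable h volume) (f ψ : L2 ℂ) :
    Integrable (fun p : Plane × Plane => f p.2 * phase B₀ p.1 p.2 * conj (ψ (p.2 + p.1)) * h p.1)
      (volume.prod volume) := by
  have hm := (stronglyMeasurable_corr_integrand B₀ f ψ).aestronglyMeasurable.mul
    (hh.aestronglyMeasurable.comp_fst (ν := (volume : Measure Plane)))
  refine (integrable_prod_iff hm).2 ⟨ae_of_all _ fun w => ?_, ?_⟩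
  · exact (integrable_corr B₀ f ψ w).mul_const (h w)
  · refine Integrable.mono' (hh.norm.const_mul (‖f‖ * ‖ψ‖)) hm.norm.integral_prod_right'
      (ae_of_all _ fun w => ?_)
    rw [Real.norm_of_nonneg (integral_nonneg fun _ => norm_nonneg _)]
    simp only [Pi.mul_apply, norm_mul _ (h w), integral_mul_const]
    gcongr
    exact integral_norm_corr_le B₀ f ψ w

/-- Under the substitution `x = w + y` the phase becomes `phase B₀ w y`, so the profile separates
from `f` and `ψ`. A matrix element is then a linear functional of `h` alone, with the bounded
function `corr` as its density. -/
lemma integrable_integral_twKer {B₀ : ℝ} {h : Plane → ℂ} (hh : Integrable h volume)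
    (f ψ : L2 ℂ) :
    Integrable (fun p : Plane × Plane => f p.2 * twKer B₀ h p.1 p.2 * conj (ψ p.1))
      (volume.prod volume) ∧
    ∫ p : Plane × Plane, f p.2 * twKer B₀ h p.1 p.2 * conj (ψ p.1) ∂(volume.prod volume)
      = ∫ w, h w * corr B₀ f ψ w := by
  have h1 := integrable_twKer_prod (B₀ := B₀) hh f ψ
  set G : Plane × Plane → ℂ := fun p => f p.2 * twKer B₀ h p.1 p.2 * conj (ψ p.1) with hGdef
  have hmp : MeasurePreserving (fun z : Plane × Plane => (z.1 + z.2, z.2))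
      (volume.prod volume) (volume.prod volume) :=
    measurePreserving_add_prod volume volume
  have hG : ∀ z : Plane × Plane, G (z.1 + z.2, z.2)
      = f z.2 * phase B₀ z.1 z.2 * conj (ψ (z.2 + z.1)) * h z.1 := fun z => by
    simp only [G, twKer, phase_add_self, add_sub_cancel_right]
    rw [add_comm z.1 z.2]
    ring
  have hemb : MeasurableEmbedding (fun z : Plane × Plane => (z.1 + z.2, z.2)) := by
    have := ((MeasurableEquiv.prodComm (α := Plane) (β := Plane)).trans
      ((MeasurableEquiv.shearAddRight Plane).trans MeasurableEquiv.prodComm)).measurableEmbedding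
    convert this using 1
    ext z : 1
    simp [MeasurableEquiv.shearAddRight, MeasurableEquiv.prodComm, add_comm]
  have hGi : Integrable G (volume.prod volume) := by
    rw [← hmp.integrable_comp_emb hemb]
    simpa only [Function.comp_def, hG] using h1
  refine ⟨hGi, ?_⟩
  calc ∫ z, G z ∂(volume.prod volume)
      = ∫ z : Plane × Plane, G (z.1 + z.2, z.2) ∂(volume.prod volume) :=
        (hmp.integral_comp hemb G).symm
    _ = ∫ w, ∫ y, G (w + y, y) := integral_prod (fun z : Plane × Plane => G (z.1 + z.2, z.2))
          ((hmp.integrable_comp_emb hemb).2 hGi)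
    _ = _ := by
        refine integral_congr_ae (ae_of_all _ fun w => ?_)
        simp only [corr, ← integral_const_mul]
        refine integral_congr_ae (ae_of_all _ fun y => ?_)
        have := hG (w, y)
        simp only at this ⊢
        rw [this]
        ring

lemma integral_twKer {B₀ : ℝ} {h : Plane → ℂ} (hh : Integrable h volume)
    (f ψ : L2 ℂ) :
    ∫ x, (∫ y, f y * twKer B₀ h x y) * conj (ψ x) = ∫ w, h w * corr B₀ f ψ w := by
  obtain ⟨h1, h2⟩ := integrable_integral_twKer (B₀ := B₀) hh f ψ
  rw [← h2, integral_prod _ h1]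
  simp only [integral_mul_const]

lemma HasKer.integral_mul_conj {B₀ : ℝ} {T : L2 ℂ →L[ℂ] L2 ℂ} {h : Plane → ℂ}
    (hT : HasKer T (twKer B₀ h)) (hh : Integrable h volume) (f ψ : L2 ℂ) :
    ∫ x, T f x * conj (ψ x) = ∫ w, h w * corr B₀ f ψ w := by
  rw [← integral_twKer hh]
  refine integral_congr_ae ?_
  filter_upwards [hT f] with x hx
  simp only [hx.2, smul_eq_mul]

lemma HasKer.integral_mul_conj' {B₀ : ℝ} {T : L2 ℂ →L[ℂ] L2 ℂ} {h : Plane → ℂ}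
    (hT : HasKer T (twKer B₀ h)) (hh : Integrable h volume) (f : L2 ℂ) {ψ : Plane → ℂ}
    (hψ : MemLp ψ 2 volume) :
    ∫ x, T f x * conj (ψ x) = ∫ w, h w * corr B₀ f ψ w := by
  simp_rw [← corr_congr B₀ f hψ.coeFn_toLp, ← hT.integral_mul_conj hh f hψ.toLp]
  refine integral_congr_ae ?_
  filter_upwards [hψ.coeFn_toLp] with x hx
  rw [hx]

lemma inner_eq_integral (f ψ : L2 ℂ) : inner ℂ ψ f = ∫ x, f x * conj (ψ x) := by
  rw [MeasureTheory.L2.inner_def]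
  refine integral_congr_ae (ae_of_all _ fun x => ?_)
  simp [RCLike.inner_apply]

lemma exists_twOp {B₀ : ℝ} {h : Plane → ℂ} (hm : StronglyMeasurable h) (hh : Integrable h volume) :
    ∃ T : L2 ℂ →L[ℂ] L2 ℂ, HasKer T (twKer B₀ h) ∧ ‖T‖ ≤ ∫ w, ‖h w‖ := by
  refine exists_hasKer (k := fun w => ‖h w‖) ?_ hm.measurable.norm hh.norm fun x y => ?_
  · exact (continuous_phase B₀).stronglyMeasurable.mul
      (hm.comp_measurable (measurable_fst.sub measurable_snd))
  · rw [twKer, norm_mul, norm_phase, one_mul]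

open Classical in
/-- The operator of twisted convolution with `h`. -/
def twOp (B₀ : ℝ) (h : Plane → ℂ) : L2 ℂ →L[ℂ] L2 ℂ :=
  if hh : StronglyMeasurable h ∧ Integrable h volume then
    (exists_twOp (B₀ := B₀) hh.1 hh.2).choose else 0

lemma hasKer_twOp (B₀ : ℝ) {h : Plane → ℂ} (hm : StronglyMeasurable h)
    (hh : Integrable h volume) : HasKer (twOp B₀ h) (twKer B₀ h) := by
  rw [twOp, dif_pos ⟨hm, hh⟩]
  exact (exists_twOp (B₀ := B₀) hm hh).choose_spec.1

lemma inner_twOp (B₀ : ℝ) {h : Plane → ℂ} (hm : StronglyMeasurable h)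
    (hh : Integrable h volume) (f ψ : L2 ℂ) :
    inner ℂ ψ (twOp B₀ h f) = ∫ w, h w * corr B₀ f ψ w := by
  rw [inner_eq_integral, (hasKer_twOp B₀ hm hh).integral_mul_conj hh]

lemma integrable_mul_corr (B₀ : ℝ) {h : Plane → ℂ} (hh : Integrable h volume) (f ψ : L2 ℂ) :
    Integrable (fun w => h w * corr B₀ f ψ w) volume :=
  hh.mul_bdd (stronglyMeasurable_corr B₀ f ψ).aestronglyMeasurable
    (ae_of_all _ (norm_corr_le B₀ f ψ))

/-- Superposition: twisted convolution commutes with parameter integrals. -/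
lemma integral_integral_mul_corr (B₀ : ℝ) {Θ : Type*} [MeasurableSpace Θ] {μ : Measure Θ}
    [SFinite μ] {h : Θ → Plane → ℂ} (hh : Integrable (Function.uncurry h) (μ.prod volume))
    (f ψ : L2 ℂ) :
    ∫ w, (∫ θ, h θ w ∂μ) * corr B₀ f ψ w = ∫ θ, (∫ w, h θ w * corr B₀ f ψ w) ∂μ := by
  simp_rw [← integral_mul_const]
  refine integral_integral_swap (f := fun w θ => h θ w * corr B₀ f ψ w) ?_
  have : Integrable (fun p : Θ × Plane => h p.1 p.2 * corr B₀ f ψ p.2) (μ.prod volume) :=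
    hh.mul_bdd ((stronglyMeasurable_corr B₀ f ψ).comp_measurable measurable_snd).aestronglyMeasurable
      (ae_of_all _ fun p => norm_corr_le B₀ f ψ p.2)
  exact this.swap




/-! ### Covariant derivatives -/

lemma gauge0_zero (B₀ : ℝ) (x : Plane) : gauge0 B₀ x 0 = B₀ / 2 * x 1 := by
  simp [gauge0, J]

lemma gauge0_one (B₀ : ℝ) (x : Plane) : gauge0 B₀ x 1 = -(B₀ / 2 * x 0) := by
  simp [gauge0, J]

lemma contDiff_gauge0 (B₀ : ℝ) (k : Fin 2) {n : WithTop ℕ∞} :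
    ContDiff ℝ n fun x => gauge0 B₀ x k := by
  fin_cases k
  · simp only [Fin.zero_eta, gauge0_zero]; fun_prop
  · simp only [Fin.mk_one, gauge0_one]; fun_prop

lemma contDiff_covDeriv (B₀ : ℝ) (k : Fin 2) {φ : Plane → ℂ}
    (hφ : ContDiff ℝ ((⊤ : ℕ∞) : WithTop ℕ∞) φ) :
    ContDiff ℝ ((⊤ : ℕ∞) : WithTop ℕ∞) (covDeriv (gauge0 B₀) k φ) := by
  have h1 : ContDiff ℝ ((⊤ : ℕ∞) : WithTop ℕ∞) fun x => fderiv ℝ φ x (e k) :=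
    (hφ.fderiv_right (m := ((⊤ : ℕ∞) : WithTop ℕ∞)) (by simp)).clm_apply contDiff_const
  have h2 : ContDiff ℝ ((⊤ : ℕ∞) : WithTop ℕ∞) fun x => ((gauge0 B₀ x k : ℝ) : ℂ) :=
    Complex.ofRealCLM.contDiff.comp (contDiff_gauge0 B₀ k)
  exact (contDiff_const.mul h1).sub (h2.mul hφ)

lemma IsTest.covDeriv {B₀ : ℝ} {k : Fin 2} {φ : Plane → ℂ} (hφ : IsTest φ) :
    IsTest (covDeriv (gauge0 B₀) k φ) :=
  ⟨contDiff_covDeriv B₀ k hφ.1, hasCompactSupport_covDeriv _ k hφ⟩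

lemma IsTest.memLp {F : Type} [NormedAddCommGroup F] [NormedSpace ℝ F] {φ : Plane → F}
    (hφ : IsTest φ) (p : ℝ≥0∞) : MemLp φ p volume :=
  hφ.1.continuous.memLp_of_hasCompactSupport hφ.2

/-- The potential is real, so its two contributions cancel and an exact derivative remains, for any
`a`. This is integration by parts before integrating. -/
lemma fderiv_mul_conj_apply {u φ : Plane → ℂ} {x : Plane} (hu : DifferentiableAt ℝ u x)
    (hφ : DifferentiableAt ℝ φ x) (a : Plane → Plane) (k : Fin 2) :
    covDeriv a k u x * conj (φ x) - u x * conj (covDeriv a k φ x)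
      = -Complex.I * fderiv ℝ (fun z => u z * conj (φ z)) x (e k) := by
  have h1 : HasFDerivAt (fun z => conj (φ z))
      ((Complex.conjCLE : ℂ →L[ℝ] ℂ).comp (fderiv ℝ φ x)) x :=
    (Complex.conjCLE : ℂ →L[ℝ] ℂ).hasFDerivAt.comp x hφ.hasFDerivAt
  have h2 := (hu.hasFDerivAt.mul h1).fderiv
  rw [show fderiv ℝ (fun z => u z * conj (φ z)) x = _ from h2]
  simp only [Landau.covDeriv, map_sub, map_mul, map_neg, Complex.conj_I, Complex.conj_ofReal,
    add_apply, smul_apply,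
    ContinuousLinearMap.comp_apply, ContinuousLinearEquiv.coe_coe, Complex.conjCLE_apply, smul_eq_mul]
  ring

lemma hasFDerivAt_phase (B₀ : ℝ) (x y : Plane) (k : Fin 2) :
    DifferentiableAt ℝ (fun x => phase B₀ x y) x ∧
    fderiv ℝ (fun x => phase B₀ x y) x (e k) = phase B₀ x y * (Complex.I * (gauge0 B₀ y k : ℂ)) := by
  have h0 : HasFDerivAt (fun x : Plane => B₀ / 2 * wedge x y)
      ((B₀ / 2) • (y 1 • (EuclideanSpace.proj 0 : Plane →L[ℝ] ℝ)
        - y 0 • (EuclideanSpace.proj 1 : Plane →L[ℝ] ℝ))) x := by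
    have a0 := (EuclideanSpace.proj 0 : Plane →L[ℝ] ℝ).hasFDerivAt (x := x)
    have a1 := (EuclideanSpace.proj 1 : Plane →L[ℝ] ℝ).hasFDerivAt (x := x)
    exact ((a0.mul_const (y 1)).sub (a1.mul_const (y 0))).const_mul (B₀ / 2)
  have h1 := ((Complex.ofRealCLM.hasFDerivAt.comp x h0).mul_const Complex.I).cexp
  refine ⟨h1.differentiableAt, ?_⟩
  rw [show fderiv ℝ (fun x => phase B₀ x y) x = _ from h1.fderiv]
  fin_cases k
  · simp [phase, e, gauge0_zero]
  · simp [phase, e, gauge0_one]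

lemma contDiff_phase (B₀ : ℝ) (y : Plane) {n : WithTop ℕ∞} :
    ContDiff ℝ n fun x => phase B₀ x y := by
  have : ContDiff ℝ n fun x : Plane => (B₀ / 2 * wedge x y : ℝ) := by unfold wedge; fun_prop
  exact ((Complex.ofRealCLM.contDiff.comp this).mul contDiff_const).cexp

lemma contDiff_twKer (B₀ : ℝ) {h : Plane → ℂ} (hh : ContDiff ℝ ((⊤ : ℕ∞) : WithTop ℕ∞) h)
    (y : Plane) : ContDiff ℝ ((⊤ : ℕ∞) : WithTop ℕ∞) fun x => twKer B₀ h x y :=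
  (contDiff_phase B₀ y).mul (hh.comp (contDiff_id.sub contDiff_const))

lemma gauge0_sub (B₀ : ℝ) (x y : Plane) (k : Fin 2) :
    gauge0 B₀ (x - y) k = gauge0 B₀ x k - gauge0 B₀ y k := by
  fin_cases k
  · simp [gauge0_zero]; ring
  · simp [gauge0_one]; ring

/-- Covariance of the covariant derivative under magnetic translations. -/
lemma covDeriv_twKer (B₀ : ℝ) {h : Plane → ℂ} (hh : Differentiable ℝ h) (k : Fin 2)
    (x y : Plane) :
    covDeriv (gauge0 B₀) k (fun x => twKer B₀ h x y) x
      = twKer B₀ (covDeriv (gauge0 B₀) k h) x y := by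
  obtain ⟨h1, h2⟩ := hasFDerivAt_phase B₀ x y k
  have h3 : HasFDerivAt (fun x => h (x - y)) (fderiv ℝ h (x - y)) x := by
    have := (hh (x - y)).hasFDerivAt.comp x ((hasFDerivAt_id x).sub_const y)
    rwa [ContinuousLinearMap.comp_id] at this
  have h4 : fderiv ℝ (fun x => twKer B₀ h x y) x = _ := (h1.hasFDerivAt.mul h3).fderiv
  rw [Landau.covDeriv, h4]
  simp only [add_apply, smul_apply, smul_eq_mul, h2,
    twKer, Landau.covDeriv, gauge0_sub]
  push_cast
  ring_nf
  rw [Complex.I_sq]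
  ring

/-! ### Weak covariant derivatives of twisted convolutions -/

/-- Bounded vector fields with vanishing weak divergence. -/
def DivFree (a : Fin 2 → Plane → ℝ) : Prop :=
  (∀ k, Measurable (a k)) ∧ (∃ C, ∀ k x, |a k x| ≤ C) ∧
    ∀ ψ : Plane → ℂ, IsTest ψ → ∑ k, ∫ x, (a k x : ℂ) * fderiv ℝ ψ x (e k) = 0

lemma integral_fderiv_eq_zero {ψ : Plane → ℂ} (hψ : IsTest ψ) (v : Plane) :
    ∫ x, fderiv ℝ ψ x v = 0 := by
  have h := integral_smul_fderiv_eq_neg_fderiv_smul_of_integrable (μ := (volume : Measure Plane))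
    (f := fun _ : Plane => (1 : ℝ)) (g := ψ) (v := v) (𝕜 := ℝ) (by simp)
    (by simpa using ((hψ.1.continuous_fderiv (by simp)).clm_apply
      continuous_const).integrable_of_hasCompactSupport (hψ.2.fderiv_apply ℝ v))
    (by simpa using hψ.1.continuous.integrable_of_hasCompactSupport hψ.2)
    (fun x _ => differentiableAt_const _) (fun x _ => hψ.1.differentiable (by simp) x)
  simpa using h

/-- With these weights a weighted identity singles out one component of the gradient; this is how
`MG.isMagGrad` recovers the unweighted statement. -/
lemma divFree_const (j : Fin 2) : DivFree fun k _ => if k = j then 1 else 0 := by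
  refine ⟨fun k => measurable_const, ⟨1, fun k x => ?_⟩, fun ψ hψ => ?_⟩
  · dsimp only; split_ifs <;> simp
  · simp [integral_const_mul, integral_fderiv_eq_zero hψ]

lemma memLp_bdd_mul_isTest {a : Plane → ℝ} (ha : Measurable a) {C : ℝ} (hC : ∀ x, |a x| ≤ C)
    {φ : Plane → ℂ} (hφ : IsTest φ) (p : ℝ≥0∞) : MemLp (fun x => (a x : ℂ) * φ x) p volume := by
  refine ((hφ.memLp p).const_mul (C : ℂ)).of_le
    ((Complex.measurable_ofReal.comp ha).aestronglyMeasurable.mul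
      hφ.1.continuous.aestronglyMeasurable) (ae_of_all _ fun x => ?_)
  rw [norm_mul, norm_mul, Complex.norm_real, Complex.norm_real, Real.norm_eq_abs, Real.norm_eq_abs]
  exact mul_le_mul_of_nonneg_right ((hC x).trans (le_abs_self C)) (norm_nonneg _)

/-- Twisted convolution with `d` is the covariant derivative of twisted convolution with `h`,
in a weak sense that allows for weighting by weakly divergence free vector fields. -/
def MG (B₀ : ℝ) (h : Plane → ℂ) (d : Fin 2 → Plane → ℂ) : Prop :=
  ∀ a, DivFree a → ∀ φ, IsTest φ → ∀ f : L2 ℂ,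
    ∑ k, ∫ w, h w * corr B₀ f (fun x => (a k x : ℂ) * covDeriv (gauge0 B₀) k φ x) w
      = ∑ k, ∫ w, d k w * corr B₀ f (fun x => (a k x : ℂ) * φ x) w

/-- For fixed `y`, the difference of the two sides pairs `a` with the gradient of the test function
`z ↦ twKer B₀ h z y * conj (φ z)`, and this pairing vanishes because `a` has no weak divergence. -/
lemma mg_of_contDiff {B₀ : ℝ} {h : Plane → ℂ} (hh : ContDiff ℝ ((⊤ : ℕ∞) : WithTop ℕ∞) h)
    (hi : Integrable h volume) (hd : ∀ k, Integrable (covDeriv (gauge0 B₀) k h) volume) :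
    MG B₀ h (fun k => covDeriv (gauge0 B₀) k h) := by
  rintro a ⟨ham, ⟨C, hC⟩, ha⟩ φ hφ f
  have hm1 := fun k => memLp_bdd_mul_isTest (ham k) (hC k) (hφ.covDeriv (B₀ := B₀) (k := k)) 2
  have hm2 := fun k => memLp_bdd_mul_isTest (ham k) (hC k) hφ 2
  have key : ∀ {g : Plane → ℂ} (hg : Integrable g volume) {ψ : Plane → ℂ}
      (hψ : MemLp ψ 2 volume),
      Integrable (fun p : Plane × Plane => f p.2 * twKer B₀ g p.1 p.2 * conj (ψ p.1))
        (volume.prod volume) ∧ ∫ w, g w * corr B₀ f ψ w =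
        ∫ p : Plane × Plane, f p.2 * twKer B₀ g p.1 p.2 * conj (ψ p.1) ∂(volume.prod volume) := by
    intro g hg ψ hψ
    obtain ⟨h1, h2⟩ := integrable_integral_twKer (B₀ := B₀) hg f hψ.toLp
    have h3 : (fun p : Plane × Plane => f p.2 * twKer B₀ g p.1 p.2 * conj (hψ.toLp ψ p.1))
        =ᵐ[volume.prod volume] fun p => f p.2 * twKer B₀ g p.1 p.2 * conj (ψ p.1) := by
      have := (Measure.quasiMeasurePreserving_fst (μ := (volume : Measure Plane))
        (ν := (volume : Measure Plane))).ae_eq hψ.coeFn_toLp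
      filter_upwards [this] with p hp
      simp only [Function.comp_apply] at hp
      rw [hp]
    refine ⟨h1.congr h3, ?_⟩
    rw [← integral_congr_ae h3, h2]
    simp_rw [corr_congr B₀ f hψ.coeFn_toLp]
  rw [← sub_eq_zero, ← Finset.sum_sub_distrib]
  have e1 : ∀ k, (∫ w, h w * corr B₀ f (fun x => (a k x : ℂ) * covDeriv (gauge0 B₀) k φ x) w)
      - ∫ w, covDeriv (gauge0 B₀) k h w * corr B₀ f (fun x => (a k x : ℂ) * φ x) w
      = ∫ p : Plane × Plane, Complex.I * f p.2 * ((a k p.1 : ℂ) *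
        fderiv ℝ (fun z => twKer B₀ h z p.2 * conj (φ z)) p.1 (e k)) ∂(volume.prod volume) := by
    intro k
    rw [(key hi (hm1 k)).2, (key (hd k) (hm2 k)).2, ← integral_sub (key hi (hm1 k)).1
      (key (hd k) (hm2 k)).1]
    refine integral_congr_ae (ae_of_all _ fun p => ?_)
    have := fderiv_mul_conj_apply (u := fun x => twKer B₀ h x p.2) (φ := φ) (x := p.1)
      ((contDiff_twKer B₀ hh p.2).differentiable (by simp) _)
      (hφ.1.differentiable (by simp) _) (gauge0 B₀) k
    rw [covDeriv_twKer B₀ (hh.differentiable (by simp))] at this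
    simp only [map_mul, Complex.conj_ofReal]
    linear_combination (-(f p.2) * (a k p.1 : ℂ)) * this
  have e2 : ∀ k, Integrable (fun p : Plane × Plane => Complex.I * f p.2 * ((a k p.1 : ℂ) *
        fderiv ℝ (fun z => twKer B₀ h z p.2 * conj (φ z)) p.1 (e k))) (volume.prod volume) := by
    intro k
    refine ((key hi (hm1 k)).1.sub (key (hd k) (hm2 k)).1).congr (ae_of_all _ fun p => ?_)
    have := fderiv_mul_conj_apply (u := fun x => twKer B₀ h x p.2) (φ := φ) (x := p.1)
      ((contDiff_twKer B₀ hh p.2).differentiable (by simp) _)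
      (hφ.1.differentiable (by simp) _) (gauge0 B₀) k
    rw [covDeriv_twKer B₀ (hh.differentiable (by simp))] at this
    simp only [Pi.sub_apply, map_mul, Complex.conj_ofReal]
    linear_combination (-(f p.2) * (a k p.1 : ℂ)) * this
  simp_rw [e1]
  -- The `x`-integral is taken inside, since the divergence condition acts for each fixed `y`.
  rw [← integral_finsetSum _ fun k _ => e2 k,
    integral_prod_symm _ (integrable_finsetSum _ fun k _ => e2 k)]
  refine integral_eq_zero_of_ae (ae_of_all _ fun y => ?_)
  have ht : IsTest fun z => twKer B₀ h z y * conj (φ z) :=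
    ⟨(contDiff_twKer B₀ hh y).mul ((Complex.conjCLE : ℂ →L[ℝ] ℂ).contDiff.comp hφ.1),
      (hφ.2.comp_left (g := fun z : ℂ => conj z) (map_zero _)).mul_left⟩
  have hint : ∀ k, Integrable (fun x => (a k x : ℂ) *
      fderiv ℝ (fun z => twKer B₀ h z y * conj (φ z)) x (e k)) volume := fun k => by
    refine (((ht.1.continuous_fderiv (by simp)).clm_apply
      continuous_const).integrable_of_hasCompactSupport (ht.2.fderiv_apply ℝ (e k))).bdd_mul
      (c := C) (Complex.measurable_ofReal.comp (ham k)).aestronglyMeasurable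
      (ae_of_all _ fun x => ?_)
    simpa using hC k x
  simp only [Pi.zero_apply]
  rw [integral_finsetSum _ fun k _ => (hint k).const_mul _]
  simp_rw [integral_const_mul]
  rw [← Finset.mul_sum, ha _ ht, mul_zero]

/-- Both sides are bounded linear functionals of the integrable profiles, so Fubini suffices. No
derivative of the superposed profile is taken, which matters because it may be singular at the
origin. -/
lemma MG.integral {B₀ : ℝ} {Θ : Type*} [MeasurableSpace Θ] {μ : Measure Θ} [SFinite μ]
    {h : Θ → Plane → ℂ} {d : Fin 2 → Θ → Plane → ℂ}
    (hh : Integrable (Function.uncurry h) (μ.prod volume))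
    (hd : ∀ k, Integrable (Function.uncurry (d k)) (μ.prod volume))
    (H : ∀ᵐ θ ∂μ, MG B₀ (h θ) fun k => d k θ) :
    MG B₀ (fun w => ∫ θ, h θ w ∂μ) fun k w => ∫ θ, d k θ w ∂μ := by
  intro a ha φ hφ f
  obtain ⟨C, hC⟩ := ha.2.1
  have hm1 := fun k => memLp_bdd_mul_isTest (ha.1 k) (hC k) (hφ.covDeriv (B₀ := B₀) (k := k)) 2
  have hm2 := fun k => memLp_bdd_mul_isTest (ha.1 k) (hC k) hφ 2
  have key : ∀ {g : Θ → Plane → ℂ} (hg : Integrable (Function.uncurry g) (μ.prod volume))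
      {ψ : Plane → ℂ} (hψ : MemLp ψ 2 volume),
      Integrable (fun θ => ∫ w, g θ w * corr B₀ f ψ w) μ ∧
      ∫ w, (∫ θ, g θ w ∂μ) * corr B₀ f ψ w = ∫ θ, (∫ w, g θ w * corr B₀ f ψ w) ∂μ := by
    intro g hg ψ hψ
    simp_rw [← corr_congr B₀ f hψ.coeFn_toLp]
    refine ⟨?_, integral_integral_mul_corr B₀ hg f hψ.toLp⟩
    have : Integrable (fun p : Θ × Plane => g p.1 p.2 * corr B₀ f (hψ.toLp ψ) p.2)
        (μ.prod volume) :=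
      hg.mul_bdd ((stronglyMeasurable_corr B₀ f _).comp_measurable
        measurable_snd).aestronglyMeasurable (ae_of_all _ fun p => norm_corr_le B₀ f _ p.2)
    exact this.integral_prod_left
  simp_rw [(key hh (hm1 _)).2, (key (hd _) (hm2 _)).2]
  rw [← integral_finsetSum _ fun k _ => (key hh (hm1 k)).1,
    ← integral_finsetSum _ fun k _ => (key (hd k) (hm2 k)).1]
  refine integral_congr_ae ?_
  filter_upwards [H] with θ hθ
  exact hθ a ha φ hφ f

lemma MG.const_mul {B₀ : ℝ} {h : Plane → ℂ} {d : Fin 2 → Plane → ℂ} (H : MG B₀ h d) (c : ℂ) :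
    MG B₀ (fun w => c * h w) fun k w => c * d k w := by
  intro a ha φ hφ f
  simp_rw [mul_assoc, integral_const_mul, ← Finset.mul_sum]
  rw [H a ha φ hφ f]

lemma integrable_mul_corr' (B₀ : ℝ) {h : Plane → ℂ} (hh : Integrable h volume) (f : L2 ℂ)
    {ψ : Plane → ℂ} (hψ : MemLp ψ 2 volume) :
    Integrable (fun w => h w * corr B₀ f ψ w) volume := by
  simp_rw [← corr_congr B₀ f hψ.coeFn_toLp]
  exact integrable_mul_corr B₀ hh f _

lemma MG.add {B₀ : ℝ} {h h' : Plane → ℂ} {d d' : Fin 2 → Plane → ℂ} (H : MG B₀ h d)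
    (H' : MG B₀ h' d') (hh : Integrable h volume) (hh' : Integrable h' volume)
    (hd : ∀ k, Integrable (d k) volume) (hd' : ∀ k, Integrable (d' k) volume) :
    MG B₀ (fun w => h w + h' w) fun k w => d k w + d' k w := by
  intro a ha φ hφ f
  obtain ⟨C, hC⟩ := ha.2.1
  have hm1 := fun k => memLp_bdd_mul_isTest (ha.1 k) (hC k) (hφ.covDeriv (B₀ := B₀) (k := k)) 2
  have hm2 := fun k => memLp_bdd_mul_isTest (ha.1 k) (hC k) hφ 2
  simp_rw [add_mul, integral_add (integrable_mul_corr' B₀ hh f (hm1 _))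
    (integrable_mul_corr' B₀ hh' f (hm1 _)), integral_add (integrable_mul_corr' B₀ (hd _) f (hm2 _))
    (integrable_mul_corr' B₀ (hd' _) f (hm2 _)), Finset.sum_add_distrib]
  rw [H a ha φ hφ f, H' a ha φ hφ f]

lemma MG.sum_integral {B₀ : ℝ} {h : Plane → ℂ} {d : Fin 2 → Plane → ℂ} (H : MG B₀ h d)
    (hh : Integrable h volume) (hd : ∀ k, Integrable (d k) volume)
    {T : L2 ℂ →L[ℂ] L2 ℂ} {V : Fin 2 → L2 ℂ →L[ℂ] L2 ℂ} (hT : HasKer T (twKer B₀ h))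
    (hV : ∀ k, HasKer (V k) (twKer B₀ (d k))) (f : L2 ℂ)
    {a : Fin 2 → Plane → ℝ} (ha : DivFree a) {φ : Plane → ℂ} (hφ : IsTest φ) :
    ∑ k, ∫ x, T f x * conj ((a k x : ℂ) * covDeriv (gauge0 B₀) k φ x)
      = ∑ k, ∫ x, V k f x * conj ((a k x : ℂ) * φ x) := by
  obtain ⟨C, hC⟩ := ha.2.1
  have hm1 := fun k => memLp_bdd_mul_isTest (ha.1 k) (hC k) (hφ.covDeriv (B₀ := B₀) (k := k)) 2
  have hm2 := fun k => memLp_bdd_mul_isTest (ha.1 k) (hC k) hφ 2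
  simp_rw [hT.integral_mul_conj' hh f (hm1 _), (hV _).integral_mul_conj' (hd _) f (hm2 _)]
  exact H a ha φ hφ f

lemma MG.isMagGrad {B₀ : ℝ} {h : Plane → ℂ} {d : Fin 2 → Plane → ℂ} (H : MG B₀ h d)
    (hh : Integrable h volume) (hd : ∀ k, Integrable (d k) volume)
    {T : L2 ℂ →L[ℂ] L2 ℂ} {V : Fin 2 → L2 ℂ →L[ℂ] L2 ℂ} (hT : HasKer T (twKer B₀ h))
    (hV : ∀ k, HasKer (V k) (twKer B₀ (d k))) (f : L2 ℂ) :
    IsMagGrad (gauge0 B₀) (T f) fun k => V k f := by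
  intro j φ hφ
  have h1 := H.sum_integral hh hd hT hV f (divFree_const j) hφ
  fin_cases j <;> simpa [Fin.sum_univ_two] using h1.symm

/-! ### Enlarging the class of test functions -/

/-- Dilated bumps: the dilation factors are at most `1`, which keeps the gradients uniformly
bounded, and near any given point the cutoff is eventually constant. -/
lemma exists_cutoff : ∃ (χ : ℕ → Plane → ℝ) (C : ℝ),
    (∀ n, ContDiff ℝ ((⊤ : ℕ∞) : WithTop ℕ∞) (χ n) ∧ HasCompactSupport (χ n)) ∧
    (∀ n x, |χ n x| ≤ 1) ∧ (∀ n x, ‖fderiv ℝ (χ n) x‖ ≤ C) ∧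
    ∀ x, ∀ᶠ n in Filter.atTop, χ n x = 1 ∧ fderiv ℝ (χ n) x = 0 := by
  let b : ContDiffBump (0 : Plane) := ⟨1, 2, by norm_num, by norm_num⟩
  have hb : ContDiff ℝ ((⊤ : ℕ∞) : WithTop ℕ∞) (b : Plane → ℝ) := b.contDiff
  obtain ⟨C, hC⟩ := (hb.continuous_fderiv (by simp)).bounded_above_of_compact_support
    (b.hasCompactSupport.fderiv ℝ)
  have hfd : ∀ (n : ℕ) x, fderiv ℝ (fun x => b ((n + 1 : ℝ)⁻¹ • x)) x
      = (n + 1 : ℝ)⁻¹ • fderiv ℝ b ((n + 1 : ℝ)⁻¹ • x) := fun n x =>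
    fderiv_comp_smul ((n + 1 : ℝ)⁻¹)
  refine ⟨fun n x => b ((n + 1 : ℝ)⁻¹ • x), C, fun n => ⟨hb.comp (contDiff_const_smul _), ?_⟩,
    fun n x => ?_, fun n x => ?_, fun x => ?_⟩
  · exact b.hasCompactSupport.comp_smul (by positivity)
  · rw [abs_of_nonneg b.nonneg]; exact b.le_one
  · rw [hfd, norm_smul]
    calc _ ≤ 1 * C := by
          gcongr
          · rw [Real.norm_of_nonneg (by positivity)]
            exact inv_le_one_of_one_le₀ (by linarith [n.cast_nonneg (α := ℝ)])
          · exact hC _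
      _ = C := one_mul C
  · obtain ⟨N, hN⟩ := exists_nat_gt ‖x‖
    filter_upwards [Filter.eventually_ge_atTop N] with n hn
    have hlt : ‖(n + 1 : ℝ)⁻¹ • x‖ < 1 := by
      have hn' : (N : ℝ) ≤ n := by exact_mod_cast hn
      rw [norm_smul, Real.norm_of_nonneg (by positivity), inv_mul_lt_one₀ (by positivity)]
      linarith
    have hev : (b : Plane → ℝ) =ᶠ[nhds ((n + 1 : ℝ)⁻¹ • x)] 1 :=
      b.eventuallyEq_one_of_mem_ball (by simpa using hlt)
    refine ⟨hev.self_of_nhds, ?_⟩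
    rw [hfd, hev.fderiv_eq]
    simp

lemma covDeriv_real_mul (a : Plane → Plane) (k : Fin 2) {χ : Plane → ℝ} {ψ : Plane → ℂ} {x : Plane}
    (hχ : DifferentiableAt ℝ χ x) (hψ : DifferentiableAt ℝ ψ x) :
    covDeriv a k (fun z => (χ z : ℂ) * ψ z) x
      = χ x * covDeriv a k ψ x - Complex.I * (fderiv ℝ χ x (e k) : ℂ) * ψ x := by
  have h1 : HasFDerivAt (fun z => ((χ z : ℝ) : ℂ)) (Complex.ofRealCLM.comp (fderiv ℝ χ x)) x :=
    Complex.ofRealCLM.hasFDerivAt.comp x hχ.hasFDerivAt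
  have h2 : fderiv ℝ (fun z => (χ z : ℂ) * ψ z) x = _ := (h1.mul hψ.hasFDerivAt).fderiv
  rw [covDeriv, h2]
  simp [covDeriv]
  ring

lemma tendsto_integral_mul_conj (u : L2 ℂ) {ψ : ℕ → Plane → ℂ} {ψ' : Plane → ℂ} {b : Plane → ℝ}
    (hb : MemLp b 2 volume) (hm : ∀ n, AEStronglyMeasurable (ψ n) volume)
    (hbd : ∀ n x, ‖ψ n x‖ ≤ b x)
    (hlim : ∀ x, Filter.Tendsto (fun n => ψ n x) Filter.atTop (nhds (ψ' x))) :
    Filter.Tendsto (fun n => ∫ x, u x * conj (ψ n x)) Filter.atTop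
      (nhds (∫ x, u x * conj (ψ' x))) := by
  refine tendsto_integral_of_dominated_convergence (fun x => ‖u x‖ * b x) (fun n => ?_)
    ((Lp.memLp u).norm.integrable_mul hb) (fun n => ae_of_all _ fun x => ?_)
    (ae_of_all _ fun x => ?_)
  · exact (Lp.aestronglyMeasurable u).mul
      (Complex.continuous_conj.comp_aestronglyMeasurable (hm n))
  · rw [norm_mul, RCLike.norm_conj]
    gcongr
    exact hbd n x
  · exact ((Complex.continuous_conj.tendsto _).comp (hlim x)).const_mul _

/-- Smooth square integrable functions with a square integrable covariant gradient are limits of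
test functions. -/
lemma exists_isTest_tendsto {B₀ : ℝ} {ψ : Plane → ℂ}
    (hψ : ContDiff ℝ ((⊤ : ℕ∞) : WithTop ℕ∞) ψ) (h2 : MemLp ψ 2 volume) :
    ∃ φ : ℕ → Plane → ℂ, (∀ n, IsTest (φ n)) ∧ ∀ u : L2 ℂ,
      Filter.Tendsto (fun n => ∫ x, u x * conj (φ n x)) Filter.atTop
        (nhds (∫ x, u x * conj (ψ x))) ∧
      ∀ k, MemLp (covDeriv (gauge0 B₀) k ψ) 2 volume →
        Filter.Tendsto (fun n => ∫ x, u x * conj (covDeriv (gauge0 B₀) k (φ n) x)) Filter.atTop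
        (nhds (∫ x, u x * conj (covDeriv (gauge0 B₀) k ψ x))) := by
  obtain ⟨χ, C, hχ, h1, hC, hlim⟩ := exists_cutoff
  have htest : ∀ n, IsTest fun x => (χ n x : ℂ) * ψ x := fun n =>
    ⟨(Complex.ofRealCLM.contDiff.comp (hχ n).1).mul hψ,
      ((hχ n).2.comp_left (g := fun r : ℝ => (r : ℂ)) Complex.ofReal_zero).mul_right⟩
  have hcov : ∀ n k x, covDeriv (gauge0 B₀) k (fun x => (χ n x : ℂ) * ψ x) x =
      χ n x * covDeriv (gauge0 B₀) k ψ x - Complex.I * (fderiv ℝ (χ n) x (e k) : ℂ) * ψ x :=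
    fun n k x => covDeriv_real_mul _ k ((hχ n).1.differentiable (by simp) x)
      (hψ.differentiable (by simp) x)
  refine ⟨fun n x => (χ n x : ℂ) * ψ x, htest, fun u => ⟨?_, fun k hk => ?_⟩⟩
  · refine tendsto_integral_mul_conj u h2.norm (fun n => (htest n).1.continuous.aestronglyMeasurable)
      (fun n x => ?_) fun x => ?_
    · rw [norm_mul, Complex.norm_real]
      exact mul_le_of_le_one_left (norm_nonneg _) (h1 n x)
    · refine tendsto_nhds_of_eventually_eq ?_
      filter_upwards [hlim x] with n hn
      simp [hn.1]
  · refine tendsto_integral_mul_conj u (hk.norm.add (h2.norm.const_mul C))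
      (fun n => ((htest n).covDeriv).1.continuous.aestronglyMeasurable)
      (fun n x => ?_) fun x => ?_
    · rw [hcov]
      refine (norm_sub_le _ _).trans ?_
      simp only [Pi.add_apply, norm_mul, Complex.norm_real, Complex.norm_I, one_mul]
      gcongr
      · exact mul_le_of_le_one_left (norm_nonneg _) (h1 n x)
      · refine ((fderiv ℝ (χ n) x).le_opNorm _).trans ?_
        have : ‖e k‖ = 1 := by simp [e]
        rw [this, mul_one]
        exact hC n x
    · refine tendsto_nhds_of_eventually_eq ?_
      filter_upwards [hlim x] with n hn
      rw [hcov]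
      simp [hn.1, hn.2]

lemma IsMagGrad.integral_eq {B₀ : ℝ} {u : L2 ℂ} {v : Fin 2 → L2 ℂ}
    (h : IsMagGrad (gauge0 B₀) u v) {ψ : Plane → ℂ}
    (hψ : ContDiff ℝ ((⊤ : ℕ∞) : WithTop ℕ∞) ψ) (h2 : MemLp ψ 2 volume) {k : Fin 2}
    (hk : MemLp (covDeriv (gauge0 B₀) k ψ) 2 volume) :
    ∫ x, v k x * conj (ψ x) = ∫ x, u x * conj (covDeriv (gauge0 B₀) k ψ x) := by
  obtain ⟨φ, hφ, hlim⟩ := exists_isTest_tendsto (B₀ := B₀) hψ h2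
  refine tendsto_nhds_unique ((hlim (v k)).1) ?_
  simp_rw [fun n => h k (φ n) (hφ n)]
  exact (hlim u).2 k hk

lemma IsH0.integral_eq {B₀ : ℝ} {u g : L2 ℂ} (h : IsH0 B₀ u g) {ψ : Plane → ℂ}
    (hψ : ContDiff ℝ ((⊤ : ℕ∞) : WithTop ℕ∞) ψ) (h2 : MemLp ψ 2 volume)
    (hk : ∀ k, MemLp (covDeriv (gauge0 B₀) k ψ) 2 volume)
    (hkk : ∀ k, MemLp (covDeriv (gauge0 B₀) k (covDeriv (gauge0 B₀) k ψ)) 2 volume) :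
    ∫ x, g x * conj (ψ x)
      = ∑ k, ∫ x, u x * conj (covDeriv (gauge0 B₀) k (covDeriv (gauge0 B₀) k ψ) x) := by
  obtain ⟨v, hv, hv'⟩ := h
  obtain ⟨φ, hφ, hlim⟩ := exists_isTest_tendsto (B₀ := B₀) hψ h2
  simp only [Pi.zero_apply, Complex.ofReal_zero, zero_mul, integral_zero, add_zero] at hv'
  have e1 : ∫ x, g x * conj (ψ x) = ∑ k, ∫ x, v k x * conj (covDeriv (gauge0 B₀) k ψ x) := by
    refine tendsto_nhds_unique ((hlim g).1) ?_
    simp_rw [fun n => (hv' (φ n) (hφ n)).symm]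
    exact tendsto_finsetSum _ fun k _ => (hlim (v k)).2 k (hk k)
  rw [e1]
  exact Finset.sum_congr rfl fun k _ => hv.integral_eq (contDiff_covDeriv B₀ k hψ) (hk k) (hkk k)

lemma IsMagGrad.isH0_iff {B₀ : ℝ} {u : L2 ℂ} {v : Fin 2 → L2 ℂ} (hv : IsMagGrad (gauge0 B₀) u v)
    {g : L2 ℂ} (h : ∀ φ : Plane → ℂ, IsTest φ →
      ∑ k, ∫ x, v k x * conj (covDeriv (gauge0 B₀) k φ x) = ∫ x, g x * conj (φ x)) :
    IsH0 B₀ u g :=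
  ⟨v, hv, fun φ hφ => by simpa using h φ hφ⟩




/-! ### Laguerre polynomials -/

/-- The coefficients of the Laguerre polynomials. -/
def lagCoeff (l n : ℕ) : ℝ := (-1) ^ n * (l.choose n : ℝ) / (n.factorial : ℝ)

/-- The Laguerre polynomials. -/
def lag (l : ℕ) : Polynomial ℝ := ∑ n ∈ Finset.range (l + 1), Polynomial.monomial n (lagCoeff l n)

lemma coeff_lag (l n : ℕ) : (lag l).coeff n = lagCoeff l n := by
  simp only [lag, Polynomial.finsetSum_coeff, Polynomial.coeff_monomial]
  rw [Finset.sum_ite_eq' (Finset.range (l + 1)) n]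
  split_ifs with h
  · rfl
  · rw [lagCoeff, Nat.choose_eq_zero_of_lt (by simpa using h)]; simp

/-- In coefficients this is the two-term recursion `hc`. It becomes the eigenvalue equation in
`sum_covDeriv_landauFun`. -/
lemma lag_ode (l : ℕ) :
    Polynomial.X * (lag l).derivative.derivative + (1 - Polynomial.X) * (lag l).derivative
      + (l : Polynomial ℝ) * lag l = 0 := by
  have hc : ∀ n : ℕ, ((n : ℝ) + 1) ^ 2 * lagCoeff l (n + 1) + ((l : ℝ) - n) * lagCoeff l n = 0 := by
    intro n
    have h1 : ((l.choose (n + 1) : ℕ) : ℝ) * (n + 1) = l.choose n * ((l : ℝ) - n) := by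
      rcases le_or_gt n l with h | h
      · have := Nat.choose_succ_right_eq l n
        have h2 : ((l - n : ℕ) : ℝ) = (l : ℝ) - n := Nat.cast_sub h
        rw [← h2]
        exact_mod_cast this
      · rw [Nat.choose_eq_zero_of_lt h, Nat.choose_eq_zero_of_lt (by omega)]; simp
    rw [lagCoeff, lagCoeff, Nat.factorial_succ, pow_succ]
    push_cast
    have h3 : (n.factorial : ℝ) ≠ 0 := by positivity
    have h4 : (n : ℝ) + 1 ≠ 0 := by positivity
    field_simp
    linear_combination (-(-1 : ℝ) ^ n) * h1
  ext n
  rw [Polynomial.coeff_add, Polynomial.coeff_add, sub_mul, one_mul, Polynomial.coeff_sub,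
    Polynomial.coeff_natCast_mul, Polynomial.coeff_zero]
  cases n with
  | zero =>
    have := hc 0
    simp [Polynomial.coeff_derivative, coeff_lag] at this ⊢
    linarith
  | succ n =>
    have := hc (n + 1)
    simp only [Polynomial.coeff_X_mul, Polynomial.coeff_derivative, coeff_lag] at this ⊢
    push_cast at this ⊢
    linear_combination this

lemma derivative_lag_succ (l : ℕ) :
    (lag (l + 1)).derivative = (lag l).derivative - lag l := by
  ext n
  rw [Polynomial.coeff_sub, Polynomial.coeff_derivative, Polynomial.coeff_derivative, coeff_lag,
    coeff_lag, coeff_lag, lagCoeff, lagCoeff, lagCoeff, Nat.choose_succ_succ, Nat.factorial_succ]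
  push_cast
  have h3 : (n.factorial : ℝ) ≠ 0 := by positivity
  have h4 : (n : ℝ) + 1 ≠ 0 := by positivity
  field_simp
  ring

/-- Reduces bounds on the derivative to the bounds on the polynomials themselves, at the price of a
factor `l`. -/
lemma derivative_lag (l : ℕ) : (lag l).derivative = -∑ j ∈ Finset.range l, lag j := by
  induction l with
  | zero => simp [lag]
  | succ l ih => rw [derivative_lag_succ, ih, Finset.sum_range_succ]; ring

/-- Expand in a double series over `(k, n)` with `l = n + k`. For fixed `k` the sum over `n` is a
negative binomial series, and the sum over `k` is then exponential; absolute summability permits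
regrouping along the antidiagonals, where the Laguerre coefficients appear. -/
lemma hasSum_lag (z : ℝ) {s : ℂ} (hs : ‖s‖ < 1) :
    HasSum (fun l => (((lag l).eval z : ℝ) : ℂ) * s ^ l)
      ((1 - s)⁻¹ * Complex.exp (-(s / (1 - s)) * z)) := by
  have h1s : 1 - s ≠ 0 := fun h => by
    rw [sub_eq_zero] at h; rw [← h] at hs; simp at hs
  let F : ℕ × ℕ → ℂ := fun p =>
    ((p.2 + p.1).choose p.1 * s ^ p.2) * ((-(z : ℂ)) ^ p.1 * s ^ p.1 / (p.1.factorial : ℂ))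
  have hrow : ∀ k, HasSum (fun n => F (k, n))
      ((1 - s)⁻¹ * ((-(s / (1 - s)) * z) ^ k / (k.factorial : ℂ))) := fun k => by
    have := (hasSum_choose_mul_geometric_of_norm_lt_one' k hs).mul_right
      ((-(z : ℂ)) ^ k * s ^ k / (k.factorial : ℂ))
    convert! this using 1
    rw [Ring.inverse_eq_inv', mul_pow, neg_pow, div_pow, neg_pow (z : ℂ), inv_pow, pow_succ]
    field_simp
  have hnorm : Summable F := by
    rw [← summable_norm_iff]
    refine (summable_prod_of_nonneg fun _ => norm_nonneg _).2 ⟨fun k => (hrow k).summable.norm, ?_⟩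
    have hs' : ‖(‖s‖ : ℝ)‖ < 1 := by simpa using hs
    have : ∀ k, ∑' n, ‖F (k, n)‖ = (1 - ‖s‖)⁻¹ * ((‖s‖ / (1 - ‖s‖) * |z|) ^ k / k.factorial) := by
      intro k
      have := (hasSum_choose_mul_geometric_of_norm_lt_one' k hs').mul_right
        (|z| ^ k * ‖s‖ ^ k / (k.factorial : ℝ))
      rw [← tsum_congr (f := fun n => (((n + k).choose k : ℝ) * ‖s‖ ^ n)
        * (|z| ^ k * ‖s‖ ^ k / (k.factorial : ℝ))) fun n => by simp [F], this.tsum_eq,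
        Ring.inverse_eq_inv']
      have : 1 - ‖s‖ ≠ 0 := by linarith
      rw [mul_pow, div_pow, inv_pow, pow_succ]
      field_simp
    simp_rw [this]
    exact (Real.summable_pow_div_factorial _).mul_left _
  have htot : HasSum F ((1 - s)⁻¹ * Complex.exp (-(s / (1 - s)) * z)) := by
    have h1 := hnorm.hasSum.prod_fiberwise hrow
    have h2 := (NormedSpace.expSeries_div_hasSum_exp (-(s / (1 - s)) * (z : ℂ))).mul_left (1 - s)⁻¹
    rw [← Complex.exp_eq_exp_ℂ] at h2
    rw [← h1.unique h2]
    exact hnorm.hasSum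
  have h3 := (Finset.HasAntidiagonal.sigmaAntidiagonalEquivProd (A := ℕ)).hasSum_iff.2 htot
  have h4 := h3.sigma (g := fun l => (((lag l).eval z : ℝ) : ℂ) * s ^ l) fun l => by
    have := hasSum_fintype (fun c : Finset.HasAntidiagonal.antidiagonal l => F c)
    convert! this using 1
    rw [Finset.sum_coe_sort (Finset.HasAntidiagonal.antidiagonal l) F, Finset.Nat.sum_antidiagonal_eq_sum_range_succ_mk]
    rw [lag, Polynomial.eval_finsetSum]
    push_cast
    rw [Finset.sum_mul]
    refine Finset.sum_congr rfl fun k hk => ?_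
    have hk' : k ≤ l := by simpa [Nat.lt_succ_iff] using hk
    simp only [F, Nat.sub_add_cancel hk', Polynomial.eval_monomial, lagCoeff]
    push_cast
    rw [show s ^ l = s ^ (l - k) * s ^ k by rw [← pow_add, Nat.sub_add_cancel hk'],
      neg_pow (z : ℂ)]
    ring
  exact h4

/-- The numbers `a l` are the Taylor coefficients of `f` at `0`, so Cauchy's estimate on the circle
of radius `r` applies. -/
lemma norm_coeff_le_of_hasSum {a : ℕ → ℂ} {f : ℂ → ℂ}
    (hf : ∀ s : ℂ, ‖s‖ < 1 → HasSum (fun l => a l * s ^ l) (f s)) {r C : ℝ} (hr0 : 0 < r)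
    (hr1 : r < 1) (hC : ∀ s : ℂ, ‖s‖ = r → ‖f s‖ ≤ C) (l : ℕ) : ‖a l‖ ≤ C / r ^ l := by
  have hps : HasFPowerSeriesOnBall f (FormalMultilinearSeries.ofScalars ℂ a) 0 1 := by
    refine ⟨?_, one_pos, fun {y} hy => ?_⟩
    · refine ENNReal.le_of_forall_nnreal_lt fun r hr => ?_
      refine FormalMultilinearSeries.le_radius_of_summable_norm _ ?_
      have hr' : ‖((r : ℝ) : ℂ)‖ < 1 := by
        simpa using hr
      have := (hf _ hr').summable.norm
      simpa [norm_mul, norm_pow, FormalMultilinearSeries.ofScalars_norm] using this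
    · have hy' : ‖y‖ < 1 := by
        rw [show (1 : ℝ≥0∞) = ENNReal.ofReal 1 by simp, Metric.eball_ofReal] at hy
        simpa using hy
      simpa [FormalMultilinearSeries.ofScalars_apply_eq, zero_add, mul_comm] using hf y hy'
  have hd : DifferentiableOn ℂ f (Metric.ball 0 1) := by
    have := hps.differentiableOn
    rwa [show (1 : ℝ≥0∞) = ENNReal.ofReal 1 by simp, Metric.eball_ofReal] at this
  have hd' : DiffContOnCl ℂ f (Metric.ball 0 r) :=
    (hd.mono (by rw [closure_ball _ hr0.ne']; exact Metric.closedBall_subset_ball hr1)).diffContOnCl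
  have h1 := Complex.norm_iteratedDeriv_le_of_forall_mem_sphere_norm_le l hr0 hd'
    (fun z hz => hC z (by simpa using hz))
  have h2 := hps.factorial_smul 1 l
  rw [FormalMultilinearSeries.ofScalars_apply_eq, one_pow, smul_eq_mul, mul_one] at h2
  rw [iteratedDeriv_eq_iteratedFDeriv, ← h2, nsmul_eq_mul, norm_mul, mul_div_assoc] at h1
  rw [Complex.norm_natCast] at h1
  exact le_of_mul_le_mul_left h1 (by positivity)

/-- Cauchy's estimate for the Laguerre polynomials. -/
lemma abs_lag_le {r : ℝ} (hr0 : 0 < r) (hr1 : r < 1) (l : ℕ) {z : ℝ} (hz : 0 ≤ z) :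
    |(lag l).eval z| * Real.exp (-z / 2)
      ≤ (1 - r)⁻¹ * (r⁻¹) ^ l * Real.exp (-((1 - r) / (2 * (1 + r))) * z) := by
  have h := norm_coeff_le_of_hasSum (a := fun l => (((lag l).eval z : ℝ) : ℂ))
    (f := fun s => (1 - s)⁻¹ * Complex.exp (-(s / (1 - s)) * z))
    (C := (1 - r)⁻¹ * Real.exp (-(1 / (1 + r) - 1) * z))
    (fun s hs => hasSum_lag z hs) hr0 hr1 (fun s hs => ?_) l
  · rw [Complex.norm_real, Real.norm_eq_abs] at h
    calc _ ≤ (1 - r)⁻¹ * Real.exp (-(1 / (1 + r) - 1) * z) / r ^ l * Real.exp (-z / 2) := by gcongr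
      _ = (1 - r)⁻¹ * (r⁻¹) ^ l * (Real.exp (-(1 / (1 + r) - 1) * z) * Real.exp (-z / 2)) := by
        rw [inv_pow]; ring
      _ = _ := by
        rw [← Real.exp_add]
        congr 2
        field_simp
        ring
  · have h1s : 1 - s ≠ 0 := fun h => by
      rw [sub_eq_zero] at h; rw [← h] at hs; simp at hs; linarith
    rw [norm_mul, norm_inv, Complex.norm_exp]
    have h1r : 0 < 1 - r := by linarith
    refine mul_le_mul (inv_anti₀ h1r ?_) (Real.exp_le_exp.2 ?_) (Real.exp_pos _).le
      (inv_nonneg.2 h1r.le)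
    · have := norm_sub_norm_le 1 s
      rw [norm_one, hs] at this
      exact this
    -- On the circle `‖s‖ = r` the real part of `(1 - s)⁻¹` is at least `1 / (1 + r)`. The factor
    -- `exp(z/2)` this falls short of is what leaves Gaussian decay after multiplication by
    -- `exp(-z/2)`.
    · have e1 : -(s / (1 - s)) * (z : ℂ) = (z : ℂ) - (z : ℂ) * (1 - s)⁻¹ := by
        field_simp
        ring
      rw [e1, Complex.sub_re, Complex.ofReal_re, Complex.re_ofReal_mul, Complex.inv_re]
      have e2 : Complex.normSq s = r ^ 2 := by rw [Complex.normSq_eq_norm_sq, hs]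
      have e3 : Complex.normSq (1 - s) = 1 - 2 * s.re + r ^ 2 := by
        rw [← e2, Complex.normSq_apply, Complex.normSq_apply]; simp; ring
      have e4 : 0 < Complex.normSq (1 - s) := Complex.normSq_pos.2 h1s
      have e5 : -r ≤ s.re := by
        have := Complex.abs_re_le_norm s
        rw [hs] at this
        exact (abs_le.1 this).1
      have e6 : 1 / (1 + r) ≤ (1 - s).re / Complex.normSq (1 - s) := by
        rw [div_le_div_iff₀ (by linarith) e4, e3, Complex.sub_re, Complex.one_re]
        nlinarith
      nlinarith

lemma abs_derivative_lag_le {r : ℝ} (hr0 : 0 < r) (hr1 : r < 1) (l : ℕ) {z : ℝ} (hz : 0 ≤ z) :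
    |(lag l).derivative.eval z| * Real.exp (-z / 2)
      ≤ l * ((1 - r)⁻¹ * (r⁻¹) ^ l * Real.exp (-((1 - r) / (2 * (1 + r))) * z)) := by
  have h1r : 0 < 1 - r := by linarith
  rw [derivative_lag, Polynomial.eval_neg, abs_neg, Polynomial.eval_finsetSum]
  calc _ ≤ (∑ j ∈ Finset.range l, |(lag j).eval z|) * Real.exp (-z / 2) := by
        gcongr; exact Finset.abs_sum_le_sum_abs _ _
    _ = ∑ j ∈ Finset.range l, |(lag j).eval z| * Real.exp (-z / 2) := Finset.sum_mul _ _ _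
    _ ≤ ∑ j ∈ Finset.range l, ((1 - r)⁻¹ * (r⁻¹) ^ l * Real.exp (-((1 - r) / (2 * (1 + r))) * z)) := by
        refine Finset.sum_le_sum fun j hj => (abs_lag_le hr0 hr1 j hz).trans ?_
        gcongr
        · exact (one_le_inv₀ hr0).2 hr1.le
        · exact (Finset.mem_range.1 hj).le
    _ = _ := by simp

/-! ### Gaussian bounds -/

lemma finrank_plane : Module.finrank ℝ Plane = 2 := by simp

lemma integrable_norm_rpow_mul_exp {s b : ℝ} (hs : -2 < s) (hb : 0 < b) :
    Integrable (fun w : Plane => ‖w‖ ^ s * Real.exp (-b * ‖w‖ ^ 2)) volume := by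
  rw [integrable_fun_norm_addHaar (μ := (volume : Measure Plane))
    (f := fun y : ℝ => y ^ s * Real.exp (-b * y ^ 2)), finrank_plane]
  refine (integrableOn_rpow_mul_exp_neg_mul_sq hb (s := s + 1) (by linarith)).congr_fun ?_
    measurableSet_Ioi
  intro y hy
  simp only [Set.mem_Ioi] at hy
  simp only [smul_eq_mul, Nat.add_one_sub_one, pow_one]
  rw [Real.rpow_add_one hy.ne']
  ring

/-- The singular Gaussian `(1 + 1 / ‖w‖) e^{-b ‖w‖²}`. -/
def singGauss (b : ℝ) (w : Plane) : ℝ := (1 + ‖w‖⁻¹) * Real.exp (-b * ‖w‖ ^ 2)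

lemma singGauss_nonneg (b : ℝ) (w : Plane) : 0 ≤ singGauss b w := by
  unfold singGauss; positivity

lemma measurable_singGauss (b : ℝ) : Measurable (singGauss b) := by unfold singGauss; fun_prop

lemma integrable_exp_neg_sq {b : ℝ} (hb : 0 < b) :
    Integrable (fun w : Plane => Real.exp (-b * ‖w‖ ^ 2)) volume := by
  simpa using integrable_norm_rpow_mul_exp (s := 0) (by norm_num) hb

lemma integrable_singGauss {b : ℝ} (hb : 0 < b) : Integrable (singGauss b) volume := by
  have h1 := integrable_exp_neg_sq hb
  have h2 := integrable_norm_rpow_mul_exp (s := -1) (by norm_num) hb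
  refine (h1.add h2).congr (ae_of_all _ fun w => ?_)
  simp only [Pi.add_apply, singGauss, Real.rpow_neg_one]
  ring

lemma exp_le_singGauss (b : ℝ) (w : Plane) : Real.exp (-b * ‖w‖ ^ 2) ≤ singGauss b w := by
  unfold singGauss
  exact le_mul_of_one_le_left (Real.exp_pos _).le (by linarith [inv_nonneg.2 (norm_nonneg w)])

/-- Products of polynomials and Gaussians. -/
def IsGaussPoly (h : Plane → ℂ) : Prop :=
  ∃ b : ℝ, 0 < b ∧ ∃ P : MvPolynomial (Fin 2) ℂ,
    h = fun w => MvPolynomial.eval (fun i => ((w i : ℝ) : ℂ)) P * Real.exp (-b * ‖w‖ ^ 2)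

lemma hasFDerivAt_coord (w : Plane) (i : Fin 2) :
    HasFDerivAt (fun w : Plane => ((w i : ℝ) : ℂ))
      (Complex.ofRealCLM.comp (EuclideanSpace.proj i : Plane →L[ℝ] ℝ)) w :=
  (Complex.ofRealCLM.comp (EuclideanSpace.proj i : Plane →L[ℝ] ℝ)).hasFDerivAt

lemma hasFDerivAt_eval (P : MvPolynomial (Fin 2) ℂ) (w : Plane) :
    DifferentiableAt ℝ (fun w : Plane => MvPolynomial.eval (fun i => ((w i : ℝ) : ℂ)) P) w ∧
    ∀ k, fderiv ℝ (fun w : Plane => MvPolynomial.eval (fun i => ((w i : ℝ) : ℂ)) P) w (e k)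
      = MvPolynomial.eval (fun i => ((w i : ℝ) : ℂ)) (MvPolynomial.pderiv k P) := by
  induction P using MvPolynomial.induction_on with
  | C a => simp
  | add p q hp hq =>
    simp only [map_add]
    refine ⟨hp.1.add hq.1, fun k => ?_⟩
    rw [fderiv_fun_add hp.1 hq.1, add_apply, hp.2, hq.2]
  | mul_X p i hp =>
    simp only [map_mul, MvPolynomial.eval_X]
    have h := hp.1.hasFDerivAt.mul (hasFDerivAt_coord w i)
    refine ⟨h.differentiableAt, fun k => ?_⟩
    rw [show fderiv ℝ (fun w : Plane => MvPolynomial.eval (fun i => ((w i : ℝ) : ℂ)) p * (w i : ℂ)) w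
      = _ from h.fderiv, Derivation.leibniz]
    simp only [add_apply, smul_apply, hp.2, smul_eq_mul, map_add, map_mul,
      MvPolynomial.eval_X, MvPolynomial.pderiv_X, ContinuousLinearMap.comp_apply]
    by_cases hk : i = k
    · subst hk; simp [e]
    · simp [e, hk]

lemma hasFDerivAt_norm_sq' (w : Plane) :
    HasFDerivAt (fun w : Plane => ‖w‖ ^ 2) (2 • innerSL ℝ w) w :=
  (hasStrictFDerivAt_norm_sq w).hasFDerivAt

lemma inner_e (w : Plane) (k : Fin 2) : inner ℝ w (e k) = w k := by
  simp [e, EuclideanSpace.inner_single_right]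

lemma norm_sq_plane (w : Plane) : ‖w‖ ^ 2 = w 0 ^ 2 + w 1 ^ 2 := by
  rw [EuclideanSpace.real_norm_sq_eq, Fin.sum_univ_two]

lemma contDiff_coord (i : Fin 2) {n : WithTop ℕ∞} : ContDiff ℝ n fun w : Plane => ((w i : ℝ) : ℂ) :=
  (Complex.ofRealCLM.comp (EuclideanSpace.proj i : Plane →L[ℝ] ℝ)).contDiff

lemma IsGaussPoly.contDiff {h : Plane → ℂ} (hh : IsGaussPoly h) :
    ContDiff ℝ ((⊤ : ℕ∞) : WithTop ℕ∞) h := by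
  obtain ⟨b, -, P, rfl⟩ := hh
  refine ContDiff.mul ?_ ?_
  · induction P using MvPolynomial.induction_on with
    | C a => simpa using contDiff_const
    | add p q hp hq => simpa using hp.add hq
    | mul_X p i hp => simpa using hp.mul (contDiff_coord i)
  · exact Complex.ofRealCLM.contDiff.comp (contDiff_const.mul (contDiff_norm_sq ℝ)).exp

/-- The rate `b` must be arbitrary for the induction to close: one more coordinate factor is paid
for with half of the rate. -/
lemma norm_eval_le (P : MvPolynomial (Fin 2) ℂ) {b : ℝ} (hb : 0 < b) :
    ∃ C, 0 ≤ C ∧ ∀ w : Plane,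
      ‖MvPolynomial.eval (fun i => ((w i : ℝ) : ℂ)) P‖ ≤ C * Real.exp (b * ‖w‖ ^ 2) := by
  induction P using MvPolynomial.induction_on generalizing b with
  | C a =>
    refine ⟨‖a‖, norm_nonneg _, fun w => ?_⟩
    simpa using le_mul_of_one_le_right (norm_nonneg a) (Real.one_le_exp (by positivity))
  | add p q hp hq =>
    obtain ⟨C, h0, hC⟩ := hp hb
    obtain ⟨C', h0', hC'⟩ := hq hb
    refine ⟨C + C', by positivity, fun w => ?_⟩
    rw [map_add, add_mul]
    exact (norm_add_le _ _).trans (add_le_add (hC w) (hC' w))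
  | mul_X p i hp =>
    obtain ⟨C, h0, hC⟩ := hp (half_pos hb)
    refine ⟨C * (1 + 2 / b), by positivity, fun w => ?_⟩
    rw [map_mul, norm_mul, MvPolynomial.eval_X, Complex.norm_real]
    have h1 : ‖w i‖ ≤ ‖w‖ := PiLp.norm_apply_le w i
    have h2 : ‖w‖ ≤ (1 + 2 / b) * Real.exp (b / 2 * ‖w‖ ^ 2) := by
      have h3 := Real.add_one_le_exp (b / 2 * ‖w‖ ^ 2)
      have h4 : ‖w‖ ≤ 1 + ‖w‖ ^ 2 := by nlinarith [sq_nonneg (‖w‖ - 1), sq_nonneg ‖w‖]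
      have h5 : 1 + ‖w‖ ^ 2 ≤ (1 + 2 / b) * (b / 2 * ‖w‖ ^ 2 + 1) := by
        have : (1 + 2 / b) * (b / 2 * ‖w‖ ^ 2 + 1)
          = 1 + ‖w‖ ^ 2 + b / 2 * ‖w‖ ^ 2 + 2 / b := by field_simp; ring
        rw [this]
        have : 0 ≤ b / 2 * ‖w‖ ^ 2 + 2 / b := by positivity
        linarith
      refine h4.trans (h5.trans ?_)
      gcongr
    calc _ ≤ (C * Real.exp (b / 2 * ‖w‖ ^ 2)) * ((1 + 2 / b) * Real.exp (b / 2 * ‖w‖ ^ 2)) := by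
          gcongr
          · exact hC w
          · exact h1.trans h2
      _ = C * (1 + 2 / b) * (Real.exp (b / 2 * ‖w‖ ^ 2) * Real.exp (b / 2 * ‖w‖ ^ 2)) := by ring
      _ = _ := by rw [← Real.exp_add]; ring_nf

lemma IsGaussPoly.norm_le {h : Plane → ℂ} (hh : IsGaussPoly h) :
    ∃ C b : ℝ, 0 ≤ C ∧ 0 < b ∧ ∀ w, ‖h w‖ ≤ C * Real.exp (-b * ‖w‖ ^ 2) := by
  obtain ⟨b, hb, P, rfl⟩ := hh
  obtain ⟨C, h0, hC⟩ := norm_eval_le P (half_pos hb)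
  refine ⟨C, b / 2, h0, half_pos hb, fun w => ?_⟩
  rw [norm_mul, Complex.norm_real, Real.norm_of_nonneg (Real.exp_pos _).le]
  calc _ ≤ C * Real.exp (b / 2 * ‖w‖ ^ 2) * Real.exp (-b * ‖w‖ ^ 2) := by
        gcongr; exact hC w
    _ = _ := by rw [mul_assoc, ← Real.exp_add]; ring_nf

lemma IsGaussPoly.integrable {h : Plane → ℂ} (hh : IsGaussPoly h) : Integrable h volume := by
  obtain ⟨C, b, -, hb, hC⟩ := hh.norm_le
  exact ((integrable_exp_neg_sq hb).const_mul C).mono'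
    hh.contDiff.continuous.aestronglyMeasurable (ae_of_all _ hC)

lemma IsGaussPoly.memLp_two {h : Plane → ℂ} (hh : IsGaussPoly h) : MemLp h 2 volume := by
  obtain ⟨C, b, h0, hb, hC⟩ := hh.norm_le
  rw [memLp_two_iff_integrable_sq_norm hh.contDiff.continuous.aestronglyMeasurable]
  refine ((integrable_exp_neg_sq hb).const_mul (C ^ 2)).mono'
    (hh.contDiff.continuous.norm.pow 2).aestronglyMeasurable (ae_of_all _ fun w => ?_)
  rw [Real.norm_of_nonneg (by positivity)]
  calc _ ≤ (C * Real.exp (-b * ‖w‖ ^ 2)) ^ 2 := by gcongr; exact hC w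
    _ = C ^ 2 * (Real.exp (-b * ‖w‖ ^ 2) * Real.exp (-b * ‖w‖ ^ 2)) := by ring
    _ ≤ C ^ 2 * (1 * Real.exp (-b * ‖w‖ ^ 2)) := by
        gcongr
        exact Real.exp_le_one_iff.2 (by nlinarith [sq_nonneg ‖w‖])
    _ = _ := by rw [one_mul]

/-- The gauge is linear in `w`, so the new prefactor is again a polynomial. Closure under this
operation makes all higher covariant derivatives integrable and square integrable at once. -/
lemma IsGaussPoly.covDeriv {h : Plane → ℂ} (hh : IsGaussPoly h) (B₀ : ℝ) (k : Fin 2) :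
    IsGaussPoly (covDeriv (gauge0 B₀) k h) := by
  obtain ⟨b, hb, P, rfl⟩ := hh
  have : ∃ G : MvPolynomial (Fin 2) ℂ, ∀ w : Plane,
      MvPolynomial.eval (fun i => ((w i : ℝ) : ℂ)) G = (gauge0 B₀ w k : ℂ) := by
    fin_cases k
    · exact ⟨MvPolynomial.C ((B₀ / 2 : ℝ) : ℂ) * MvPolynomial.X 1, fun w => by
        simp [gauge0_zero]⟩
    · exact ⟨-(MvPolynomial.C ((B₀ / 2 : ℝ) : ℂ) * MvPolynomial.X 0), fun w => by
        simp [gauge0_one]⟩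
  obtain ⟨G, hG⟩ := this
  refine ⟨b, hb, MvPolynomial.C (-Complex.I) * MvPolynomial.pderiv k P
    + MvPolynomial.C (2 * Complex.I * b) * (P * MvPolynomial.X k) - G * P, ?_⟩
  funext w
  obtain ⟨h1, h2⟩ := hasFDerivAt_eval P w
  have h3 : HasFDerivAt (fun w : Plane => ((Real.exp (-b * ‖w‖ ^ 2) : ℝ) : ℂ)) _ w :=
    Complex.ofRealCLM.hasFDerivAt.comp w ((hasFDerivAt_norm_sq' w).const_mul (-b)).exp
  have h4 : fderiv ℝ (fun w : Plane => MvPolynomial.eval (fun i => ((w i : ℝ) : ℂ)) P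
    * Real.exp (-b * ‖w‖ ^ 2)) w = _ := (h1.hasFDerivAt.mul h3).fderiv
  rw [Landau.covDeriv, h4]
  simp only [add_apply, smul_apply, h2, ContinuousLinearMap.comp_apply, Complex.ofRealCLM_apply,
    smul_eq_mul, map_add, map_sub, map_mul, MvPolynomial.eval_C, MvPolynomial.eval_X, hG,
    nsmul_eq_mul, innerSL_apply_apply, inner_e]
  push_cast
  ring

lemma isGaussPoly_radial {b : ℝ} (hb : 0 < b) (P : Polynomial ℝ) :
    IsGaussPoly fun w => ((P.eval (‖w‖ ^ 2) * Real.exp (-b * ‖w‖ ^ 2) : ℝ) : ℂ) := by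
  refine ⟨b, hb, Polynomial.aeval (MvPolynomial.X 0 ^ 2 + MvPolynomial.X 1 ^ 2)
    (P.map (algebraMap ℝ ℂ)), ?_⟩
  funext w
  have : MvPolynomial.eval (fun i => ((w i : ℝ) : ℂ)) (Polynomial.aeval
      (MvPolynomial.X 0 ^ 2 + MvPolynomial.X 1 ^ 2) (P.map (algebraMap ℝ ℂ)))
      = ((P.eval (‖w‖ ^ 2) : ℝ) : ℂ) := by
    rw [← MvPolynomial.coe_aeval_eq_eval, RingHom.coe_coe, ← Polynomial.aeval_algHom_apply]
    simp only [map_add, map_pow, MvPolynomial.aeval_X]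
    rw [norm_sq_plane, ← Complex.ofReal_pow, ← Complex.ofReal_pow, ← Complex.ofReal_add,
      Polynomial.aeval_def, Polynomial.eval₂_map]
    have := Polynomial.hom_eval₂ P (RingHom.id ℝ) (algebraMap ℝ ℂ) (w 0 ^ 2 + w 1 ^ 2)
    simpa [Polynomial.eval₂_id] using this.symm
  rw [this]
  push_cast
  ring




/-! ### Radial functions -/

/-- The potential is tangential; on radial functions the cross term of the squared covariant
derivative therefore cancels in the sum over `k`. -/
lemma sum_gauge0_mul (B₀ : ℝ) (w : Plane) : gauge0 B₀ w 0 * w 0 + gauge0 B₀ w 1 * w 1 = 0 := by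
  rw [gauge0_zero, gauge0_one]; ring

lemma sum_gauge0_sq (B₀ : ℝ) (w : Plane) :
    gauge0 B₀ w 0 ^ 2 + gauge0 B₀ w 1 ^ 2 = B₀ ^ 2 / 4 * ‖w‖ ^ 2 := by
  rw [gauge0_zero, gauge0_one, norm_sq_plane]; ring

lemma hasFDerivAt_gauge0 (B₀ : ℝ) (k : Fin 2) :
    ∃ A : Plane →L[ℝ] ℂ, (∀ w, HasFDerivAt (fun w => ((gauge0 B₀ w k : ℝ) : ℂ)) A w) ∧
      A (e k) = 0 := by
  fin_cases k
  · refine ⟨((B₀ / 2 : ℝ) : ℂ) • Complex.ofRealCLM.comp (EuclideanSpace.proj 1 : Plane →L[ℝ] ℝ),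
      fun w => ?_, by simp [e]⟩
    have := (hasFDerivAt_coord w 1).const_mul ((B₀ / 2 : ℝ) : ℂ)
    refine this.congr_of_eventuallyEq (Filter.Eventually.of_forall fun w => ?_)
    simp [gauge0_zero]
  · refine ⟨-(((B₀ / 2 : ℝ) : ℂ) • Complex.ofRealCLM.comp (EuclideanSpace.proj 0 : Plane →L[ℝ] ℝ)),
      fun w => ?_, by simp [e]⟩
    have := ((hasFDerivAt_coord w 0).const_mul ((B₀ / 2 : ℝ) : ℂ)).neg
    refine this.congr_of_eventuallyEq (Filter.Eventually.of_forall fun w => ?_)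
    simp [gauge0_one]

lemma hasFDerivAt_radial {q : ℝ → ℝ} {q' : ℝ} {w : Plane} (hq : HasDerivAt q q' (‖w‖ ^ 2)) :
    ∃ A : Plane →L[ℝ] ℂ, HasFDerivAt (fun w : Plane => ((q (‖w‖ ^ 2) : ℝ) : ℂ)) A w ∧
      ∀ k, A (e k) = 2 * w k * q' := by
  have h := Complex.ofRealCLM.hasFDerivAt.comp w (hq.comp_hasFDerivAt w (hasFDerivAt_norm_sq' w))
  refine ⟨_, h, fun k => ?_⟩
  simp only [ContinuousLinearMap.comp_apply, smul_apply, Complex.ofRealCLM_apply, smul_eq_mul,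
    nsmul_eq_mul, innerSL_apply_apply, inner_e]
  push_cast
  ring

lemma covDeriv_radial (B₀ : ℝ) (k : Fin 2) {q q' : ℝ → ℝ} (hq : ∀ x, HasDerivAt q (q' x) x)
    (w : Plane) :
    covDeriv (gauge0 B₀) k (fun w => ((q (‖w‖ ^ 2) : ℝ) : ℂ)) w
      = -(2 * Complex.I) * ((w k : ℂ) * (q' (‖w‖ ^ 2) : ℂ))
        - (gauge0 B₀ w k : ℂ) * (q (‖w‖ ^ 2) : ℂ) := by
  obtain ⟨A, h, hA⟩ := hasFDerivAt_radial (w := w) (hq _)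
  rw [covDeriv, h.fderiv, hA]
  ring

lemma covDeriv_covDeriv_radial (B₀ : ℝ) (k : Fin 2) {q q' q'' : ℝ → ℝ}
    (hq : ∀ x, HasDerivAt q (q' x) x) (hq' : ∀ x, HasDerivAt q' (q'' x) x) (w : Plane) :
    covDeriv (gauge0 B₀) k (covDeriv (gauge0 B₀) k (fun w => ((q (‖w‖ ^ 2) : ℝ) : ℂ))) w
      = -2 * q' (‖w‖ ^ 2) - 4 * (w k : ℂ) ^ 2 * q'' (‖w‖ ^ 2)
        + 4 * Complex.I * ((gauge0 B₀ w k * w k : ℝ) : ℂ) * q' (‖w‖ ^ 2)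
        + (gauge0 B₀ w k : ℂ) ^ 2 * q (‖w‖ ^ 2) := by
  obtain ⟨A, h, hA⟩ := hasFDerivAt_radial (w := w) (hq _)
  obtain ⟨A', h', hA'⟩ := hasFDerivAt_radial (w := w) (hq' _)
  obtain ⟨G, hG, hG0⟩ := hasFDerivAt_gauge0 B₀ k
  rw [show covDeriv (gauge0 B₀) k (fun w => ((q (‖w‖ ^ 2) : ℝ) : ℂ)) = _ from
    funext (covDeriv_radial B₀ k hq)]
  have h1 := (((hasFDerivAt_coord w k).mul h').const_mul (-(2 * Complex.I))).sub ((hG w).mul h)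
  rw [covDeriv, show fderiv ℝ (fun w : Plane => -(2 * Complex.I) * ((w k : ℂ) * (q' (‖w‖ ^ 2) : ℂ))
        - (gauge0 B₀ w k : ℂ) * (q (‖w‖ ^ 2) : ℂ)) w = _ from h1.fderiv]
  have hek : (EuclideanSpace.proj k : Plane →L[ℝ] ℝ) (e k) = 1 := by simp [e]
  simp only [sub_apply, add_apply, smul_apply, hA, hA', hG0, ContinuousLinearMap.comp_apply, hek,
    smul_eq_mul, Complex.ofRealCLM_apply]
  push_cast
  linear_combination (2 * (q' (‖w‖ ^ 2) : ℂ) + 4 * (w k : ℂ) ^ 2 * q'' (‖w‖ ^ 2)) * Complex.I_sq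

/-! ### The kernels of the spectral projections and of the heat semigroup -/

/-- The profile of the kernel of the projection onto the `l`-th Landau level. -/
def landauFun (B₀ : ℝ) (l : ℕ) (w : Plane) : ℂ :=
  ((B₀ / (2 * Real.pi) * ((lag l).eval (B₀ / 2 * ‖w‖ ^ 2) * Real.exp (-(B₀ / 4) * ‖w‖ ^ 2)) : ℝ) : ℂ)

/-- The profile of the heat kernel of the Landau Hamiltonian. -/
def heatFun (B₀ t : ℝ) (w : Plane) : ℂ :=
  ((B₀ / (4 * Real.pi * Real.sinh (B₀ * t))
    * Real.exp (-(B₀ * Real.cosh (B₀ * t) / (4 * Real.sinh (B₀ * t))) * ‖w‖ ^ 2) : ℝ) : ℂ)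

lemma isGaussPoly_landauFun {B₀ : ℝ} (hB : 0 < B₀) (l : ℕ) : IsGaussPoly (landauFun B₀ l) := by
  convert isGaussPoly_radial (b := B₀ / 4) (by positivity) (Polynomial.C (B₀ / (2 * Real.pi))
    * (lag l).comp (Polynomial.C (B₀ / 2) * Polynomial.X)) using 1
  funext w
  simp [landauFun, Polynomial.eval_comp]
  ring

lemma isGaussPoly_heatFun {B₀ : ℝ} (hB : 0 < B₀) {t : ℝ} (ht : 0 < t) :
    IsGaussPoly (heatFun B₀ t) := by
  have h1 : 0 < Real.sinh (B₀ * t) := Real.sinh_pos_iff.2 (by positivity)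
  have h2 := Real.cosh_pos (B₀ * t)
  convert isGaussPoly_radial (b := B₀ * Real.cosh (B₀ * t) / (4 * Real.sinh (B₀ * t)))
    (by positivity) (Polynomial.C (B₀ / (4 * Real.pi * Real.sinh (B₀ * t)))) using 1
  funext w
  simp [heatFun]

lemma landauFun_eq_radial (B₀ : ℝ) (l : ℕ) :
    landauFun B₀ l = fun w => (((fun x => B₀ / (2 * Real.pi) * ((lag l).eval (B₀ / 2 * x)
      * Real.exp (-(B₀ / 4) * x))) (‖w‖ ^ 2) : ℝ) : ℂ) := rfl

lemma hasDerivAt_landau_profile (B₀ : ℝ) (P : Polynomial ℝ) (x : ℝ) :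
    HasDerivAt (fun x => B₀ / (2 * Real.pi) * (P.eval (B₀ / 2 * x) * Real.exp (-(B₀ / 4) * x)))
      (B₀ / (2 * Real.pi) * ((Polynomial.C (B₀ / 2) * P.derivative
        - Polynomial.C (B₀ / 4) * P).eval (B₀ / 2 * x) * Real.exp (-(B₀ / 4) * x))) x := by
  have h1 : HasDerivAt (fun x => P.eval (B₀ / 2 * x)) (P.derivative.eval (B₀ / 2 * x) * (B₀ / 2)) x := by
    have := (P.hasDerivAt (B₀ / 2 * x)).comp x ((hasDerivAt_id x).const_mul (B₀ / 2))
    rwa [mul_one] at this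
  have h2 : HasDerivAt (fun x => Real.exp (-(B₀ / 4) * x))
      (Real.exp (-(B₀ / 4) * x) * (-(B₀ / 4))) x := by
    simpa using ((hasDerivAt_id x).const_mul (-(B₀ / 4))).exp
  refine ((h1.mul h2).const_mul (B₀ / (2 * Real.pi))).congr_deriv ?_
  simp only [Polynomial.eval_sub, Polynomial.eval_mul, Polynomial.eval_C]
  ring

/-- In the variable `z = B₀ ‖w‖² / 2` the radial part is Laguerre's equation, and the quadratic term
of the potential cancels the second derivative of the Gaussian. The imaginary part vanishes because
the potential is tangential. -/
lemma sum_covDeriv_landauFun (B₀ : ℝ) (l : ℕ) (w : Plane) :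
    ∑ k, covDeriv (gauge0 B₀) k (covDeriv (gauge0 B₀) k (landauFun B₀ l)) w
      = level B₀ l * landauFun B₀ l w := by
  rw [Fin.sum_univ_two, landauFun_eq_radial]
  rw [covDeriv_covDeriv_radial B₀ 0 (hasDerivAt_landau_profile B₀ _) (hasDerivAt_landau_profile B₀ _),
    covDeriv_covDeriv_radial B₀ 1 (hasDerivAt_landau_profile B₀ _) (hasDerivAt_landau_profile B₀ _)]
  have hode := congrArg (Polynomial.eval (B₀ / 2 * ‖w‖ ^ 2)) (lag_ode l)
  simp only [Polynomial.eval_add, Polynomial.eval_mul, Polynomial.eval_X, Polynomial.eval_sub,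
    Polynomial.eval_one, Polynomial.eval_natCast, Polynomial.eval_zero] at hode
  simp only [level, ← Complex.ofReal_pow, Polynomial.derivative_sub, Polynomial.derivative_mul,
    Polynomial.derivative_C, zero_mul, zero_add, Polynomial.eval_mul,
    Polynomial.eval_sub, Polynomial.eval_C]
  have h1 := sum_gauge0_mul B₀ w
  have h2 := sum_gauge0_sq B₀ w
  have h3 := norm_sq_plane w
  apply Complex.ext
  · simp only [Complex.add_re, Complex.sub_re, Complex.mul_re, Complex.neg_re, Complex.re_ofNat,
      Complex.im_ofNat, Complex.ofReal_re, Complex.ofReal_im, Complex.I_re, Complex.I_im,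
      Complex.neg_im, Complex.mul_im]
    generalize Real.exp (-(B₀ / 4) * ‖w‖ ^ 2) = E at *
    generalize (lag l).eval (B₀ / 2 * ‖w‖ ^ 2) = L at *
    generalize (lag l).derivative.eval (B₀ / 2 * ‖w‖ ^ 2) = L' at *
    generalize (lag l).derivative.derivative.eval (B₀ / 2 * ‖w‖ ^ 2) = L'' at *
    generalize gauge0 B₀ w 0 = a at *
    generalize gauge0 B₀ w 1 = b at *
    generalize w 0 = x at *
    generalize w 1 = y at *
    generalize ‖w‖ ^ 2 = ρ at *
    subst h3
    linear_combination (-(2 * B₀) * (B₀ / (2 * Real.pi)) * E) * hode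
      + (B₀ / (2 * Real.pi)) * E * L * h2
  · simp only [Complex.add_im, Complex.sub_im, Complex.mul_re, Complex.neg_re, Complex.re_ofNat,
      Complex.im_ofNat, Complex.ofReal_re, Complex.ofReal_im, Complex.I_re, Complex.I_im,
      Complex.neg_im, Complex.mul_im]
    linear_combination (4 * (B₀ / (2 * Real.pi)) * (B₀ / 2 *
      (lag l).derivative.eval (B₀ / 2 * ‖w‖ ^ 2) - B₀ / 4 * (lag l).eval (B₀ / 2 * ‖w‖ ^ 2))
      * Real.exp (-(B₀ / 4) * ‖w‖ ^ 2)) * h1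

/-! ### Spectral theory of the Landau Hamiltonian -/

/-- The projection onto the `l`-th Landau level, as an integral operator. -/
def landauOp (B₀ : ℝ) (l : ℕ) : L2 ℂ →L[ℂ] L2 ℂ := twOp B₀ (landauFun B₀ l)

lemma hasKer_twOp_gaussPoly (B₀ : ℝ) {h : Plane → ℂ} (hh : IsGaussPoly h) :
    HasKer (twOp B₀ h) (twKer B₀ h) :=
  hasKer_twOp B₀ hh.contDiff.continuous.stronglyMeasurable hh.integrable

lemma hasKer_landauOp {B₀ : ℝ} (hB : 0 < B₀) (l : ℕ) :
    HasKer (landauOp B₀ l) (twKer B₀ (landauFun B₀ l)) :=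
  hasKer_twOp_gaussPoly B₀ (isGaussPoly_landauFun hB l)

lemma IsGaussPoly.mg {B₀ : ℝ} {h : Plane → ℂ} (hh : IsGaussPoly h) :
    MG B₀ h (fun k => Landau.covDeriv (gauge0 B₀) k h) :=
  mg_of_contDiff hh.contDiff hh.integrable fun k => (hh.covDeriv B₀ k).integrable

lemma IsGaussPoly.isMagGrad {B₀ : ℝ} {h : Plane → ℂ} (hh : IsGaussPoly h) (f : L2 ℂ) :
    IsMagGrad (gauge0 B₀) (twOp B₀ h f)
      fun k => twOp B₀ (Landau.covDeriv (gauge0 B₀) k h) f :=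
  hh.mg.isMagGrad hh.integrable (fun k => (hh.covDeriv B₀ k).integrable)
    (hasKer_twOp_gaussPoly B₀ hh)
    (V := fun k => twOp B₀ (Landau.covDeriv (gauge0 B₀) k h))
    (fun k => hasKer_twOp_gaussPoly B₀ (hh.covDeriv B₀ k)) f

/-- The second covariant derivative is also moved from the test function to the profile, where the
eigenvalue equation holds pointwise. -/
lemma landauOp_mem_eigenspace {B₀ : ℝ} (hB : 0 < B₀) (l : ℕ) (f : L2 ℂ) :
    landauOp B₀ l f ∈ eigenspace B₀ l := by
  have hh := isGaussPoly_landauFun hB l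
  refine (hh.isMagGrad (B₀ := B₀) f).isH0_iff fun φ hφ => ?_
  have h1 : ∀ k, ∫ x, twOp B₀ (covDeriv (gauge0 B₀) k (landauFun B₀ l)) f x
      * conj (covDeriv (gauge0 B₀) k φ x)
      = ∫ w, covDeriv (gauge0 B₀) k (covDeriv (gauge0 B₀) k (landauFun B₀ l)) w
        * corr B₀ f φ w := fun k => by
    rw [← (hh.covDeriv B₀ k).isMagGrad f k φ hφ]
    exact (hasKer_twOp_gaussPoly B₀ ((hh.covDeriv B₀ k).covDeriv B₀ k)).integral_mul_conj'
      ((hh.covDeriv B₀ k).covDeriv B₀ k).integrable f (hφ.memLp 2)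
  simp_rw [h1]
  rw [integral_smul_mul_conj, (hasKer_landauOp hB l).integral_mul_conj' hh.integrable f (hφ.memLp 2),
    ← integral_finsetSum _ fun k _ =>
      integrable_mul_corr' B₀ ((hh.covDeriv B₀ k).covDeriv B₀ k).integrable f (hφ.memLp 2),
    ← integral_const_mul]
  refine integral_congr_ae (ae_of_all _ fun w => ?_)
  simp only [← Finset.sum_mul, sum_covDeriv_landauFun]
  ring

lemma landauFun_neg (B₀ : ℝ) (l : ℕ) (w : Plane) : landauFun B₀ l (-w) = landauFun B₀ l w := by
  simp [landauFun]

lemma conj_landauFun (B₀ : ℝ) (l : ℕ) (w : Plane) :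
    conj (landauFun B₀ l w) = landauFun B₀ l w := Complex.conj_ofReal _

lemma conj_twKer_landauFun (B₀ : ℝ) (l : ℕ) (x y : Plane) :
    conj (twKer B₀ (landauFun B₀ l) x y) = twKer B₀ (landauFun B₀ l) y x := by
  rw [twKer, twKer, map_mul, conj_phase, conj_landauFun, ← landauFun_neg, neg_sub]

lemma IsGaussPoly.memLp_twKer {B₀ : ℝ} {h : Plane → ℂ} (hh : IsGaussPoly h) (x : Plane) :
    MemLp (fun y => twKer B₀ h y x) 2 volume := by
  refine (memLp_comp_add_right hh.memLp_two (-x)).of_le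
    (contDiff_twKer B₀ hh.contDiff x).continuous.aestronglyMeasurable (ae_of_all _ fun y => ?_)
  rw [twKer, norm_mul, norm_phase, one_mul, sub_eq_add_neg]

/-- The function `y ↦ twKer B₀ (landauFun B₀ l) y x` is smooth and square integrable together with
its covariant derivatives, so it may be inserted in the weak equation for `u`; there it is an
eigenfunction. -/
lemma IsH0.landauOp_eq {B₀ : ℝ} (hB : 0 < B₀) {u g : L2 ℂ} (h : IsH0 B₀ u g) (l : ℕ) :
    landauOp B₀ l g = level B₀ l • landauOp B₀ l u := by
  have hh := isGaussPoly_landauFun hB l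
  apply Lp.ext
  filter_upwards [hasKer_landauOp hB l g, hasKer_landauOp hB l u,
    Lp.coeFn_smul (level B₀ l) (landauOp B₀ l u)] with x h1 h2 h3
  have hcov : ∀ {h : Plane → ℂ} (hh : IsGaussPoly h) (k : Fin 2),
      covDeriv (gauge0 B₀) k (fun y => twKer B₀ h y x)
        = fun y => twKer B₀ (covDeriv (gauge0 B₀) k h) y x := fun hh k =>
    funext fun y => covDeriv_twKer B₀ (hh.contDiff.differentiable (by simp)) k y x
  have h4 := h.integral_eq (contDiff_twKer B₀ hh.contDiff x) (hh.memLp_twKer x)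
    (fun k => by rw [hcov hh]; exact (hh.covDeriv B₀ k).memLp_twKer x)
    (fun k => by
      rw [hcov hh, hcov (hh.covDeriv B₀ k)]
      exact ((hh.covDeriv B₀ k).covDeriv B₀ k).memLp_twKer x)
  rw [h3, Pi.smul_apply, h1.2, h2.2]
  simp only [smul_eq_mul, ← conj_twKer_landauFun B₀ l _ x]
  rw [h4, ← integral_finsetSum, ← integral_const_mul]
  · refine integral_congr_ae (ae_of_all _ fun y => ?_)
    simp only [hcov hh, hcov (hh.covDeriv B₀ _), ← Finset.mul_sum, ← map_sum]
    simp only [twKer, ← Finset.mul_sum, sum_covDeriv_landauFun, map_mul, level, Complex.conj_ofReal]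
    ring
  · intro k _
    rw [hcov hh, hcov (hh.covDeriv B₀ k)]
    exact (Lp.memLp u).integrable_mul
      (memLp_conj (((hh.covDeriv B₀ k).covDeriv B₀ k).memLp_twKer x))

lemma level_injective {B₀ : ℝ} (hB : 0 < B₀) : Function.Injective (level B₀) := by
  intro l m h
  have h1 : B₀ * (2 * (l : ℝ) + 1) = B₀ * (2 * (m : ℝ) + 1) := Complex.ofReal_injective h
  have := mul_left_cancel₀ hB.ne' h1
  exact_mod_cast (by linarith : (l : ℝ) = m)

lemma landauOp_eq_zero {B₀ : ℝ} (hB : 0 < B₀) {l m : ℕ} (hlm : m ≠ l) {u : L2 ℂ}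
    (hu : u ∈ eigenspace B₀ l) : landauOp B₀ m u = 0 := by
  have h1 := IsH0.landauOp_eq hB (u := u) (g := level B₀ l • u) hu m
  rw [map_smul, ← sub_eq_zero, ← sub_smul, smul_eq_zero, sub_eq_zero] at h1
  exact h1.resolve_left fun h => hlm (level_injective hB h).symm

lemma conj_corr (B₀ : ℝ) (f ψ : L2 ℂ) (w : Plane) :
    conj (corr B₀ ψ f (-w)) = corr B₀ f ψ w := by
  rw [corr, ← integral_conj,
    ← integral_add_right_eq_self (fun y => conj (ψ y * phase B₀ (-w) y * conj (f (y + -w)))) w]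
  refine integral_congr_ae (ae_of_all _ fun y => ?_)
  simp only [map_mul, Complex.conj_conj, conj_phase, add_neg_cancel_right]
  have hw : wedge (y + w) (-w) = wedge w y := by
    simp only [wedge, PiLp.add_apply, PiLp.neg_apply]; ring
  rw [show phase B₀ (y + w) (-w) = phase B₀ w y by rw [phase, phase, hw]]
  ring

lemma inner_landauOp {B₀ : ℝ} (hB : 0 < B₀) (l : ℕ) (f ψ : L2 ℂ) :
    inner ℂ (landauOp B₀ l ψ) f = inner ℂ ψ (landauOp B₀ l f) := by
  have hh := isGaussPoly_landauFun hB l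
  have hm := hh.contDiff.continuous.stronglyMeasurable
  rw [← inner_conj_symm, landauOp, inner_twOp B₀ hm hh.integrable, inner_twOp B₀ hm hh.integrable,
    ← integral_conj, ← integral_neg_eq_self]
  refine integral_congr_ae (ae_of_all _ fun w => ?_)
  simp only [map_mul, conj_landauFun, landauFun_neg, conj_corr]

/-- Superposition for series of twisted convolutions. -/
lemma hasSum_integral_mul_corr (B₀ : ℝ) {h : ℕ → Plane → ℂ} (hi : ∀ l, Integrable (h l) volume)
    (hs : Summable fun l => ∫ w, ‖h l w‖) (f ψ : L2 ℂ) :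
    HasSum (fun l => ∫ w, h l w * corr B₀ f ψ w) (∫ w, (∑' l, h l w) * corr B₀ f ψ w) := by
  have h1 := hasSum_integral_of_summable_integral_norm
    (F := fun l w => h l w * corr B₀ f ψ w) (fun l => integrable_mul_corr B₀ (hi l) f ψ) ?_
  · simpa only [tsum_mul_right] using h1
  · refine Summable.of_nonneg_of_le (fun l => integral_nonneg fun _ => norm_nonneg _) (fun l => ?_)
      (hs.mul_right (‖f‖ * ‖ψ‖))
    rw [← integral_mul_const]
    refine integral_mono (integrable_mul_corr B₀ (hi l) f ψ).norm ((hi l).norm.mul_const _)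
      fun w => ?_
    simp only [norm_mul]
    gcongr
    exact norm_corr_le B₀ f ψ w

lemma norm_landauFun_le {B₀ : ℝ} (hB : 0 < B₀) {r : ℝ} (hr0 : 0 < r) (hr1 : r < 1) (l : ℕ)
    (w : Plane) : ‖landauFun B₀ l w‖ ≤ B₀ / (2 * Real.pi) * ((1 - r)⁻¹ * (r⁻¹) ^ l
      * Real.exp (-(B₀ * (1 - r) / (4 * (1 + r))) * ‖w‖ ^ 2)) := by
  have h := abs_lag_le hr0 hr1 l (z := B₀ / 2 * ‖w‖ ^ 2) (by positivity)
  rw [landauFun, Complex.norm_real, norm_mul, norm_mul, Real.norm_of_nonneg (Real.exp_pos _).le,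
    Real.norm_of_nonneg (by positivity), Real.norm_eq_abs]
  refine mul_le_mul_of_nonneg_left (le_trans (le_of_eq ?_) (h.trans (le_of_eq ?_))) (by positivity)
  · congr 2; ring
  · congr 2; field_simp; ring

lemma summable_integral_norm_landauFun {B₀ : ℝ} (hB : 0 < B₀) {r : ℝ} (hr0 : 0 < r) (hr1 : r < 1)
    {c : ℕ → ℂ} (hc : Summable fun l => ‖c l‖ * (r⁻¹) ^ l) :
    Summable fun l => ∫ w, ‖c l * landauFun B₀ l w‖ := by
  have h1r : 0 < 1 - r := by linarith
  have hi := (integrable_exp_neg_sq (b := B₀ * (1 - r) / (4 * (1 + r))) (by positivity))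
  refine Summable.of_nonneg_of_le (fun l => integral_nonneg fun _ => norm_nonneg _) (fun l => ?_)
    (hc.mul_right (B₀ / (2 * Real.pi) * (1 - r)⁻¹
      * ∫ w : Plane, Real.exp (-(B₀ * (1 - r) / (4 * (1 + r))) * ‖w‖ ^ 2)))
  rw [← mul_assoc, ← integral_const_mul]
  refine integral_mono (((isGaussPoly_landauFun hB l).integrable.const_mul _).norm)
    (hi.const_mul _) fun w => ?_
  simp only [norm_mul]
  calc _ ≤ ‖c l‖ * (B₀ / (2 * Real.pi) * ((1 - r)⁻¹ * (r⁻¹) ^ l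
      * Real.exp (-(B₀ * (1 - r) / (4 * (1 + r))) * ‖w‖ ^ 2))) := by
        gcongr; exact norm_landauFun_le hB hr0 hr1 l w
    _ = _ := by ring

/-- The Mehler formula. -/
lemma hasSum_heatFun {B₀ : ℝ} (hB : 0 < B₀) {t : ℝ} (ht : 0 < t) (w : Plane) :
    HasSum (fun l : ℕ => ((Real.exp (-(t * (B₀ * (2 * (l : ℝ) + 1)))) : ℝ) : ℂ) * landauFun B₀ l w)
      (heatFun B₀ t w) := by
  have hx : 0 < B₀ * t := by positivity
  -- The weights `exp(-t B₀ (2l + 1))` are `exp(-B₀ t) * s ^ l`, so the sum is the generating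
  -- function at this point.
  set s : ℝ := Real.exp (-(2 * (B₀ * t))) with hs
  have hs1 : s < 1 := Real.exp_lt_one_iff.2 (by linarith)
  have hs0 : 0 < s := Real.exp_pos _
  have h := hasSum_lag (B₀ / 2 * ‖w‖ ^ 2) (s := (s : ℂ))
    (by rw [Complex.norm_real, Real.norm_of_nonneg hs0.le]; exact hs1)
  have h' := h.mul_left (((Real.exp (-(B₀ * t)) * (B₀ / (2 * Real.pi))
    * Real.exp (-(B₀ / 4) * ‖w‖ ^ 2) : ℝ) : ℂ))
  have hsinh : 0 < Real.sinh (B₀ * t) := Real.sinh_pos_iff.2 hx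
  have e1 : Real.exp (-(B₀ * t)) * (1 - s)⁻¹ = (2 * Real.sinh (B₀ * t))⁻¹ := by
    have : 1 - s = Real.exp (-(B₀ * t)) * (2 * Real.sinh (B₀ * t)) := by
      rw [Real.sinh_eq, hs, two_mul, neg_add, Real.exp_add, mul_div_cancel₀ _ two_ne_zero, mul_sub,
        ← Real.exp_add, ← Real.exp_add, neg_add_cancel, Real.exp_zero, Real.exp_add]
    rw [this, mul_inv, ← mul_assoc, mul_inv_cancel₀ (Real.exp_pos _).ne', one_mul]
  have e2 : -(B₀ / 4) * ‖w‖ ^ 2 + -(s / (1 - s)) * (B₀ / 2 * ‖w‖ ^ 2)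
      = -(B₀ * Real.cosh (B₀ * t) / (4 * Real.sinh (B₀ * t))) * ‖w‖ ^ 2 := by
    have e3 : s = Real.exp (-(B₀ * t)) * Real.exp (-(B₀ * t)) := by
      rw [← Real.exp_add, hs]; congr 1; ring
    have e4 : Real.exp (B₀ * t) * Real.exp (-(B₀ * t)) = 1 := by
      rw [← Real.exp_add, add_neg_cancel, Real.exp_zero]
    have e5 : 1 - s ≠ 0 := by linarith
    have e6 : Real.cosh (B₀ * t) * (1 - s) = Real.sinh (B₀ * t) * (1 + s) := by
      rw [Real.cosh_eq, Real.sinh_eq, e3]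
      linear_combination (-Real.exp (-(B₀ * t))) * e4
    have e7 : Real.cosh (B₀ * t) / Real.sinh (B₀ * t) = (1 + s) / (1 - s) := by
      rw [div_eq_div_iff hsinh.ne' e5, e6]; ring
    have e8 : B₀ * Real.cosh (B₀ * t) / (4 * Real.sinh (B₀ * t))
        = B₀ / 4 * (Real.cosh (B₀ * t) / Real.sinh (B₀ * t)) := by
      field_simp
    rw [e8, e7]
    field_simp
    ring
  convert! h' using 1
  · funext l
    rw [landauFun, ← Complex.ofReal_pow, ← Complex.ofReal_mul, ← Complex.ofReal_mul,
      ← Complex.ofReal_mul]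
    congr 1
    rw [show -(t * (B₀ * (2 * (l : ℝ) + 1))) = -(B₀ * t) + (l : ℝ) * (-(2 * (B₀ * t))) by ring,
      Real.exp_add, Real.exp_nat_mul, ← hs]
    ring
  · rw [heatFun, ← e2, Real.exp_add]
    have : Complex.exp (-((s : ℂ) / (1 - s)) * ((B₀ / 2 * ‖w‖ ^ 2 : ℝ) : ℂ))
      = ((Real.exp (-(s / (1 - s)) * (B₀ / 2 * ‖w‖ ^ 2)) : ℝ) : ℂ) := by push_cast; rfl
    rw [this]
    have e9 : ((1 - (s : ℂ))⁻¹) = (((1 - s)⁻¹ : ℝ) : ℂ) := by push_cast; rfl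
    rw [e9, ← Complex.ofReal_mul, ← Complex.ofReal_mul]
    congr 1
    have : B₀ / (4 * Real.pi * Real.sinh (B₀ * t))
      = (2 * Real.sinh (B₀ * t))⁻¹ * (B₀ / (2 * Real.pi)) := by field_simp; ring
    rw [this, ← e1]
    ring

/-- This is the spectral expansion of the heat semigroup, obtained from the kernels without any
functional calculus for `H₀`. -/
lemma hasSum_inner_heat {B₀ : ℝ} (hB : 0 < B₀) {t : ℝ} (ht : 0 < t) (f ψ : L2 ℂ) :
    HasSum (fun l : ℕ => ((Real.exp (-(t * (B₀ * (2 * (l : ℝ) + 1)))) : ℝ) : ℂ)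
      * inner ℂ ψ (landauOp B₀ l f)) (∫ w, heatFun B₀ t w * corr B₀ f ψ w) := by
  have hbt : 0 < B₀ * t := by positivity
  -- With `r = exp(-B₀ t)` the growth `r⁻¹ ^ l` uses up half of the decay `exp(-2 B₀ t l)` and
  -- leaves a geometric series.
  have hsum := summable_integral_norm_landauFun hB (r := Real.exp (-(B₀ * t))) (Real.exp_pos _)
    (Real.exp_lt_one_iff.2 (by linarith))
    (c := fun l : ℕ => ((Real.exp (-(t * (B₀ * (2 * l + 1)))) : ℝ) : ℂ)) ?_
  · have h := hasSum_integral_mul_corr B₀ (fun l =>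
      (isGaussPoly_landauFun hB l).integrable.const_mul
        ((Real.exp (-(t * (B₀ * (2 * l + 1)))) : ℝ) : ℂ)) hsum f ψ
    simp only [(hasSum_heatFun hB ht _).tsum_eq] at h
    convert! h using 1
    funext l
    have hh := isGaussPoly_landauFun hB l
    rw [landauOp, inner_twOp B₀ hh.contDiff.continuous.stronglyMeasurable hh.integrable,
      ← integral_const_mul]
    simp only [mul_assoc]
  · have hg := (summable_geometric_of_lt_one (Real.exp_pos (-(B₀ * t))).le
      (Real.exp_lt_one_iff.2 (by linarith))).mul_left (Real.exp (-(B₀ * t)))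
    refine hg.congr fun l => ?_
    rw [Complex.norm_real, Real.norm_of_nonneg (Real.exp_pos _).le, ← Real.exp_neg,
      ← Real.exp_nat_mul, ← Real.exp_nat_mul, ← Real.exp_add, ← Real.exp_add]
    congr 1
    ring

lemma integral_exp_neg_sq : ∫ w : Plane, Real.exp (-1 * ‖w‖ ^ 2) = Real.pi := by
  rw [GaussianFourier.integral_rexp_neg_mul_sq_norm one_pos]
  simp

lemma tendsto_corr_zero (B₀ : ℝ) (f : L2 ℂ) {ψ : Plane → ℂ} (hψ : IsTest ψ) :
    Filter.Tendsto (corr B₀ f ψ) (nhds 0) (nhds (∫ y, f y * conj (ψ y))) := by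
  obtain ⟨C, hC⟩ := hψ.1.continuous.bounded_above_of_compact_support hψ.2
  obtain ⟨R, hR⟩ := hψ.2.isCompact.isBounded.subset_closedBall (0 : Plane)
  have hC0 : 0 ≤ C := (norm_nonneg _).trans (hC 0)
  have hlim : ∀ y, Filter.Tendsto (fun w => f y * phase B₀ w y * conj (ψ (y + w))) (nhds 0)
      (nhds (f y * conj (ψ y))) := fun y => by
    have : Continuous fun w => f y * phase B₀ w y * conj (ψ (y + w)) :=
      (continuous_const.mul ((continuous_phase B₀).comp (Continuous.prodMk_left y))).mul
        (Complex.continuous_conj.comp (hψ.1.continuous.comp (continuous_const.add continuous_id)))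
    have h := this.tendsto 0
    simpa [phase, wedge] using h
  have hg : MemLp ((Metric.closedBall (0 : Plane) (R + 1)).indicator fun _ => C) 2 volume :=
    memLp_indicator_const 2 Metric.isClosed_closedBall.measurableSet C
      (Or.inr (isCompact_closedBall 0 (R + 1)).measure_lt_top.ne)
  refine tendsto_integral_filter_of_dominated_convergence
    (fun y => ‖f y‖ * (Metric.closedBall (0 : Plane) (R + 1)).indicator (fun _ => C) y)
    (Filter.Eventually.of_forall fun w => ?_) ?_ ((Lp.memLp f).norm.integrable_mul hg)
    (ae_of_all _ hlim)
  · refine ((Lp.aestronglyMeasurable f).mul (Continuous.aestronglyMeasurable ?_)).mul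
      (Continuous.aestronglyMeasurable ?_)
    · exact (continuous_phase B₀).comp (Continuous.prodMk_right w)
    · exact Complex.continuous_conj.comp (hψ.1.continuous.comp (continuous_id.add continuous_const))
  · filter_upwards [Metric.ball_mem_nhds (0 : Plane) one_pos] with w hw
    refine ae_of_all _ fun y => ?_
    rw [norm_mul, norm_mul, norm_phase, mul_one, RCLike.norm_conj]
    gcongr
    by_cases hy : y ∈ Metric.closedBall (0 : Plane) (R + 1)
    · rw [Set.indicator_of_mem hy]; exact hC _
    · rw [Set.indicator_of_notMem hy]
      have : y + w ∉ tsupport ψ := fun h => hy <| by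
        have h1 := hR h
        simp only [Metric.mem_closedBall, dist_zero_right, Metric.mem_ball] at h1 hw ⊢
        calc ‖y‖ = ‖(y + w) - w‖ := by rw [add_sub_cancel_right]
          _ ≤ ‖y + w‖ + ‖w‖ := norm_sub_le _ _
          _ ≤ R + 1 := by linarith
      rw [image_eq_zero_of_notMem_tsupport this, norm_zero]

/-- The heat semigroup is weakly continuous at `t = 0`. -/
lemma tendsto_heat {B₀ : ℝ} (hB : 0 < B₀) (f : L2 ℂ) {ψ : Plane → ℂ} (hψ : IsTest ψ) :
    Filter.Tendsto (fun n : ℕ => ∫ w, heatFun B₀ ((n : ℝ) + 1)⁻¹ w * corr B₀ f ψ w) Filter.atTop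
      (nhds (∫ y, f y * conj (ψ y))) := by
  set t : ℕ → ℝ := fun n => ((n : ℝ) + 1)⁻¹ with ht
  have ht0 : ∀ n, 0 < t n := fun n => by positivity
  have htlim : Filter.Tendsto t Filter.atTop (nhds 0) := by
    simpa [ht, one_div] using tendsto_one_div_add_atTop_nhds_zero_nat (𝕜 := ℝ)
  have hsinh : ∀ n, 0 < Real.sinh (B₀ * t n) := fun n => Real.sinh_pos_iff.2 (mul_pos hB (ht0 n))
  have hcosh := fun n => Real.cosh_pos (B₀ * t n)
  -- The width of the Gaussian: after `w = c n • v` the heat kernel is `π⁻¹ exp(-‖v‖²) / cosh(B₀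
  -- t)`, and `c n → 0` concentrates the correlation at the origin.
  set c : ℕ → ℝ := fun n => √(4 * Real.sinh (B₀ * t n) / (B₀ * Real.cosh (B₀ * t n))) with hc
  have hc2 : ∀ n, c n ^ 2 = 4 * Real.sinh (B₀ * t n) / (B₀ * Real.cosh (B₀ * t n)) := fun n =>
    Real.sq_sqrt (by have := hsinh n; have := hcosh n; positivity)
  have hc0 : ∀ n, 0 < c n := fun n => Real.sqrt_pos.2 (by
    have := hsinh n; have := hcosh n; positivity)
  have hclim : Filter.Tendsto c Filter.atTop (nhds 0) := by
    have : Continuous fun s : ℝ => √(4 * Real.sinh (B₀ * s) / (B₀ * Real.cosh (B₀ * s))) := by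
      refine Real.continuous_sqrt.comp (Continuous.div ?_ ?_ fun s => ?_)
      · exact continuous_const.mul (Real.continuous_sinh.comp (continuous_const.mul continuous_id))
      · exact continuous_const.mul (Real.continuous_cosh.comp (continuous_const.mul continuous_id))
      · exact (mul_pos hB (Real.cosh_pos _)).ne'
    have h := (this.tendsto 0).comp htlim
    simpa [Function.comp_def] using h
  set Φ := corr B₀ f ψ with hΦ
  set ψ' : L2 ℂ := (hψ.memLp 2).toLp ψ with hψ'
  have hΦ' : Φ = corr B₀ f ψ' := funext fun w => (corr_congr B₀ f (hψ.memLp 2).coeFn_toLp w).symm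
  have hscale : ∀ n, ∫ w, heatFun B₀ (t n) w * Φ w = ((Real.cosh (B₀ * t n))⁻¹ : ℝ)
      * ∫ v : Plane, ((Real.pi⁻¹ * Real.exp (-1 * ‖v‖ ^ 2) : ℝ) : ℂ) * Φ (c n • v) := fun n => by
    have h1 := Measure.integral_comp_smul_of_nonneg (volume : Measure Plane)
      (fun w => heatFun B₀ (t n) w * Φ w) (c n) (hR := (hc0 n).le)
    rw [finrank_plane] at h1
    have h2 : ∫ w, heatFun B₀ (t n) w * Φ w
        = (c n ^ 2) • ∫ v : Plane, heatFun B₀ (t n) (c n • v) * Φ (c n • v) := by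
      rw [h1, smul_smul, mul_inv_cancel₀ (pow_ne_zero 2 (hc0 n).ne'), one_smul]
    rw [h2, ← integral_smul, ← integral_const_mul]
    refine integral_congr_ae (ae_of_all _ fun v => ?_)
    have e1 : c n ^ 2 * (B₀ / (4 * Real.pi * Real.sinh (B₀ * t n))
        * Real.exp (-(B₀ * Real.cosh (B₀ * t n) / (4 * Real.sinh (B₀ * t n))) * ‖c n • v‖ ^ 2))
        = (Real.cosh (B₀ * t n))⁻¹ * (Real.pi⁻¹ * Real.exp (-1 * ‖v‖ ^ 2)) := by
      have := hsinh n; have := hcosh n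
      rw [norm_smul, mul_pow, Real.norm_of_nonneg (hc0 n).le, hc2]
      rw [show -(B₀ * Real.cosh (B₀ * t n) / (4 * Real.sinh (B₀ * t n)))
        * (4 * Real.sinh (B₀ * t n) / (B₀ * Real.cosh (B₀ * t n)) * ‖v‖ ^ 2) = -1 * ‖v‖ ^ 2 by
          field_simp]
      field_simp
    simp only [heatFun, Complex.real_smul]
    rw [← mul_assoc, ← Complex.ofReal_mul, e1, Complex.ofReal_mul, mul_assoc]
  change Filter.Tendsto (fun n => ∫ w, heatFun B₀ (t n) w * Φ w) _ _
  simp_rw [hscale]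
  have hlim1 : Filter.Tendsto (fun n => (((Real.cosh (B₀ * t n))⁻¹ : ℝ) : ℂ)) Filter.atTop
      (nhds 1) := by
    have : Continuous fun s : ℝ => (((Real.cosh (B₀ * s))⁻¹ : ℝ) : ℂ) :=
      Complex.continuous_ofReal.comp ((Real.continuous_cosh.comp
        (continuous_const.mul continuous_id)).inv₀ fun s => (Real.cosh_pos _).ne')
    have h := (this.tendsto 0).comp htlim
    simpa [Function.comp_def] using h
  have hlim2 : Filter.Tendsto (fun n => ∫ v : Plane,
      ((Real.pi⁻¹ * Real.exp (-1 * ‖v‖ ^ 2) : ℝ) : ℂ) * Φ (c n • v)) Filter.atTop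
      (nhds (∫ v : Plane, ((Real.pi⁻¹ * Real.exp (-1 * ‖v‖ ^ 2) : ℝ) : ℂ)
        * ∫ y, f y * conj (ψ y))) := by
    have hi := (integrable_exp_neg_sq (b := 1) one_pos).const_mul (Real.pi⁻¹ * (‖f‖ * ‖ψ'‖))
    refine tendsto_integral_of_dominated_convergence _ (fun n => ?_) hi (fun n => ae_of_all _ fun v => ?_)
      (ae_of_all _ fun v => ?_)
    · refine AEStronglyMeasurable.mul (Continuous.aestronglyMeasurable (by fun_prop)) ?_
      rw [hΦ']
      exact ((stronglyMeasurable_corr B₀ f ψ').comp_measurable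
        (measurable_const_smul (c n))).aestronglyMeasurable
    · rw [norm_mul, Complex.norm_real, Real.norm_of_nonneg (by positivity), hΦ']
      calc _ ≤ Real.pi⁻¹ * Real.exp (-1 * ‖v‖ ^ 2) * (‖f‖ * ‖ψ'‖) := by
            gcongr; exact norm_corr_le B₀ f ψ' _
        _ = _ := by ring
    · refine Filter.Tendsto.const_mul _ ((tendsto_corr_zero B₀ f hψ).comp ?_)
      simpa using hclim.smul_const v
  have h := hlim1.mul hlim2
  rw [one_mul, integral_mul_const, integral_complex_ofReal, integral_const_mul, integral_exp_neg_sq,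
    inv_mul_cancel₀ Real.pi_ne_zero, Complex.ofReal_one, one_mul] at h
  exact h

lemma eq_zero_of_forall_isTest {u : L2 ℂ} (h : ∀ φ : Plane → ℂ, IsTest φ →
    ∫ x, u x * conj (φ x) = 0) : u = 0 := by
  have hloc : LocallyIntegrable u volume := (Lp.memLp u).locallyIntegrable (by norm_num)
  have h1 := ae_eq_zero_of_integral_contDiff_smul_eq_zero hloc fun g hg hs => by
    have := h (fun x => (g x : ℂ)) ⟨Complex.ofRealCLM.contDiff.comp hg,
      hs.comp_left (g := fun r : ℝ => (r : ℂ)) Complex.ofReal_zero⟩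
    simpa [mul_comm] using this
  exact Lp.eq_zero_iff_ae_eq_zero.2 h1

/-- Only one term of the expansion of the heat semigroup survives, namely `exp(-t B₀ (2l + 1)) ⟨φ,
g⟩`; let `t → 0` on both sides. With `g = 0` this is the completeness of the Landau levels. -/
lemma eq_of_heat_eq {B₀ : ℝ} (hB : 0 < B₀) {f g : L2 ℂ} (l : ℕ)
    (hl : landauOp B₀ l f = g) (h : ∀ m, m ≠ l → landauOp B₀ m f = 0) : f = g := by
  rw [← sub_eq_zero]
  refine eq_zero_of_forall_isTest fun φ hφ => ?_
  have h1 := tendsto_heat hB f hφ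
  have h2 : ∀ n : ℕ, ∫ w, heatFun B₀ ((n : ℝ) + 1)⁻¹ w * corr B₀ f φ w
      = ((Real.exp (-(((n : ℝ) + 1)⁻¹ * (B₀ * (2 * (l : ℝ) + 1)))) : ℝ) : ℂ) * ∫ y, g y * conj (φ y) := by
    intro n
    have h3 := hasSum_inner_heat hB (t := ((n : ℝ) + 1)⁻¹) (by positivity) f ((hφ.memLp 2).toLp φ)
    have h4 := h3.unique (hasSum_single l fun m hm => by rw [h m hm, inner_zero_right, mul_zero])
    simp_rw [corr_congr B₀ f (hφ.memLp 2).coeFn_toLp] at h4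
    rw [h4, hl, inner_eq_integral]
    congr 1
    refine integral_congr_ae ?_
    filter_upwards [(hφ.memLp 2).coeFn_toLp] with x hx
    rw [hx]
  simp_rw [h2] at h1
  have h5 : Filter.Tendsto (fun n : ℕ =>
      ((Real.exp (-(((n : ℝ) + 1)⁻¹ * (B₀ * (2 * (l : ℝ) + 1)))) : ℝ) : ℂ) * ∫ y, g y * conj (φ y))
      Filter.atTop (nhds (1 * ∫ y, g y * conj (φ y))) := by
    refine Filter.Tendsto.mul_const _ ?_
    have htlim : Filter.Tendsto (fun n : ℕ => ((n : ℝ) + 1)⁻¹) Filter.atTop (nhds 0) := by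
      simpa [one_div] using tendsto_one_div_add_atTop_nhds_zero_nat (𝕜 := ℝ)
    have hc : Continuous fun s : ℝ => ((Real.exp (-(s * (B₀ * (2 * l + 1)))) : ℝ) : ℂ) := by fun_prop
    have := (hc.tendsto 0).comp htlim
    simpa [Function.comp_def] using this
  have h6 := tendsto_nhds_unique h1 h5
  rw [one_mul] at h6
  have h7 := integral_add_mul_conj (f - g) g hφ.1.continuous hφ.2
  rw [sub_add_cancel, h6] at h7
  simpa using h7

lemma eq_zero_of_landauOp_eq_zero {B₀ : ℝ} (hB : 0 < B₀) {f : L2 ℂ}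
    (h : ∀ l, landauOp B₀ l f = 0) : f = 0 :=
  eq_of_heat_eq hB 0 (h 0) fun _ _ => h _

lemma landauOp_eq_self {B₀ : ℝ} (hB : 0 < B₀) {l : ℕ} {u : L2 ℂ} (hu : u ∈ eigenspace B₀ l) :
    landauOp B₀ l u = u :=
  (eq_of_heat_eq hB l rfl fun _ hm => landauOp_eq_zero hB hm hu).symm

/-- The values lie in the eigenspace, and `f - landauOp B₀ l f` is orthogonal to it by symmetry and
because `landauOp` fixes eigenvectors. -/
lemma landauProj_eq {B₀ : ℝ} (hB : 0 < B₀) (l : ℕ) : landauProj B₀ l = landauOp B₀ l := by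
  ext1 f
  refine Submodule.eq_starProjection_of_mem_orthogonal
    (Submodule.le_topologicalClosure _ (landauOp_mem_eigenspace hB l f)) ?_
  rw [Submodule.orthogonal_closure]
  refine (Submodule.mem_orthogonal _ _).2 fun u hu => ?_
  rw [inner_sub_right, ← inner_landauOp hB, landauOp_eq_self hB hu, sub_self]

lemma landauOp_landauOp {B₀ : ℝ} (hB : 0 < B₀) (l m : ℕ) (f : L2 ℂ) :
    landauOp B₀ m (landauOp B₀ l f) = if m = l then landauOp B₀ l f else 0 := by
  split_ifs with h
  · rw [h, landauOp_eq_self hB (landauOp_mem_eigenspace hB l f)]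
  · exact landauOp_eq_zero hB h (landauOp_mem_eigenspace hB l f)

/-- The adjoint of the difference takes values annihilated by every projection, and such vectors
vanish by completeness. -/
lemma clm_ext_of_landauOp {B₀ : ℝ} (hB : 0 < B₀) {E : Type*} [NormedAddCommGroup E]
    [InnerProductSpace ℂ E] [CompleteSpace E] {S T : L2 ℂ →L[ℂ] E}
    (h : ∀ l f, S (landauOp B₀ l f) = T (landauOp B₀ l f)) : S = T := by
  rw [← sub_eq_zero]
  have h1 : ContinuousLinearMap.adjoint (S - T) = 0 := by
    ext1 ψ
    refine eq_zero_of_landauOp_eq_zero hB fun l => ?_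
    refine ext_inner_right ℂ fun f => ?_
    rw [inner_landauOp hB, ContinuousLinearMap.adjoint_inner_left, sub_apply, h l f, sub_self,
      inner_zero_right, inner_zero_left]
  rw [← ContinuousLinearMap.adjoint_adjoint (S - T), h1, map_zero]




/-! ### Convergence of the series defining `M` -/

lemma sum_norm_landauOp_sq {B₀ : ℝ} (hB : 0 < B₀) (s : Finset ℕ) (c : ℕ → ℂ) (f : L2 ℂ) :
    ‖∑ l ∈ s, c l • landauOp B₀ l f‖ ^ 2 = ∑ l ∈ s, ‖c l‖ ^ 2 * ‖landauOp B₀ l f‖ ^ 2 := by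
  have h : (inner ℂ (∑ l ∈ s, c l • landauOp B₀ l f) (∑ l ∈ s, c l • landauOp B₀ l f))
      = ((∑ l ∈ s, ‖c l‖ ^ 2 * ‖landauOp B₀ l f‖ ^ 2 : ℝ) : ℂ) := by
    rw [sum_inner]
    push_cast
    refine Finset.sum_congr rfl fun l hl => ?_
    rw [inner_sum, Finset.sum_eq_single l]
    · rw [inner_smul_left, inner_smul_right, inner_self_eq_norm_sq_to_K, ← mul_assoc,
        RCLike.conj_mul]
      rfl
    · intro m _ hm
      rw [inner_smul_left, inner_smul_right, inner_landauOp hB, landauOp_landauOp hB,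
        if_neg hm.symm, inner_zero_right, mul_zero, mul_zero]
    · exact fun h => absurd hl h
  rw [inner_self_eq_norm_sq_to_K] at h
  apply Complex.ofReal_injective
  rw [← h]
  push_cast
  rfl

/-- Pythagoras for the mutually orthogonal ranges, combined with Bessel's inequality: the norm is
governed by the largest coefficient and not by the sum of the coefficients. -/
lemma norm_sum_landauOp_le {B₀ : ℝ} (hB : 0 < B₀) (s : Finset ℕ) (c : ℕ → ℂ) {δ : ℝ} (hδ : 0 ≤ δ)
    (hc : ∀ l ∈ s, ‖c l‖ ≤ δ) : ‖∑ l ∈ s, c l • landauOp B₀ l‖ ≤ δ := by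
  refine ContinuousLinearMap.opNorm_le_bound _ hδ fun f => ?_
  have h1 : ∑ l ∈ s, ‖landauOp B₀ l f‖ ^ 2 ≤ ‖f‖ ^ 2 := by
    set g := ∑ l ∈ s, landauOp B₀ l f with hg
    have e1 : ‖g‖ ^ 2 = ∑ l ∈ s, ‖landauOp B₀ l f‖ ^ 2 := by
      simpa using sum_norm_landauOp_sq hB s (fun _ => 1) f
    have e2 : inner ℂ f g = ((∑ l ∈ s, ‖landauOp B₀ l f‖ ^ 2 : ℝ) : ℂ) := by
      rw [hg, inner_sum]
      push_cast
      refine Finset.sum_congr rfl fun l _ => ?_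
      rw [← landauOp_eq_self hB (landauOp_mem_eigenspace hB l f), ← inner_landauOp hB,
        landauOp_eq_self hB (landauOp_mem_eigenspace hB l f), inner_self_eq_norm_sq_to_K]
      rfl
    have e3 : ‖g‖ ^ 2 ≤ ‖f‖ * ‖g‖ := by
      have := norm_inner_le_norm (𝕜 := ℂ) f g
      rw [e2, ← e1, Complex.norm_real, Real.norm_of_nonneg (by positivity)] at this
      exact this
    rw [← e1]
    have e4 : ‖g‖ ≤ ‖f‖ := by
      by_contra h
      push Not at h
      nlinarith [norm_nonneg f, norm_nonneg g]
    gcongr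
  have h2 : ‖(∑ l ∈ s, c l • landauOp B₀ l) f‖ ^ 2 ≤ (δ * ‖f‖) ^ 2 := by
    have := sum_norm_landauOp_sq hB s c f
    simp only [sum_apply, smul_apply]
    rw [this, mul_pow]
    calc _ ≤ ∑ l ∈ s, δ ^ 2 * ‖landauOp B₀ l f‖ ^ 2 := by
          refine Finset.sum_le_sum fun l hl => ?_
          have := hc l hl
          gcongr
      _ = δ ^ 2 * ∑ l ∈ s, ‖landauOp B₀ l f‖ ^ 2 := by rw [Finset.mul_sum]
      _ ≤ _ := by gcongr
  exact (abs_le_of_sq_le_sq' h2 (by positivity)).2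

lemma norm_level_sub_ge {B₀ : ℝ} (hB : 0 < B₀) (ζ : ℂ) (l : ℕ) :
    B₀ * (2 * l + 1) - ‖ζ‖ ≤ ‖level B₀ l - ζ‖ := by
  have h := norm_sub_norm_le (level B₀ l) ζ
  rwa [level, Complex.norm_real, Real.norm_of_nonneg (by positivity)] at h

/-- The norms of the terms only decay like `1 / l`, but by orthogonality the Cauchy criterion over
finite sets needs no more than coefficients tending to zero. This makes the convergence
unconditional. -/
lemma hasSum_resolventTerm {B₀ : ℝ} (hB : 0 < B₀) (I : Set ℕ) (ζ : ℂ) :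
    HasSum (resolventTerm B₀ I ζ) (M B₀ I ζ) := by
  refine Summable.hasSum (summable_iff_vanishing_norm.2 fun ε hε => ?_)
  -- Levels with index at least `N` have distance at least `2 / ε` from `ζ`; the resulting bound `ε
  -- / 2` gives the strict inequality in the end.
  obtain ⟨N, hN⟩ := exists_nat_gt ((‖ζ‖ + 2 / ε) / (2 * B₀))
  rw [div_lt_iff₀ (by positivity)] at hN
  classical
  refine ⟨(Finset.range N).subtype (· ∈ I), fun t ht => ?_⟩
  have hb : ∀ l ∈ t.map (Function.Embedding.subtype _), ‖(level B₀ l - ζ)⁻¹‖ ≤ ε / 2 := by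
    intro l hl
    obtain ⟨m, hm, rfl⟩ := Finset.mem_map.1 hl
    have hmN : N ≤ (m : ℕ) := by
      by_contra h
      push Not at h
      exact Finset.disjoint_left.1 ht hm (by simpa using h)
    have hmN' : (N : ℝ) ≤ (m : ℕ) := by exact_mod_cast hmN
    have h1 := norm_level_sub_ge hB ζ m
    have h2 : 2 / ε ≤ ‖level B₀ m - ζ‖ := by nlinarith
    rw [norm_inv, Function.Embedding.subtype_apply]
    calc _ ≤ (2 / ε)⁻¹ := inv_anti₀ (by positivity) h2
      _ = ε / 2 := by rw [inv_div]
  have h := norm_sum_landauOp_le hB _ (fun l => (level B₀ l - ζ)⁻¹) (by positivity) hb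
  rw [Finset.sum_map] at h
  refine lt_of_le_of_lt (le_trans (le_of_eq ?_) h) (by linarith : ε / 2 < ε)
  congr 1
  refine Finset.sum_congr rfl fun l _ => ?_
  rw [resolventTerm, landauProj_eq hB]
  rfl

open Classical in
/-- The coefficients of `M`. -/
def resolCoeff (B₀ : ℝ) (I : Set ℕ) (ζ : ℂ) (l : ℕ) : ℂ :=
  if l ∈ I then (level B₀ l - ζ)⁻¹ else 0

lemma M_landauOp {B₀ : ℝ} (hB : 0 < B₀) (I : Set ℕ) (ζ : ℂ) (l : ℕ) (f : L2 ℂ) :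
    M B₀ I ζ (landauOp B₀ l f) = resolCoeff B₀ I ζ l • landauOp B₀ l f := by
  have h := (hasSum_resolventTerm hB I ζ).mapL (ContinuousLinearMap.apply ℂ (L2 ℂ) (landauOp B₀ l f))
  simp only [ContinuousLinearMap.apply_apply, resolventTerm, landauProj_eq hB,
    smul_apply, landauOp_landauOp hB] at h
  by_cases hl : l ∈ I
  · have h2 := h.unique (hasSum_single (⟨l, hl⟩ : I) fun m hm => by
      rw [if_neg (fun h => hm (Subtype.ext h)), smul_zero])
    rw [h2, resolCoeff, if_pos hl, if_pos rfl]
  · have h0 : (fun m : I => (level B₀ m - ζ)⁻¹ • if (m : ℕ) = l then landauOp B₀ l f else 0)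
        = fun _ => 0 := funext fun m => by
      rw [if_neg (fun h : (m : ℕ) = l => hl (h ▸ m.2)), smul_zero]
    rw [h0] at h
    rw [h.unique hasSum_zero, resolCoeff, if_neg hl, zero_smul]

/-! ### Bounds on the heat kernel -/

/-- For `x = B₀ t` these are `x ≤ sinh x` and `1 ≤ x coth x ≤ 1 + x`. The last bound serves the
prefactor `2β‖w‖ + B₀‖w‖/2` of the covariant gradient, with `t ≤ 1` absorbing the bounded terms into
`1 / t`. -/
lemma heat_profile_bounds {B₀ : ℝ} (hB : 0 < B₀) {t : ℝ} (ht : 0 < t) (ht1 : t ≤ 1) :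
    0 ≤ B₀ / (4 * Real.pi * Real.sinh (B₀ * t)) ∧
    B₀ / (4 * Real.pi * Real.sinh (B₀ * t)) ≤ 1 / t ∧
    1 / (4 * t) ≤ B₀ * Real.cosh (B₀ * t) / (4 * Real.sinh (B₀ * t)) ∧
    2 * (B₀ * Real.cosh (B₀ * t) / (4 * Real.sinh (B₀ * t))) + B₀ / 2 ≤ (B₀ + 1) / t := by
  have hx : 0 < B₀ * t := by positivity
  have hs := Real.self_le_sinh_iff.2 hx.le
  have hs0 : 0 < Real.sinh (B₀ * t) := hx.trans_le hs
  have hc1 := Real.one_le_cosh (B₀ * t)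
  refine ⟨by positivity, ?_, ?_, ?_⟩
  · rw [div_le_div_iff₀ (by positivity) ht]
    nlinarith [Real.pi_gt_three]
  · rw [div_le_div_iff₀ (by positivity) (by positivity)]
    have : Real.sinh (B₀ * t) ≤ B₀ * t * Real.cosh (B₀ * t) := by
      have h1 : Real.exp (-(B₀ * t)) * (1 + 2 * (B₀ * t)) ≤ Real.exp (B₀ * t) := by
        have := Real.add_one_le_exp (2 * (B₀ * t))
        calc _ ≤ Real.exp (-(B₀ * t)) * Real.exp (2 * (B₀ * t)) := by
              gcongr; linarith
          _ = _ := by rw [← Real.exp_add]; ring_nf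
      have h2 : (1 - B₀ * t) * Real.exp (B₀ * t) ≤ (1 + B₀ * t) * Real.exp (-(B₀ * t)) := by
        rcases le_or_gt 1 (B₀ * t) with h | h
        · have := Real.exp_pos (B₀ * t)
          have := Real.exp_pos (-(B₀ * t))
          have : 0 ≤ (1 + B₀ * t) * Real.exp (-(B₀ * t)) := by positivity
          nlinarith
        · -- `(1 - x) e^{2 x} ≤ 1 + x` on `[0, 1)`
          have hmono : ∀ x : ℝ, 0 ≤ x → (1 - x) * Real.exp (2 * x) ≤ 1 + x := by
            intro x hx
            have hd : ∀ y : ℝ, HasDerivAt (fun y => 1 + y - (1 - y) * Real.exp (2 * y))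
                (1 - (1 - 2 * y) * Real.exp (2 * y)) y := fun y => by
              have a1 := ((hasDerivAt_id y).const_add 1)
              have a2 := ((hasDerivAt_id y).const_sub 1).mul
                (((hasDerivAt_id y).const_mul 2).exp)
              refine (a1.sub a2).congr_deriv ?_
              simp; ring
            have hmon : MonotoneOn (fun y => 1 + y - (1 - y) * Real.exp (2 * y)) (Set.Ici 0) := by
              refine monotoneOn_of_deriv_nonneg (convex_Ici 0)
                (fun y _ => (hd y).continuousAt.continuousWithinAt)
                (fun y _ => (hd y).differentiableAt.differentiableWithinAt) fun y _ => ?_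
              rw [(hd y).deriv]
              have h3 := Real.add_one_le_exp (-(2 * y))
              have h4 : (1 - 2 * y) * Real.exp (2 * y) ≤ Real.exp (-(2 * y)) * Real.exp (2 * y) := by
                gcongr; linarith
              rw [← Real.exp_add, neg_add_cancel, Real.exp_zero] at h4
              linarith
            have := hmon (Set.mem_Ici.2 le_rfl) (Set.mem_Ici.2 hx) hx
            simp at this
            linarith
          have h5 := hmono (B₀ * t) hx.le
          have h6 : (1 - B₀ * t) * Real.exp (B₀ * t)
              = (1 - B₀ * t) * Real.exp (2 * (B₀ * t)) * Real.exp (-(B₀ * t)) := by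
            rw [mul_assoc, ← Real.exp_add]; ring_nf
          rw [h6]
          gcongr
      rw [Real.sinh_eq, Real.cosh_eq]
      linarith
    nlinarith
  · have h1 : Real.cosh (B₀ * t) ≤ Real.sinh (B₀ * t) + 1 := by
      have h := Real.cosh_sub_sinh (B₀ * t)
      have : Real.exp (-(B₀ * t)) ≤ 1 := Real.exp_le_one_iff.2 (by linarith)
      linarith
    have h2 : B₀ * Real.cosh (B₀ * t) / (4 * Real.sinh (B₀ * t)) ≤ B₀ / 4 + 1 / (4 * t) := by
      rw [div_add_div _ _ (by norm_num) (by positivity), div_le_div_iff₀ (by positivity)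
        (by positivity)]
      nlinarith
    have h3 : B₀ ≤ B₀ / t := by rw [le_div_iff₀ ht]; nlinarith
    have h4 : 1 / (4 * t) = 1 / t / 4 := by field_simp
    have h5 : 0 < 1 / t := by positivity
    rw [add_div]
    linarith

/-- The dominating function for the heat kernel and its gradient. -/
def heatDom (w : Plane) (t : ℝ) : ℝ :=
  ‖w‖⁻¹ * (8 * (‖w‖ ^ 2 / (8 * t ^ 2) * Real.exp (-(‖w‖ ^ 2 / (8 * t)))) + 1)
    * Real.exp (-(1 / 8) * ‖w‖ ^ 2)

/-- Half of the exponent is kept for the integral over `t`; the other half, since `t ≤ 1`, is decay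
uniform in `t`. -/
lemma exp_heat_le {w : Plane} {t : ℝ} (ht : 0 < t) (ht1 : t ≤ 1) :
    Real.exp (-(‖w‖ ^ 2 / (4 * t)))
      ≤ Real.exp (-(‖w‖ ^ 2 / (8 * t))) * Real.exp (-(1 / 8) * ‖w‖ ^ 2) := by
  rw [← Real.exp_add]
  refine Real.exp_le_exp.2 ?_
  have h1 : ‖w‖ ^ 2 / (4 * t) = ‖w‖ ^ 2 / (8 * t) + ‖w‖ ^ 2 / (8 * t) := by field_simp; ring
  have h2 : ‖w‖ ^ 2 / 8 ≤ ‖w‖ ^ 2 / (8 * t) := by gcongr; linarith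
  linarith

lemma norm_heatFun_le {B₀ : ℝ} (hB : 0 < B₀) {t : ℝ} (ht : 0 < t) (ht1 : t ≤ 1) {w : Plane}
    (hw : w ≠ 0) : ‖heatFun B₀ t w‖ ≤ (B₀ + 1) * heatDom w t := by
  obtain ⟨h1, h2, h3, -⟩ := heat_profile_bounds hB ht ht1
  have hr : 0 < ‖w‖ := norm_pos_iff.2 hw
  rw [heatFun, Complex.norm_real, Real.norm_of_nonneg (mul_nonneg h1 (Real.exp_pos _).le)]
  have h4 : Real.exp (-(B₀ * Real.cosh (B₀ * t) / (4 * Real.sinh (B₀ * t))) * ‖w‖ ^ 2)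
      ≤ Real.exp (-(‖w‖ ^ 2 / (8 * t))) * Real.exp (-(1 / 8) * ‖w‖ ^ 2) := by
    refine le_trans (Real.exp_le_exp.2 ?_) (exp_heat_le ht ht1)
    have : ‖w‖ ^ 2 / (4 * t) = 1 / (4 * t) * ‖w‖ ^ 2 := by ring
    rw [this]
    nlinarith [sq_nonneg ‖w‖]
  -- Trades `1 / t` for the factor `‖w‖ / t²` that also occurs in the gradient. This is wasteful, as
  -- the integrated kernel has only a logarithmic singularity, but one dominating function then
  -- serves both.
  have h5 : 1 / t ≤ ‖w‖⁻¹ * (‖w‖ ^ 2 / t ^ 2) + ‖w‖⁻¹ := by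
    have e : ‖w‖⁻¹ * (‖w‖ ^ 2 / t ^ 2) + ‖w‖⁻¹ - 1 / t
        = ‖w‖⁻¹ * ((‖w‖ / t - 1 / 2) ^ 2 + 3 / 4) := by field_simp; ring
    have : 0 ≤ ‖w‖⁻¹ * ((‖w‖ / t - 1 / 2) ^ 2 + 3 / 4) := by positivity
    linarith
  have h6 : Real.exp (-(‖w‖ ^ 2 / (8 * t))) ≤ 1 := Real.exp_le_one_iff.2 (by
    have : 0 ≤ ‖w‖ ^ 2 / (8 * t) := by positivity
    linarith)
  calc _ ≤ 1 / t * (Real.exp (-(‖w‖ ^ 2 / (8 * t))) * Real.exp (-(1 / 8) * ‖w‖ ^ 2)) := by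
        gcongr
    _ ≤ (‖w‖⁻¹ * (‖w‖ ^ 2 / t ^ 2) + ‖w‖⁻¹)
        * (Real.exp (-(‖w‖ ^ 2 / (8 * t))) * Real.exp (-(1 / 8) * ‖w‖ ^ 2)) := by gcongr
    _ = ‖w‖⁻¹ * (8 * (‖w‖ ^ 2 / (8 * t ^ 2) * Real.exp (-(‖w‖ ^ 2 / (8 * t))))
        + Real.exp (-(‖w‖ ^ 2 / (8 * t)))) * Real.exp (-(1 / 8) * ‖w‖ ^ 2) := by
        field_simp
    _ ≤ heatDom w t := by unfold heatDom; gcongr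
    _ ≤ _ := le_mul_of_one_le_left (by unfold heatDom; positivity) (by linarith)

lemma covDeriv_heatFun (B₀ t : ℝ) (k : Fin 2) (w : Plane) :
    covDeriv (gauge0 B₀) k (heatFun B₀ t) w
      = (2 * Complex.I * ((B₀ * Real.cosh (B₀ * t) / (4 * Real.sinh (B₀ * t)) : ℝ) : ℂ) * (w k : ℂ)
        - (gauge0 B₀ w k : ℂ)) * heatFun B₀ t w := by
  set β := B₀ * Real.cosh (B₀ * t) / (4 * Real.sinh (B₀ * t)) with hβ
  set α := B₀ / (4 * Real.pi * Real.sinh (B₀ * t)) with hα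
  have hq : ∀ x, HasDerivAt (fun x => α * Real.exp (-β * x)) (-β * (α * Real.exp (-β * x))) x :=
    fun x => by
      refine ((((hasDerivAt_id x).const_mul (-β)).exp).const_mul α).congr_deriv ?_
      simp; ring
  have h := covDeriv_radial B₀ k hq w
  have e : heatFun B₀ t = fun w => (((fun x => α * Real.exp (-β * x)) (‖w‖ ^ 2) : ℝ) : ℂ) := rfl
  rw [e, h]
  push_cast
  ring

lemma abs_gauge0_le {B₀ : ℝ} (hB : 0 < B₀) (w : Plane) (k : Fin 2) :
    |gauge0 B₀ w k| ≤ B₀ / 2 * ‖w‖ := by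
  have h : ∀ i, |w i| ≤ ‖w‖ := fun i => by simpa using PiLp.norm_apply_le w i
  fin_cases k
  · simp only [Fin.zero_eta, gauge0_zero, abs_mul, abs_of_pos (half_pos hB)]
    have := h 1
    gcongr
  · simp only [Fin.mk_one, gauge0_one, abs_neg, abs_mul, abs_of_pos (half_pos hB)]
    have := h 0
    gcongr

lemma norm_covDeriv_heatFun_le {B₀ : ℝ} (hB : 0 < B₀) {t : ℝ} (ht : 0 < t) (ht1 : t ≤ 1) {w : Plane}
    (hw : w ≠ 0) (k : Fin 2) :
    ‖covDeriv (gauge0 B₀) k (heatFun B₀ t) w‖ ≤ (B₀ + 1) * heatDom w t := by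
  obtain ⟨h1, h2, h3, h4⟩ := heat_profile_bounds hB ht ht1
  set β := B₀ * Real.cosh (B₀ * t) / (4 * Real.sinh (B₀ * t)) with hβ
  have hr : 0 < ‖w‖ := norm_pos_iff.2 hw
  have hβ0 : 0 ≤ β := le_trans (by positivity) h3
  rw [covDeriv_heatFun, norm_mul, heatFun, Complex.norm_real (_ * _),
    Real.norm_of_nonneg (mul_nonneg h1 (Real.exp_pos _).le)]
  have h5 : Real.exp (-β * ‖w‖ ^ 2)
      ≤ Real.exp (-(‖w‖ ^ 2 / (8 * t))) * Real.exp (-(1 / 8) * ‖w‖ ^ 2) := by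
    refine le_trans (Real.exp_le_exp.2 ?_) (exp_heat_le ht ht1)
    have : ‖w‖ ^ 2 / (4 * t) = 1 / (4 * t) * ‖w‖ ^ 2 := by ring
    rw [this]
    nlinarith [sq_nonneg ‖w‖]
  have hwk : |w k| ≤ ‖w‖ := by simpa using PiLp.norm_apply_le w k
  have h6 : ‖2 * Complex.I * (β : ℂ) * (w k : ℂ) - (gauge0 B₀ w k : ℂ)‖ ≤ (B₀ + 1) / t * ‖w‖ := by
    refine (norm_sub_le _ _).trans ?_
    simp only [norm_mul, Complex.norm_ofNat, Complex.norm_I, Complex.norm_real, mul_one,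
      Real.norm_eq_abs, abs_of_nonneg hβ0]
    have h7 := abs_gauge0_le hB w k
    calc 2 * β * |w k| + |gauge0 B₀ w k| ≤ 2 * β * ‖w‖ + B₀ / 2 * ‖w‖ := by gcongr
      _ = (2 * β + B₀ / 2) * ‖w‖ := by ring
      _ ≤ _ := by gcongr
  calc _ ≤ (B₀ + 1) / t * ‖w‖ * (1 / t *
        (Real.exp (-(‖w‖ ^ 2 / (8 * t))) * Real.exp (-(1 / 8) * ‖w‖ ^ 2))) := by
        gcongr
    _ = (B₀ + 1) * (‖w‖⁻¹ * (8 * (‖w‖ ^ 2 / (8 * t ^ 2) * Real.exp (-(‖w‖ ^ 2 / (8 * t)))) + 0)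
        * Real.exp (-(1 / 8) * ‖w‖ ^ 2)) := by
        field_simp; ring
    _ ≤ _ := by unfold heatDom; gcongr; norm_num

/-- The factor `‖w‖² / (8 t²) * exp(-‖w‖² / (8 t))` is the derivative in `t` of `exp(-‖w‖² / (8
t))`, so its integral is at most `1` whatever `w` is. Weights `8` and `1` add up to the constant
`9`. -/
lemma integral_heatDom_le {w : Plane} (hw : w ≠ 0) :
    IntegrableOn (heatDom w) (Set.Ioc 0 1) volume ∧
      ∫ t in Set.Ioc (0 : ℝ) 1, heatDom w t ≤ 9 * singGauss (1 / 8) w := by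
  have hr : 0 < ‖w‖ := norm_pos_iff.2 hw
  set ρ := ‖w‖ ^ 2 / 8 with hρ
  have hρ0 : 0 < ρ := by positivity
  -- Continuous at `0` with value `0`, so that the fundamental theorem of calculus applies on the
  -- closed interval.
  let G : ℝ → ℝ := fun t => expNegInvGlue (ρ⁻¹ * t)
  have hGt : ∀ t, 0 < t → G t = Real.exp (-(ρ / t)) := fun t ht => by
    simp only [G, expNegInvGlue, if_neg (not_le.2 (show 0 < ρ⁻¹ * t by positivity)), mul_inv,
      inv_inv, div_eq_mul_inv]
  have hGc : Continuous G := expNegInvGlue.contDiff (n := 0) |>.continuous.comp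
    (continuous_const.mul continuous_id)
  have hd : ∀ t ∈ Set.Ioo (0 : ℝ) 1, HasDerivAt G (ρ / t ^ 2 * Real.exp (-(ρ / t))) t := by
    intro t ht
    have h1 : HasDerivAt (fun t => Real.exp (-(ρ / t))) (ρ / t ^ 2 * Real.exp (-(ρ / t))) t := by
      have h2 := ((hasDerivAt_inv ht.1.ne').const_mul ρ).neg.exp
      refine (h2.congr_deriv ?_).congr_of_eventuallyEq (Filter.Eventually.of_forall fun s => ?_)
      · simp only [Pi.neg_apply, div_eq_mul_inv]; ring
      · simp [div_eq_mul_inv]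
    refine h1.congr_of_eventuallyEq ?_
    filter_upwards [lt_mem_nhds ht.1] with s hs
    exact hGt s hs
  have hnn : ∀ t ∈ Set.Ioo (0 : ℝ) 1, 0 ≤ ρ / t ^ 2 * Real.exp (-(ρ / t)) := fun t _ => by positivity
  have hint : IntervalIntegrable (fun t => ρ / t ^ 2 * Real.exp (-(ρ / t))) volume 0 1 :=
    intervalIntegral.intervalIntegrable_deriv_of_nonneg hGc.continuousOn
      (by simpa using hd) (by simpa using hnn)
  have hval := intervalIntegral.integral_eq_sub_of_hasDerivAt_of_le zero_le_one hGc.continuousOn hd hint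
  have hG1 : G 1 - G 0 ≤ 1 := by
    have h0 : G 0 = 0 := by simp [G, expNegInvGlue]
    rw [hGt 1 one_pos, h0, sub_zero]
    exact Real.exp_le_one_iff.2 (by have : 0 < ρ / 1 := by positivity
                                    linarith)
  have hfun : heatDom w = fun t => ‖w‖⁻¹ * (8 * (ρ / t ^ 2 * Real.exp (-(ρ / t))) + 1)
      * Real.exp (-(1 / 8) * ‖w‖ ^ 2) := by
    funext t
    rw [heatDom, hρ, div_div, div_div]
  have hint' : IntegrableOn (fun t => ρ / t ^ 2 * Real.exp (-(ρ / t))) (Set.Ioc 0 1) volume :=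
    (intervalIntegrable_iff_integrableOn_Ioc_of_le zero_le_one).1 hint
  have hint2 : IntegrableOn (fun t => 8 * (ρ / t ^ 2 * Real.exp (-(ρ / t))) + 1)
      (Set.Ioc 0 1) volume := (hint'.const_mul 8).add (integrableOn_const (by simp))
  refine ⟨by rw [hfun]; exact (hint2.const_mul _).mul_const _, ?_⟩
  rw [hfun, integral_mul_const, integral_const_mul, integral_add (hint'.const_mul 8)
    (integrableOn_const (by simp)), integral_const_mul,
    ← intervalIntegral.integral_of_le zero_le_one, hval]
  simp only [integral_const, MeasurableSet.univ, measureReal_restrict_apply, Set.univ_inter,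
    Real.volume_real_Ioc, sub_zero, smul_eq_mul, mul_one]
  unfold singGauss
  rw [← mul_assoc]
  refine mul_le_mul_of_nonneg_right ?_ (Real.exp_pos _).le
  have h9 : (max 1 0 : ℝ) = 1 := by norm_num
  have h10 : 0 < ‖w‖⁻¹ := inv_pos.2 hr
  rw [h9]
  nlinarith




/-! ### Superpositions of magnetic kernels -/

lemma ae_ne_zero : ∀ᵐ w : Plane, w ≠ 0 := by
  rw [ae_iff]
  simp

/-- Kernels with an integrable singularity and Gaussian decay that have magnetic derivatives of
the same kind. -/
structure IsMagKer (B₀ b C : ℝ) (g : Plane → ℂ) (d : Fin 2 → Plane → ℂ) : Prop where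
  sm : StronglyMeasurable g
  smd : ∀ k, StronglyMeasurable (d k)
  bd : ∀ w, w ≠ 0 → ‖g w‖ ≤ C * singGauss b w
  bdd : ∀ k w, w ≠ 0 → ‖d k w‖ ≤ C * singGauss b w
  mg : MG B₀ g d

lemma integrable_of_le_singGauss {b C : ℝ} (hb : 0 < b) {g : Plane → ℂ}
    (hm : StronglyMeasurable g) (h : ∀ w, w ≠ 0 → ‖g w‖ ≤ C * singGauss b w) :
    Integrable g volume := by
  refine ((integrable_singGauss hb).const_mul C).mono' hm.aestronglyMeasurable ?_
  filter_upwards [ae_ne_zero] with w hw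
  exact h w hw

lemma IsMagKer.integrable {B₀ b C : ℝ} (hb : 0 < b) {g : Plane → ℂ} {d : Fin 2 → Plane → ℂ}
    (h : IsMagKer B₀ b C g d) : Integrable g volume :=
  integrable_of_le_singGauss hb h.sm h.bd

lemma IsMagKer.integrable_d {B₀ b C : ℝ} (hb : 0 < b) {g : Plane → ℂ} {d : Fin 2 → Plane → ℂ}
    (h : IsMagKer B₀ b C g d) (k : Fin 2) : Integrable (d k) volume :=
  integrable_of_le_singGauss hb (h.smd k) (h.bdd k)

lemma singGauss_anti {b b' : ℝ} (h : b ≤ b') (w : Plane) : singGauss b' w ≤ singGauss b w := by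
  unfold singGauss
  gcongr

lemma IsMagKer.mono {B₀ b b' C C' : ℝ} {g : Plane → ℂ} {d : Fin 2 → Plane → ℂ}
    (h : IsMagKer B₀ b C g d) (hb : b' ≤ b) (hC : C ≤ C') (hC' : 0 ≤ C') :
    IsMagKer B₀ b' C' g d := by
  have key : ∀ w, C * singGauss b w ≤ C' * singGauss b' w := fun w =>
    mul_le_mul hC (singGauss_anti hb w) (singGauss_nonneg _ _) hC'
  exact ⟨h.sm, h.smd, fun w hw => (h.bd w hw).trans (key w),
    fun k w hw => (h.bdd k w hw).trans (key w), h.mg⟩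

lemma IsMagKer.add {B₀ b C C' : ℝ} (hb : 0 < b) {g g' : Plane → ℂ} {d d' : Fin 2 → Plane → ℂ}
    (h : IsMagKer B₀ b C g d) (h' : IsMagKer B₀ b C' g' d') :
    IsMagKer B₀ b (C + C') (fun w => g w + g' w) (fun k w => d k w + d' k w) where
  sm := h.sm.add h'.sm
  smd k := (h.smd k).add (h'.smd k)
  bd w hw := by
    rw [add_mul]
    exact (norm_add_le _ _).trans (add_le_add (h.bd w hw) (h'.bd w hw))
  bdd k w hw := by
    rw [add_mul]
    exact (norm_add_le _ _).trans (add_le_add (h.bdd k w hw) (h'.bdd k w hw))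
  mg := h.mg.add h'.mg (h.integrable hb) (h'.integrable hb) (h.integrable_d hb)
    (h'.integrable_d hb)

lemma integrable_uncurry_of_singGauss {Θ : Type*} [MeasurableSpace Θ] {μ : Measure Θ} [SFinite μ]
    {b C : ℝ} (hb : 0 < b) {h : Θ → Plane → ℂ} (hm : StronglyMeasurable (Function.uncurry h))
    (hi : ∀ w, w ≠ 0 → Integrable (fun θ => h θ w) μ ∧ ∫ θ, ‖h θ w‖ ∂μ ≤ C * singGauss b w) :
    Integrable (Function.uncurry h) (μ.prod volume) := by
  rw [integrable_prod_iff' hm.aestronglyMeasurable]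
  refine ⟨ae_ne_zero.mono fun w hw => (hi w hw).1, ?_⟩
  refine ((integrable_singGauss hb).const_mul C).mono' ?_ ?_
  · exact (StronglyMeasurable.integral_prod_left (f := fun θ w => ‖h θ w‖)
      hm.norm).aestronglyMeasurable
  · filter_upwards [ae_ne_zero] with w hw
    rw [Real.norm_of_nonneg (integral_nonneg fun _ => norm_nonneg _)]
    exact (hi w hw).2

/-- The parameter integrals are only controlled off the origin. A single point is negligible both
for the integrability on the product and for the weak identity. -/
lemma isMagKer_integral {Θ : Type*} [MeasurableSpace Θ] {μ : Measure Θ} [SFinite μ]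
    {B₀ b C : ℝ} (hb : 0 < b) {h : Θ → Plane → ℂ} {d : Fin 2 → Θ → Plane → ℂ}
    (hm : StronglyMeasurable (Function.uncurry h))
    (hdm : ∀ k, StronglyMeasurable (Function.uncurry (d k)))
    (hi : ∀ w, w ≠ 0 → Integrable (fun θ => h θ w) μ ∧ ∫ θ, ‖h θ w‖ ∂μ ≤ C * singGauss b w)
    (hdi : ∀ k w, w ≠ 0 →
      Integrable (fun θ => d k θ w) μ ∧ ∫ θ, ‖d k θ w‖ ∂μ ≤ C * singGauss b w)
    (H : ∀ᵐ θ ∂μ, MG B₀ (h θ) fun k => d k θ) :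
    IsMagKer B₀ b C (fun w => ∫ θ, h θ w ∂μ) (fun k w => ∫ θ, d k θ w ∂μ) where
  sm := hm.integral_prod_left
  smd k := (hdm k).integral_prod_left
  bd w hw := (norm_integral_le_integral_norm _).trans (hi w hw).2
  bdd k w hw := (norm_integral_le_integral_norm _).trans (hdi k w hw).2
  mg := MG.integral (integrable_uncurry_of_singGauss hb hm hi)
    (fun k => integrable_uncurry_of_singGauss hb (hdm k) (hdi k)) H

/-! ### The short time heat part -/

/-- The profile of `∫_0^1 exp (t (ζ - H₀)) dt`. -/
def heatPart (B₀ : ℝ) (ζ : ℂ) (w : Plane) : ℂ :=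
  ∫ t in Set.Ioc (0 : ℝ) 1, Complex.exp (t * ζ) * heatFun B₀ t w

/-- The magnetic derivatives of `heatPart`. -/
def heatPartD (B₀ : ℝ) (ζ : ℂ) (k : Fin 2) (w : Plane) : ℂ :=
  ∫ t in Set.Ioc (0 : ℝ) 1, Complex.exp (t * ζ) * covDeriv (gauge0 B₀) k (heatFun B₀ t) w

lemma measurable_heatFun (B₀ : ℝ) :
    Measurable fun p : ℝ × Plane => heatFun B₀ p.1 p.2 := by
  unfold heatFun
  refine Complex.measurable_ofReal.comp ?_
  have h1 : Measurable fun p : ℝ × Plane => Real.sinh (B₀ * p.1) :=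
    Real.measurable_sinh.comp (measurable_fst.const_mul _)
  have h2 : Measurable fun p : ℝ × Plane => Real.cosh (B₀ * p.1) :=
    Real.measurable_cosh.comp (measurable_fst.const_mul _)
  fun_prop

lemma measurable_covDeriv_heatFun (B₀ : ℝ) (k : Fin 2) :
    Measurable fun p : ℝ × Plane => covDeriv (gauge0 B₀) k (heatFun B₀ p.1) p.2 := by
  simp_rw [covDeriv_heatFun]
  refine Measurable.mul (Measurable.sub ?_ ?_) (measurable_heatFun B₀)
  · have h1 : Measurable fun p : ℝ × Plane => Real.sinh (B₀ * p.1) :=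
      Real.measurable_sinh.comp (measurable_fst.const_mul _)
    have h2 : Measurable fun p : ℝ × Plane => Real.cosh (B₀ * p.1) :=
      Real.measurable_cosh.comp (measurable_fst.const_mul _)
    have h3 : Measurable fun p : ℝ × Plane => ((p.2 k : ℝ) : ℂ) :=
      ((contDiff_coord (n := 0) k).continuous.comp continuous_snd).measurable
    refine Measurable.mul (measurable_const.mul (Complex.measurable_ofReal.comp ?_)) h3
    fun_prop
  · exact Complex.measurable_ofReal.comp
      (((contDiff_gauge0 B₀ k (n := 0)).continuous.comp continuous_snd).measurable)

lemma norm_exp_mul_le {t : ℝ} (ht : 0 < t) (ht1 : t ≤ 1) (ζ : ℂ) :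
    ‖Complex.exp (t * ζ)‖ ≤ Real.exp ‖ζ‖ := by
  refine (Complex.norm_exp_le_exp_norm _).trans (Real.exp_le_exp.2 ?_)
  rw [norm_mul, Complex.norm_real, Real.norm_of_nonneg ht.le]
  exact mul_le_of_le_one_left (norm_nonneg _) ht1

lemma integral_heat_le {B₀ : ℝ} (hB : 0 < B₀) (ζ : ℂ) {h : ℝ → Plane → ℂ}
    (hm : StronglyMeasurable (Function.uncurry h))
    (hb : ∀ t, 0 < t → t ≤ 1 → ∀ w, w ≠ 0 → ‖h t w‖ ≤ (B₀ + 1) * heatDom w t) (w : Plane)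
    (hw : w ≠ 0) :
    Integrable (fun t : ℝ => Complex.exp (t * ζ) * h t w) (volume.restrict (Set.Ioc 0 1)) ∧
      ∫ t in Set.Ioc (0 : ℝ) 1, ‖Complex.exp (t * ζ) * h t w‖
        ≤ (9 * (B₀ + 1) * Real.exp ‖ζ‖) * singGauss (1 / 8) w := by
  obtain ⟨hi, hle⟩ := integral_heatDom_le hw
  have hb' : ∀ᵐ t : ℝ ∂(volume.restrict (Set.Ioc (0 : ℝ) 1)),
      ‖Complex.exp (t * ζ) * h t w‖ ≤ Real.exp ‖ζ‖ * (B₀ + 1) * heatDom w t := by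
    filter_upwards [ae_restrict_mem measurableSet_Ioc] with t ht
    rw [norm_mul, mul_assoc]
    exact mul_le_mul (norm_exp_mul_le ht.1 ht.2 ζ) (hb t ht.1 ht.2 w hw) (norm_nonneg _)
      (Real.exp_pos _).le
  have hmeas : AEStronglyMeasurable (fun t : ℝ => Complex.exp (t * ζ) * h t w)
      (volume.restrict (Set.Ioc 0 1)) := by
    refine (StronglyMeasurable.mul ?_ (hm.comp_measurable
      (measurable_id.prodMk measurable_const))).aestronglyMeasurable
    exact (by fun_prop : Continuous fun t : ℝ => Complex.exp (t * ζ)).stronglyMeasurable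
  refine ⟨(hi.const_mul _).mono' hmeas hb', ?_⟩
  calc _ ≤ ∫ t in Set.Ioc (0 : ℝ) 1, Real.exp ‖ζ‖ * (B₀ + 1) * heatDom w t :=
        integral_mono_ae ((hi.const_mul _).mono' hmeas hb').norm (hi.const_mul _) hb'
    _ = Real.exp ‖ζ‖ * (B₀ + 1) * ∫ t in Set.Ioc (0 : ℝ) 1, heatDom w t := integral_const_mul _ _
    _ ≤ Real.exp ‖ζ‖ * (B₀ + 1) * (9 * singGauss (1 / 8) w) := by gcongr
    _ = _ := by ring

lemma stronglyMeasurable_exp_mul (ζ : ℂ) {h : ℝ → Plane → ℂ}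
    (hm : StronglyMeasurable (Function.uncurry h)) :
    StronglyMeasurable (Function.uncurry fun (t : ℝ) w => Complex.exp (t * ζ) * h t w) := by
  refine StronglyMeasurable.mul ?_ hm
  exact (by fun_prop : Continuous fun p : ℝ × Plane => Complex.exp (p.1 * ζ)).stronglyMeasurable

lemma isMagKer_heatPart {B₀ : ℝ} (hB : 0 < B₀) (ζ : ℂ) :
    IsMagKer B₀ (1 / 8) (9 * (B₀ + 1) * Real.exp ‖ζ‖) (heatPart B₀ ζ) (heatPartD B₀ ζ) := by
  have hm := (measurable_heatFun B₀).stronglyMeasurable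
  have hmd := fun k => (measurable_covDeriv_heatFun B₀ k).stronglyMeasurable
  refine isMagKer_integral (by norm_num) (stronglyMeasurable_exp_mul ζ hm)
    (fun k => stronglyMeasurable_exp_mul ζ (hmd k))
    (integral_heat_le hB ζ hm fun t ht ht1 w hw => norm_heatFun_le hB ht ht1 hw)
    (fun k => integral_heat_le hB ζ (hmd k)
      fun t ht ht1 w hw => norm_covDeriv_heatFun_le hB ht ht1 hw k) ?_
  filter_upwards [ae_restrict_mem measurableSet_Ioc] with t ht
  exact (isGaussPoly_heatFun hB ht.1).mg.const_mul _

/-- On one level the heat semigroup acts as the scalar `exp(-t B₀ (2l + 1))`, so the heat part acts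
as a scalar integral in `t`. -/
lemma inner_heatPart {B₀ : ℝ} (hB : 0 < B₀) (ζ : ℂ) (l : ℕ) (f ψ : L2 ℂ) :
    inner ℂ ψ (twOp B₀ (heatPart B₀ ζ) (landauOp B₀ l f))
      = (∫ t in Set.Ioc (0 : ℝ) 1, Complex.exp (t * (ζ - level B₀ l)))
        * inner ℂ ψ (landauOp B₀ l f) := by
  have hm : StronglyMeasurable (Function.uncurry (heatFun B₀)) :=
    (measurable_heatFun B₀).stronglyMeasurable
  have hk := isMagKer_heatPart hB ζ
  rw [inner_twOp B₀ hk.sm (hk.integrable (by norm_num)), ← integral_mul_const]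
  unfold heatPart
  rw [integral_integral_mul_corr B₀ (integrable_uncurry_of_singGauss (by norm_num)
    (stronglyMeasurable_exp_mul ζ hm)
    (integral_heat_le hB ζ hm fun t ht ht1 w hw => norm_heatFun_le hB ht ht1 hw))]
  refine setIntegral_congr_fun measurableSet_Ioc fun t ht => ?_
  simp only [mul_assoc]
  rw [integral_const_mul, ← (hasSum_inner_heat hB ht.1 (landauOp B₀ l f) ψ).tsum_eq,
    tsum_eq_single l fun m hm => by rw [landauOp_landauOp hB, if_neg hm, inner_zero_right, mul_zero],
    landauOp_landauOp hB, if_pos rfl, ← mul_assoc, Complex.ofReal_exp, ← Complex.exp_add]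
  congr 2
  rw [level]
  push_cast
  ring

/-! ### The series part -/

lemma norm_covDeriv_landauFun_le {B₀ : ℝ} (hB : 0 < B₀) {r : ℝ} (hr0 : 0 < r) (hr1 : r < 1)
    (k : Fin 2) (l : ℕ) (w : Plane) :
    ‖covDeriv (gauge0 B₀) k (landauFun B₀ l) w‖ ≤ B₀ ^ 2 / Real.pi * (l + 1) * ((1 - r)⁻¹
      * (r⁻¹) ^ l * (‖w‖ * Real.exp (-(B₀ * (1 - r) / (4 * (1 + r))) * ‖w‖ ^ 2))) := by
  set z := B₀ / 2 * ‖w‖ ^ 2 with hz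
  have hz0 : 0 ≤ z := by positivity
  have h1r : 0 < 1 - r := by linarith
  have h1 := abs_lag_le hr0 hr1 l hz0
  have h2 := abs_derivative_lag_le hr0 hr1 l hz0
  set X := (1 - r)⁻¹ * (r⁻¹) ^ l * Real.exp (-((1 - r) / (2 * (1 + r))) * z) with hX
  have hX' : X = (1 - r)⁻¹ * (r⁻¹) ^ l
      * Real.exp (-(B₀ * (1 - r) / (4 * (1 + r))) * ‖w‖ ^ 2) := by
    rw [hX, hz]; congr 2; field_simp; ring
  have hX0 : 0 ≤ X := by positivity
  have he : Real.exp (-(B₀ / 4) * ‖w‖ ^ 2) = Real.exp (-z / 2) := by rw [hz]; congr 1; ring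
  rw [landauFun_eq_radial, covDeriv_radial B₀ k (hasDerivAt_landau_profile B₀ (lag l))]
  have hwk : ‖(w k : ℂ)‖ ≤ ‖w‖ := by
    rw [Complex.norm_real]; exact PiLp.norm_apply_le w k
  have hq : |B₀ / (2 * Real.pi) * ((lag l).eval (B₀ / 2 * ‖w‖ ^ 2)
      * Real.exp (-(B₀ / 4) * ‖w‖ ^ 2))| ≤ B₀ / (2 * Real.pi) * X := by
    rw [he, abs_mul, abs_of_nonneg (show 0 ≤ B₀ / (2 * Real.pi) by positivity), abs_mul,
      abs_of_nonneg (Real.exp_pos _).le]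
    gcongr
  have hq' : |B₀ / (2 * Real.pi) * ((Polynomial.C (B₀ / 2) * (lag l).derivative
        - Polynomial.C (B₀ / 4) * lag l).eval (B₀ / 2 * ‖w‖ ^ 2)
        * Real.exp (-(B₀ / 4) * ‖w‖ ^ 2))|
      ≤ B₀ / (2 * Real.pi) * (B₀ / 2 * (l * X) + B₀ / 4 * X) := by
    rw [he, abs_mul, abs_of_nonneg (show 0 ≤ B₀ / (2 * Real.pi) by positivity), abs_mul,
      abs_of_nonneg (Real.exp_pos _).le]
    refine mul_le_mul_of_nonneg_left ?_ (by positivity)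
    simp only [Polynomial.eval_sub, Polynomial.eval_mul, Polynomial.eval_C]
    calc _ ≤ (|B₀ / 2 * (lag l).derivative.eval z| + |B₀ / 4 * (lag l).eval z|)
          * Real.exp (-z / 2) := by gcongr; exact abs_sub _ _
      _ = B₀ / 2 * (|(lag l).derivative.eval z| * Real.exp (-z / 2))
          + B₀ / 4 * (|(lag l).eval z| * Real.exp (-z / 2)) := by
          rw [abs_mul, abs_mul, abs_of_pos (show 0 < B₀ / 2 by positivity),
            abs_of_pos (show 0 < B₀ / 4 by positivity)]
          ring
      _ ≤ _ := by gcongr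
  refine (norm_sub_le _ _).trans ?_
  simp only [norm_mul, norm_neg, Complex.norm_I, Complex.norm_real, Complex.norm_ofNat,
    Real.norm_eq_abs, mul_one] at hwk ⊢
  calc _ ≤ 2 * (‖w‖ * (B₀ / (2 * Real.pi) * (B₀ / 2 * (l * X) + B₀ / 4 * X)))
        + B₀ / 2 * ‖w‖ * (B₀ / (2 * Real.pi) * X) := by
        refine add_le_add ?_ (mul_le_mul (abs_gauge0_le hB w k) ?_ (by positivity) (by positivity))
        · refine mul_le_mul_of_nonneg_left (mul_le_mul hwk ?_ (by positivity) (norm_nonneg _))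
            zero_le_two
          simpa only [abs_mul] using hq'
        · simpa only [abs_mul] using hq
    _ = B₀ ^ 2 / (2 * Real.pi) * (l + 1) * (X * ‖w‖) := by field_simp; ring
    _ ≤ B₀ ^ 2 / Real.pi * (l + 1) * (X * ‖w‖) := by
        gcongr
        nlinarith [Real.pi_pos]
    _ = _ := by rw [hX']; ring

lemma norm_mul_exp_le {b : ℝ} (hb : 0 < b) (w : Plane) :
    ‖w‖ * Real.exp (-(2 * b) * ‖w‖ ^ 2) ≤ (1 + b⁻¹) * singGauss b w := by
  have h1 : ‖w‖ ≤ (1 + b⁻¹) * Real.exp (b * ‖w‖ ^ 2) := by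
    calc ‖w‖ ≤ 1 + ‖w‖ ^ 2 := by nlinarith [sq_nonneg (‖w‖ - 1)]
      _ ≤ (1 + b⁻¹) * (b * ‖w‖ ^ 2 + 1) := by
        have : (1 + b⁻¹) * (b * ‖w‖ ^ 2 + 1) = 1 + ‖w‖ ^ 2 + (b * ‖w‖ ^ 2 + b⁻¹) := by
          field_simp; ring
        rw [this]
        have : 0 ≤ b * ‖w‖ ^ 2 + b⁻¹ := by positivity
        linarith
      _ ≤ _ := by gcongr; exact Real.add_one_le_exp _
  calc ‖w‖ * Real.exp (-(2 * b) * ‖w‖ ^ 2)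
      ≤ (1 + b⁻¹) * Real.exp (b * ‖w‖ ^ 2) * Real.exp (-(2 * b) * ‖w‖ ^ 2) := by gcongr
    _ = (1 + b⁻¹) * Real.exp (-b * ‖w‖ ^ 2) := by
      rw [mul_assoc, ← Real.exp_add]; congr 2; ring
    _ ≤ _ := by gcongr; exact exp_le_singGauss b w

/-- Series are treated as integrals against the counting measure, so the superposition results for
parameter integrals cover them. -/
lemma count_bounds {K : ℝ} {s : ℕ → ℝ} (hs : Summable s) {h : ℕ → ℂ}
    (hb : ∀ l, ‖h l‖ ≤ s l * K) :
    Integrable h Measure.count ∧ ∫ l, ‖h l‖ ∂Measure.count ≤ (∑' l, s l) * K := by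
  have h1 : Summable fun l => ‖h l‖ :=
    Summable.of_nonneg_of_le (fun _ => norm_nonneg _) hb (hs.mul_right K)
  have hi : Integrable h Measure.count := integrable_count_iff.2 h1
  refine ⟨hi, ?_⟩
  rw [integral_countable hi.norm, ← tsum_mul_right]
  simp only [Measure.real, Measure.count_singleton, ENNReal.toReal_one, one_smul]
  exact h1.tsum_le_tsum hb (hs.mul_right K)

/-- The profile of `∑ a_l P_l`. -/
def seriesPart (B₀ : ℝ) (a : ℕ → ℂ) (w : Plane) : ℂ :=
  ∫ l, a l * landauFun B₀ l w ∂Measure.count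

/-- The magnetic derivatives of `seriesPart`. -/
def seriesPartD (B₀ : ℝ) (a : ℕ → ℂ) (k : Fin 2) (w : Plane) : ℂ :=
  ∫ l, a l * covDeriv (gauge0 B₀) k (landauFun B₀ l) w ∂Measure.count

/-- Coefficients of size `r^{2l}` meet profiles of size `r^{-l}` and gradients of size `(l + 1)
r^{-l}`, which leaves the convergent series of `(l + 1) r^l`. The rate `b` and the constant `C` do
not depend on the coefficients. -/
lemma exists_isMagKer_seriesPart {B₀ : ℝ} (hB : 0 < B₀) {r : ℝ} (hr0 : 0 < r) (hr1 : r < 1) :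
    ∃ b C : ℝ, 0 < b ∧ 0 ≤ C ∧ ∀ (a : ℕ → ℂ) (A : ℝ), 0 ≤ A → (∀ l, ‖a l‖ ≤ A * (r ^ 2) ^ l) →
      IsMagKer B₀ b (C * A) (seriesPart B₀ a) (seriesPartD B₀ a) ∧
      ∀ (l : ℕ) (f ψ : L2 ℂ), inner ℂ ψ (twOp B₀ (seriesPart B₀ a) (landauOp B₀ l f))
        = a l * inner ℂ ψ (landauOp B₀ l f) := by
  have h1r : 0 < 1 - r := by linarith
  set b := B₀ * (1 - r) / (8 * (1 + r)) with hbdef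
  have hb : 0 < b := by positivity
  have h2b : B₀ * (1 - r) / (4 * (1 + r)) = 2 * b := by rw [hbdef]; field_simp; norm_num
  set K := B₀ / (2 * Real.pi) * (1 - r)⁻¹ + B₀ ^ 2 / Real.pi * (1 - r)⁻¹ * (1 + b⁻¹) with hK
  have hK0 : 0 ≤ K := by positivity
  have hsum : Summable fun l : ℕ => ((l : ℝ) + 1) * r ^ l := by
    have hr : ‖r‖ < 1 := by rwa [Real.norm_of_nonneg hr0.le]
    have := (summable_pow_mul_geometric_of_norm_lt_one 1 hr).add
      (summable_pow_mul_geometric_of_norm_lt_one 0 hr)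
    refine this.congr fun l => ?_
    simp only [pow_one, pow_zero, one_mul]
    ring
  have hS0 : 0 ≤ ∑' l : ℕ, ((l : ℝ) + 1) * r ^ l := tsum_nonneg fun l => by positivity
  refine ⟨b, (∑' l : ℕ, ((l : ℝ) + 1) * r ^ l) * K, hb, by positivity, fun a A hA ha => ?_⟩
  have hrr : ∀ l : ℕ, (r ^ 2) ^ l * (r⁻¹) ^ l = r ^ l := fun l => by
    rw [← mul_pow]; congr 1; field_simp
  have hbd : ∀ l w, ‖a l * landauFun B₀ l w‖ ≤ ((l : ℝ) + 1) * r ^ l * (K * A * singGauss b w) := by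
    intro l w
    rw [norm_mul]
    calc _ ≤ (A * (r ^ 2) ^ l) * (B₀ / (2 * Real.pi) * ((1 - r)⁻¹ * (r⁻¹) ^ l
          * Real.exp (-(B₀ * (1 - r) / (4 * (1 + r))) * ‖w‖ ^ 2))) :=
          mul_le_mul (ha l) (norm_landauFun_le hB hr0 hr1 l w) (norm_nonneg _) (by positivity)
      _ = ((r ^ 2) ^ l * (r⁻¹) ^ l) * (B₀ / (2 * Real.pi) * (1 - r)⁻¹
            * A * Real.exp (-(B₀ * (1 - r) / (4 * (1 + r))) * ‖w‖ ^ 2)) := by ring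
      _ = (1 * r ^ l) * (B₀ / (2 * Real.pi) * (1 - r)⁻¹
            * A * Real.exp (-(2 * b) * ‖w‖ ^ 2)) := by rw [hrr, h2b, one_mul]
      _ ≤ _ := by
        have h1 : (1 : ℝ) ≤ l + 1 := le_add_of_nonneg_left (Nat.cast_nonneg l)
        have h2 : B₀ / (2 * Real.pi) * (1 - r)⁻¹ ≤ K := le_add_of_nonneg_right (by positivity)
        have h3 : Real.exp (-(2 * b) * ‖w‖ ^ 2) ≤ singGauss b w :=
          (exp_le_singGauss _ _).trans (singGauss_anti (by linarith) _)
        gcongr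
  have hbdd : ∀ k l w, ‖a l * covDeriv (gauge0 B₀) k (landauFun B₀ l) w‖
      ≤ ((l : ℝ) + 1) * r ^ l * (K * A * singGauss b w) := by
    intro k l w
    rw [norm_mul]
    calc _ ≤ (A * (r ^ 2) ^ l) * (B₀ ^ 2 / Real.pi * (l + 1) * ((1 - r)⁻¹
      * (r⁻¹) ^ l * (‖w‖ * Real.exp (-(B₀ * (1 - r) / (4 * (1 + r))) * ‖w‖ ^ 2)))) :=
          mul_le_mul (ha l) (norm_covDeriv_landauFun_le hB hr0 hr1 k l w) (norm_nonneg _)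
            (by positivity)
      _ = ((l : ℝ) + 1) * ((r ^ 2) ^ l * (r⁻¹) ^ l) * (B₀ ^ 2 / Real.pi * (1 - r)⁻¹
            * A * (‖w‖ * Real.exp (-(B₀ * (1 - r) / (4 * (1 + r))) * ‖w‖ ^ 2))) := by ring
      _ = ((l : ℝ) + 1) * r ^ l * (B₀ ^ 2 / Real.pi * (1 - r)⁻¹
            * A * (‖w‖ * Real.exp (-(2 * b) * ‖w‖ ^ 2))) := by rw [hrr, h2b]
      _ ≤ ((l : ℝ) + 1) * r ^ l * (B₀ ^ 2 / Real.pi * (1 - r)⁻¹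
            * A * ((1 + b⁻¹) * singGauss b w)) := by
        exact mul_le_mul_of_nonneg_left (mul_le_mul_of_nonneg_left (norm_mul_exp_le hb w)
          (by positivity)) (by positivity)
      _ = ((l : ℝ) + 1) * r ^ l * (B₀ ^ 2 / Real.pi * (1 - r)⁻¹ * (1 + b⁻¹)
            * A * singGauss b w) := by ring
      _ ≤ _ := by
        gcongr
        · exact singGauss_nonneg _ _
        · exact le_add_of_nonneg_left (by positivity)
  have hm : StronglyMeasurable (Function.uncurry fun l w => a l * landauFun B₀ l w) :=
    (measurable_from_prod_countable_right fun l =>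
      (isGaussPoly_landauFun hB l).contDiff.continuous.measurable.const_mul (a l)
        ).stronglyMeasurable
  have hmd : ∀ k, StronglyMeasurable (Function.uncurry fun l w =>
      a l * covDeriv (gauge0 B₀) k (landauFun B₀ l) w) := fun k =>
    (measurable_from_prod_countable_right fun l =>
      ((isGaussPoly_landauFun hB l).covDeriv B₀ k).contDiff.continuous.measurable.const_mul (a l)
        ).stronglyMeasurable
  have hi : ∀ w : Plane, w ≠ 0 → Integrable (fun l => a l * landauFun B₀ l w) Measure.count ∧
      ∫ l, ‖a l * landauFun B₀ l w‖ ∂Measure.count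
        ≤ (∑' l : ℕ, ((l : ℝ) + 1) * r ^ l) * K * A * singGauss b w := fun w _ => by
    have := count_bounds hsum fun l => hbd l w
    exact ⟨this.1, this.2.trans (le_of_eq (by ring))⟩
  have hk : IsMagKer B₀ b ((∑' l : ℕ, ((l : ℝ) + 1) * r ^ l) * K * A) (seriesPart B₀ a)
      (seriesPartD B₀ a) := by
    refine isMagKer_integral hb hm hmd hi (fun k w _ => ?_) (ae_of_all _ fun l =>
      (isGaussPoly_landauFun hB l).mg.const_mul _)
    have := count_bounds hsum fun l => hbdd k l w
    exact ⟨this.1, this.2.trans (le_of_eq (by ring))⟩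
  refine ⟨hk, fun l f ψ => ?_⟩
  rw [inner_twOp B₀ hk.sm (hk.integrable hb)]
  unfold seriesPart
  rw [integral_integral_mul_corr B₀ (integrable_uncurry_of_singGauss hb hm hi)]
  have key : ∀ m, ∫ w, a m * landauFun B₀ m w * corr B₀ (landauOp B₀ l f) ψ w
      = if m = l then a l * inner ℂ ψ (landauOp B₀ l f) else 0 := fun m => by
    simp only [mul_assoc]
    have hg := isGaussPoly_landauFun hB m
    rw [integral_const_mul, ← inner_twOp B₀ hg.contDiff.continuous.stronglyMeasurable hg.integrable]
    change a m * inner ℂ ψ (landauOp B₀ m (landauOp B₀ l f)) = _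
    rw [landauOp_landauOp hB]
    split_ifs with h
    · rw [h]
    · rw [inner_zero_right, mul_zero]
  simp_rw [key]
  rw [integral_countable]
  · simp only [Measure.real, Measure.count_singleton, ENNReal.toReal_one, one_smul]
    exact tsum_ite_eq l _
  · refine integrable_count_iff.2 (summable_of_ne_finset_zero (s := {l}) fun m hm => ?_)
    rw [if_neg (by simpa using hm), norm_zero]

/-! ### The kernel of `M` -/

/-- The growth of the bounds on `M` and its kernel. -/
def growth (B₀ : ℝ) (I : Set ℕ) (ζ : ℂ) : ℝ :=
  Real.exp ‖ζ‖ * (1 + (Metric.infDist ζ (levels B₀ I))⁻¹)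

lemma growth_nonneg (B₀ : ℝ) (I : Set ℕ) (ζ : ℂ) : 0 ≤ growth B₀ I ζ := by
  unfold growth
  have := Metric.infDist_nonneg (x := ζ) (s := levels B₀ I)
  positivity

lemma exp_norm_le_growth (B₀ : ℝ) (I : Set ℕ) (ζ : ℂ) : Real.exp ‖ζ‖ ≤ growth B₀ I ζ := by
  unfold growth
  have := inv_nonneg.2 (Metric.infDist_nonneg (x := ζ) (s := levels B₀ I))
  exact le_mul_of_one_le_right (Real.exp_pos _).le (by linarith)

lemma isClosed_levels {B₀ : ℝ} (hB : 0 < B₀) (I : Set ℕ) : IsClosed (levels B₀ I) := by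
  refine Metric.isClosed_of_pairwise_le_dist (ε := 2 * B₀) (by positivity) ?_
  rintro _ ⟨l, -, rfl⟩ _ ⟨m, -, rfl⟩ hne
  have hlm : l ≠ m := fun h => hne (by rw [h])
  rw [level, level, Complex.dist_eq, ← Complex.ofReal_sub, Complex.norm_real, Real.norm_eq_abs]
  have : B₀ * (2 * (l : ℝ) + 1) - B₀ * (2 * m + 1) = 2 * B₀ * (((l : ℤ) - (m : ℤ) : ℤ) : ℝ) := by
    push_cast; ring
  rw [this, abs_mul, abs_of_pos (show 0 < 2 * B₀ by positivity)]
  refine le_mul_of_one_le_right (by positivity) ?_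
  rw [← Int.cast_abs, ← Int.cast_one, Int.cast_le]
  exact Int.one_le_abs (sub_ne_zero.2 (by exact_mod_cast hlm))

lemma infDist_levels_pos {B₀ : ℝ} (hB : 0 < B₀) {I : Set ℕ} (hI : I.Nonempty) {ζ : ℂ}
    (hζ : ζ ∉ levels B₀ I) : 0 < Metric.infDist ζ (levels B₀ I) :=
  ((isClosed_levels hB I).notMem_iff_infDist_pos (hI.image _)).1 hζ

lemma isLocBdd_growth {B₀ : ℝ} (hB : 0 < B₀) {I : Set ℕ} (hI : I.Nonempty) (C : ℝ) :
    IsLocBdd (levels B₀ I)ᶜ fun ζ => C * growth B₀ I ζ := by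
  have hc := Metric.continuous_infDist_pt (levels B₀ I)
  refine ⟨?_, fun K hK hKU => ?_⟩
  · unfold growth
    have := hc.measurable
    fun_prop
  · refine hK.exists_bound_of_continuousOn (f := fun ζ => C * growth B₀ I ζ) ?_
    unfold growth
    refine continuousOn_const.mul (ContinuousOn.mul (by fun_prop) (continuousOn_const.add
      (hc.continuousOn.inv₀ fun ζ hζ => (infDist_levels_pos hB hI (hKU hζ)).ne')))

/-- The coefficients of the smooth part of `M`. -/
def tailCoeff (B₀ : ℝ) (I : Set ℕ) (ζ : ℂ) (l : ℕ) : ℂ :=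
  resolCoeff B₀ I ζ l - ∫ t in Set.Ioc (0 : ℝ) 1, Complex.exp (t * (ζ - level B₀ l))

/-- For `l ∈ I` the integral over `[0, 1]` cancels the resolvent up to `-exp(ζ - λ_l) / (ζ - λ_l)`,
with `λ_l` the `l`-th level. For the finitely many `l ∉ I`, all at most `N`, there is no
denominator, and the factor `exp(2 B₀ N)` pays for the claimed decay. -/
lemma exists_norm_tailCoeff_le {B₀ : ℝ} (hB : 0 < B₀) {I : Set ℕ} (hI : Iᶜ.Finite)
    (hI' : I.Nonempty) :
    ∃ K : ℝ, 0 ≤ K ∧ ∀ ζ, ζ ∉ levels B₀ I → ∀ l, ‖tailCoeff B₀ I ζ l‖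
      ≤ K * growth B₀ I ζ * (Real.exp (-B₀) ^ 2) ^ l := by
  obtain ⟨N, hN⟩ := hI.bddAbove
  have hexp : ∀ l : ℕ, (Real.exp (-B₀) ^ 2) ^ l = Real.exp (-(2 * B₀ * l)) := fun l => by
    rw [← pow_mul, ← Real.exp_nat_mul]; congr 1; push_cast; ring
  refine ⟨Real.exp (2 * B₀ * N), (Real.exp_pos _).le, fun ζ hζ l => ?_⟩
  have hK1 : 1 ≤ Real.exp (2 * B₀ * N) := Real.one_le_exp (by positivity)
  have hg := growth_nonneg B₀ I ζ
  rw [hexp]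
  have hlre : (level B₀ l).re = B₀ * (2 * l + 1) := by rw [level, Complex.ofReal_re]
  by_cases hl : l ∈ I
  · have hz : ζ - level B₀ l ≠ 0 := fun h => hζ ⟨l, hl, (sub_eq_zero.1 h).symm⟩
    have hint : ∫ t in Set.Ioc (0 : ℝ) 1, Complex.exp (t * (ζ - level B₀ l))
        = (Complex.exp (ζ - level B₀ l) - 1) / (ζ - level B₀ l) := by
      rw [← intervalIntegral.integral_of_le zero_le_one]
      simp_rw [mul_comm _ (ζ - level B₀ l)]
      rw [integral_exp_mul_complex hz]
      simp
    have heq : tailCoeff B₀ I ζ l = -(Complex.exp (ζ - level B₀ l) / (ζ - level B₀ l)) := by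
      rw [tailCoeff, hint, resolCoeff, if_pos hl, ← neg_sub ζ, inv_neg]
      field_simp
      ring
    rw [heq, norm_neg, norm_div, Complex.norm_exp, Complex.sub_re, hlre]
    have hd := infDist_levels_pos hB hI' hζ
    have hd' : Metric.infDist ζ (levels B₀ I) ≤ ‖ζ - level B₀ l‖ := by
      rw [← dist_eq_norm]; exact Metric.infDist_le_dist_of_mem ⟨l, hl, rfl⟩
    calc Real.exp (ζ.re - B₀ * (2 * l + 1)) / ‖ζ - level B₀ l‖
        ≤ Real.exp (‖ζ‖ + -(2 * B₀ * l)) / Metric.infDist ζ (levels B₀ I) := by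
          gcongr
          have := (le_abs_self _).trans (Complex.abs_re_le_norm ζ)
          nlinarith
      _ = Real.exp ‖ζ‖ * (Metric.infDist ζ (levels B₀ I))⁻¹ * Real.exp (-(2 * B₀ * l)) := by
          rw [Real.exp_add, div_eq_mul_inv]; ring
      _ ≤ 1 * growth B₀ I ζ * Real.exp (-(2 * B₀ * l)) := by
          rw [one_mul, growth]
          gcongr
          linarith
      _ ≤ _ := by gcongr
  · have hlN : (l : ℝ) ≤ N := by exact_mod_cast hN hl
    rw [tailCoeff, resolCoeff, if_neg hl, zero_sub, norm_neg]
    calc _ ≤ Real.exp ‖ζ‖ * (volume (Set.Ioc (0 : ℝ) 1)).toReal := by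
          refine norm_setIntegral_le_of_norm_le_const (by simp) fun t ht => ?_
          rw [Complex.norm_exp]
          refine Real.exp_le_exp.2 ?_
          rw [Complex.re_ofReal_mul, Complex.sub_re, hlre]
          have h1 := (le_abs_self _).trans (Complex.abs_re_le_norm ζ)
          have h2 : 0 ≤ B₀ * (2 * (l : ℝ) + 1) := by positivity
          have h3 := norm_nonneg ζ
          nlinarith [ht.1, ht.2, mul_nonneg ht.1.le h2,
            mul_le_mul_of_nonneg_left h1 ht.1.le, mul_le_of_le_one_left h3 ht.2]
      _ = Real.exp ‖ζ‖ := by simp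
      _ ≤ 1 * growth B₀ I ζ := by rw [one_mul]; exact exp_norm_le_growth _ _ _
      _ ≤ (Real.exp (2 * B₀ * N) * Real.exp (-(2 * B₀ * l))) * growth B₀ I ζ := by
          gcongr
          rw [← Real.exp_add]
          refine Real.one_le_exp ?_
          nlinarith
      _ = _ := by ring

lemma twOp_add_apply {B₀ : ℝ} {g g' : Plane → ℂ} (hm : StronglyMeasurable g)
    (hm' : StronglyMeasurable g') (hg : Integrable g volume) (hg' : Integrable g' volume)
    (f ψ : L2 ℂ) : inner ℂ ψ (twOp B₀ (fun w => g w + g' w) f)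
      = inner ℂ ψ (twOp B₀ g f) + inner ℂ ψ (twOp B₀ g' f) := by
  rw [inner_twOp B₀ (h := fun w => g w + g' w) (hm.add hm') (hg.add hg'), inner_twOp B₀ hm hg, inner_twOp B₀ hm' hg',
    ← integral_add (integrable_mul_corr B₀ hg f ψ) (integrable_mul_corr B₀ hg' f ψ)]
  simp only [add_mul]

/-- `M` is a twisted convolution, with a kernel that has magnetic derivatives. -/
lemma exists_kernel_M {B₀ : ℝ} (hB : 0 < B₀) {I : Set ℕ} (hI : Iᶜ.Finite) (hI' : I.Nonempty) :
    ∃ b C : ℝ, 0 < b ∧ 0 ≤ C ∧ ∀ ζ, ζ ∉ levels B₀ I → ∃ (g : Plane → ℂ) (d : Fin 2 → Plane → ℂ),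
      IsMagKer B₀ b (C * growth B₀ I ζ) g d ∧ twOp B₀ g = M B₀ I ζ := by
  -- With `r = exp(-B₀)` the requirement `r^{2l}` matches the decay `exp(-2 B₀ l)` of `tailCoeff`.
  obtain ⟨b, C, hb, hC, H⟩ := exists_isMagKer_seriesPart hB (Real.exp_pos (-B₀))
    (Real.exp_lt_one_iff.2 (neg_lt_zero.2 hB))
  obtain ⟨K, hK, hK'⟩ := exists_norm_tailCoeff_le hB hI hI'
  refine ⟨min b (1 / 8), 9 * (B₀ + 1) + C * K, lt_min hb (by norm_num), by positivity,
    fun ζ hζ => ?_⟩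
  have hg := growth_nonneg B₀ I ζ
  obtain ⟨h2, h2'⟩ := H (tailCoeff B₀ I ζ) (K * growth B₀ I ζ) (by positivity) (hK' ζ hζ)
  have h1 := isMagKer_heatPart hB ζ
  have h12 := (h1.mono (min_le_right b _) (mul_le_mul_of_nonneg_left (exp_norm_le_growth B₀ I ζ)
    (by positivity)) (by positivity)).add (lt_min hb (by norm_num))
    (h2.mono (min_le_left b (1 / 8)) le_rfl (by positivity))
  refine ⟨_, _, h12.mono le_rfl (le_of_eq (by ring)) (by positivity), ?_⟩
  refine clm_ext_of_landauOp hB fun l f => ext_inner_left ℂ fun ψ => ?_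
  rw [twOp_add_apply h1.sm h2.sm (h1.integrable (by norm_num)) (h2.integrable hb),
    inner_heatPart hB, h2', ← add_mul, tailCoeff, add_sub_cancel, M_landauOp hB, inner_smul_right]

/-- `M` maps into the domain of the Landau Hamiltonian. -/
lemma exists_isH0_M {B₀ : ℝ} (hB : 0 < B₀) {I : Set ℕ} (hI : Iᶜ.Finite) {ζ : ℂ}
    (hζ : ζ ∉ levels B₀ I) {V : Fin 2 → L2 ℂ →L[ℂ] L2 ℂ}
    (hV : ∀ f, IsMagGrad (gauge0 B₀) (M B₀ I ζ f) fun k => V k f) :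
    ∃ Y : L2 ℂ →L[ℂ] L2 ℂ, ∀ f, (∀ φ : Plane → ℂ, IsTest φ →
      ∑ k, ∫ x, V k f x * conj (covDeriv (gauge0 B₀) k φ x) = ∫ x, Y f x * conj (φ x)) ∧
      IsH0 B₀ (M B₀ I ζ f) (Y f) := by
  -- `H₀ M = (H₀ - ζ) M + ζ M`, and `(H₀ - ζ) M` is the projection onto the levels in `I`, hence the
  -- identity minus finitely many `P_l`.
  set Y : L2 ℂ →L[ℂ] L2 ℂ := ContinuousLinearMap.id ℂ _ - ∑ l ∈ hI.toFinset, landauOp B₀ l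
    + ζ • M B₀ I ζ with hY
  suffices h : ∀ f, ∀ φ : Plane → ℂ, IsTest φ →
      ∑ k, ∫ x, V k f x * conj (covDeriv (gauge0 B₀) k φ x) = ∫ x, Y f x * conj (φ x) from
    ⟨Y, fun f => ⟨h f, (hV f).isH0_iff (h f)⟩⟩
  intro f φ hφ
  have hD := fun k => (hφ.covDeriv (B₀ := B₀) (k := k)).memLp 2
  have h2 := hφ.memLp 2
  have hin : ∀ {ψ : Plane → ℂ} (hψ : MemLp ψ 2 volume) (u : L2 ℂ),
      ∫ x, u x * conj (ψ x) = innerSL ℂ (hψ.toLp ψ) u := fun {ψ} hψ u => by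
    rw [innerSL_apply_apply, inner_eq_integral]
    refine integral_congr_ae ?_
    filter_upwards [hψ.coeFn_toLp] with x hx
    rw [hx]
  -- For a fixed test function both sides are bounded functionals of `f`, so it is enough to compare
  -- them on each level, where the eigenvalue equation can be tested.
  have key : (∑ k, (innerSL ℂ ((hD k).toLp _)).comp (V k)) = (innerSL ℂ (h2.toLp φ)).comp Y := by
    refine clm_ext_of_landauOp hB fun l f => ?_
    have hYl : Y (landauOp B₀ l f)
        = (resolCoeff B₀ I ζ l * level B₀ l) • landauOp B₀ l f := by
      simp only [hY, add_apply, sub_apply, smul_apply, ContinuousLinearMap.id_apply,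
        sum_apply, M_landauOp hB, landauOp_landauOp hB]
      by_cases hl : l ∈ I
      · rw [Finset.sum_eq_zero fun m hm => if_neg fun h : m = l => (hI.mem_toFinset.1 hm) (h ▸ hl), sub_zero,
          resolCoeff, if_pos hl, smul_smul]
        have hz : level B₀ l - ζ ≠ 0 := fun h => hζ ⟨l, hl, sub_eq_zero.1 h⟩
        nth_rw 1 [← one_smul ℂ (landauOp B₀ l f)]
        rw [← add_smul]
        congr 1
        field_simp
        ring
      · rw [Finset.sum_ite_eq', if_pos (hI.mem_toFinset.2 hl), resolCoeff, if_neg hl]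
        simp
    have hE : IsH0 B₀ (landauOp B₀ l f) (level B₀ l • landauOp B₀ l f) :=
      landauOp_mem_eigenspace hB l f
    simp only [sum_apply, ContinuousLinearMap.comp_apply]
    rw [← hin h2, hYl, mul_smul, integral_smul_mul_conj, hE.integral_eq hφ.1 h2 hD
      fun k => hφ.covDeriv.covDeriv.memLp 2, Finset.mul_sum]
    refine Finset.sum_congr rfl fun k _ => ?_
    rw [← hin (hD k), hV (landauOp B₀ l f) k _ hφ.covDeriv, M_landauOp hB, integral_smul_mul_conj]
  have := congrArg (fun T : L2 ℂ →L[ℂ] ℂ => T f) key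
  simp only [sum_apply, ContinuousLinearMap.comp_apply, ← hin] at this
  exact this





/-! ### Weighted bounds for convolutions with the Biot-Savart kernel -/

/-- The area of the unit disc. -/
def discArea : ℝ := volume.real (Metric.ball (0 : Plane) 1)

lemma discArea_nonneg : 0 ≤ discArea := measureReal_nonneg

lemma integral_norm_rpow_inside {s ρ : ℝ} (hs : s < 2) (hρ : 0 < ρ) :
    Integrable (fun w : Plane => (Set.Ioc 0 ρ).indicator (fun r => r ^ (-s)) ‖w‖) volume ∧
      ∫ w : Plane, (Set.Ioc 0 ρ).indicator (fun r => r ^ (-s)) ‖w‖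
        = 2 * discArea / (2 - s) * ρ ^ (2 - s) := by
  have h1 : ∀ r : ℝ, r ^ (2 - 1) • (Set.Ioc 0 ρ).indicator (fun r => r ^ (-s)) r
      = (Set.Ioc 0 ρ).indicator (fun r => r ^ (1 - s)) r := fun r => by
    by_cases hr : r ∈ Set.Ioc 0 ρ
    · rw [Set.indicator_of_mem hr, Set.indicator_of_mem hr, Nat.add_one_sub_one, pow_one,
        smul_eq_mul, sub_eq_add_neg, Real.rpow_add hr.1, Real.rpow_one]
    · rw [Set.indicator_of_notMem hr, Set.indicator_of_notMem hr, smul_zero]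
  have hsub : Set.Ioi (0 : ℝ) ∩ Set.Ioc 0 ρ = Set.Ioc 0 ρ :=
    Set.inter_eq_right.2 fun _ h => h.1
  have hi : IntegrableOn (fun r : ℝ => r ^ (1 - s)) (Set.Ioc 0 ρ) volume := by
    rw [← intervalIntegrable_iff_integrableOn_Ioc_of_le hρ.le]
    exact intervalIntegral.intervalIntegrable_rpow' (by linarith)
  constructor
  · rw [integrable_fun_norm_addHaar (μ := (volume : Measure Plane)), finrank_plane]
    simp_rw [h1]
    rw [integrableOn_indicator_iff measurableSet_Ioc, Set.inter_comm, hsub]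
    exact hi
  · rw [integral_fun_norm_addHaar (volume : Measure Plane), finrank_plane]
    simp_rw [h1]
    rw [setIntegral_indicator measurableSet_Ioc, hsub, ← intervalIntegral.integral_of_le hρ.le,
      integral_rpow (Or.inl (by linarith)), Real.zero_rpow (by linarith), discArea, nsmul_eq_mul,
      smul_eq_mul]
    have : 1 - s + 1 = 2 - s := by ring
    rw [this]
    push_cast
    ring

lemma integral_norm_rpow_outside {s ρ : ℝ} (hs : 2 < s) (hρ : 0 < ρ) :
    Integrable (fun w : Plane => (Set.Ioi ρ).indicator (fun r => r ^ (-s)) ‖w‖) volume ∧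
      ∫ w : Plane, (Set.Ioi ρ).indicator (fun r => r ^ (-s)) ‖w‖
        = 2 * discArea / (s - 2) * ρ ^ (2 - s) := by
  have h1 : ∀ r : ℝ, r ^ (2 - 1) • (Set.Ioi ρ).indicator (fun r => r ^ (-s)) r
      = (Set.Ioi ρ).indicator (fun r => r ^ (1 - s)) r := fun r => by
    by_cases hr : r ∈ Set.Ioi ρ
    · rw [Set.indicator_of_mem hr, Set.indicator_of_mem hr, Nat.add_one_sub_one, pow_one,
        smul_eq_mul, sub_eq_add_neg, Real.rpow_add (hρ.trans hr), Real.rpow_one]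
    · rw [Set.indicator_of_notMem hr, Set.indicator_of_notMem hr, smul_zero]
  have hsub : Set.Ioi (0 : ℝ) ∩ Set.Ioi ρ = Set.Ioi ρ :=
    Set.inter_eq_right.2 fun _ h => hρ.trans h
  constructor
  · rw [integrable_fun_norm_addHaar (μ := (volume : Measure Plane)), finrank_plane]
    simp_rw [h1]
    rw [integrableOn_indicator_iff measurableSet_Ioi, Set.inter_comm, hsub]
    exact integrableOn_Ioi_rpow_of_lt (by linarith) hρ
  · rw [integral_fun_norm_addHaar (volume : Measure Plane), finrank_plane]
    simp_rw [h1]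
    rw [setIntegral_indicator measurableSet_Ioi, hsub,
      integral_Ioi_rpow_of_lt (by linarith) hρ, discArea, nsmul_eq_mul, smul_eq_mul]
    have : 1 - s + 1 = -(s - 2) := by ring
    rw [this, ← neg_sub s 2, neg_div_neg_eq]
    push_cast
    ring

/-- The weight `(1 + ‖x‖)^{-ρ}`. -/
def wt (ρ : ℝ) (x : Plane) : ℝ := (1 + ‖x‖) ^ (-ρ)

lemma wt_pos (ρ : ℝ) (x : Plane) : 0 < wt ρ x := Real.rpow_pos_of_pos (by positivity) _

lemma continuous_wt (ρ : ℝ) : Continuous (wt ρ) :=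
  (continuous_const.add continuous_norm).rpow_const fun x =>
    Or.inl (by positivity : (1 + ‖x‖ : ℝ) ≠ 0)

lemma wt_le_one {ρ : ℝ} (hρ : 0 ≤ ρ) (x : Plane) : wt ρ x ≤ 1 :=
  Real.rpow_le_one_of_one_le_of_nonpos (by linarith [norm_nonneg x]) (by linarith)

/-- Three regions: `y` far out, where `1 + ‖x - y‖ ≥ ‖y‖ / 2`; `1 + ‖x - y‖ ≥ (1 + ‖x‖) / 4`, where
the weight is comparable to its value at `x`; and `x - y` small, where `‖y‖` is at least half of `1
+ ‖x‖`. Each leaves a radial power whose integral scales to order `-ε`. -/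
lemma wt_mul_inv_le {ε : ℝ} (hε : 0 < ε) (x y : Plane) (hy : y ≠ 0)
    (hxy : x - y ≠ 0) :
    wt (1 + ε) (x - y) * ‖y‖⁻¹ ≤
      2 ^ (1 + ε) * (Set.Ioi (2 * (1 + ‖x‖))).indicator (fun r => r ^ (-(2 + ε))) ‖y‖
      + (4 ^ (1 + ε) * (1 + ‖x‖) ^ (-(1 + ε))
          * (Set.Ioc 0 (2 * (1 + ‖x‖))).indicator (fun r => r ^ (-(1 : ℝ))) ‖y‖
      + 2 * (1 + ‖x‖)⁻¹
          * (Set.Ioc 0 (1 + ‖x‖)).indicator (fun r => r ^ (-(1 + ε))) ‖x - y‖) := by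
  set Y := 1 + ‖x‖ with hY
  have hY1 : 1 ≤ Y := by rw [hY]; linarith [norm_nonneg x]
  have hY0 : 0 < Y := by linarith
  have hb : 0 < ‖y‖ := norm_pos_iff.2 hy
  have ha : 0 < ‖x - y‖ := norm_pos_iff.2 hxy
  have htri : ‖x‖ ≤ ‖x - y‖ + ‖y‖ := by simpa using norm_add_le (x - y) y
  have htri' : ‖y‖ ≤ ‖x‖ + ‖x - y‖ := by
    simpa using norm_sub_le x (x - y)
  have hn1 : 0 ≤ (Set.Ioi (2 * Y)).indicator (fun r : ℝ => r ^ (-(2 + ε))) ‖y‖ :=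
    Set.indicator_nonneg (fun r hr => Real.rpow_nonneg (by
      have := Set.mem_Ioi.1 hr; linarith) _) _
  have hn2 : 0 ≤ (Set.Ioc 0 (2 * Y)).indicator (fun r : ℝ => r ^ (-(1 : ℝ))) ‖y‖ :=
    Set.indicator_nonneg (fun r hr => Real.rpow_nonneg hr.1.le _) _
  have hn3 : 0 ≤ (Set.Ioc 0 Y).indicator (fun r : ℝ => r ^ (-(1 + ε))) ‖x - y‖ :=
    Set.indicator_nonneg (fun r hr => Real.rpow_nonneg hr.1.le _) _
  by_cases h1 : 2 * Y < ‖y‖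
  · refine le_trans ?_ (le_add_of_nonneg_right (by positivity))
    rw [Set.indicator_of_mem (show ‖y‖ ∈ Set.Ioi (2 * Y) from h1)]
    have h2 : wt (1 + ε) (x - y) ≤ (‖y‖ / 2) ^ (-(1 + ε)) :=
      Real.rpow_le_rpow_of_nonpos (by positivity) (by linarith) (by linarith)
    calc _ ≤ (‖y‖ / 2) ^ (-(1 + ε)) * ‖y‖⁻¹ := by gcongr
      _ = _ := by
        rw [Real.div_rpow hb.le zero_le_two, Real.rpow_neg zero_le_two, div_inv_eq_mul,
          show -(2 + ε) = -(1 + ε) - 1 by ring, Real.rpow_sub_one hb.ne']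
        ring
  · refine le_trans ?_ (le_add_of_nonneg_left (by positivity))
    by_cases h2 : Y / 4 ≤ 1 + ‖x - y‖
    · refine le_trans ?_ (le_add_of_nonneg_right (by positivity))
      rw [Set.indicator_of_mem (show ‖y‖ ∈ Set.Ioc 0 (2 * Y) from ⟨hb, not_lt.1 h1⟩), Real.rpow_neg_one]
      have h3 : wt (1 + ε) (x - y) ≤ (Y / 4) ^ (-(1 + ε)) :=
        Real.rpow_le_rpow_of_nonpos (by positivity) h2 (by linarith)
      rw [Real.div_rpow hY0.le (by norm_num), Real.rpow_neg (show (0 : ℝ) ≤ 4 by norm_num), div_inv_eq_mul,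
        mul_comm] at h3
      gcongr
    · refine le_trans ?_ (le_add_of_nonneg_left (by positivity))
      rw [Set.indicator_of_mem (show ‖x - y‖ ∈ Set.Ioc 0 Y from ⟨ha, by linarith⟩)]
      have h3 : wt (1 + ε) (x - y) ≤ ‖x - y‖ ^ (-(1 + ε)) :=
        Real.rpow_le_rpow_of_nonpos ha (by linarith) (by linarith)
      have h4 : ‖y‖⁻¹ ≤ 2 * Y⁻¹ := by
        rw [← div_eq_mul_inv, inv_le_comm₀ hb (by positivity), inv_div]
        linarith
      calc _ ≤ ‖x - y‖ ^ (-(1 + ε)) * (2 * Y⁻¹) := by gcongr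
        _ = _ := by ring

/-- The constant in the weighted bound for the Biot-Savart kernel. -/
lemma exists_integral_wt_le {ε : ℝ} (hε : 0 < ε) (hε1 : ε < 1) :
    ∃ C : ℝ, 0 ≤ C ∧ ∀ x : Plane,
      Integrable (fun y : Plane => wt (1 + ε) (x - y) * ‖y‖⁻¹) volume ∧
      ∫ y : Plane, wt (1 + ε) (x - y) * ‖y‖⁻¹ ≤ C * wt ε x := by
  have hA := discArea_nonneg
  refine ⟨2 ^ (1 + ε) * (2 * discArea / ε) + (4 ^ (1 + ε) * (2 * discArea * 2)
    + 2 * (2 * discArea / (1 - ε))), ?_, fun x => ?_⟩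
  · have : 0 < 1 - ε := by linarith
    positivity
  set Y := 1 + ‖x‖ with hY
  have hY1 : 1 ≤ Y := by rw [hY]; linarith [norm_nonneg x]
  have hY0 : 0 < Y := by linarith
  obtain ⟨i1, e1⟩ := integral_norm_rpow_outside (s := 2 + ε) (ρ := 2 * Y) (by linarith)
    (by positivity)
  obtain ⟨i2, e2⟩ := integral_norm_rpow_inside (s := 1) (ρ := 2 * Y) (by linarith) (by positivity)
  obtain ⟨i3, e3⟩ := integral_norm_rpow_inside (s := 1 + ε) (ρ := Y) (by linarith) hY0
  have i3' := i3.comp_sub_left x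
  have e3' := (integral_sub_left_eq_self (fun w : Plane =>
    (Set.Ioc 0 Y).indicator (fun r : ℝ => r ^ (-(1 + ε))) ‖w‖) (volume : Measure Plane) x).trans e3
  have hle : ∀ᵐ y : Plane, ‖wt (1 + ε) (x - y) * ‖y‖⁻¹‖ ≤
      2 ^ (1 + ε) * (Set.Ioi (2 * Y)).indicator (fun r => r ^ (-(2 + ε))) ‖y‖
      + (4 ^ (1 + ε) * Y ^ (-(1 + ε))
          * (Set.Ioc 0 (2 * Y)).indicator (fun r => r ^ (-(1 : ℝ))) ‖y‖
      + 2 * Y⁻¹ * (Set.Ioc 0 Y).indicator (fun r => r ^ (-(1 + ε))) ‖x - y‖) := by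
    have hx : ∀ᵐ y : Plane, x - y ≠ 0 := by
      have : {y : Plane | ¬ x - y ≠ 0} = {x} := by
        ext y; simp [sub_eq_zero, eq_comm]
      rw [ae_iff, this]
      simp
    filter_upwards [ae_ne_zero, hx] with y hy hxy
    rw [Real.norm_of_nonneg (mul_nonneg (wt_pos _ _).le (by positivity))]
    exact wt_mul_inv_le hε x y hy hxy
  have him := (i1.const_mul (2 ^ (1 + ε))).add ((i2.const_mul (4 ^ (1 + ε) * Y ^ (-(1 + ε)))).add
    (i3'.const_mul (2 * Y⁻¹)))
  have hm : AEStronglyMeasurable (fun y : Plane => wt (1 + ε) (x - y) * ‖y‖⁻¹) volume := by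
    have := (continuous_wt (1 + ε)).measurable
    exact Measurable.aestronglyMeasurable (by fun_prop)
  have hi := him.mono' hm hle
  refine ⟨hi, ?_⟩
  calc _ ≤ _ := integral_mono_ae hi him (hle.mono fun y hy => (le_abs_self _).trans hy)
    _ = 2 ^ (1 + ε) * (2 * discArea / ε * (2 * Y) ^ (-ε))
        + (4 ^ (1 + ε) * Y ^ (-(1 + ε)) * (2 * discArea * (2 * Y))
        + 2 * Y⁻¹ * (2 * discArea / (1 - ε) * Y ^ (1 - ε))) := by
      refine (integral_add (i1.const_mul _) ((i2.const_mul _).add (i3'.const_mul _))).trans ?_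
      refine congrArg₂ (· + ·) ?_ ((integral_add (i2.const_mul _) (i3'.const_mul _)).trans ?_)
      · rw [integral_const_mul, e1]
        congr 3 <;> ring
      rw [integral_const_mul, integral_const_mul, e2, e3']
      have h3 : 2 - (1 + ε) = 1 - ε := by ring
      have h4 : (2 : ℝ) - 1 = 1 := by ring
      rw [h3, h4, Real.rpow_one, div_one]
    _ ≤ 2 ^ (1 + ε) * (2 * discArea / ε * Y ^ (-ε))
        + (4 ^ (1 + ε) * (2 * discArea * 2) * Y ^ (-ε)
        + 2 * (2 * discArea / (1 - ε)) * Y ^ (-ε)) := by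
      refine add_le_add ?_ (add_le_add (le_of_eq ?_) (le_of_eq ?_))
      · have : (2 * Y) ^ (-ε) ≤ Y ^ (-ε) :=
          Real.rpow_le_rpow_of_nonpos hY0 (by linarith) (by linarith)
        gcongr
      · rw [show -(1 + ε) = -ε - 1 by ring, Real.rpow_sub_one hY0.ne']
        field_simp
      · rw [show 1 - ε = -ε + 1 by ring, Real.rpow_add_one hY0.ne']
        field_simp
    _ = _ := by rw [wt]; ring

lemma abs_biotSavart_le (y : Plane) (k : Fin 2) : |biotSavart y k| ≤ ‖y‖⁻¹ := by
  rcases eq_or_ne y 0 with rfl | hy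
  · have : biotSavart 0 k = 0 := by fin_cases k <;> simp [biotSavart, J]
    rw [this]; simp
  have hb : 0 < ‖y‖ := norm_pos_iff.2 hy
  have hJ : |J y k| ≤ ‖y‖ := by
    have h0 : |y 0| ≤ ‖y‖ := PiLp.norm_apply_le y 0
    have h1 : |y 1| ≤ ‖y‖ := PiLp.norm_apply_le y 1
    fin_cases k <;> simpa [J]
  have hpi := Real.pi_gt_three
  have : biotSavart y k = (2 * Real.pi * ‖y‖ ^ 2)⁻¹ * J y k := rfl
  rw [this, abs_mul, abs_of_pos (by positivity)]
  calc _ ≤ (1 * ‖y‖ ^ 2)⁻¹ * ‖y‖ := by gcongr; linarith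
    _ = _ := by field_simp

lemma measurable_biotSavart (k : Fin 2) : Measurable fun y : Plane => biotSavart y k := by
  have hJ : Measurable fun y : Plane => J y k := by
    have := (contDiff_gauge0 2 k (n := 0)).continuous.measurable
    simpa [gauge0] using this
  have : (fun y : Plane => biotSavart y k) = fun y => (2 * Real.pi * ‖y‖ ^ 2)⁻¹ * J y k := rfl
  rw [this]
  fun_prop

/-- The convolution with a component of the Biot-Savart kernel. -/
def bsConv (k : Fin 2) (f : Plane → ℝ) (x : Plane) : ℝ := ∫ y, f (x - y) * biotSavart y k

/-- Bounded by a multiple of the weight of order `ρ`. -/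
def WtBdd (ρ C : ℝ) (f : Plane → ℝ) : Prop :=
  AEStronglyMeasurable f volume ∧ ∀ᵐ x : Plane, |f x| ≤ C * wt ρ x

lemma bsConv_congr {f g : Plane → ℝ} (h : f =ᵐ[volume] g) (k : Fin 2) :
    bsConv k f = bsConv k g := by
  funext x
  refine integral_congr_ae ?_
  filter_upwards [(quasiMeasurePreserving_sub_left_of_right_invariant volume x).ae h] with y hy
  rw [hy]

lemma measurable_bsConv {f : Plane → ℝ} (hf : AEStronglyMeasurable f volume) (k : Fin 2) :
    Measurable (bsConv k f) := by
  rw [bsConv_congr hf.ae_eq_mk k]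
  have hm := hf.stronglyMeasurable_mk.measurable
  have hb := measurable_biotSavart k
  exact (StronglyMeasurable.integral_prod_right
    (f := fun (x y : Plane) => hf.mk f (x - y) * biotSavart y k)
    (Measurable.stronglyMeasurable (by
      change Measurable fun p : Plane × Plane => hf.mk f (p.1 - p.2) * biotSavart p.2 k
      fun_prop))).measurable

lemma WtBdd.integrable {ε R : ℝ} (hε : 0 < ε) (hε1 : ε < 1) {f : Plane → ℝ}
    (hf : WtBdd (1 + ε) R f) (k : Fin 2) (x : Plane) :
    Integrable (fun y => f (x - y) * biotSavart y k) volume ∧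
      ∀ᵐ y : Plane, ‖f (x - y) * biotSavart y k‖ ≤ R * (wt (1 + ε) (x - y) * ‖y‖⁻¹) := by
  obtain ⟨C, hC, h⟩ := exists_integral_wt_le hε hε1
  have hb : ∀ᵐ y : Plane, ‖f (x - y) * biotSavart y k‖ ≤ R * (wt (1 + ε) (x - y) * ‖y‖⁻¹) := by
    filter_upwards [(quasiMeasurePreserving_sub_left_of_right_invariant volume x).ae hf.2] with y hy
    rw [norm_mul, ← mul_assoc]
    exact mul_le_mul hy (abs_biotSavart_le y k) (abs_nonneg _) ((abs_nonneg _).trans hy)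
  refine ⟨((h x).1.const_mul R).mono' ?_ hb, hb⟩
  exact (hf.1.comp_quasiMeasurePreserving
    (quasiMeasurePreserving_sub_left_of_right_invariant volume x)).mul
    (measurable_biotSavart k).aestronglyMeasurable

/-- Convolution with the Biot-Savart kernel gains one power of the weight. -/
lemma exists_abs_bsConv_le {ε : ℝ} (hε : 0 < ε) (hε1 : ε < 1) :
    ∃ C : ℝ, 0 ≤ C ∧ ∀ (R : ℝ) (f : Plane → ℝ), 0 ≤ R → WtBdd (1 + ε) R f → ∀ (k : Fin 2) x,
      ∫ y, ‖f (x - y) * biotSavart y k‖ ≤ C * R * wt ε x ∧ |bsConv k f x| ≤ C * R * wt ε x := by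
  obtain ⟨C, hC, h⟩ := exists_integral_wt_le hε hε1
  refine ⟨C, hC, fun R f hR hf k x => ?_⟩
  obtain ⟨hi, hb⟩ := hf.integrable hε hε1 k x
  have : ∫ y, ‖f (x - y) * biotSavart y k‖ ≤ C * R * wt ε x := by
    calc _ ≤ ∫ y, R * (wt (1 + ε) (x - y) * ‖y‖⁻¹) :=
          integral_mono_ae hi.norm ((h x).1.const_mul R) hb
      _ = R * ∫ y, (wt (1 + ε) (x - y) * ‖y‖⁻¹) := integral_const_mul _ _
      _ ≤ R * (C * wt ε x) := mul_le_mul_of_nonneg_left (h x).2 hR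
      _ = _ := by ring
  exact ⟨this, (norm_integral_le_integral_norm _).trans this⟩

/-! ### Duality for the convolution -/

section Duality

variable {E : Type*} [NormedAddCommGroup E] [NormedSpace ℝ E]

lemma integrable_bsConv_prod {ε R : ℝ} (hε : 0 < ε) (hε1 : ε < 1) (hR : 0 ≤ R) {f : Plane → ℝ}
    (hf : WtBdd (1 + ε) R f) (k : Fin 2) {χ : Plane → E} (hχ : Continuous χ)
    (hs : HasCompactSupport χ) :
    Integrable (fun p : Plane × Plane => (f (p.1 - p.2) * biotSavart p.2 k) • χ p.1)
      (volume.prod volume) := by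
  obtain ⟨C, hC, h⟩ := exists_abs_bsConv_le hε hε1
  have hm0 : AEStronglyMeasurable (fun p : Plane × Plane => f (p.1 - p.2) * biotSavart p.2 k)
      (volume.prod volume) :=
    (hf.1.comp_quasiMeasurePreserving
      (quasiMeasurePreserving_sub_of_right_invariant volume volume)).mul
      ((measurable_biotSavart k).comp measurable_snd).aestronglyMeasurable
  have hm : AEStronglyMeasurable
      (fun p : Plane × Plane => (f (p.1 - p.2) * biotSavart p.2 k) • χ p.1)
      (volume.prod volume) := by
    refine hm0.smul ?_
    have : StronglyMeasurable χ := hχ.stronglyMeasurable_of_hasCompactSupport hs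
    exact (this.comp_measurable measurable_fst).aestronglyMeasurable
  rw [integrable_prod_iff hm]
  refine ⟨ae_of_all _ fun x => (hf.integrable hε hε1 k x).1.smul_const (χ x), ?_⟩
  have hχi : Integrable χ volume := hχ.integrable_of_hasCompactSupport hs
  refine (hχi.norm.const_mul (C * R)).mono' hm.norm.integral_prod_right' (ae_of_all _ fun x => ?_)
  rw [Real.norm_of_nonneg (integral_nonneg fun _ => norm_nonneg _)]
  simp_rw [norm_smul]
  rw [integral_mul_const]
  refine mul_le_mul_of_nonneg_right (((h R f hR hf k x).1).trans ?_) (norm_nonneg _)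
  exact mul_le_of_le_one_right (by positivity) (wt_le_one hε.le x)

/-- With `f` integrated innermost, a weak derivative can be moved between the translated test
function and `f`. -/
lemma integral_bsConv_smul [CompleteSpace E] {ε R : ℝ} (hε : 0 < ε) (hε1 : ε < 1) (hR : 0 ≤ R)
    {f : Plane → ℝ} (hf : WtBdd (1 + ε) R f) (k : Fin 2) {χ : Plane → E} (hχ : Continuous χ)
    (hs : HasCompactSupport χ) :
    ∫ x, bsConv k f x • χ x = ∫ y, biotSavart y k • ∫ z, f z • χ (z + y) := by
  have hi := integrable_bsConv_prod hε hε1 hR hf k hχ hs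
  simp_rw [bsConv, ← integral_smul_const]
  rw [integral_integral_swap hi]
  refine integral_congr_ae (ae_of_all _ fun y => ?_)
  simp only
  rw [← integral_smul, ← integral_add_right_eq_self _ y]
  refine integral_congr_ae (ae_of_all _ fun z => ?_)
  simp only [add_sub_cancel_right, smul_smul]
  rw [mul_comm]

/-- With the Biot-Savart kernel integrated innermost, its vanishing divergence can be used for each
`z`, whatever `f` is. -/
lemma integral_bsConv_smul' [CompleteSpace E] {ε R : ℝ} (hε : 0 < ε) (hε1 : ε < 1) (hR : 0 ≤ R)
    {f : Plane → ℝ} (hf : WtBdd (1 + ε) R f) (k : Fin 2) {χ : Plane → E} (hχ : Continuous χ)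
    (hs : HasCompactSupport χ) :
    Integrable (fun z => f z • ∫ y, biotSavart y k • χ (z + y)) volume ∧
    ∫ x, bsConv k f x • χ x = ∫ z, f z • ∫ y, biotSavart y k • χ (z + y) := by
  have hi := integrable_bsConv_prod hε hε1 hR hf k hχ hs
  have hi' : Integrable (fun p : Plane × Plane => f p.1 • (biotSavart p.2 k • χ (p.1 + p.2)))
      (volume.prod volume) := by
    have := (measurePreserving_add_prod (volume : Measure Plane) (volume : Measure Plane)
      ).integrable_comp_of_integrable hi
    refine this.congr (ae_of_all _ fun p => ?_)
    simp [smul_smul]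
  rw [integral_bsConv_smul hε hε1 hR hf k hχ hs]
  constructor
  · refine hi'.integral_prod_left.congr (ae_of_all _ fun z => ?_)
    simp only [integral_smul]
  · simp_rw [← integral_smul]
    rw [integral_integral_swap (f := fun y z => biotSavart y k • f z • χ (z + y))
      (hi'.swap.congr (ae_of_all _ fun p => smul_comm _ _ _))]
    simp_rw [smul_comm (f _)]

end Duality





/-! ### Bounded functions with bounded weak derivatives -/

lemma WtBdd.mono {ρ C C' : ℝ} {f : Plane → ℝ} (h : WtBdd ρ C f) (hC : C ≤ C') : WtBdd ρ C' f :=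
  ⟨h.1, h.2.mono fun x hx => hx.trans (mul_le_mul_of_nonneg_right hC (wt_pos ρ x).le)⟩

lemma WtBdd.ae_abs_le {ρ C : ℝ} (hρ : 0 ≤ ρ) (hC : 0 ≤ C) {f : Plane → ℝ} (h : WtBdd ρ C f) :
    ∀ᵐ x, |f x| ≤ C :=
  h.2.mono fun x hx => hx.trans (mul_le_of_le_one_right hC (wt_le_one hρ x))

lemma WtBdd.locallyIntegrable {ρ C : ℝ} (hρ : 0 ≤ ρ) (hC : 0 ≤ C) {f : Plane → ℝ}
    (h : WtBdd ρ C f) : LocallyIntegrable f volume :=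
  (memLp_top_of_bound h.1 C (h.ae_abs_le hρ hC)).locallyIntegrable le_top

lemma IsTest.mul {φ ψ : Plane → ℝ} (hφ : ContDiff ℝ ((⊤ : ℕ∞) : WithTop ℕ∞) φ)
    (hψ : IsTest ψ) : IsTest fun x => φ x * ψ x :=
  ⟨hφ.mul hψ.1, hψ.2.mul_left⟩

lemma IsTest.fderiv_apply {φ : Plane → ℝ} (hφ : IsTest φ) (v : Plane) :
    IsTest fun x => fderiv ℝ φ x v :=
  ⟨(hφ.1.fderiv_right (m := ((⊤ : ℕ∞) : WithTop ℕ∞)) (by simp)).clm_apply contDiff_const,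
    hφ.2.fderiv_apply ℝ v⟩

lemma IsTest.comp_add {φ : Plane → ℝ} (hφ : IsTest φ) (y : Plane) :
    IsTest fun x => φ (x + y) :=
  ⟨hφ.1.comp (contDiff_id.add contDiff_const),
    hφ.2.comp_homeomorph (Homeomorph.addRight y)⟩

lemma integrable_mul_isTest {f : Plane → ℝ} (hf : LocallyIntegrable f volume) {φ : Plane → ℝ}
    (hφ : IsTest φ) : Integrable (fun x => f x * φ x) volume := by
  have := hf.integrable_smul_right_of_hasCompactSupport hφ.1.continuous hφ.2
  simpa [smul_eq_mul] using this

/-- `g` is the weak derivative `∂_k f`. -/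
def WD (k : Fin 2) (f g : Plane → ℝ) : Prop :=
  ∀ φ : Plane → ℝ, IsTest φ → ∫ x, f x * fderiv ℝ φ x (e k) = -∫ x, g x * φ x

lemma WD.add {k : Fin 2} {f f' g g' : Plane → ℝ} (h : WD k f g) (h' : WD k f' g')
    (hf : LocallyIntegrable f volume) (hf' : LocallyIntegrable f' volume)
    (hg : LocallyIntegrable g volume) (hg' : LocallyIntegrable g' volume) :
    WD k (fun x => f x + f' x) fun x => g x + g' x := by
  intro φ hφ
  simp only [add_mul]
  rw [integral_add (integrable_mul_isTest hf (hφ.fderiv_apply _))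
    (integrable_mul_isTest hf' (hφ.fderiv_apply _)), integral_add (integrable_mul_isTest hg hφ)
    (integrable_mul_isTest hg' hφ), h φ hφ, h' φ hφ, neg_add]

lemma WD.congr_left {k : Fin 2} {f f' g : Plane → ℝ} (h : WD k f g) (hf : f =ᵐ[volume] f') :
    WD k f' g := by
  intro φ hφ
  rw [← h φ hφ]
  refine integral_congr_ae ?_
  filter_upwards [hf] with x hx
  rw [hx]

/-- Mollification. -/
def moll (η : ContDiffBump (0 : Plane)) (f : Plane → ℝ) : Plane → ℝ :=
  convolution f (η.normed volume) (ContinuousLinearMap.lsmul ℝ ℝ).flip volume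

lemma moll_apply (η : ContDiffBump (0 : Plane)) (f : Plane → ℝ) (x : Plane) :
    moll η f x = ∫ t, f t * η.normed volume (x - t) := by
  rw [moll, convolution_def]
  refine integral_congr_ae (ae_of_all _ fun t => ?_)
  simp [mul_comm]

lemma contDiff_moll (η : ContDiffBump (0 : Plane)) {f : Plane → ℝ}
    (hf : LocallyIntegrable f volume) : ContDiff ℝ ((⊤ : ℕ∞) : WithTop ℕ∞) (moll η f) :=
  η.hasCompactSupport_normed.contDiff_convolution_right _ hf η.contDiff_normed

/-- Differentiation falls on the mollifier, whose reflected translate is a test function for the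
weak derivative. -/
lemma WD.fderiv_moll {k : Fin 2} {f g : Plane → ℝ} (h : WD k f g)
    (hf : LocallyIntegrable f volume) (η : ContDiffBump (0 : Plane)) (x : Plane) :
    fderiv ℝ (moll η f) x (e k) = moll η g x := by
  have h1 := (η.hasCompactSupport_normed (μ := volume)).hasFDerivAt_convolution_right
    (ContinuousLinearMap.lsmul ℝ ℝ).flip hf (η.contDiff_normed (n := 1)) x
  have hfd : fderiv ℝ (moll η f) x = _ := h1.fderiv
  rw [hfd, convolution_precompR_apply]
  · have ht : IsTest fun t => η.normed volume (x - t) := by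
      refine ⟨η.contDiff_normed.comp (contDiff_const.sub contDiff_id), ?_⟩
      exact (η.hasCompactSupport_normed (μ := volume)).comp_homeomorph (Homeomorph.subLeft x)
    have h2 := h _ ht
    have h3 : ∀ t, fderiv ℝ (fun t => η.normed volume (x - t)) t (e k)
        = -fderiv ℝ (η.normed volume) (x - t) (e k) := fun t => by
      have h4 : HasFDerivAt (fun t : Plane => x - t) (-ContinuousLinearMap.id ℝ Plane) t :=
        (hasFDerivAt_id t).const_sub x
      have h5 : HasFDerivAt (η.normed volume) (fderiv ℝ (η.normed volume) (x - t)) (x - t) :=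
        ((η.contDiff_normed (n := 1)).differentiable (by simp)).differentiableAt.hasFDerivAt
      have h6 : fderiv ℝ (fun t => η.normed volume (x - t)) t = _ := (h5.comp t h4).fderiv
      rw [h6]
      simp
    simp_rw [h3, mul_neg, integral_neg, neg_inj] at h2
    rw [moll_apply, ← h2, convolution_def]
    refine integral_congr_ae (ae_of_all _ fun t => ?_)
    simp [mul_comm]
  · exact hf
  · exact (η.hasCompactSupport_normed).fderiv ℝ
  · exact (η.contDiff_normed (n := 1)).continuous_fderiv (by simp)

lemma abs_moll_le (η : ContDiffBump (0 : Plane)) {f : Plane → ℝ} {C : ℝ}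
    (hC : ∀ᵐ x, |f x| ≤ C) (x : Plane) : |moll η f x| ≤ C := by
  rw [moll_apply]
  have hi : Integrable (fun t => η.normed volume (x - t)) volume :=
    (η.integrable_normed (μ := volume)).comp_sub_left x
  rw [← Real.norm_eq_abs]
  calc ‖∫ t, f t * η.normed volume (x - t)‖ ≤ ∫ t, C * η.normed volume (x - t) := by
        refine norm_integral_le_of_norm_le (hi.const_mul C) ?_
        filter_upwards [hC] with t ht
        rw [norm_mul, Real.norm_of_nonneg (η.nonneg_normed _)]
        exact mul_le_mul_of_nonneg_right ht (η.nonneg_normed _)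
    _ = C := by
        rw [integral_const_mul, integral_sub_left_eq_self (η.normed volume), η.integral_normed,
          mul_one]

lemma exists_bump_seq : ∃ η : ℕ → ContDiffBump (0 : Plane), ∀ f : Plane → ℝ,
    LocallyIntegrable f volume →
      ∀ᵐ x, Filter.Tendsto (fun n => moll (η n) f x) Filter.atTop (nhds (f x)) := by
  refine ⟨fun n => ⟨1 / ((n : ℝ) + 1), 2 * (1 / ((n : ℝ) + 1)), by positivity,
    by have : 0 < 1 / ((n : ℝ) + 1) := by positivity
       linarith⟩, fun f hf => ?_⟩
  have := ContDiffBump.ae_convolution_tendsto_right_of_locallyIntegrable (μ := volume)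
    (φ := fun n : ℕ => (⟨1 / ((n : ℝ) + 1), 2 * (1 / ((n : ℝ) + 1)), by positivity,
    by have : 0 < 1 / ((n : ℝ) + 1) := by positivity
       linarith⟩ : ContDiffBump (0 : Plane))) (l := Filter.atTop) (K := 2) ?_ ?_ hf
  · simpa only [moll, convolution_flip] using this
  · simpa using tendsto_one_div_add_atTop_nhds_zero_nat.const_mul (2 : ℝ)
  · exact Filter.Eventually.of_forall fun n => le_rfl

/-- Only `f'` is mollified: the product of its mollification with `φ` is a test function for `f`,
which gives the Leibniz rule before the limit. Dominated convergence, with the common bound `C`,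
removes the mollifier. -/
lemma WD.mul {k : Fin 2} {f f' g g' : Plane → ℝ} (h : WD k f g) (h' : WD k f' g') {C : ℝ}
    (hf : AEStronglyMeasurable f volume) (hf' : AEStronglyMeasurable f' volume)
    (hg : AEStronglyMeasurable g volume) (hg' : AEStronglyMeasurable g' volume)
    (bf : ∀ᵐ x, |f x| ≤ C) (bf' : ∀ᵐ x, |f' x| ≤ C) (bg : ∀ᵐ x, |g x| ≤ C)
    (bg' : ∀ᵐ x, |g' x| ≤ C) :
    WD k (fun x => f x * f' x) fun x => g x * f' x + f x * g' x := by
  intro φ hφ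
  have li : ∀ {u : Plane → ℝ}, AEStronglyMeasurable u volume → (∀ᵐ x, |u x| ≤ C) →
      LocallyIntegrable u volume := fun hu bu =>
    (memLp_top_of_bound hu C bu).locallyIntegrable le_top
  have hmul : ∀ {u v : Plane → ℝ}, (∀ᵐ x, |u x| ≤ C) → (∀ᵐ x, |v x| ≤ C) →
      ∀ᵐ x, |u x * v x| ≤ C * C := fun hu hv => by
    filter_upwards [hu, hv] with x h1 h2
    rw [abs_mul]
    exact mul_le_mul h1 h2 (abs_nonneg _) ((abs_nonneg _).trans h1)
  have li2 : ∀ {u v : Plane → ℝ}, AEStronglyMeasurable u volume → (∀ᵐ x, |u x| ≤ C) →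
      AEStronglyMeasurable v volume → (∀ᵐ x, |v x| ≤ C) →
      LocallyIntegrable (fun x => u x * v x) volume := fun hu bu hv bv =>
    (memLp_top_of_bound (hu.mul hv) (C * C) (hmul bu bv)).locallyIntegrable le_top
  obtain ⟨η, hη⟩ := exists_bump_seq
  have lf' := li hf' bf'
  have lg' := li hg' bg'
  have hseq : ∀ n, ∫ x, f x * moll (η n) g' x * φ x + f x * moll (η n) f' x * fderiv ℝ φ x (e k)
      = -∫ x, g x * moll (η n) f' x * φ x := fun n => by
    have hs := contDiff_moll (η n) lf'
    have h1 := h _ (IsTest.mul hs hφ)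
    simp_rw [mul_assoc] at h1 ⊢
    rw [← h1]
    refine integral_congr_ae (ae_of_all _ fun x => ?_)
    have hd1 : DifferentiableAt ℝ (moll (η n) f') x := hs.differentiable (by simp) x
    have hd2 : DifferentiableAt ℝ φ x := hφ.1.differentiable (by simp) x
    simp only
    rw [fderiv_fun_mul hd1 hd2]
    simp only [add_apply, smul_apply, smul_eq_mul, h'.fderiv_moll lf']
    ring
  have hlim : ∀ {u v : Plane → ℝ} {ψ : Plane → ℝ}, AEStronglyMeasurable u volume →
      (∀ᵐ x, |u x| ≤ C) → AEStronglyMeasurable v volume → (∀ᵐ x, |v x| ≤ C) → IsTest ψ →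
      Filter.Tendsto (fun n => ∫ x, u x * moll (η n) v x * ψ x) Filter.atTop
        (nhds (∫ x, u x * v x * ψ x)) := by
    intro u v ψ hu bu hv bv hψ
    have lv := li hv bv
    refine tendsto_integral_of_dominated_convergence (fun x => C * C * |ψ x|) (fun n => ?_) ?_
      (fun n => ?_) ?_
    · exact (hu.mul (contDiff_moll (η n) lv).continuous.aestronglyMeasurable).mul
        hψ.1.continuous.aestronglyMeasurable
    · exact ((hψ.1.continuous.integrable_of_hasCompactSupport hψ.2).norm.const_mul _)
    · filter_upwards [hmul bu (ae_of_all _ (abs_moll_le (η n) bv))] with x hx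
      rw [norm_mul]
      exact mul_le_mul_of_nonneg_right hx (abs_nonneg _)
    · filter_upwards [hη v lv] with x hx
      exact (hx.const_mul _).mul_const _
  have hint : ∀ {u v : Plane → ℝ} {ψ : Plane → ℝ}, AEStronglyMeasurable u volume →
      (∀ᵐ x, |u x| ≤ C) → AEStronglyMeasurable v volume → (∀ᵐ x, |v x| ≤ C) → IsTest ψ →
      Integrable (fun x => u x * v x * ψ x) volume := fun hu bu hv bv hψ =>
    integrable_mul_isTest (li2 hu bu hv bv) hψ
  have hbm : ∀ {u : Plane → ℝ} n, (∀ᵐ x, |u x| ≤ C) → ∀ᵐ x, |moll (η n) u x| ≤ C :=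
    fun n bu => ae_of_all _ (abs_moll_le (η n) bu)
  have hsm : ∀ {u : Plane → ℝ} n, LocallyIntegrable u volume →
      AEStronglyMeasurable (moll (η n) u) volume := fun n lu =>
    (contDiff_moll (η n) lu).continuous.aestronglyMeasurable
  have hφk := hφ.fderiv_apply (e k)
  have hA : ∀ n, ∫ x, f x * moll (η n) f' x * fderiv ℝ φ x (e k)
      = -(∫ x, g x * moll (η n) f' x * φ x) - ∫ x, f x * moll (η n) g' x * φ x := fun n => by
    rw [← hseq n, integral_add (hint hf bf (hsm n lg') (hbm n bg') hφ)
      (hint hf bf (hsm n lf') (hbm n bf') hφk)]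
    ring
  have hB := ((hlim hg bg hf' bf' hφ).neg.sub (hlim hf bf hg' bg' hφ)).congr fun n => (hA n).symm
  rw [tendsto_nhds_unique (hlim hf bf hf' bf' hφk) hB]
  simp only [add_mul]
  rw [integral_add (hint hg bg hf' bf' hφ) (hint hf bf hg' bg' hφ)]
  ring

/-- Functions bounded by `C` times the weight of order `ρ`, together with their weak derivatives
up to order `n`. -/
def SobBdd (ρ C : ℝ) : ℕ → (Plane → ℝ) → Prop
  | 0, f => WtBdd ρ C f
  | n + 1, f => WtBdd ρ C f ∧ ∀ k, ∃ g, WD k f g ∧ SobBdd ρ C n g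

lemma SobBdd.wtBdd {ρ C : ℝ} {n : ℕ} {f : Plane → ℝ} (h : SobBdd ρ C n f) : WtBdd ρ C f := by
  cases n with
  | zero => exact h
  | succ n => exact h.1

lemma SobBdd.mono {ρ C C' : ℝ} (hC : C ≤ C') {n : ℕ} : ∀ {f : Plane → ℝ}, SobBdd ρ C n f →
    SobBdd ρ C' n f := by
  induction n with
  | zero => exact fun h => WtBdd.mono h hC
  | succ n ih => exact fun h => ⟨h.1.mono hC, fun k => let ⟨g, hg, hg'⟩ := h.2 k; ⟨g, hg, ih hg'⟩⟩

lemma SobBdd.pred {ρ C : ℝ} {n : ℕ} : ∀ {f : Plane → ℝ}, SobBdd ρ C (n + 1) f →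
    SobBdd ρ C n f := by
  induction n with
  | zero => exact fun h => h.1
  | succ n ih => exact fun h => ⟨h.1, fun k => let ⟨g, hg, hg'⟩ := h.2 k; ⟨g, hg, ih hg'⟩⟩

lemma WtBdd.add {ρ C C' : ℝ} {f g : Plane → ℝ} (h : WtBdd ρ C f) (h' : WtBdd ρ C' g) :
    WtBdd ρ (C + C') fun x => f x + g x := by
  refine ⟨h.1.add h'.1, ?_⟩
  filter_upwards [h.2, h'.2] with x h1 h2
  rw [add_mul]
  exact (abs_add_le _ _).trans (add_le_add h1 h2)

lemma WtBdd.mul {ρ C C' : ℝ} (hρ : 0 ≤ ρ) (hC' : 0 ≤ C') {f g : Plane → ℝ}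
    (h : WtBdd ρ C f) (h' : WtBdd ρ C' g) : WtBdd ρ (C * C') fun x => f x * g x := by
  refine ⟨h.1.mul h'.1, ?_⟩
  filter_upwards [h.2, h'.ae_abs_le hρ hC'] with x h1 h2
  rw [abs_mul, mul_right_comm]
  exact mul_le_mul h1 h2 (abs_nonneg _) ((abs_nonneg _).trans h1)

lemma SobBdd.add {ρ C C' : ℝ} (hρ : 0 ≤ ρ) (hC : 0 ≤ C) (hC' : 0 ≤ C') {n : ℕ} :
    ∀ {f g : Plane → ℝ}, SobBdd ρ C n f → SobBdd ρ C' n g →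
      SobBdd ρ (C + C') n fun x => f x + g x := by
  induction n with
  | zero => exact fun h h' => WtBdd.add h h'
  | succ n ih =>
    refine fun h h' => ⟨h.1.add h'.1, fun k => ?_⟩
    obtain ⟨u, hu, hu'⟩ := h.2 k
    obtain ⟨v, hv, hv'⟩ := h'.2 k
    exact ⟨_, hu.add hv (h.1.locallyIntegrable hρ hC) (h'.1.locallyIntegrable hρ hC')
      (hu'.wtBdd.locallyIntegrable hρ hC) (hv'.wtBdd.locallyIntegrable hρ hC'), ih hu' hv'⟩

/-- Each derivative produces two terms and doubles the constant. One of the two weights is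
discarded, so the order `ρ` is kept. -/
lemma SobBdd.mul {ρ C : ℝ} (hρ : 0 ≤ ρ) (hC : 0 ≤ C) {n : ℕ} :
    ∀ {f g : Plane → ℝ}, SobBdd ρ C n f → SobBdd ρ C n g →
      SobBdd ρ (2 ^ n * C ^ 2) n fun x => f x * g x := by
  induction n with
  | zero => exact fun h h' => (WtBdd.mul hρ hC h h').mono (by rw [pow_zero, one_mul, sq])
  | succ n ih =>
    intro f g h h'
    refine ⟨(h.1.mul hρ hC h'.1).mono ?_, fun k => ?_⟩
    · rw [← sq]
      exact le_mul_of_one_le_left (sq_nonneg C) (one_le_pow₀ one_le_two)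
    obtain ⟨u, hu, hu'⟩ := h.2 k
    obtain ⟨v, hv, hv'⟩ := h'.2 k
    refine ⟨_, hu.mul hv (C := C) h.1.1 h'.1.1 hu'.wtBdd.1 hv'.wtBdd.1 (h.1.ae_abs_le hρ hC)
      (h'.1.ae_abs_le hρ hC) (hu'.wtBdd.ae_abs_le hρ hC) (hv'.wtBdd.ae_abs_le hρ hC), ?_⟩
    have h1 := ih hu' h'.pred
    have h2 := ih h.pred hv'
    have := h1.add hρ (by positivity) (by positivity) h2
    exact this.mono (le_of_eq (by ring))

lemma WtBdd.congr {ρ C : ℝ} {f g : Plane → ℝ} (h : WtBdd ρ C f) (hfg : f =ᵐ[volume] g) :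
    WtBdd ρ C g :=
  ⟨h.1.congr hfg, by filter_upwards [h.2, hfg] with x hx hx'; rwa [← hx']⟩

lemma SobBdd.congr {ρ C : ℝ} {n : ℕ} {f g : Plane → ℝ} (h : SobBdd ρ C n f)
    (hfg : f =ᵐ[volume] g) : SobBdd ρ C n g := by
  cases n with
  | zero => exact WtBdd.congr h hfg
  | succ n => exact ⟨h.1.congr hfg, fun k =>
      let ⟨u, hu, hu'⟩ := h.2 k; ⟨u, hu.congr_left hfg, hu'⟩⟩

lemma WD.bsConv {ε R : ℝ} (hε : 0 < ε) (hε1 : ε < 1) (hR : 0 ≤ R) {f g : Plane → ℝ}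
    (hf : WtBdd (1 + ε) R f) (hg : WtBdd (1 + ε) R g) {j : Fin 2} (h : WD j f g) (k : Fin 2) :
    WD j (bsConv k f) (bsConv k g) := by
  intro φ hφ
  have h1 := integral_bsConv_smul hε hε1 hR hf k (hφ.fderiv_apply (e j)).1.continuous
    (hφ.fderiv_apply (e j)).2
  have h2 := integral_bsConv_smul hε hε1 hR hg k hφ.1.continuous hφ.2
  simp only [smul_eq_mul] at h1 h2
  rw [h1, h2, ← integral_neg]
  refine integral_congr_ae (ae_of_all _ fun y => ?_)
  simp only
  rw [← mul_neg, ← h _ (hφ.comp_add y)]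
  congr 1
  refine integral_congr_ae (ae_of_all _ fun z => ?_)
  simp only
  rw [fderiv_comp_add_right]

/-- Weak derivatives commute with the convolution, so the constant for order zero works for every
order. -/
lemma exists_sobBdd_bsConv {ε : ℝ} (hε : 0 < ε) (hε1 : ε < 1) :
    ∃ C : ℝ, 0 ≤ C ∧ ∀ (R : ℝ), 0 ≤ R → ∀ (n : ℕ) (f : Plane → ℝ) (k : Fin 2),
      SobBdd (1 + ε) R n f → SobBdd ε (C * R) n (bsConv k f) := by
  obtain ⟨C, hC, H⟩ := exists_abs_bsConv_le hε hε1
  have H' : ∀ (R : ℝ) (f : Plane → ℝ) (k : Fin 2), 0 ≤ R → WtBdd (1 + ε) R f →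
      WtBdd ε (C * R) (bsConv k f) := fun R f k hR hf =>
    ⟨(measurable_bsConv hf.1 k).aestronglyMeasurable, ae_of_all _ fun x => (H R f hR hf k x).2⟩
  refine ⟨C, hC, fun R hR n => ?_⟩
  induction n with
  | zero => exact fun f k hf => H' R f k hR hf
  | succ n ih =>
    refine fun f k hf => ⟨H' R f k hR hf.1, fun j => ?_⟩
    obtain ⟨g, hg, hg'⟩ := hf.2 j
    exact ⟨bsConv k g, hg.bsConv hε hε1 hR hf.1 hg'.wtBdd k, ih g k hg'⟩

/-! ### Higher weak derivatives -/

lemma IsTest.iteratedFDeriv_apply {φ : Plane → ℝ} (hφ : IsTest φ) {j : ℕ} (m : Fin j → Plane) :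
    IsTest fun x => iteratedFDeriv ℝ j φ x m := by
  constructor
  · have h1 : ContDiff ℝ ((⊤ : ℕ∞) : WithTop ℕ∞) (iteratedFDeriv ℝ j φ) :=
      hφ.1.iteratedFDeriv_right (by exact_mod_cast le_top)
    exact (ContinuousMultilinearMap.apply ℝ (fun _ : Fin j => Plane) ℝ m).contDiff.comp h1
  · exact (hφ.2.iteratedFDeriv (𝕜 := ℝ) j).comp_left (g := fun T => T m) rfl

lemma fderiv_iteratedFDeriv_apply {φ : Plane → ℝ} (hφ : IsTest φ) {j : ℕ}
    (m : Fin (j + 1) → Plane) (x : Plane) :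
    iteratedFDeriv ℝ (j + 1) φ x m
      = fderiv ℝ (fun x => iteratedFDeriv ℝ j φ x (Fin.tail m)) x (m 0) := by
  rw [iteratedFDeriv_succ_apply_left]
  have h1 : ContDiff ℝ ((⊤ : ℕ∞) : WithTop ℕ∞) (iteratedFDeriv ℝ j φ) :=
    hφ.1.iteratedFDeriv_right (by exact_mod_cast le_top)
  have h2 : HasFDerivAt (iteratedFDeriv ℝ j φ) (fderiv ℝ (iteratedFDeriv ℝ j φ) x) x :=
    (h1.differentiable (by simp) x).hasFDerivAt
  have h3 := (ContinuousMultilinearMap.apply ℝ (fun _ : Fin j => Plane) ℝ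
    (Fin.tail m)).hasFDerivAt.comp x h2
  have h4 : fderiv ℝ (fun x => iteratedFDeriv ℝ j φ x (Fin.tail m)) x = _ := h3.fderiv
  rw [h4]
  rfl

/-- The derivative `v` is split off as the last index; this matches the `Fin.snoc` in
`MemWeighted.wd`, while `fderiv_iteratedFDeriv_apply` peels off the first index for
`SobBdd.exists_isWeakDeriv`. -/
lemma iteratedFDeriv_fderiv_apply {φ : Plane → ℝ} (hφ : IsTest φ) {j : ℕ}
    (m : Fin j → Plane) (v x : Plane) :
    iteratedFDeriv ℝ j (fun x => fderiv ℝ φ x v) x m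
      = iteratedFDeriv ℝ (j + 1) φ x (Fin.snoc m v : Fin (j + 1) → Plane) := by
  rw [iteratedFDeriv_succ_apply_right]
  have h1 : ContDiff ℝ ((⊤ : ℕ∞) : WithTop ℕ∞) (fderiv ℝ φ) :=
    hφ.1.fderiv_right (by simp)
  have h2 := (ContinuousLinearMap.apply ℝ ℝ v).iteratedFDeriv_comp_left
    (h1.contDiffAt (x := x)) (i := j) (by exact_mod_cast le_top)
  have h3 : (ContinuousLinearMap.apply ℝ ℝ v) ∘ (fderiv ℝ φ) = fun x => fderiv ℝ φ x v := rfl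
  rw [h3] at h2
  rw [h2, Fin.init_snoc, Fin.snoc_last]
  rfl

lemma SobBdd.exists_isWeakDeriv {ρ C : ℝ} (hρ : 0 ≤ ρ) (hC : 0 ≤ C) {j : ℕ} :
    ∀ {n : ℕ} {f : Plane → ℝ}, SobBdd ρ C n f → j ≤ n → ∀ θ : Fin j → Fin 2,
      ∃ g, IsWeakDeriv θ f g ∧ WtBdd ρ C g := by
  induction j with
  | zero =>
    intro n f hf _ θ
    have := hf.wtBdd.locallyIntegrable hρ hC
    exact ⟨f, ⟨this, this, fun φ hφ => by simp⟩, hf.wtBdd⟩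
  | succ j ih =>
    intro n f hf hn θ
    obtain ⟨n, rfl⟩ := Nat.exists_eq_add_of_le' (Nat.one_le_of_lt hn)
    obtain ⟨u, hu, hu'⟩ := hf.2 (θ 0)
    obtain ⟨g, ⟨-, hg, hg'⟩, hgb⟩ := ih hu' (by omega) (Fin.tail θ)
    refine ⟨g, ⟨hf.1.locallyIntegrable hρ hC, hg, fun φ hφ => ?_⟩, hgb⟩
    simp_rw [fderiv_iteratedFDeriv_apply hφ]
    rw [hu _ (hφ.iteratedFDeriv_apply _), pow_succ, mul_neg_one, neg_mul, ← hg' φ hφ]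
    rfl

lemma IsWeakDeriv.ae_eq {j : ℕ} {θ : Fin j → Fin 2} {f g g' : Plane → ℝ} (h : IsWeakDeriv θ f g)
    (h' : IsWeakDeriv θ f g') : g =ᵐ[volume] g' := by
  refine ae_eq_of_integral_contDiff_smul_eq h.2.1 h'.2.1 fun φ h1 h2 => ?_
  have h3 := (h.2.2 φ ⟨h1, h2⟩).symm.trans (h'.2.2 φ ⟨h1, h2⟩)
  have h4 := mul_left_cancel₀ (pow_ne_zero j (by norm_num)) h3
  simpa only [smul_eq_mul, mul_comm] using h4

lemma isWeakDeriv_weakDeriv {j : ℕ} {θ : Fin j → Fin 2} {f : Plane → ℝ}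
    (h : ∃ g, IsWeakDeriv θ f g) : IsWeakDeriv θ f (weakDeriv θ f) := by
  rw [weakDeriv, dif_pos h]
  exact h.choose_spec

lemma SobBdd.weakDeriv {ρ C : ℝ} (hρ : 0 ≤ ρ) (hC : 0 ≤ C) {n : ℕ} {f : Plane → ℝ}
    (hf : SobBdd ρ C n f) {j : ℕ} (hj : j ≤ n) (θ : Fin j → Fin 2) :
    WtBdd ρ C (Landau.weakDeriv θ f) := by
  obtain ⟨g, hg, hgb⟩ := hf.exists_isWeakDeriv hρ hC hj θ
  exact hgb.congr (hg.ae_eq (isWeakDeriv_weakDeriv ⟨g, hg⟩))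

lemma MemWeighted.wtBdd {γ : ℕ} {ρ : ℝ} {f : Plane → ℝ} (h : MemWeighted γ ρ f) {R : NNReal}
    (hR : weightedNorm γ ρ f ≤ R) {j : ℕ} (hj : j ≤ γ) (θ : Fin j → Fin 2) :
    IsWeakDeriv θ f (weakDeriv θ f) ∧ WtBdd ρ R (weakDeriv θ f) := by
  have h1 := isWeakDeriv_weakDeriv (h.1 j hj θ)
  refine ⟨h1, h1.2.1.aestronglyMeasurable, ?_⟩
  have h2 : eLpNorm (fun x : Plane => (1 + ‖x‖) ^ ρ •
      (WithLp.toLp 2 (fun θ : Fin j → Fin 2 => Landau.weakDeriv θ f x) :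
        EuclideanSpace ℝ (Fin j → Fin 2))) ⊤ volume ≤ R :=
    (Finset.single_le_sum (f := fun j => eLpNorm (fun x : Plane => (1 + ‖x‖) ^ ρ •
      (WithLp.toLp 2 (fun θ : Fin j → Fin 2 => Landau.weakDeriv θ f x) :
        EuclideanSpace ℝ (Fin j → Fin 2))) ⊤ volume) (fun _ _ => zero_le)
      (Finset.mem_range.2 (Nat.lt_succ_of_le hj))).trans hR
  rw [eLpNorm_exponent_top] at h2
  filter_upwards [ae_le_eLpNormEssSup (f := fun x : Plane => (1 + ‖x‖) ^ ρ •
      (WithLp.toLp 2 (fun θ : Fin j → Fin 2 => Landau.weakDeriv θ f x) :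
        EuclideanSpace ℝ (Fin j → Fin 2))) (μ := volume)] with x hx
  have h3 : ‖(1 + ‖x‖) ^ ρ • (WithLp.toLp 2 (fun θ : Fin j → Fin 2 => Landau.weakDeriv θ f x) :
        EuclideanSpace ℝ (Fin j → Fin 2))‖ ≤ R := by
    have := hx.trans h2
    rwa [enorm_le_coe, ← NNReal.coe_le_coe, coe_nnnorm] at this
  have hpos : 0 < (1 + ‖x‖) ^ ρ := Real.rpow_pos_of_pos (by positivity) _
  have h4 := PiLp.norm_apply_le (WithLp.toLp 2 (fun θ : Fin j → Fin 2 => Landau.weakDeriv θ f x) :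
        EuclideanSpace ℝ (Fin j → Fin 2)) θ
  rw [norm_smul, Real.norm_of_nonneg hpos.le] at h3
  rw [wt, Real.rpow_neg (by positivity), ← div_eq_mul_inv, le_div_iff₀ hpos, mul_comm]
  exact (mul_le_mul_of_nonneg_left h4 hpos.le).trans h3

/-- The functions `weakDeriv` of consecutive orders are chosen independently of each other. Testing
the lower one with `∂_k φ` and the higher one with `φ` shows that they are compatible. -/
lemma MemWeighted.wd {γ : ℕ} {ρ : ℝ} {f : Plane → ℝ} (h : MemWeighted γ ρ f) {j : ℕ}
    (hj : j + 1 ≤ γ) (θ : Fin j → Fin 2) (k : Fin 2) :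
    WD k (weakDeriv θ f) (weakDeriv (Fin.snoc θ k : Fin (j + 1) → Fin 2) f) := by
  intro φ hφ
  have h1 := (isWeakDeriv_weakDeriv (h.1 j (by omega) θ)).2.2 _ (hφ.fderiv_apply (e k))
  have h2 := (isWeakDeriv_weakDeriv (h.1 (j + 1) hj (Fin.snoc θ k : Fin (j + 1) → Fin 2))).2.2 φ hφ
  have h3 : ∀ x, iteratedFDeriv ℝ j (fun x => fderiv ℝ φ x (e k)) x (fun i => e (θ i))
      = iteratedFDeriv ℝ (j + 1) φ x
        (fun i => e ((Fin.snoc θ k : Fin (j + 1) → Fin 2) i)) := fun x => by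
    rw [iteratedFDeriv_fderiv_apply hφ]
    congr 1
    funext i
    refine Fin.lastCases ?_ (fun i => ?_) i <;> simp
  simp_rw [h3] at h1
  rw [h2, pow_succ, mul_neg_one, neg_mul, ← mul_neg] at h1
  exact (mul_left_cancel₀ (pow_ne_zero j (by norm_num)) h1).symm

lemma MemWeighted.sobBdd_weakDeriv {γ : ℕ} {ρ : ℝ} {f : Plane → ℝ} (h : MemWeighted γ ρ f)
    {R : NNReal} (hR : weightedNorm γ ρ f ≤ R) {n : ℕ} :
    ∀ {j : ℕ}, j + n ≤ γ → ∀ θ : Fin j → Fin 2, SobBdd ρ R n (weakDeriv θ f) := by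
  induction n with
  | zero => exact fun hj θ => (h.wtBdd hR hj θ).2
  | succ n ih =>
    exact fun hj θ => ⟨(h.wtBdd hR (by omega) θ).2, fun k => ⟨_, h.wd (by omega) θ k,
      ih (by omega) _⟩⟩

lemma MemWeighted.sobBdd {γ : ℕ} {ρ : ℝ} {f : Plane → ℝ} (h : MemWeighted γ ρ f)
    {R : NNReal} (hR : weightedNorm γ ρ f ≤ R) : SobBdd ρ R γ f := by
  have h1 := h.sobBdd_weakDeriv hR (n := γ) (j := 0) (by omega) Fin.elim0
  have h2 := isWeakDeriv_weakDeriv (h.1 0 (by omega) Fin.elim0)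
  exact h1.congr (h2.ae_eq ⟨h2.1, h2.1, fun φ hφ => by simp⟩)

/-- The pseudo potential has bounded weak derivatives. -/
lemma exists_sobBdd_pseudoPot {ε : ℝ} (hε : 0 < ε) (hε1 : ε < 1) (γ : ℕ) (R : NNReal) :
    ∃ C : ℝ, 0 ≤ C ∧ ∀ B V : Plane → ℝ, Tame γ ε B V → weightedNorm γ (1 + ε) B ≤ R →
      weightedNorm γ ε V ≤ R → SobBdd ε C γ (pseudoPot B V) := by
  obtain ⟨C, hC, H⟩ := exists_sobBdd_bsConv hε hε1
  refine ⟨2 ^ γ * (C * R) ^ 2 + 2 ^ γ * (C * R) ^ 2 + R, by positivity, fun B V hT hB hV => ?_⟩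
  have hb := fun k => H R R.2 γ B k (hT.2.sobBdd hB)
  have hCR : 0 ≤ C * R := by positivity
  have h1 := (((hb 0).mul hε.le hCR (hb 0)).add hε.le (by positivity) (by positivity)
    ((hb 1).mul hε.le hCR (hb 1))).add hε.le (by positivity) (by positivity) (hT.1.sobBdd hV)
  refine h1.congr (ae_of_all _ fun x => ?_)
  simp only
  rw [pseudoPot, norm_sq_plane, sq, sq]
  rfl





/-! ### The gauge is divergence free -/

/-- Lets a multiple of `singGauss 1` dominate a product of `‖y‖⁻¹` with a compactly supported
function. -/
lemma exists_le_exp_of_compactSupport {F : Type*} [NormedAddCommGroup F] {χ : Plane → F}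
    (hχ : Continuous χ) (hs : HasCompactSupport χ) :
    ∃ M : ℝ, 0 ≤ M ∧ ∀ y, ‖χ y‖ ≤ M * Real.exp (-1 * ‖y‖ ^ 2) := by
  obtain ⟨M, hM⟩ := (hs.norm.mul_right (f' := fun y : Plane => Real.exp (‖y‖ ^ 2))
    ).exists_bound_of_continuous (by fun_prop)
  refine ⟨M, (norm_nonneg _).trans (hM 0), fun y => ?_⟩
  have := (le_abs_self _).trans (hM y)
  simp only [Pi.mul_apply] at this
  rw [neg_one_mul, Real.exp_neg, ← div_eq_mul_inv, le_div_iff₀ (Real.exp_pos _)]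
  exact this

/-- The regularised Biot-Savart kernel. -/
def bsReg (δ : ℝ) (k : Fin 2) (y : Plane) : ℝ := (2 * Real.pi * (‖y‖ ^ 2 + δ))⁻¹ * J y k

lemma contDiff_J (k : Fin 2) {n : WithTop ℕ∞} : ContDiff ℝ n fun y : Plane => J y k := by
  have := contDiff_gauge0 2 k (n := n)
  simpa [gauge0] using this

lemma contDiff_bsReg {δ : ℝ} (hδ : 0 < δ) (k : Fin 2) {n : WithTop ℕ∞} :
    ContDiff ℝ n (bsReg δ k) := by
  refine ContDiff.mul (ContDiff.inv (contDiff_const.mul ((contDiff_norm_sq ℝ).add contDiff_const))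
    fun y => ?_) (contDiff_J k)
  have := Real.pi_pos
  positivity

/-- The gradient of a radial factor is parallel to `y`, hence orthogonal to `J y`, and `J y` itself
has no divergence. -/
lemma sum_fderiv_bsReg {δ : ℝ} (hδ : 0 < δ) (y : Plane) :
    ∑ k, fderiv ℝ (bsReg δ k) y (e k) = 0 := by
  have hne : 2 * Real.pi * (‖y‖ ^ 2 + δ) ≠ 0 := by
    have := Real.pi_pos
    positivity
  have h1 : HasFDerivAt (fun y : Plane => 2 * Real.pi * (‖y‖ ^ 2 + δ))
      ((2 * Real.pi) • (2 • innerSL ℝ y)) y :=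
    ((hasFDerivAt_norm_sq' y).add_const δ).const_mul (2 * Real.pi)
  have h2 := (hasDerivAt_inv hne).comp_hasFDerivAt y h1
  have hc : ∀ i : Fin 2, HasFDerivAt (fun y : Plane => y i)
      (EuclideanSpace.proj i : Plane →L[ℝ] ℝ) y :=
    fun i => (EuclideanSpace.proj i : Plane →L[ℝ] ℝ).hasFDerivAt
  have e0 : fderiv ℝ (bsReg δ 0) y = _ := (h2.mul (hc 1)).fderiv
  have e1 : fderiv ℝ (bsReg δ 1) y = _ := (h2.mul (hc 0).neg).fderiv
  rw [Fin.sum_univ_two, e0, e1]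
  have hs : ∀ k, inner ℝ y (EuclideanSpace.single k (1 : ℝ)) = y k := inner_e y
  simp [e, hs]
  ring

lemma abs_bsReg_le {δ : ℝ} (hδ : 0 < δ) (k : Fin 2) (y : Plane) : |bsReg δ k y| ≤ ‖y‖⁻¹ := by
  rcases eq_or_ne y 0 with rfl | hy
  · have : bsReg δ k 0 = 0 := by fin_cases k <;> simp [bsReg, J]
    rw [this]; simp
  have hb : 0 < ‖y‖ := norm_pos_iff.2 hy
  have hJ : |J y k| ≤ ‖y‖ := by
    have h0 : |y 0| ≤ ‖y‖ := PiLp.norm_apply_le y 0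
    have h1 : |y 1| ≤ ‖y‖ := PiLp.norm_apply_le y 1
    fin_cases k <;> simpa [J]
  have hpi := Real.pi_gt_three
  rw [bsReg, abs_mul, abs_of_pos (by positivity)]
  calc _ ≤ (1 * ‖y‖ ^ 2)⁻¹ * ‖y‖ := by
        gcongr
        · linarith
        · linarith
    _ = _ := by field_simp

lemma sum_integral_bsReg {δ : ℝ} (hδ : 0 < δ) {χ : Plane → ℂ} (hχ : IsTest χ) :
    ∑ k, ∫ y, bsReg δ k y • fderiv ℝ χ y (e k) = 0 := by
  have ht : ∀ k, IsTest fun y => bsReg δ k y • χ y := fun k =>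
    ⟨(contDiff_bsReg hδ k).smul hχ.1, HasCompactSupport.smul_left (f := bsReg δ k) hχ.2⟩
  have hd : ∀ k y, fderiv ℝ (fun y => bsReg δ k y • χ y) y (e k)
      = bsReg δ k y • fderiv ℝ χ y (e k) + fderiv ℝ (bsReg δ k) y (e k) • χ y := fun k y => by
    rw [fderiv_fun_smul ((contDiff_bsReg hδ k (n := 1)).differentiable (by simp) y)
      (hχ.1.differentiable (by simp) y)]
    simp
  have hi1 : ∀ k, Integrable (fun y => fderiv ℝ (fun y => bsReg δ k y • χ y) y (e k)) volume :=
    fun k => Continuous.integrable_of_hasCompactSupport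
      (((ht k).1.continuous_fderiv (by simp)).clm_apply continuous_const)
      ((ht k).2.fderiv_apply ℝ (e k))
  have hi2 : ∀ k, Integrable (fun y => bsReg δ k y • fderiv ℝ χ y (e k)) volume := fun k => by
    have h1 : Continuous fun y => fderiv ℝ χ y (e k) :=
      (hχ.1.continuous_fderiv (by simp)).clm_apply continuous_const
    have h2 : HasCompactSupport fun y => fderiv ℝ χ y (e k) := hχ.2.fderiv_apply ℝ (e k)
    have h3 : Continuous (bsReg δ k) := (contDiff_bsReg hδ k (n := 0)).continuous
    exact (h3.smul h1).integrable_of_hasCompactSupport h2.smul_left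
  have h0 : ∑ k, ∫ y, fderiv ℝ (fun y => bsReg δ k y • χ y) y (e k) = 0 :=
    Finset.sum_eq_zero fun k _ => integral_fderiv_eq_zero (ht k) (e k)
  rw [← integral_finsetSum _ fun k _ => hi1 k] at h0
  rw [← integral_finsetSum _ fun k _ => hi2 k, ← h0]
  refine integral_congr_ae (ae_of_all _ fun y => ?_)
  simp only [hd, Finset.sum_add_distrib, ← Finset.sum_smul, sum_fderiv_bsReg hδ, zero_smul,
    add_zero]

/-- The identity holds for the smooth regularised kernels and passes to the limit `δ → 0` by
dominated convergence, as `‖y‖⁻¹` is locally integrable. No boundary term at the origin has to be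
discussed. -/
lemma sum_integral_biotSavart {χ : Plane → ℂ} (hχ : IsTest χ) :
    ∑ k, ∫ y, biotSavart y k • fderiv ℝ χ y (e k) = 0 := by
  have hlim : ∀ k : Fin 2, Filter.Tendsto
      (fun n : ℕ => ∫ y, bsReg (1 / ((n : ℝ) + 1)) k y • fderiv ℝ χ y (e k)) Filter.atTop
      (nhds (∫ y, biotSavart y k • fderiv ℝ χ y (e k))) := by
    intro k
    have hc : Continuous fun y => fderiv ℝ χ y (e k) :=
      (hχ.1.continuous_fderiv (by simp)).clm_apply continuous_const
    obtain ⟨M, hM, hMb⟩ := exists_le_exp_of_compactSupport hc (hχ.2.fderiv_apply ℝ (e k))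
    refine tendsto_integral_of_dominated_convergence (fun y => M * singGauss 1 y)
      (fun n => ?_) ((integrable_singGauss one_pos).const_mul M) (fun n => ae_of_all _ fun y => ?_)
      ?_
    · exact ((contDiff_bsReg (by positivity) k (n := 0)).continuous.smul hc).aestronglyMeasurable
    · rw [norm_smul]
      calc _ ≤ ‖y‖⁻¹ * (M * Real.exp (-1 * ‖y‖ ^ 2)) :=
            mul_le_mul (abs_bsReg_le (by positivity) k y) (hMb y) (norm_nonneg _) (by positivity)
        _ = M * (‖y‖⁻¹ * Real.exp (-1 * ‖y‖ ^ 2)) := by ring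
        _ ≤ M * ((1 + ‖y‖⁻¹) * Real.exp (-1 * ‖y‖ ^ 2)) := by gcongr; linarith
    · filter_upwards [ae_ne_zero] with y hy
      refine Filter.Tendsto.smul_const ?_ _
      have h0 : Filter.Tendsto (fun n : ℕ => ‖y‖ ^ 2 + 1 / ((n : ℝ) + 1)) Filter.atTop
          (nhds (‖y‖ ^ 2)) := by
        simpa using tendsto_one_div_add_atTop_nhds_zero_nat.const_add (‖y‖ ^ 2)
      have hne : 2 * Real.pi * ‖y‖ ^ 2 ≠ 0 := by
        have := Real.pi_pos
        have := norm_pos_iff.2 hy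
        positivity
      exact ((h0.const_mul (2 * Real.pi)).inv₀ hne).mul_const (J y k)
  have := tendsto_finsetSum Finset.univ fun k (_ : k ∈ Finset.univ) => hlim k
  refine tendsto_nhds_unique this (tendsto_const_nhds.congr fun n => ?_)
  exact (sum_integral_bsReg (by positivity) hχ).symm

lemma divFree_bsConv {ε R : ℝ} (hε : 0 < ε) (hε1 : ε < 1) (hR : 0 ≤ R) {f : Plane → ℝ}
    (hf : WtBdd (1 + ε) R f) : DivFree fun k => bsConv k f := by
  obtain ⟨C, hC, H⟩ := exists_abs_bsConv_le hε hε1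
  refine ⟨fun k => measurable_bsConv hf.1 k, ⟨C * R, fun k x => ((H R f hR hf k x).2).trans
    (mul_le_of_le_one_right (by positivity) (wt_le_one hε.le x))⟩, fun ψ hψ => ?_⟩
  have hψk : ∀ k, Continuous fun x => fderiv ℝ ψ x (e k) := fun k =>
    (hψ.1.continuous_fderiv (by simp)).clm_apply continuous_const
  have h1 := fun k => integral_bsConv_smul' hε hε1 hR hf k (hψk k) (hψ.2.fderiv_apply ℝ (e k))
  simp_rw [← Complex.real_smul, (h1 _).2]
  rw [← integral_finsetSum _ fun k _ => (h1 k).1]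
  refine (integral_congr_ae (ae_of_all _ fun z => ?_)).trans (integral_zero Plane ℂ)
  simp only
  rw [← Finset.smul_sum]
  have ht : IsTest fun y => ψ (z + y) :=
    ⟨hψ.1.comp (contDiff_const.add contDiff_id), hψ.2.comp_homeomorph (Homeomorph.addLeft z)⟩
  have h2 := sum_integral_biotSavart ht
  simp_rw [fderiv_comp_add_left] at h2
  rw [h2, smul_zero]





/-! ### Schatten classes via orthonormal families -/

section Abstract

variable {H₁ H₂ : Type*} [NormedAddCommGroup H₁] [InnerProductSpace ℂ H₁]
  [NormedAddCommGroup H₂] [InnerProductSpace ℂ H₂]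

lemma sum_le_of_orthonormal {S : H₁ →L[ℂ] H₂} {p : ℕ} {C : ℝ}
    (h : ∀ (N : ℕ) (v : Fin N → H₁), Orthonormal ℂ v → ∑ i, ‖S (v i)‖ ^ p ≤ C)
    {ι : Type*} [Fintype ι] {v : ι → H₁} (hv : Orthonormal ℂ v) : ∑ i, ‖S (v i)‖ ^ p ≤ C := by
  have h1 := h _ (v ∘ (Fintype.equivFin ι).symm) (hv.comp _ (Fintype.equivFin ι).symm.injective)
  rwa [show ∑ i, ‖S ((v ∘ (Fintype.equivFin ι).symm) i)‖ ^ p = ∑ i, ‖S (v i)‖ ^ p from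
    (Fintype.equivFin ι).symm.sum_comp fun i => ‖S (v i)‖ ^ p] at h1

lemma orthonormal_option {N : ℕ} {v : Fin N → H₁} (hv : Orthonormal ℂ v) {u : H₁} (hu : ‖u‖ = 1)
    (h : ∀ i, inner ℂ (v i) u = 0) :
    Orthonormal ℂ (fun o : Option (Fin N) => o.elim u v) := by
  refine ⟨fun o => ?_, fun o o' hne => ?_⟩
  · cases o with
    | none => exact hu
    | some i => exact hv.1 i
  · cases o with
    | none =>
      cases o' with
      | none => exact absurd rfl hne
      | some j => exact inner_eq_zero_symm.1 (h j)
    | some i =>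
      cases o' with
      | none => exact h i
      | some j => exact hv.2 fun hij => hne (by rw [hij])

/-- Take a finite orthonormal family whose sum is within `δ ^ p` of the supremum. A unit vector
orthogonal to it could be adjoined, so `S` has norm at most `δ` on the orthogonal complement of its
span; compose `S` with the projection onto the span. -/
lemma exists_finiteRank_near {S : H₁ →L[ℂ] H₂} {p : ℕ} (hp : p ≠ 0) {C : ℝ}
    (h : ∀ (N : ℕ) (v : Fin N → H₁), Orthonormal ℂ v → ∑ i, ‖S (v i)‖ ^ p ≤ C) {δ : ℝ}
    (hδ : 0 < δ) : ∃ T : H₁ →L[ℂ] H₂, IsCompactOperator T ∧ ‖S - T‖ ≤ δ := by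
  set A : Set ℝ := {a | ∃ (N : ℕ) (v : Fin N → H₁), Orthonormal ℂ v ∧ ∑ i, ‖S (v i)‖ ^ p = a}
    with hA
  have hne : A.Nonempty := ⟨0, 0, Fin.elim0, ⟨fun i => i.elim0, fun i => i.elim0⟩, by simp⟩
  have hbd : BddAbove A := ⟨C, by rintro _ ⟨N, v, hv, rfl⟩; exact h N v hv⟩
  obtain ⟨_, ⟨N, v, hv, rfl⟩, hlt⟩ := exists_lt_of_lt_csSup hne
    (show sSup A - δ ^ p < sSup A by have := pow_pos hδ p; linarith)
  set K : Submodule ℂ H₁ := Submodule.span ℂ (Set.range v) with hK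
  have : FiniteDimensional ℂ K := FiniteDimensional.span_of_finite ℂ (Set.finite_range v)
  refine ⟨S ∘L K.starProjection, ?_, ?_⟩
  · have : ProperSpace K := FiniteDimensional.proper ℂ K
    have h1 : IsCompactOperator K.orthogonalProjectionOnto :=
      isCompactOperator_of_locallyCompactSpace_dom K.orthogonalProjectionOnto
    exact h1.clm_comp (S ∘L K.subtypeL)
  · refine ContinuousLinearMap.opNorm_le_bound _ hδ.le fun u => ?_
    set w := u - K.starProjection u with hw
    have hwK : w ∈ Kᗮ := Submodule.sub_starProjection_mem_orthogonal u
    have hSw : (S - S ∘L K.starProjection) u = S w := by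
      rw [hw, map_sub]; rfl
    have hwu : ‖w‖ ≤ ‖u‖ := by
      have h1 : w = Kᗮ.starProjection u := by
        rw [Submodule.starProjection_orthogonal']
        rfl
      rw [h1]
      exact (Kᗮ.starProjection.le_opNorm u).trans (mul_le_of_le_one_left (norm_nonneg _)
        Kᗮ.starProjection_norm_le)
    rw [hSw]
    refine le_trans ?_ (mul_le_mul_of_nonneg_left hwu hδ.le)
    rcases eq_or_ne w 0 with h0 | h0
    · rw [h0]; simp
    have hwn : 0 < ‖w‖ := norm_pos_iff.2 h0
    set z : H₁ := ((‖w‖⁻¹ : ℝ) : ℂ) • w with hz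
    have hz1 : ‖z‖ = 1 := by
      rw [hz, norm_smul, Complex.norm_real, norm_inv, norm_norm, inv_mul_cancel₀ hwn.ne']
    have hzo : ∀ i, inner ℂ (v i) z = 0 := fun i => by
      rw [hz, inner_smul_right, hwK (v i) (Submodule.subset_span ⟨i, rfl⟩), mul_zero]
    have h1 := orthonormal_option hv hz1 hzo
    have h2 : ∑ o : Option (Fin N), ‖S (o.elim z v)‖ ^ p ≤ sSup A := by
      refine sum_le_of_orthonormal (fun N v hv => ?_) h1
      exact le_csSup hbd ⟨N, v, hv, rfl⟩
    rw [Fintype.sum_option] at h2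
    simp only [Option.elim_none, Option.elim_some] at h2
    have h3 : ‖S z‖ ^ p ≤ δ ^ p := by linarith
    have h4 : ‖S z‖ ≤ δ := le_of_pow_le_pow_left₀ hp hδ.le h3
    rw [hz, map_smul, norm_smul, Complex.norm_real, norm_inv, norm_norm, inv_mul_le_iff₀ hwn] at h4
    linarith

variable [CompleteSpace H₂]

lemma isCompactOperator_of_sum_le {S : H₁ →L[ℂ] H₂} {p : ℕ} (hp : p ≠ 0) {C : ℝ}
    (h : ∀ (N : ℕ) (v : Fin N → H₁), Orthonormal ℂ v → ∑ i, ‖S (v i)‖ ^ p ≤ C) :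
    IsCompactOperator S := by
  choose T hT hT' using fun n : ℕ => exists_finiteRank_near hp h (δ := 1 / ((n : ℝ) + 1))
    (by positivity)
  refine isCompactOperator_of_tendsto (l := Filter.atTop) (F := T) ?_ (Filter.Eventually.of_forall hT)
  rw [tendsto_iff_norm_sub_tendsto_zero]
  refine squeeze_zero (fun n => norm_nonneg _) (fun n => ?_) tendsto_one_div_add_atTop_nhds_zero_nat
  rw [norm_sub_rev]
  exact hT' n

variable [CompleteSpace H₁]

lemma exists_orthonormal_singular (S : H₁ →L[ℂ] H₂) (s : ℝ) :
    ∃ w : Fin (singularMult S s) → Module.End.eigenspace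
      ((ContinuousLinearMap.adjoint S ∘L S : H₁ →L[ℂ] H₁) : H₁ →ₗ[ℂ] H₁) ((s ^ 2 : ℝ) : ℂ),
      Orthonormal ℂ w := by
  by_cases hf : FiniteDimensional ℂ (Module.End.eigenspace
      ((ContinuousLinearMap.adjoint S ∘L S : H₁ →L[ℂ] H₁) : H₁ →ₗ[ℂ] H₁) ((s ^ 2 : ℝ) : ℂ))
  · exact ⟨stdOrthonormalBasis ℂ _, (stdOrthonormalBasis ℂ _).orthonormal⟩
  -- An infinite dimensional eigenspace has `finrank` equal to `0`, so the empty family serves.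
  · have h0 : singularMult S s = 0 := Module.finrank_of_not_finite hf
    rw [h0]
    exact ⟨Fin.elim0, fun i => i.elim0, fun i => i.elim0⟩

lemma norm_of_mem_singular {S : H₁ →L[ℂ] H₂} {s : ℝ} (hs : 0 < s) {u : H₁} (hu : ‖u‖ = 1)
    (h : u ∈ Module.End.eigenspace
      ((ContinuousLinearMap.adjoint S ∘L S : H₁ →L[ℂ] H₁) : H₁ →ₗ[ℂ] H₁) ((s ^ 2 : ℝ) : ℂ)) :
    ‖S u‖ = s := by
  have h1 : ContinuousLinearMap.adjoint S (S u) = ((s ^ 2 : ℝ) : ℂ) • u :=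
    Module.End.mem_eigenspace_iff.1 h
  have h2 : inner ℂ (S u) (S u) = ((s ^ 2 : ℝ) : ℂ) := by
    rw [← ContinuousLinearMap.adjoint_inner_right, h1, inner_smul_right,
      inner_self_eq_norm_sq_to_K, hu]
    simp
  rw [inner_self_eq_norm_sq_to_K] at h2
  have h3 : ‖S u‖ ^ 2 = s ^ 2 := Complex.ofReal_injective (by simpa using h2)
  exact (pow_left_inj₀ (norm_nonneg _) hs.le two_ne_zero).1 h3

/-- A finite part of the sum over singular values is the sum of `‖S v‖ ^ p` over orthonormal bases
of the corresponding eigenspaces of `S* S`. These are mutually orthogonal for distinct singular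
values, so together they form one admissible family. -/
lemma schattenNorm_le_of_sum_le {S : H₁ →L[ℂ] H₂} {p : ℕ} (hp : p ≠ 0) {C : ℝ} (hC : 0 ≤ C)
    (h : ∀ (N : ℕ) (v : Fin N → H₁), Orthonormal ℂ v → ∑ i, ‖S (v i)‖ ^ p ≤ C ^ p) :
    schattenNorm (p : ℝ) S ≤ ENNReal.ofReal C := by
  have hp' : (0 : ℝ) < p := by exact_mod_cast Nat.pos_of_ne_zero hp
  rw [schattenNorm, one_div, ENNReal.rpow_inv_le_iff hp', ENNReal.ofReal_rpow_of_nonneg hC hp'.le,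
    Real.rpow_natCast, ENNReal.tsum_eq_iSup_sum]
  refine iSup_le fun F => ?_
  choose w hw using fun s : F => exists_orthonormal_singular S (s : {s : ℝ // 0 < s})
  have hsym : ((ContinuousLinearMap.adjoint S ∘L S : H₁ →L[ℂ] H₁) : H₁ →ₗ[ℂ] H₁).IsSymmetric := by
    intro x y
    change inner ℂ (ContinuousLinearMap.adjoint S (S x)) y
      = inner ℂ x (ContinuousLinearMap.adjoint S (S y))
    rw [ContinuousLinearMap.adjoint_inner_left, ContinuousLinearMap.adjoint_inner_right]
  have hinj : Function.Injective fun s : F => ((((s : {s : ℝ // 0 < s}) : ℝ) ^ 2 : ℝ) : ℂ) := by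
    intro s t hst
    have h1 : (((s : {s : ℝ // 0 < s}) : ℝ)) ^ 2 = ((t : {s : ℝ // 0 < s}) : ℝ) ^ 2 :=
      Complex.ofReal_injective hst
    exact Subtype.ext (Subtype.ext ((pow_left_inj₀ s.1.2.le t.1.2.le two_ne_zero).1 h1))
  have horth := (hsym.orthogonalFamily_eigenspaces.comp hinj).orthonormal_sigma_orthonormal hw
  have h1 := sum_le_of_orthonormal h horth
  have h2 : ∀ a : (Σ s : F, Fin (singularMult S (s : {s : ℝ // 0 < s}))),
      ‖S ((w a.1 a.2 : _) : H₁)‖ = ((a.1 : {s : ℝ // 0 < s}) : ℝ) := fun a =>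
    norm_of_mem_singular a.1.1.2 ((hw a.1).1 a.2) (w a.1 a.2).2
  have h3 : ∑ a : (Σ s : F, Fin (singularMult S (s : {s : ℝ // 0 < s}))),
      ‖S ((w a.1 a.2 : _) : H₁)‖ ^ p
      = ∑ s ∈ F, (singularMult S (s : ℝ) : ℝ) * (s : ℝ) ^ p := by
    simp_rw [h2]
    rw [Fintype.sum_sigma]
    simp only [Finset.sum_const, Finset.card_univ, Fintype.card_fin, nsmul_eq_mul]
    exact Finset.sum_coe_sort F fun s => (singularMult S (s : ℝ) : ℝ) * (s : ℝ) ^ p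
  have h4 : ∑ s ∈ F, (singularMult S (s : ℝ) : ℝ) * (s : ℝ) ^ p ≤ C ^ p := by
    rw [← h3]; exact h1
  refine le_trans (le_of_eq ?_) (ENNReal.ofReal_le_ofReal h4)
  rw [ENNReal.ofReal_sum_of_nonneg fun s _ => by have := s.2; positivity]
  refine Finset.sum_congr rfl fun s _ => ?_
  rw [ENNReal.ofReal_mul (by positivity), ENNReal.ofReal_natCast, Real.rpow_natCast]

/-- The composition `(S* S)^n`. -/
def starPow (S : H₁ →L[ℂ] H₂) (n : ℕ) (u : H₁) : H₁ :=
  (fun v => ContinuousLinearMap.adjoint S (S v))^[n] u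

lemma starPow_succ (S : H₁ →L[ℂ] H₂) (n : ℕ) (u : H₁) :
    starPow S (n + 1) u = ContinuousLinearMap.adjoint S (S (starPow S n u)) :=
  Function.iterate_succ_apply' _ _ _

/-- Log-convexity `y² ≤ x z` carries the ratio bound `s ≤ y / x` over to `s ≤ z / y`; stated without
division because the terms may vanish. -/
lemma mul_le_of_sq_le {s x y z : ℝ} (hx : 0 ≤ x) (hy : 0 ≤ y) (hz : 0 ≤ z) (h1 : s * x ≤ y)
    (h2 : y ^ 2 ≤ x * z) : s * y ≤ z := by
  rcases hx.eq_or_lt with rfl | hx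
  · have : y = 0 := by
      rw [zero_mul] at h2
      exact pow_eq_zero_iff two_ne_zero |>.1 (le_antisymm h2 (sq_nonneg y))
    rw [this, mul_zero]; exact hz
  · refine le_of_mul_le_mul_left ?_ hx
    nlinarith

/-- The norms of `u`, `S u`, `S* S u`, `S S* S u`, and so on form a log-convex sequence by
Cauchy-Schwarz, so all consecutive ratios are at least the first one, `‖S u‖`. -/
lemma norm_pow_le_norm_starPow (S : H₁ →L[ℂ] H₂) {u : H₁} (hu : ‖u‖ = 1) (n : ℕ) :
    ‖S u‖ * ‖starPow S n u‖ ≤ ‖S (starPow S n u)‖ ∧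
    ‖S u‖ * ‖S (starPow S n u)‖ ≤ ‖starPow S (n + 1) u‖ ∧
    ‖S u‖ ^ (2 * n) ≤ ‖starPow S n u‖ := by
  have key1 : ∀ v : H₁, ‖S v‖ ^ 2 ≤ ‖v‖ * ‖ContinuousLinearMap.adjoint S (S v)‖ := fun v => by
    have h := norm_inner_le_norm (𝕜 := ℂ) v (ContinuousLinearMap.adjoint S (S v))
    rw [ContinuousLinearMap.adjoint_inner_right, inner_self_eq_norm_sq_to_K] at h
    simpa using h
  have key2 : ∀ v : H₁, ‖ContinuousLinearMap.adjoint S (S v)‖ ^ 2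
      ≤ ‖S v‖ * ‖S (ContinuousLinearMap.adjoint S (S v))‖ := fun v => by
    have h := norm_inner_le_norm (𝕜 := ℂ) (S v) (S (ContinuousLinearMap.adjoint S (S v)))
    rw [← ContinuousLinearMap.adjoint_inner_left, inner_self_eq_norm_sq_to_K] at h
    simpa using h
  induction n with
  | zero =>
    refine ⟨by simp [starPow, hu], ?_, by simp [starPow, hu]⟩
    have := key1 u
    rw [hu, one_mul, sq] at this
    exact this
  | succ n ih =>
    obtain ⟨h1, h2, h3⟩ := ih
    have h4 : ‖S u‖ * ‖starPow S (n + 1) u‖ ≤ ‖S (starPow S (n + 1) u)‖ := by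
      refine mul_le_of_sq_le (norm_nonneg _) (norm_nonneg _) (norm_nonneg _) h2 ?_
      rw [starPow_succ]
      exact key2 _
    refine ⟨h4, ?_, ?_⟩
    · refine mul_le_of_sq_le (norm_nonneg _) (norm_nonneg _) (norm_nonneg _) h4 ?_
      rw [starPow_succ S (n + 1)]
      exact key1 _
    · calc ‖S u‖ ^ (2 * (n + 1)) = ‖S u‖ * (‖S u‖ * ‖S u‖ ^ (2 * n)) := by ring
        _ ≤ ‖S u‖ * (‖S u‖ * ‖starPow S n u‖) := by gcongr
        _ ≤ ‖S u‖ * ‖S (starPow S n u)‖ := by gcongr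
        _ ≤ _ := h2

end Abstract





/-! ### Pointwise domination of integral operators -/

lemma phase_zero (x y : Plane) : phase 0 x y = 1 := by simp [phase]

/-- At field strength `0` the phase is `1`, so the dominating convolution kernel is a twisted one
and the earlier integrability result applies to it. -/
lemma integrable_kernel_mul {K : Plane → Plane → ℂ} {k : Plane → ℝ}
    (hK : StronglyMeasurable (Function.uncurry K)) (hk : Integrable k volume)
    (hKk : ∀ x y, ‖K x y‖ ≤ k (x - y)) (f ψ : L2 ℂ) :
    Integrable (fun p : Plane × Plane => f p.2 * K p.1 p.2 * conj (ψ p.1))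
      (volume.prod volume) := by
  refine (integrable_integral_twKer (B₀ := 0) hk.ofReal f ψ).1.mono ?_ (ae_of_all _ fun p => ?_)
  · refine ((((Lp.stronglyMeasurable f).comp_measurable measurable_snd).mul hK).mul
      ?_).aestronglyMeasurable
    exact Complex.continuous_conj.comp_stronglyMeasurable
      ((Lp.stronglyMeasurable ψ).comp_measurable measurable_fst)
  · have h0 : 0 ≤ k (p.1 - p.2) := (norm_nonneg _).trans (hKk _ _)
    simp only [norm_mul, twKer, phase_zero, one_mul]
    gcongr
    exact (hKk _ _).trans (le_of_eq (by simp [abs_of_nonneg h0]))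

lemma HasKer.adjoint {K : Plane → Plane → ℂ} {k : Plane → ℝ} {S : L2 ℂ →L[ℂ] L2 ℂ}
    (hS : HasKer S K) (hK : StronglyMeasurable (Function.uncurry K)) (hkm : Measurable k)
    (hk : Integrable k volume) (hKk : ∀ x y, ‖K x y‖ ≤ k (x - y)) :
    HasKer (ContinuousLinearMap.adjoint S) fun x y => conj (K y x) := by
  have hK' : StronglyMeasurable (Function.uncurry fun x y => conj (K y x)) :=
    Complex.continuous_conj.comp_stronglyMeasurable (hK.comp_measurable measurable_swap)
  have hKk' : ∀ x y, ‖conj (K y x)‖ ≤ (fun w => k (-w)) (x - y) := fun x y => by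
    simpa using hKk y x
  obtain ⟨T, hT, -⟩ := exists_hasKer (k := fun w => k (-w)) hK' (hkm.comp measurable_neg)
    hk.comp_neg hKk'
  suffices h : T = ContinuousLinearMap.adjoint S by rwa [← h]
  rw [ContinuousLinearMap.eq_adjoint_iff]
  intro f g
  have hi := integrable_kernel_mul hK hk hKk g f
  have h1 : inner ℂ f (S g)
      = ∫ x, ∫ y, g y * K x y * conj (f x) := by
    rw [inner_eq_integral]
    refine integral_congr_ae ?_
    filter_upwards [hS g] with x hx
    rw [hx.2, integral_mul_const]
    rfl
  rw [h1, integral_integral_swap hi, inner_eq_integral]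
  refine integral_congr_ae ?_
  filter_upwards [hT f] with y hy
  rw [hy.2, ← integral_conj, ← integral_const_mul]
  refine integral_congr_ae (ae_of_all _ fun x => ?_)
  simp only [smul_eq_mul, map_mul, Complex.conj_conj]
  ring

lemma HasKer.enorm_le {K : Plane → Plane → ℂ} {S : L2 ℂ →L[ℂ] L2 ℂ} (hS : HasKer S K)
    {q : Plane → Plane → ℝ≥0∞} (hq : ∀ x y, ‖K x y‖ₑ ≤ q x y) (f : L2 ℂ) :
    ∀ᵐ x, ‖S f x‖ₑ ≤ ∫⁻ y, q x y * ‖f y‖ₑ := by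
  filter_upwards [hS f] with x hx
  rw [hx.2]
  refine (enorm_integral_le_lintegral_enorm _).trans (lintegral_mono fun y => ?_)
  rw [enorm_smul, mul_comm]
  gcongr
  exact hq x y

/-- Convolution of nonnegative functions. -/
def lconv (q u : Plane → ℝ≥0∞) (x : Plane) : ℝ≥0∞ := ∫⁻ y, q (x - y) * u y

lemma measurable_lconv {q u : Plane → ℝ≥0∞} (hq : Measurable q) (hu : Measurable u) :
    Measurable (lconv q u) :=
  Measurable.lintegral_prod_right' (f := fun p : Plane × Plane => q (p.1 - p.2) * u p.2)
    (by fun_prop)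

lemma measurable_lconv_iterate {q u : Plane → ℝ≥0∞} (hq : Measurable q) (hu : Measurable u)
    (n : ℕ) : Measurable ((lconv q)^[n] u) := by
  induction n with
  | zero => exact hu
  | succ n ih => rw [Function.iterate_succ_apply']; exact measurable_lconv hq ih

lemma lintegral_lconv_iterate_sq_le {q u : Plane → ℝ≥0∞} (hq : Measurable q) (hu : Measurable u)
    (n : ℕ) : ∫⁻ x, (lconv q)^[n] u x ^ 2 ≤ ((∫⁻ x, q x) ^ 2) ^ n * ∫⁻ x, u x ^ 2 := by
  induction n with
  | zero => simp
  | succ n ih =>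
    rw [Function.iterate_succ_apply']
    refine (lintegral_conv_sq_le hq (measurable_lconv_iterate hq hu n)).trans ?_
    rw [pow_succ' _ n, mul_assoc]
    gcongr

/-- Young's inequality `L^{4/3} * L^{4/3} ⊂ L²` with a crude constant. The singularity `1 / ‖w‖` is
not square integrable in the plane, but its power `4/3` is locally integrable, so one convolution
repairs this. The proof splits `a b = (a b)^{2/3} (a b)^{1/3}` and uses `(a b)^{2/3} ≤ a^{4/3} +
b^{4/3}`. -/
lemma lintegral_lconv_self_sq_le {q : Plane → ℝ≥0∞} (hq : Measurable q) :
    ∫⁻ w, lconv q q w ^ 2 ≤ 2 * (∫⁻ w, q w ^ (4 / 3 : ℝ)) ^ 3 := by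
  set L := ∫⁻ w, q w ^ (4 / 3 : ℝ) with hL
  have hp : ∀ r : ℝ, Measurable fun w => q w ^ r := fun r => hq.pow_const r
  have h1 : ∀ w, lconv q q w ^ 2
      ≤ (∫⁻ z, (q (w - z)) ^ (4 / 3 : ℝ) * q z ^ (4 / 3 : ℝ)) * (2 * L) := fun w => by
    have e1 : ∀ a b : ℝ≥0∞, a * b = (a * b) ^ (2 / 3 : ℝ) * (a * b) ^ (1 / 3 : ℝ) := fun a b => by
      rw [← ENNReal.rpow_add_of_nonneg _ _ (by norm_num) (by norm_num)]
      norm_num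
    have e2 : ∀ a b : ℝ≥0∞, ((a * b) ^ (2 / 3 : ℝ)) ^ 2 = a ^ (4 / 3 : ℝ) * b ^ (4 / 3 : ℝ) :=
      fun a b => by
        rw [← ENNReal.mul_rpow_of_nonneg _ _ (by norm_num), ← ENNReal.rpow_natCast,
          ← ENNReal.rpow_mul]
        norm_num
    have e3 : ∀ a b : ℝ≥0∞, ((a * b) ^ (1 / 3 : ℝ)) ^ 2
        ≤ a ^ (4 / 3 : ℝ) + b ^ (4 / 3 : ℝ) := fun a b => by
      rw [← ENNReal.rpow_natCast, ← ENNReal.rpow_mul]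
      rcases le_total a b with h | h
      · refine le_trans ?_ le_add_self
        calc _ ≤ (b * b) ^ (1 / 3 * ((2 : ℕ) : ℝ)) := by gcongr
          _ = _ := by rw [← sq, ← ENNReal.rpow_natCast, ← ENNReal.rpow_mul]; norm_num
      · refine le_trans ?_ le_self_add
        calc _ ≤ (a * a) ^ (1 / 3 * ((2 : ℕ) : ℝ)) := by gcongr
          _ = _ := by rw [← sq, ← ENNReal.rpow_natCast, ← ENNReal.rpow_mul]; norm_num
    have hm : Measurable fun z => q (w - z) * q z := by fun_prop
    have h2 := sq_lintegral_mul_le (volume : Measure Plane)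
      (f := fun z => (q (w - z) * q z) ^ (2 / 3 : ℝ)) (g := fun z => (q (w - z) * q z) ^ (1 / 3 : ℝ))
      (hm.pow_const _).aemeasurable (hm.pow_const _).aemeasurable
    simp only [← e1, e2] at h2
    refine h2.trans ?_
    gcongr
    calc _ ≤ ∫⁻ z, (q (w - z) ^ (4 / 3 : ℝ) + q z ^ (4 / 3 : ℝ)) := lintegral_mono fun z => e3 _ _
      _ = L + L := by
        rw [lintegral_add_right _ (hp _), lintegral_sub_left_eq_self (fun z => q z ^ (4 / 3 : ℝ)) w]
      _ = 2 * L := (two_mul L).symm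
  have hm : Measurable fun p : Plane × Plane => q (p.1 - p.2) ^ (4 / 3 : ℝ) * q p.2 ^ (4 / 3 : ℝ) :=
    ((hp _).comp (measurable_fst.sub measurable_snd)).mul ((hp _).comp measurable_snd)
  calc _ ≤ ∫⁻ w, (∫⁻ z, (q (w - z)) ^ (4 / 3 : ℝ) * q z ^ (4 / 3 : ℝ)) * (2 * L) :=
        lintegral_mono h1
    _ = (∫⁻ w, ∫⁻ z, (q (w - z)) ^ (4 / 3 : ℝ) * q z ^ (4 / 3 : ℝ)) * (2 * L) :=
        lintegral_mul_const _ hm.lintegral_prod_right'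
    _ = (∫⁻ z, ∫⁻ w, (q (w - z)) ^ (4 / 3 : ℝ) * q z ^ (4 / 3 : ℝ)) * (2 * L) := by
        rw [lintegral_lintegral_swap hm.aemeasurable]
    _ = L * L * (2 * L) := by
        have : ∀ z, ∫⁻ w, (q (w - z)) ^ (4 / 3 : ℝ) * q z ^ (4 / 3 : ℝ) = L * q z ^ (4 / 3 : ℝ) :=
          fun z => by
            rw [lintegral_mul_const _ (show Measurable fun w => q (w - z) ^ (4 / 3 : ℝ) from
              (hp _).comp (measurable_id.sub_const z)),
              lintegral_sub_right_eq_self (fun w => q w ^ (4 / 3 : ℝ)) z]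
        simp_rw [this]
        rw [lintegral_const_mul _ (hp _)]
    _ = _ := by ring

/-- Two convolutions with `q` are one convolution with `q * q`, which is in `L²`; Cauchy-Schwarz
then gives a bound at every point. -/
lemma lconv_lconv_sq_le {q u : Plane → ℝ≥0∞} (hq : Measurable q) (hu : Measurable u) (x : Plane) :
    lconv q (lconv q u) x ^ 2 ≤ 2 * (∫⁻ w, q w ^ (4 / 3 : ℝ)) ^ 3 * ∫⁻ y, u y ^ 2 := by
  have h1 : lconv q (lconv q u) x = ∫⁻ y, lconv q q (x - y) * u y := by
    have hm : Measurable fun p : Plane × Plane => q (x - p.1) * (q (p.1 - p.2) * u p.2) := by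
      fun_prop
    calc _ = ∫⁻ z, ∫⁻ y, q (x - z) * (q (z - y) * u y) := by
          refine lintegral_congr fun z => ?_
          rw [lconv, lintegral_const_mul _ (by fun_prop)]
      _ = ∫⁻ y, ∫⁻ z, q (x - z) * (q (z - y) * u y) := lintegral_lintegral_swap hm.aemeasurable
      _ = _ := by
          refine lintegral_congr fun y => ?_
          rw [lconv, ← lintegral_mul_const _ (by fun_prop), ← lintegral_add_right_eq_self _ y]
          refine lintegral_congr fun z => ?_
          rw [add_sub_cancel_right, ← mul_assoc, sub_add_eq_sub_sub_swap]
  rw [h1]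
  refine (sq_lintegral_mul_le volume ((measurable_lconv hq hq).comp
    (measurable_id.const_sub x)).aemeasurable hu.aemeasurable).trans ?_
  gcongr
  refine le_trans (le_of_eq ?_) (lintegral_lconv_self_sq_le hq)
  exact lintegral_sub_left_eq_self (fun w => lconv q q w ^ 2) x

/-! ### The Hilbert-Schmidt bound -/

/-- The hypothesis says that evaluation of `X f` at `x` is a functional of norm at most `a x`. By
Bessel's inequality the sum of `|X v_i (x)|²` is at most `a x ^ 2`; integrate over `x`. -/
lemma sum_norm_sq_le_of_ae_le {X : L2 ℂ →L[ℂ] L2 ℂ} {a : Plane → ℝ} (ha : ∀ x, 0 ≤ a x)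
    (hi : Integrable (fun x => a x ^ 2) volume) (h : ∀ f : L2 ℂ, ∀ᵐ x, ‖X f x‖ ≤ a x * ‖f‖)
    {N : ℕ} {v : Fin N → L2 ℂ} (hv : Orthonormal ℂ v) :
    ∑ i, ‖X (v i)‖ ^ 2 ≤ ∫ x, a x ^ 2 := by
  have hcoe : ∀ c : EuclideanSpace ℂ (Fin N), ∀ᵐ x, X (∑ i, c i • v i) x
      = ∑ i, c i * X (v i) x := fun c => by
    rw [map_sum]
    have h1 : ∀ᵐ x, ∀ i, (c i • X (v i)) x = c i * X (v i) x := by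
      rw [ae_all_iff]
      intro i
      filter_upwards [Lp.coeFn_smul (c i) (X (v i))] with x hx
      rw [hx, Pi.smul_apply, smul_eq_mul]
    filter_upwards [h1, Lp.coeFn_finsetSum Finset.univ fun i => c i • X (v i)] with x hx hx'
    simp only [map_smul]
    rw [hx', Finset.sum_apply]
    exact Finset.sum_congr rfl fun i _ => hx i
  have hnorm : ∀ c : EuclideanSpace ℂ (Fin N), ‖∑ i, c i • v i‖ = ‖c‖ := fun c => by
    have h1 := hv.inner_sum c c Finset.univ
    have h2 : ‖∑ i, c i • v i‖ ^ 2 = ‖c‖ ^ 2 := by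
      rw [EuclideanSpace.norm_sq_eq]
      rw [inner_self_eq_norm_sq_to_K] at h1
      refine Complex.ofReal_injective ?_
      simp only [Complex.ofReal_pow, Complex.ofReal_sum]
      refine Eq.trans (by simp) (h1.trans (Finset.sum_congr rfl fun i _ => ?_))
      rw [mul_comm, Complex.mul_conj, Complex.normSq_eq_norm_sq]
      simp
    exact (pow_left_inj₀ (norm_nonneg _) (norm_nonneg _) two_ne_zero).1 h2
  have hae : ∀ᵐ x, ∑ i, ‖X (v i) x‖ ^ 2 ≤ a x ^ 2 := by
    -- The exceptional null set in `h` depends on `f`. Only countably many linear combinations are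
    -- tested, and continuity in the coefficients covers the rest.
    have hd : ∀ᵐ x, ∀ n, ‖∑ i, TopologicalSpace.denseSeq (EuclideanSpace ℂ (Fin N)) n i * X (v i) x‖
        ≤ a x * ‖TopologicalSpace.denseSeq (EuclideanSpace ℂ (Fin N)) n‖ := by
      rw [ae_all_iff]
      intro n
      filter_upwards [hcoe (TopologicalSpace.denseSeq _ n), h (∑ i,
        TopologicalSpace.denseSeq (EuclideanSpace ℂ (Fin N)) n i • v i)] with x h1 h2
      rwa [h1, hnorm] at h2
    filter_upwards [hd] with x hx
    have hall : ∀ c : EuclideanSpace ℂ (Fin N), ‖∑ i, c i * X (v i) x‖ ≤ a x * ‖c‖ := by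
      intro c
      refine (TopologicalSpace.denseRange_denseSeq (EuclideanSpace ℂ (Fin N))).induction_on
        (p := fun c => ‖∑ i, c i * X (v i) x‖ ≤ a x * ‖c‖) c ?_ hx
      exact isClosed_le (by fun_prop) (by fun_prop)
    -- The extremal choice of coefficients, turning the bound on linear combinations into one on the
    -- sum of squares.
    set y : EuclideanSpace ℂ (Fin N) := WithLp.toLp 2 fun i => conj (X (v i) x) with hy
    have hy2 : ‖y‖ ^ 2 = ∑ i, ‖X (v i) x‖ ^ 2 := by
      rw [EuclideanSpace.norm_sq_eq]
      exact Finset.sum_congr rfl fun i _ => by simp [hy]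
    have hsum : ∑ i, y i * X (v i) x = ((‖y‖ ^ 2 : ℝ) : ℂ) := by
      rw [hy2, Complex.ofReal_sum]
      refine Finset.sum_congr rfl fun i _ => ?_
      rw [mul_comm]
      change X (v i) x * conj (X (v i) x) = _
      rw [Complex.mul_conj, Complex.normSq_eq_norm_sq]
    have h1 := hall y
    rw [hsum, Complex.norm_real, Real.norm_of_nonneg (by positivity)] at h1
    rw [← hy2]
    have h2 : ‖y‖ ≤ a x := by
      rcases (norm_nonneg y).eq_or_lt with h0 | h0
      · rw [← h0]; exact ha x
      · rw [sq] at h1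
        exact le_of_mul_le_mul_right h1 h0
    gcongr
  have hsq : ∀ i, Integrable (fun x => ‖X (v i) x‖ ^ 2) volume ∧
      ∫ x, ‖X (v i) x‖ ^ 2 = ‖X (v i)‖ ^ 2 := fun i => by
    refine ⟨(Lp.memLp (X (v i))).integrable_norm_pow two_ne_zero, ?_⟩
    have h1 := inner_self_eq_norm_sq_to_K (𝕜 := ℂ) (X (v i))
    rw [inner_eq_integral] at h1
    refine Complex.ofReal_injective ?_
    refine Eq.trans ?_ (h1.trans (by simp))
    rw [← integral_complex_ofReal]
    refine integral_congr_ae (ae_of_all _ fun x => ?_)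
    simp only [Complex.mul_conj, Complex.normSq_eq_norm_sq]
  calc ∑ i, ‖X (v i)‖ ^ 2 = ∑ i, ∫ x, ‖X (v i) x‖ ^ 2 :=
        Finset.sum_congr rfl fun i _ => (hsq i).2.symm
    _ = ∫ x, ∑ i, ‖X (v i) x‖ ^ 2 := (integral_finsetSum _ fun i _ => (hsq i).1).symm
    _ ≤ _ := integral_mono_ae (integrable_finsetSum _ fun i _ => (hsq i).1) hi hae





/-! ### Schatten bound for weighted integral operators -/

/-- Completing the square: `N ‖w‖ ≤ b ‖w‖² / 2 + N² / (2 b)`. -/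
lemma one_add_pow_mul_singGauss_le {b : ℝ} (hb : 0 < b) (N : ℕ) (w : Plane) :
    (1 + ‖w‖) ^ N * singGauss b w ≤ Real.exp (N ^ 2 / (2 * b)) * singGauss (b / 2) w := by
  have h1 : (1 + ‖w‖) ^ N ≤ Real.exp (N * ‖w‖) := by
    rw [Real.exp_nat_mul]
    have := Real.add_one_le_exp ‖w‖
    gcongr
    linarith
  have h2 : Real.exp (N * ‖w‖) * Real.exp (-b * ‖w‖ ^ 2)
      ≤ Real.exp (N ^ 2 / (2 * b)) * Real.exp (-(b / 2) * ‖w‖ ^ 2) := by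
    rw [← Real.exp_add, ← Real.exp_add]
    refine Real.exp_le_exp.2 ?_
    have h3 : (N : ℝ) ^ 2 / (2 * b) + -(b / 2) * ‖w‖ ^ 2 - (N * ‖w‖ + -b * ‖w‖ ^ 2)
        = (N - b * ‖w‖) ^ 2 / (2 * b) := by field_simp; ring
    have h4 : 0 ≤ (N - b * ‖w‖) ^ 2 / (2 * b) := by positivity
    linarith
  have h0 : 0 ≤ 1 + ‖w‖⁻¹ := by positivity
  unfold singGauss
  calc _ ≤ Real.exp (N * ‖w‖) * ((1 + ‖w‖⁻¹) * Real.exp (-b * ‖w‖ ^ 2)) := by gcongr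
    _ = (1 + ‖w‖⁻¹) * (Real.exp (N * ‖w‖) * Real.exp (-b * ‖w‖ ^ 2)) := by ring
    _ ≤ (1 + ‖w‖⁻¹) * (Real.exp (N ^ 2 / (2 * b)) * Real.exp (-(b / 2) * ‖w‖ ^ 2)) := by gcongr
    _ = _ := by ring

lemma integrable_singGauss_rpow {b : ℝ} (hb : 0 < b) :
    Integrable (fun w => singGauss b w ^ (4 / 3 : ℝ)) volume := by
  have h1 := (integrable_exp_neg_sq (b := b * (4 / 3)) (by positivity)).add
    (integrable_norm_rpow_mul_exp (s := -(4 / 3)) (b := b * (4 / 3)) (by norm_num) (by positivity))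
  refine (h1.const_mul (2 ^ (4 / 3 : ℝ))).mono'
    ((measurable_singGauss b).pow_const _).aestronglyMeasurable (ae_of_all _ fun w => ?_)
  have h0 := singGauss_nonneg b w
  rw [Real.norm_of_nonneg (by positivity), singGauss, Real.mul_rpow (by positivity)
    (Real.exp_pos _).le, ← Real.exp_mul]
  have h2 : (1 + ‖w‖⁻¹) ^ (4 / 3 : ℝ) ≤ 2 ^ (4 / 3 : ℝ) * (1 + ‖w‖ ^ (-(4 / 3) : ℝ)) := by
    have e : ‖w‖ ^ (-(4 / 3) : ℝ) = ‖w‖⁻¹ ^ (4 / 3 : ℝ) := by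
      rw [Real.rpow_neg (norm_nonneg _), Real.inv_rpow (norm_nonneg _)]
    have hn : 0 ≤ ‖w‖⁻¹ := by positivity
    rw [e]
    rcases le_total ‖w‖⁻¹ 1 with h | h
    · calc _ ≤ (2 : ℝ) ^ (4 / 3 : ℝ) := by gcongr; linarith
        _ ≤ _ := le_mul_of_one_le_right (by positivity) (by
          linarith [Real.rpow_nonneg hn (4 / 3 : ℝ)])
    · calc _ ≤ (2 * ‖w‖⁻¹) ^ (4 / 3 : ℝ) := by gcongr; linarith
        _ = 2 ^ (4 / 3 : ℝ) * ‖w‖⁻¹ ^ (4 / 3 : ℝ) := Real.mul_rpow (by norm_num) hn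
        _ ≤ _ := by gcongr; linarith
  have e2 : -b * ‖w‖ ^ 2 * (4 / 3) = -(b * (4 / 3)) * ‖w‖ ^ 2 := by ring
  rw [e2]
  refine (mul_le_mul_of_nonneg_right h2 (Real.exp_pos _).le).trans (le_of_eq ?_)
  simp only [Pi.add_apply]
  ring

lemma singGauss_neg (b : ℝ) (w : Plane) : singGauss b (-w) = singGauss b w := by
  simp [singGauss]

/-- Peetre's inequality `1 + ‖x‖ ≤ (1 + ‖z‖) (1 + ‖x - z‖)`, raised to the power `ε`; as `ε ≤ 1`,
the last factor may be kept to first power, so that only integer powers occur later. -/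
lemma wt_le_mul {ε : ℝ} (hε : 0 ≤ ε) (hε1 : ε ≤ 1) (x z : Plane) :
    wt ε z ≤ wt ε x * (1 + ‖x - z‖) := by
  have hz : 0 < 1 + ‖z‖ := by positivity
  have hx : 0 < 1 + ‖x‖ := by positivity
  have hxz : 0 < 1 + ‖x - z‖ := by positivity
  have h1 : 1 + ‖x‖ ≤ (1 + ‖z‖) * (1 + ‖x - z‖) := by
    have : ‖x‖ ≤ ‖z‖ + ‖x - z‖ := by simpa using norm_add_le z (x - z)
    nlinarith [norm_nonneg z, norm_nonneg (x - z)]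
  unfold wt
  rw [Real.rpow_neg hz.le, Real.rpow_neg hx.le, ← div_eq_inv_mul, inv_eq_one_div,
    div_le_div_iff₀ (by positivity) (by positivity), one_mul]
  calc (1 + ‖x‖) ^ ε ≤ ((1 + ‖z‖) * (1 + ‖x - z‖)) ^ ε := by gcongr
    _ = (1 + ‖z‖) ^ ε * (1 + ‖x - z‖) ^ ε := Real.mul_rpow hz.le hxz.le
    _ ≤ (1 + ‖z‖) ^ ε * (1 + ‖x - z‖) := by
      gcongr
      exact Real.rpow_le_self_of_one_le (by linarith [norm_nonneg (x - z)]) hε1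
    _ = _ := mul_comm _ _

section Weighted

variable {ε b C : ℝ} {K : Plane → Plane → ℂ} {S : L2 ℂ →L[ℂ] L2 ℂ}

/-- Powers of the weight can be moved through the convolution with a Gaussian kernel. -/
lemma lintegral_singGauss_mul_wt_le (hε : 0 ≤ ε) (hε1 : ε ≤ 1) (hb : 0 < b) {j N : ℕ}
    (hj : j ≤ N) (U : Plane → ℝ≥0∞) (x : Plane) :
    ∫⁻ y, ENNReal.ofReal (singGauss b (x - y)) * (ENNReal.ofReal (C * wt ε y) ^ j * U y)
      ≤ ENNReal.ofReal (C * wt ε x) ^ j * lconv (fun w => ENNReal.ofReal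
        (Real.exp (N ^ 2 / (2 * b)) * singGauss (b / 2) w)) U x := by
  -- Here `ENNReal.ofReal` truncates the weights to zero, and only the case `j = 0` has any content.
  by_cases hC : C ≤ 0
  · rcases j.eq_zero_or_pos with rfl | hj0
    · simp only [pow_zero, one_mul, lconv]
      refine lintegral_mono fun y => ?_
      gcongr
      have := one_add_pow_mul_singGauss_le hb N (x - y)
      refine le_trans (le_mul_of_one_le_left (singGauss_nonneg _ _) ?_) this
      exact one_le_pow₀ (by linarith [norm_nonneg (x - y)])
    · have : ∀ y, ENNReal.ofReal (C * wt ε y) = 0 := fun y =>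
        ENNReal.ofReal_eq_zero.2 (mul_nonpos_of_nonpos_of_nonneg hC (wt_pos _ _).le)
      simp [this, hj0.ne']
  push Not at hC
  rw [lconv, ← lintegral_const_mul' _ _ (by finiteness)]
  refine lintegral_mono fun y => ?_
  have hw := wt_le_mul hε hε1 x y
  have h0 := wt_pos ε x
  calc _ = (ENNReal.ofReal (singGauss b (x - y)) * ENNReal.ofReal (C * wt ε y) ^ j) * U y := by ring
    _ ≤ (ENNReal.ofReal (C * wt ε x) ^ j * ENNReal.ofReal
        (Real.exp (N ^ 2 / (2 * b)) * singGauss (b / 2) (x - y))) * U y := by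
      gcongr ?_ * U y
      rw [← ENNReal.ofReal_pow (mul_pos hC (wt_pos _ _)).le, ← ENNReal.ofReal_pow (by positivity),
        ← ENNReal.ofReal_mul (singGauss_nonneg _ _), ← ENNReal.ofReal_mul (by positivity)]
      refine ENNReal.ofReal_le_ofReal ?_
      have h1 : (C * wt ε y) ^ j ≤ (C * wt ε x) ^ j * (1 + ‖x - y‖) ^ N := by
        calc (C * wt ε y) ^ j ≤ (C * wt ε x * (1 + ‖x - y‖)) ^ j := by
              have := (wt_pos ε y).le
              refine pow_le_pow_left₀ (by positivity) ?_ _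
              rw [mul_assoc]
              gcongr
          _ = (C * wt ε x) ^ j * (1 + ‖x - y‖) ^ j := mul_pow _ _ _
          _ ≤ _ := by
              gcongr
              linarith [norm_nonneg (x - y)]
      calc _ ≤ singGauss b (x - y) * ((C * wt ε x) ^ j * (1 + ‖x - y‖) ^ N) :=
            mul_le_mul_of_nonneg_left h1 (singGauss_nonneg _ _)
        _ = (C * wt ε x) ^ j * ((1 + ‖x - y‖) ^ N * singGauss b (x - y)) := by ring
        _ ≤ _ := by
            exact mul_le_mul_of_nonneg_left (one_add_pow_mul_singGauss_le hb N _) (by positivity)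
    _ = _ := by ring

/-- An application of `S` brings one weight in the output variable, one of `S*` a weight in the
integration variable; either way all weights collected so far are moved to the output. At most `N`
weights are ever moved, so one kernel `q` with half the Gaussian rate serves all steps. -/
lemma enorm_starPow_le (hε : 0 ≤ ε) (hε1 : ε ≤ 1) (hb : 0 < b) (hC : 0 ≤ C) (hS : HasKer S K)
    (hK : StronglyMeasurable (Function.uncurry K))
    (hbd : ∀ x y, ‖K x y‖ ≤ C * wt ε x * singGauss b (x - y)) (N : ℕ) (f : L2 ℂ) (m : ℕ)
    (hm : 2 * m ≤ N) :
    ∀ᵐ x, ‖starPow S m f x‖ₑ ≤ ENNReal.ofReal (C * wt ε x) ^ (2 * m) *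
      (lconv fun w => ENNReal.ofReal (Real.exp (N ^ 2 / (2 * b)) * singGauss (b / 2) w))^[2 * m]
        (fun y => ‖f y‖ₑ) x := by
  set q : Plane → ℝ≥0∞ :=
    fun w => ENNReal.ofReal (Real.exp (N ^ 2 / (2 * b)) * singGauss (b / 2) w) with hq
  have hadj := hS.adjoint (k := fun w => C * singGauss b w) hK ((measurable_singGauss b).const_mul C)
    ((integrable_singGauss hb).const_mul C) fun x y => (hbd x y).trans (by
      have := wt_le_one hε x
      have h2 := singGauss_nonneg b (x - y)
      calc _ ≤ C * 1 * singGauss b (x - y) := by gcongr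
        _ = _ := by ring)
  have hb1 : ∀ x y, ‖K x y‖ₑ ≤ ENNReal.ofReal (C * wt ε x) * ENNReal.ofReal (singGauss b (x - y)) :=
    fun x y => by
      rw [← ENNReal.ofReal_mul (mul_nonneg hC (wt_pos _ _).le), ← ofReal_norm]
      exact ENNReal.ofReal_le_ofReal (hbd x y)
  have hb2 : ∀ x y, ‖conj (K y x)‖ₑ
      ≤ ENNReal.ofReal (C * wt ε y) * ENNReal.ofReal (singGauss b (x - y)) :=
    fun x y => by
      rw [← singGauss_neg, neg_sub, ← ofReal_norm, RCLike.norm_conj, ofReal_norm]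
      exact hb1 y x
  induction m with
  | zero => exact ae_of_all _ fun x => by simp [starPow]
  | succ m ih =>
    have ih := ih (by omega)
    set U := (lconv q)^[2 * m] (fun y => ‖f y‖ₑ) with hU
    have e : 2 * (m + 1) = 2 * m + 1 + 1 := by ring
    have h1 : ∀ᵐ x, ‖S (starPow S m f) x‖ₑ
        ≤ ENNReal.ofReal (C * wt ε x) ^ (2 * m + 1) * lconv q U x := by
      filter_upwards [hS.enorm_le hb1 (starPow S m f)] with x hx
      refine hx.trans ?_
      calc _ ≤ ∫⁻ y, ENNReal.ofReal (C * wt ε x) * (ENNReal.ofReal (singGauss b (x - y))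
              * (ENNReal.ofReal (C * wt ε y) ^ (2 * m) * U y)) := by
            refine lintegral_mono_ae ?_
            filter_upwards [ih] with y hy
            rw [mul_assoc]
            gcongr
        _ ≤ _ := by
            rw [lintegral_const_mul' _ _ (by finiteness), pow_succ', mul_assoc]
            gcongr
            exact lintegral_singGauss_mul_wt_le hε hε1 hb (by omega) U x
    rw [starPow_succ, e, Function.iterate_succ_apply', Function.iterate_succ_apply', ← hU]
    filter_upwards [hadj.enorm_le hb2 (S (starPow S m f))] with x hx
    refine hx.trans ?_
    calc _ ≤ ∫⁻ y, (ENNReal.ofReal (singGauss b (x - y))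
            * (ENNReal.ofReal (C * wt ε y) ^ (2 * m + 1 + 1) * lconv q U y)) := by
          refine lintegral_mono_ae ?_
          filter_upwards [h1] with y hy
          calc _ ≤ ENNReal.ofReal (C * wt ε y) * ENNReal.ofReal (singGauss b (x - y))
                * (ENNReal.ofReal (C * wt ε y) ^ (2 * m + 1) * lconv q U y) := by gcongr
            _ = _ := by ring
      _ ≤ _ := lintegral_singGauss_mul_wt_le hε hε1 hb (by omega) _ x

/-- `(S* S)^n` maps into weighted bounded functions. -/
lemma exists_norm_starPow_le (hε : 0 ≤ ε) (hε1 : ε ≤ 1) (hb : 0 < b) {n : ℕ} (hn : n ≠ 0) :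
    ∃ A : ℝ, 0 ≤ A ∧ ∀ (C : ℝ) (K : Plane → Plane → ℂ) (S : L2 ℂ →L[ℂ] L2 ℂ), 0 ≤ C → HasKer S K →
      StronglyMeasurable (Function.uncurry K) →
      (∀ x y, ‖K x y‖ ≤ C * wt ε x * singGauss b (x - y)) → ∀ f : L2 ℂ,
      ∀ᵐ x, ‖starPow S n f x‖ ≤ (C * wt ε x) ^ (2 * n) * A * ‖f‖ := by
  set q : Plane → ℝ≥0∞ := fun w => ENNReal.ofReal
    (Real.exp ((2 * n : ℕ) ^ 2 / (2 * b)) * singGauss (b / 2) w) with hq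
  have hqm : Measurable q := ((measurable_singGauss _).const_mul _).ennreal_ofReal
  have hq1 : ∫⁻ w, q w ≠ ⊤ :=
    ((integrable_singGauss (half_pos hb)).const_mul _).lintegral_lt_top.ne
  have hq2 : ∫⁻ w, q w ^ (4 / 3 : ℝ) ≠ ⊤ := by
    have h1 := ((integrable_singGauss_rpow (half_pos hb)).const_mul
      (Real.exp ((2 * n : ℕ) ^ 2 / (2 * b)) ^ (4 / 3 : ℝ))).lintegral_lt_top.ne
    convert h1 using 3 with w
    have h0 := singGauss_nonneg (b / 2) w
    rw [hq, ← Real.mul_rpow (Real.exp_pos _).le h0, ENNReal.ofReal_rpow_of_nonneg (by positivity)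
      (by norm_num)]
  set L := 2 * (∫⁻ w, q w ^ (4 / 3 : ℝ)) ^ 3 * ((∫⁻ w, q w) ^ 2) ^ (2 * n - 2) with hL
  have hLt : L ≠ ⊤ := by
    rw [hL]
    finiteness
  refine ⟨√L.toReal, Real.sqrt_nonneg _, fun C K S hC hS hK hbd f => ?_⟩
  filter_upwards [enorm_starPow_le hε hε1 hb hC hS hK hbd (2 * n) f n le_rfl] with x hx
  have hfm : Measurable fun y => ‖f y‖ₑ := (Lp.stronglyMeasurable f).measurable.enorm
  -- The first `2n - 2` convolutions are bounded on `L²` by Young's inequality; the last two map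
  -- into `L^∞`.
  have e : 2 * n = (2 * n - 2) + 1 + 1 := by omega
  have h1 : ((lconv q)^[2 * n] (fun y => ‖f y‖ₑ) x) ^ 2 ≤ L * ‖f‖ₑ ^ 2 := by
    rw [e, Function.iterate_succ_apply', Function.iterate_succ_apply']
    refine (lconv_lconv_sq_le hqm (measurable_lconv_iterate hqm hfm _) x).trans ?_
    rw [hL, mul_assoc, ← lintegral_enorm_sq]
    rw [mul_assoc (2 : ℝ≥0∞), mul_assoc (2 : ℝ≥0∞), mul_assoc]
    exact mul_le_mul_right (mul_le_mul_right (lintegral_lconv_iterate_sq_le hqm hfm _) _) _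
  have h2 : (lconv q)^[2 * n] (fun y => ‖f y‖ₑ) x ≤ ENNReal.ofReal (√L.toReal * ‖f‖) := by
    refine (ENNReal.pow_le_pow_left_iff two_ne_zero).1 (h1.trans ?_)
    rw [← ENNReal.ofReal_pow (by positivity), mul_pow, Real.sq_sqrt ENNReal.toReal_nonneg,
      ENNReal.ofReal_mul ENNReal.toReal_nonneg, ENNReal.ofReal_toReal hLt,
      ENNReal.ofReal_pow (norm_nonneg _), ofReal_norm]
  have hw : 0 ≤ C * wt ε x := mul_nonneg hC (wt_pos _ _).le
  have h3 : ‖starPow S n f x‖ₑ ≤ ENNReal.ofReal ((C * wt ε x) ^ (2 * n) * √L.toReal * ‖f‖) := by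
    rw [mul_assoc, ENNReal.ofReal_mul (by positivity), ENNReal.ofReal_pow hw]
    exact hx.trans (mul_le_mul_right h2 _)
  rw [← ofReal_norm] at h3
  exact (ENNReal.ofReal_le_ofReal_iff (by positivity)).1 h3

lemma wt_pow (ε : ℝ) (n : ℕ) (x : Plane) : wt ε x ^ n = wt (n * ε) x := by
  rw [wt, wt, ← Real.rpow_natCast, ← Real.rpow_mul (by positivity)]
  ring_nf

lemma integrable_wt {ρ : ℝ} (hρ : 2 < ρ) : Integrable (wt ρ) volume :=
  integrable_one_add_norm (by rw [finrank_plane]; exact_mod_cast hρ)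

/-- The pointwise bound on `(S* S)^n f` has the square `wt (4 n ε)` up to constants, integrable in
the plane since `4 n ε > 2`. This makes `(S* S)^n` Hilbert-Schmidt, and `norm_pow_le_norm_starPow`
converts its Hilbert-Schmidt bound into the bound on the sum of `‖S v_i‖^{4n}`. -/
lemma exists_schattenNorm_le (hε : 0 ≤ ε) (hε1 : ε ≤ 1) (hb : 0 < b) {n : ℕ} (hn : n ≠ 0)
    (hnε : 1 < 2 * n * ε) :
    ∃ D : ℝ, 0 ≤ D ∧ ∀ (C : ℝ) (K : Plane → Plane → ℂ) (S : L2 ℂ →L[ℂ] L2 ℂ), 0 ≤ C → HasKer S K →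
      StronglyMeasurable (Function.uncurry K) →
      (∀ x y, ‖K x y‖ ≤ C * wt ε x * singGauss b (x - y)) →
      MemSchatten (4 * (n : ℝ)) S ∧ schattenNorm (4 * (n : ℝ)) S ≤ ENNReal.ofReal (D * C) := by
  obtain ⟨A, hA, H⟩ := exists_norm_starPow_le hε hε1 hb hn
  have hint := integrable_wt (ρ := 4 * n * ε) (by linarith)
  have hi0 : 0 ≤ ∫ x, wt (4 * n * ε) x := integral_nonneg fun x => (wt_pos _ x).le
  -- The summand `1` gives `D ≤ D ^ (4 n)`, so no root has to be extracted.
  set D := 1 + A ^ 2 * ∫ x, wt (4 * n * ε) x with hD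
  have hD1 : 1 ≤ D := by rw [hD]; nlinarith [sq_nonneg A]
  refine ⟨D, by linarith, fun C K S hC hS hK hbd => ?_⟩
  have hsq : ∀ x, ((C * wt ε x) ^ (2 * n) * A) ^ 2 = C ^ (4 * n) * A ^ 2 * wt (4 * n * ε) x :=
    fun x => by
      have : wt (4 * n * ε) x = wt ε x ^ (4 * n) := by rw [wt_pow]; push_cast; rfl
      rw [this]
      ring
  have hsum : ∀ (N : ℕ) (v : Fin N → L2 ℂ), Orthonormal ℂ v →
      ∑ i, ‖S (v i)‖ ^ (4 * n) ≤ (D * C) ^ (4 * n) := by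
    intro N v hv
    set X : L2 ℂ →L[ℂ] L2 ℂ := (ContinuousLinearMap.adjoint S ∘L S) ^ n with hX
    have hXS : ∀ u, X u = starPow S n u := fun u => by
      rw [hX, FunLike.coe_pow_eq_iterate]
      rfl
    have h1 := sum_norm_sq_le_of_ae_le (X := X) (a := fun x => (C * wt ε x) ^ (2 * n) * A)
      (fun x => by have := (wt_pos ε x).le; positivity)
      (by simp_rw [hsq]; exact hint.const_mul _)
      (fun f => by rw [hXS]; exact H C K S hC hS hK hbd f) hv
    simp_rw [hsq] at h1
    rw [integral_const_mul] at h1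
    calc _ ≤ ∑ i, ‖X (v i)‖ ^ 2 := Finset.sum_le_sum fun i _ => by
          rw [hXS]
          calc ‖S (v i)‖ ^ (4 * n) = (‖S (v i)‖ ^ (2 * n)) ^ 2 := by ring
            _ ≤ _ := by
              gcongr
              exact (norm_pow_le_norm_starPow S (hv.1 i) n).2.2
      _ ≤ _ := h1
      _ ≤ C ^ (4 * n) * D := by
          rw [mul_assoc]
          gcongr
          rw [hD]; linarith
      _ ≤ C ^ (4 * n) * D ^ (4 * n) := by
          gcongr
          exact le_self_pow₀ hD1 (by omega)
      _ = _ := by rw [mul_pow, mul_comm]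
  have hp : 4 * n ≠ 0 := by omega
  have h2 := schattenNorm_le_of_sum_le hp (mul_nonneg (by linarith) hC) hsum
  push_cast at h2
  exact ⟨⟨isCompactOperator_of_sum_le hp hsum, h2.trans_lt ENNReal.ofReal_lt_top⟩, h2⟩

end Weighted





/-! ### First order operators composed with twisted convolutions -/

/-- Kernel bounds are needed at every point, so an almost everywhere bounded function is replaced by
a measurable representative cut to zero where the bound fails. -/
lemma WtBdd.exists_measurable {ρ C : ℝ} (hC : 0 ≤ C) {f : Plane → ℝ} (h : WtBdd ρ C f) :
    ∃ f' : Plane → ℝ, Measurable f' ∧ f =ᵐ[volume] f' ∧ ∀ x, |f' x| ≤ C * wt ρ x := by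
  obtain ⟨hm, hb⟩ := h
  set h' := hm.mk f with hh'
  have hms : MeasurableSet {x | |h' x| ≤ C * wt ρ x} :=
    measurableSet_le (hm.stronglyMeasurable_mk.measurable.norm)
      ((continuous_wt ρ).measurable.const_mul C)
  refine ⟨{x | |h' x| ≤ C * wt ρ x}.indicator h',
    hm.stronglyMeasurable_mk.measurable.indicator hms, ?_, fun x => ?_⟩
  · filter_upwards [hm.ae_eq_mk, hb] with x hx hx'
    rw [Set.indicator_of_mem]
    · exact hx
    · rwa [Set.mem_ofPred_eq, hh', ← hx]
  · by_cases hx : x ∈ {x | |h' x| ≤ C * wt ρ x}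
    · rw [Set.indicator_of_mem hx]; exact hx
    · rw [Set.indicator_of_notMem hx, abs_zero]
      exact mul_nonneg hC (wt_pos _ _).le

open Classical in
/-- The kernel of `∑ k, α k * T_k + β * T`, where `T_k` and `T` are the twisted convolutions with
`d k` and `g`; it is set to zero on the diagonal. -/
def combKer (B₀ : ℝ) (α : Fin 2 → Plane → ℂ) (β : Plane → ℂ) (g : Plane → ℂ)
    (d : Fin 2 → Plane → ℂ) (x y : Plane) : ℂ :=
  if x = y then 0 else ∑ k, α k x * twKer B₀ (d k) x y + β x * twKer B₀ g x y

section Comb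

variable {B₀ ε b G Q : ℝ} {x₀ : Plane} {g : Plane → ℂ} {d : Fin 2 → Plane → ℂ}
  {α : Fin 2 → Plane → ℂ} {β : Plane → ℂ}

lemma stronglyMeasurable_twKer {h : Plane → ℂ} (hh : StronglyMeasurable h) :
    StronglyMeasurable fun p : Plane × Plane => twKer B₀ h p.1 p.2 :=
  (continuous_phase B₀).stronglyMeasurable.mul
    (hh.comp_measurable (measurable_fst.sub measurable_snd))

lemma stronglyMeasurable_combKer (h : IsMagKer B₀ b G g d) (hα : ∀ k, Measurable (α k))
    (hβ : Measurable β) : StronglyMeasurable (Function.uncurry (combKer B₀ α β g d)) := by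
  classical
  have h1 : ∀ {a : Plane → ℂ} {h : Plane → ℂ}, Measurable a → StronglyMeasurable h →
      StronglyMeasurable fun p : Plane × Plane => a p.1 * twKer B₀ h p.1 p.2 := fun ha hh =>
    (ha.comp measurable_fst).stronglyMeasurable.mul (stronglyMeasurable_twKer hh)
  unfold Function.uncurry combKer
  refine StronglyMeasurable.ite (measurableSet_eq_fun measurable_fst measurable_snd)
    stronglyMeasurable_const (StronglyMeasurable.add ?_ (h1 hβ h.sm))
  exact Finset.stronglyMeasurable_fun_sum _ fun k _ => h1 (hα k) (h.smd k)

lemma norm_combKer_le (h : IsMagKer B₀ b G g d) (hG : 0 ≤ G) (hQ : 0 ≤ Q)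
    (hα : ∀ k x, ‖α k x‖ ≤ Q * wt ε (x + x₀)) (hβ : ∀ x, ‖β x‖ ≤ Q * wt ε (x + x₀))
    (x y : Plane) :
    ‖combKer B₀ α β g d x y‖ ≤ 3 * Q * G * wt ε (x + x₀) * singGauss b (x - y) := by
  have hw := (wt_pos ε (x + x₀)).le
  have hs := singGauss_nonneg b (x - y)
  unfold combKer
  split_ifs with hxy
  · rw [norm_zero]
    positivity
  · have hne : x - y ≠ 0 := sub_ne_zero.2 hxy
    have h1 : ∀ {a h : Plane → ℂ}, ‖a x‖ ≤ Q * wt ε (x + x₀) →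
        ‖h (x - y)‖ ≤ G * singGauss b (x - y) →
        ‖a x * twKer B₀ h x y‖ ≤ Q * wt ε (x + x₀) * (G * singGauss b (x - y)) := fun ha hh => by
      rw [norm_mul, twKer, norm_mul, norm_phase, one_mul]
      gcongr
    rw [Fin.sum_univ_two]
    refine (norm_add₃_le).trans ?_
    have e0 := h1 (hα 0 x) (h.bdd 0 _ hne)
    have e1 := h1 (hα 1 x) (h.bdd 1 _ hne)
    have e2 := h1 (hβ x) (h.bd _ hne)
    linarith

lemma integral_combKer (hb : 0 < b) (h : IsMagKer B₀ b G g d) (f : L2 ℂ) :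
    ∀ᵐ x, ∫ y, f y • combKer B₀ α β g d x y
      = ∑ k, α k x * twOp B₀ (d k) f x + β x * twOp B₀ g f x := by
  have h0 := hasKer_twOp B₀ h.sm (h.integrable hb) f
  have h1 : ∀ᵐ x, ∀ k, Integrable (fun y => f y • twKer B₀ (d k) x y) volume ∧
      twOp B₀ (d k) f x = ∫ y, f y • twKer B₀ (d k) x y :=
    ae_all_iff.2 fun k => hasKer_twOp B₀ (h.smd k) (h.integrable_d hb k) f
  filter_upwards [h0, h1] with x hx hx'
  rw [hx.2]
  simp_rw [(hx' _).2]
  have hne : ∀ᵐ y : Plane, x ≠ y := by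
    have : {y : Plane | ¬ x ≠ y} = {x} := by ext y; simp [eq_comm]
    rw [ae_iff, this, measure_singleton]
  simp_rw [← integral_const_mul]
  rw [← integral_finsetSum _ fun k _ => (hx' k).1.const_mul _, ← integral_add
    (integrable_finsetSum _ fun k _ => (hx' k).1.const_mul _) (hx.1.const_mul _)]
  refine integral_congr_ae ?_
  filter_upwards [hne] with y hy
  simp only [combKer, if_neg hy, smul_eq_mul]
  rw [mul_add, Finset.mul_sum, mul_left_comm]
  congr 1
  exact Finset.sum_congr rfl fun k _ => mul_left_comm _ _ _

/-- The scalar operator `∑ k, α k * T_k + β * T`. -/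
lemma exists_combOp (hε : 0 ≤ ε) (hb : 0 < b) (h : IsMagKer B₀ b G g d) (hG : 0 ≤ G) (hQ : 0 ≤ Q)
    (hαm : ∀ k, Measurable (α k)) (hβm : Measurable β)
    (hα : ∀ k x, ‖α k x‖ ≤ Q * wt ε (x + x₀)) (hβ : ∀ x, ‖β x‖ ≤ Q * wt ε (x + x₀)) :
    ∃ S : L2 ℂ →L[ℂ] L2 ℂ, HasKer S (combKer B₀ α β g d) ∧
      ∀ f, ∀ᵐ x, S f x = ∑ k, α k x * twOp B₀ (d k) f x + β x * twOp B₀ g f x := by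
  obtain ⟨S, hS, -⟩ := exists_hasKer (k := fun w => 3 * Q * G * singGauss b w)
    (stronglyMeasurable_combKer h hαm hβm) ((measurable_singGauss b).const_mul _)
    ((integrable_singGauss hb).const_mul _) fun x y =>
      (norm_combKer_le (ε := ε) (x₀ := x₀) h hG hQ hα hβ x y).trans (by
        have := wt_le_one hε (x + x₀)
        have h2 := singGauss_nonneg b (x - y)
        calc _ ≤ 3 * Q * G * 1 * singGauss b (x - y) := by gcongr
          _ = _ := by ring)
  refine ⟨S, hS, fun f => ?_⟩
  filter_upwards [hS f, integral_combKer (α := α) (β := β) hb h f] with x hx hx'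
  rw [hx.2, hx']

/-- The tensor valued kernel with components `combKer`. -/
def combTens (B₀ : ℝ) {m : ℕ} (α : (Fin m → Fin 2) → Fin 2 → Plane → ℂ)
    (β : (Fin m → Fin 2) → Plane → ℂ) (g : Plane → ℂ) (d : Fin 2 → Plane → ℂ)
    (x y : Plane) : Tens m :=
  WithLp.toLp 2 fun θ => combKer B₀ (α θ) (β θ) g d x y

/-- There are `2 ^ m` components; the square root of this number is not exploited. -/
lemma norm_tens_le {m : ℕ} (v : Tens m) {A : ℝ} (hA : 0 ≤ A) (hv : ∀ θ, ‖v θ‖ ≤ A) :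
    ‖v‖ ≤ 2 ^ m * A := by
  refine le_of_sq_le_sq ?_ (by positivity)
  rw [EuclideanSpace.norm_sq_eq]
  calc ∑ θ, ‖v θ‖ ^ 2 ≤ ∑ θ : Fin m → Fin 2, A ^ 2 := Finset.sum_le_sum fun θ _ => by
        gcongr; exact hv θ
    _ = 2 ^ m * A ^ 2 := by simp
    _ ≤ (2 ^ m) ^ 2 * A ^ 2 := by
        gcongr
        exact le_self_pow₀ (one_le_pow₀ one_le_two) two_ne_zero
    _ = _ := by ring

variable {m : ℕ} {αt : (Fin m → Fin 2) → Fin 2 → Plane → ℂ} {βt : (Fin m → Fin 2) → Plane → ℂ}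

lemma stronglyMeasurable_combTens (h : IsMagKer B₀ b G g d) (hα : ∀ θ k, Measurable (αt θ k))
    (hβ : ∀ θ, Measurable (βt θ)) :
    StronglyMeasurable (Function.uncurry (combTens B₀ αt βt g d)) := by
  unfold Function.uncurry combTens
  refine (PiLp.continuous_toLp 2 _).comp_stronglyMeasurable ?_
  exact (measurable_pi_lambda _ fun θ =>
    (stronglyMeasurable_combKer h (hα θ) (hβ θ)).measurable).stronglyMeasurable

lemma norm_combTens_le (h : IsMagKer B₀ b G g d) (hG : 0 ≤ G) (hQ : 0 ≤ Q)
    (hα : ∀ θ k x, ‖αt θ k x‖ ≤ Q * wt ε (x + x₀)) (hβ : ∀ θ x, ‖βt θ x‖ ≤ Q * wt ε (x + x₀))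
    (x y : Plane) :
    ‖combTens B₀ αt βt g d x y‖ ≤ 2 ^ m * (3 * Q * G) * wt ε (x + x₀) * singGauss b (x - y) := by
  have hw := (wt_pos ε (x + x₀)).le
  have hs := singGauss_nonneg b (x - y)
  rw [mul_assoc, mul_assoc, ← mul_assoc (3 * Q * G)]
  exact norm_tens_le _ (by positivity) fun θ => norm_combKer_le h hG hQ (hα θ) (hβ θ) x y

lemma isNice_of_norm_le {t : Plane → Plane → Tens m} {c : ℝ} (hb : 0 < b)
    (ht : StronglyMeasurable (Function.uncurry t))
    (hc : ∀ x y, ‖t x y‖ ≤ c * singGauss b (x - y)) : IsNice t := by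
  have hi := (integrable_singGauss hb).const_mul c
  have h1 : ∀ x, Integrable (fun y => c * singGauss b (x - y)) volume := fun x =>
    hi.comp_sub_left x
  have h2 : ∀ x, Integrable (fun y => c * singGauss b (y - x)) volume := fun x =>
    hi.comp_sub_right x
  have m1 : ∀ x, Integrable (fun y => t x y) volume := fun x => (h1 x).mono'
    (ht.comp_measurable measurable_prodMk_left).aestronglyMeasurable (ae_of_all _ fun y => hc x y)
  have m2 : ∀ x, Integrable (fun y => t y x) volume := fun x => (h2 x).mono'
    (ht.comp_measurable measurable_prodMk_right).aestronglyMeasurable (ae_of_all _ fun y => hc y x)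
  refine ⟨∫ w, c * singGauss b w, fun x => ⟨m1 x, m2 x, ?_, ?_⟩⟩
  · exact (integral_mono (m1 x).norm (h1 x) fun y => hc x y).trans_eq
      (integral_sub_left_eq_self (fun w => c * singGauss b w) volume x)
  · exact (integral_mono (m2 x).norm (h2 x) fun y => hc y x).trans_eq
      (integral_sub_right_eq_self (fun w => c * singGauss b w) x)

lemma HasKer.hasKernel {T : L2 ℂ →L[ℂ] L2 (Tens m)} {t : Plane → Plane → Tens m}
    (h : HasKer T t) (ht : StronglyMeasurable (Function.uncurry t)) : HasKernel T t := by
  refine ⟨ht.aestronglyMeasurable, fun f hf hs => ?_⟩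
  have hfL := hf.memLp_of_hasCompactSupport (p := 2) (μ := (volume : Measure Plane)) hs
  filter_upwards [h (hfL.toLp f)] with x hx
  have e : (fun y => (hfL.toLp f) y • t x y) =ᵐ[volume] fun y => f y • t x y := by
    filter_upwards [hfL.coeFn_toLp] with y hy
    rw [hy]
  exact ⟨hx.1.congr e, hx.2.trans (integral_congr_ae e)⟩

/-- The tensor valued operator with components `∑ k, α θ k * T_k + β θ * T`. -/
lemma exists_combTensOp (hε : 0 ≤ ε) (hb : 0 < b) (h : IsMagKer B₀ b G g d) (hG : 0 ≤ G)
    (hQ : 0 ≤ Q) (hαm : ∀ θ k, Measurable (αt θ k)) (hβm : ∀ θ, Measurable (βt θ))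
    (hα : ∀ θ k x, ‖αt θ k x‖ ≤ Q * wt ε (x + x₀)) (hβ : ∀ θ x, ‖βt θ x‖ ≤ Q * wt ε (x + x₀)) :
    ∃ T : L2 ℂ →L[ℂ] L2 (Tens m), HasKernel T (combTens B₀ αt βt g d) ∧
      IsNice (combTens B₀ αt βt g d) ∧
      ‖T‖ ≤ 2 ^ m * (3 * Q * G) * ∫ w, singGauss b w ∧
      ∀ f, ∀ᵐ x, ∀ θ, T f x θ
        = ∑ k, αt θ k x * twOp B₀ (d k) f x + βt θ x * twOp B₀ g f x := by
  have hsm := stronglyMeasurable_combTens h hαm hβm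
  have hle : ∀ x y, ‖combTens B₀ αt βt g d x y‖
      ≤ (fun w => 2 ^ m * (3 * Q * G) * singGauss b w) (x - y) := fun x y =>
    (norm_combTens_le (ε := ε) (x₀ := x₀) h hG hQ hα hβ x y).trans (by
      have := wt_le_one hε (x + x₀)
      have h2 := singGauss_nonneg b (x - y)
      calc _ ≤ 2 ^ m * (3 * Q * G) * 1 * singGauss b (x - y) := by gcongr
        _ = _ := by ring)
  obtain ⟨T, hT, hTn⟩ := exists_hasKer hsm ((measurable_singGauss b).const_mul _)
    ((integrable_singGauss hb).const_mul _) hle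
  rw [integral_const_mul] at hTn
  refine ⟨T, hT.hasKernel hsm, isNice_of_norm_le hb hsm hle, hTn, fun f => ?_⟩
  have h1 := ae_all_iff.2 fun θ => integral_combKer (α := αt θ) (β := βt θ) hb h f
  filter_upwards [hT f, h1] with x hx hx' θ
  rw [← hx' θ, hx.2]
  exact ((EuclideanSpace.proj θ : Tens m →L[ℂ] ℂ).integral_comp_comm hx.1).symm

end Comb

/-- Inside the disc of radius `1 / √B₀` the singularity is `b1` itself; outside it is at most `√B₀`
and is absorbed by the Gaussian. -/
lemma singGauss_le_b1 {B₀ b : ℝ} (hB : 0 < B₀) (hb : 0 < b) {x y : Plane} (hxy : x ≠ y) :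
    singGauss b (x - y) ≤ (1 + √B₀) * (b1 B₀ x y + Real.exp (-b * ‖x - y‖ ^ 2)) := by
  have h0 : 0 < ‖x - y‖ := norm_pos_iff.2 (sub_ne_zero.2 hxy)
  have hs := Real.sqrt_pos.2 hB
  have he : Real.exp (-b * ‖x - y‖ ^ 2) ≤ 1 := Real.exp_le_one_iff.2 (by
    have := mul_pos hb (pow_pos h0 2)
    linarith)
  have he0 := Real.exp_pos (-b * ‖x - y‖ ^ 2)
  have hi := inv_pos.2 h0
  unfold singGauss b1
  split_ifs with h
  · rw [one_div]
    nlinarith [mul_le_mul_of_nonneg_left he hi.le, mul_pos hs hi, mul_pos hs he0]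
  · have h1 : ‖x - y‖⁻¹ ≤ √B₀ := by
      rw [inv_le_comm₀ h0 hs, ← one_div]
      exact not_lt.1 h
    rw [zero_add]
    gcongr

/-! ### The operators of the theorem -/

section Main

variable {B₀ ε b G Q : ℝ} {B V : Plane → ℝ} {g : Plane → ℂ} {d : Fin 2 → Plane → ℂ}

lemma gaugeDeriv_eq {m : ℕ} (B : Plane → ℝ) (x₀ : Plane) (θ : Fin m → Fin 2) (k : Fin 2)
    (x : Plane) :
    gaugeDeriv B x₀ θ k x = (-Complex.I) ^ m * (bsConv k (weakDeriv θ B) (x + x₀) : ℂ) := by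
  unfold gaugeDeriv fieldDeriv bsConv
  rw [← integral_complex_ofReal, ← integral_const_mul]
  refine integral_congr_ae (ae_of_all _ fun y => ?_)
  simp only [sub_add_eq_add_sub, Complex.ofReal_mul, mul_assoc]

lemma norm_neg_I_pow (m : ℕ) : ‖(-Complex.I) ^ m‖ = 1 := by simp

lemma IsMagKer.isMagGrad (hb : 0 < b) (h : IsMagKer B₀ b G g d) (f : L2 ℂ) :
    IsMagGrad (gauge0 B₀) (twOp B₀ g f) fun k => twOp B₀ (d k) f :=
  h.mg.isMagGrad (h.integrable hb) (fun k => h.integrable_d hb k)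
    (hasKer_twOp B₀ h.sm (h.integrable hb))
    (fun k => hasKer_twOp B₀ (h.smd k) (h.integrable_d hb k)) f

/-- The weak magnetic gradient of `twOp B₀ g f` consists of the twisted convolutions with `d k`, so
multiplication by the shifted potentials acts directly on the kernels. -/
lemma exists_hepsDeriv (hε : 0 ≤ ε) (hb : 0 < b) (h : IsMagKer B₀ b G g d) (hG : 0 ≤ G)
    (hQ : 0 ≤ Q) {κ : ℝ} {m : ℕ} (x₀ : Plane)
    (hBm : ∀ θ : Fin m → Fin 2, AEStronglyMeasurable (weakDeriv θ B) volume)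
    (hBb : ∀ (θ : Fin m → Fin 2) k x, |κ| * |bsConv k (weakDeriv θ B) x| ≤ Q * wt ε x)
    (hW : ∀ θ : Fin m → Fin 2, WtBdd ε Q (weakDeriv θ (pseudoPot B V))) :
    ∃ T : L2 ℂ →L[ℂ] L2 (Tens m),
      (∀ f, IsHepsDeriv κ B₀ B V x₀ m (twOp B₀ g f) (T f)) ∧
      ‖T‖ ≤ 2 ^ m * (3 * Q * G) * ∫ w, singGauss b w ∧
      ∃ t : Plane → Plane → Tens m, HasKernel T t ∧ IsNice t ∧
        ∀ x y, ‖t x y‖ ≤ 2 ^ m * (3 * Q * G) * wt ε (x + x₀) * singGauss b (x - y) := by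
  choose W hWm hWe hWb using fun θ => (hW θ).exists_measurable hQ
  set α : (Fin m → Fin 2) → Fin 2 → Plane → ℂ := fun θ k x =>
    κ * ((-Complex.I) ^ m * (bsConv k (weakDeriv θ B) (x + x₀) : ℂ)) with hα
  set β : (Fin m → Fin 2) → Plane → ℂ := fun θ x => (-Complex.I) ^ m * (W θ (x + x₀) : ℂ) with hβ
  have hαm : ∀ θ k, Measurable (α θ k) := fun θ k => by
    have := (measurable_bsConv (hBm θ) k).comp (measurable_add_const x₀)
    exact ((Complex.measurable_ofReal.comp this).const_mul _).const_mul _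
  have hβm : ∀ θ, Measurable (β θ) := fun θ =>
    (Complex.measurable_ofReal.comp ((hWm θ).comp (measurable_add_const x₀))).const_mul _
  have hαb : ∀ θ k x, ‖α θ k x‖ ≤ Q * wt ε (x + x₀) := fun θ k x => by
    simpa only [hα, norm_mul, norm_neg_I_pow, one_mul, Complex.norm_real,
      Real.norm_eq_abs] using hBb θ k (x + x₀)
  have hβb : ∀ θ x, ‖β θ x‖ ≤ Q * wt ε (x + x₀) := fun θ x => by
    simpa only [hβ, norm_mul, norm_neg_I_pow, one_mul, Complex.norm_real,
      Real.norm_eq_abs] using hWb θ (x + x₀)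
  obtain ⟨T, hT, hTnice, hTn, hTf⟩ := exists_combTensOp hε hb h hG hQ hαm hβm hαb hβb
  refine ⟨T, fun f => ⟨fun k => twOp B₀ (d k) f, h.isMagGrad hb f, ?_⟩, hTn, _, hT, hTnice,
    norm_combTens_le h hG hQ hαb hβb⟩
  have hW' : ∀ᵐ x, ∀ θ, weakDeriv θ (pseudoPot B V) (x + x₀) = W θ (x + x₀) :=
    ae_all_iff.2 fun θ =>
      (measurePreserving_add_right volume x₀).quasiMeasurePreserving.ae_eq_comp (hWe θ)
  filter_upwards [hTf f, hW'] with x hx hx' θ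
  rw [hx θ, Finset.mul_sum]
  simp only [hα, hβ, gaugeDeriv_eq, potDeriv, hx' θ, mul_assoc]

lemma covDeriv_sub (a a' : Plane → Plane) (k : Fin 2) (φ : Plane → ℂ) (x : Plane) :
    covDeriv (fun x => a x - a' x) k φ x = covDeriv a k φ x + (a' x k : ℂ) * φ x := by
  simp only [covDeriv, PiLp.sub_apply, Complex.ofReal_sub]
  ring

lemma gauge_apply (B : Plane → ℝ) (x : Plane) (k : Fin 2) : gauge B x k = bsConv k B x := rfl

lemma pseudoPot_eq (B V : Plane → ℝ) (x : Plane) :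
    pseudoPot B V x = (∑ k, bsConv k B x ^ 2) + V x := by
  rw [pseudoPot, norm_sq_plane, Fin.sum_univ_two]
  rfl

lemma integrable_L2_mul_conj (u : L2 ℂ) {ψ : Plane → ℂ} (hψ : MemLp ψ 2 volume) :
    Integrable (fun x => u x * conj (ψ x)) volume :=
  (Lp.memLp u).integrable_mul (memLp_conj hψ)

lemma memLp_bdd_mul {a : Plane → ℝ} (ha : Measurable a) {A : ℝ} (hA : ∀ x, |a x| ≤ A)
    (u : L2 ℂ) : MemLp (fun x => (a x : ℂ) * u x) 2 volume := by
  refine ((Lp.memLp u).const_mul (A : ℂ)).mono ((Complex.measurable_ofReal.comp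
    ha).aestronglyMeasurable.mul (Lp.aestronglyMeasurable u)) (ae_of_all _ fun x => ?_)
  rw [norm_mul, norm_mul, Complex.norm_real, Complex.norm_real]
  gcongr
  exact (hA x).trans (le_abs_self A)

/-- The perturbed operator applied to `u` is the Landau operator applied to `u` plus first order
terms. -/
lemma isH_of_isMagGrad {u Y s : L2 ℂ} {v : Fin 2 → L2 ℂ} {W : Plane → ℝ} {A : ℝ}
    (hA : ∀ k x, |bsConv k B x| ≤ A) (hdiv : DivFree fun k => bsConv k B)
    (hWm : Measurable W) (hWb : ∀ x, |W x| ≤ A) (hWe : pseudoPot B V =ᵐ[volume] W)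
    (hv : IsMagGrad (gauge0 B₀) u v)
    (hY : ∀ φ : Plane → ℂ, IsTest φ →
      ∑ k, ∫ x, v k x * conj (covDeriv (gauge0 B₀) k φ x) = ∫ x, Y x * conj (φ x))
    (hsum : ∀ φ : Plane → ℂ, IsTest φ →
      ∑ k, ∫ x, u x * conj ((bsConv k B x : ℂ) * covDeriv (gauge0 B₀) k φ x)
        = ∑ k, ∫ x, v k x * conj ((bsConv k B x : ℂ) * φ x))
    (hs : ∀ᵐ x, s x = ∑ k, 2 * (bsConv k B x : ℂ) * v k x + (W x : ℂ) * u x) :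
    IsH B₀ B V u (Y + s) := by
  have hm := hdiv.1
  have hAu : ∀ k, MemLp (fun x => (bsConv k B x : ℂ) * u x) 2 volume := fun k =>
    memLp_bdd_mul (hm k) (hA k) u
  -- Subtracting `A_ε` from the gauge adds `A_ε u` to the magnetic gradient.
  set v' : Fin 2 → L2 ℂ := fun k => v k + (hAu k).toLp _ with hv'
  have hv'e : ∀ (k : Fin 2) (ψ : Plane → ℂ), ∫ x, v' k x * conj (ψ x)
      = ∫ x, (v k x * conj (ψ x) + u x * conj ((bsConv k B x : ℂ) * ψ x)) := fun k ψ => by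
    refine integral_congr_ae ?_
    filter_upwards [Lp.coeFn_add (v k) ((hAu k).toLp _), (hAu k).coeFn_toLp] with x h1 h2
    rw [h1, Pi.add_apply, h2, map_mul, Complex.conj_ofReal]
    ring
  have m1 : ∀ (k : Fin 2) {φ : Plane → ℂ}, IsTest φ →
      MemLp (fun x => (bsConv k B x : ℂ) * φ x) 2 volume := fun k φ hφ =>
    memLp_bdd_mul_isTest (hm k) (hA k) hφ 2
  refine ⟨v', fun k φ hφ => ?_, fun φ hφ => ?_⟩
  · rw [hv'e, integral_add (integrable_L2_mul_conj _ (hφ.memLp 2))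
      (integrable_L2_mul_conj _ (m1 k hφ)), hv k φ hφ,
      ← integral_add (integrable_L2_mul_conj _ (hφ.covDeriv.memLp 2))
      (integrable_L2_mul_conj _ (m1 k hφ))]
    refine integral_congr_ae (ae_of_all _ fun x => ?_)
    simp only [covDeriv_sub, gauge_apply, map_add, mul_add]
  · have m2 : ∀ k, MemLp (fun x => ((bsConv k B x ^ 2 : ℝ) : ℂ) * φ x) 2 volume := fun k =>
      memLp_bdd_mul_isTest ((hm k).pow_const 2) (C := A ^ 2) (fun x => by
        rw [abs_pow]
        exact pow_le_pow_left₀ (abs_nonneg _) (hA k x) 2) hφ 2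
    have m3 : MemLp (fun x => (W x : ℂ) * φ x) 2 volume := memLp_bdd_mul_isTest hWm hWb hφ 2
    have e1 : ∀ k, ∫ x, v' k x * conj (covDeriv (fun x => gauge0 B₀ x - gauge B x) k φ x)
        = ((∫ x, v k x * conj (covDeriv (gauge0 B₀) k φ x))
          + ∫ x, v k x * conj ((bsConv k B x : ℂ) * φ x))
          + ((∫ x, u x * conj ((bsConv k B x : ℂ) * covDeriv (gauge0 B₀) k φ x))
          + ∫ x, u x * conj (((bsConv k B x ^ 2 : ℝ) : ℂ) * φ x)) := fun k => by
      have i1 := integrable_L2_mul_conj (v k) (hφ.covDeriv (B₀ := B₀) (k := k) |>.memLp 2)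
      have i2 := integrable_L2_mul_conj (v k) (m1 k hφ)
      have i3 := integrable_L2_mul_conj u (m1 k (hφ.covDeriv (B₀ := B₀) (k := k)))
      have i4 := integrable_L2_mul_conj u (m2 k)
      rw [hv'e, ← integral_add i1 i2, ← integral_add i3 i4]
      refine Eq.trans ?_ (integral_add (i1.add i2) (i3.add i4))
      refine integral_congr_ae (ae_of_all _ fun x => ?_)
      simp only [covDeriv_sub, gauge_apply, map_add, map_mul, Complex.ofReal_pow, map_pow]
      ring
    -- Written as `V = W - ‖A_ε‖²`, so that the subtracted square cancels the one produced by
    -- expanding the form in `e1`.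
    have e2 : ∫ x, (V x : ℂ) * u x * conj (φ x) = (∫ x, u x * conj ((W x : ℂ) * φ x))
        - ∑ k, ∫ x, u x * conj (((bsConv k B x ^ 2 : ℝ) : ℂ) * φ x) := by
      rw [← integral_finsetSum _ fun k _ => integrable_L2_mul_conj u (m2 k),
        ← integral_sub (integrable_L2_mul_conj u m3)
          (integrable_finsetSum _ fun k _ => integrable_L2_mul_conj u (m2 k))]
      refine integral_congr_ae ?_
      filter_upwards [hWe] with x hx
      simp only [map_mul, Complex.conj_ofReal, Fin.sum_univ_two]
      rw [← hx, pseudoPot_eq, Fin.sum_univ_two, Complex.ofReal_add, Complex.ofReal_add]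
      ring
    have e3 : ∫ x, (Y + s) x * conj (φ x) = (∫ x, Y x * conj (φ x))
        + (2 * (∑ k, ∫ x, v k x * conj ((bsConv k B x : ℂ) * φ x))
          + ∫ x, u x * conj ((W x : ℂ) * φ x)) := by
      have i1 : ∀ k, Integrable (fun x => v k x * conj ((bsConv k B x : ℂ) * φ x)) volume :=
        fun k => integrable_L2_mul_conj (v k) (m1 k hφ)
      have i2 := integrable_L2_mul_conj u m3
      rw [integral_add_mul_conj _ _ hφ.1.continuous hφ.2,
        ← integral_finsetSum _ fun k _ => i1 k, ← integral_const_mul,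
        ← integral_add ((integrable_finsetSum _ fun k _ => i1 k).const_mul 2) i2]
      congr 1
      refine integral_congr_ae ?_
      filter_upwards [hs] with x hx
      rw [hx]
      simp only [map_mul, Complex.conj_ofReal, Fin.sum_univ_two]
      ring
    -- Because `A_ε` is divergence free, `hsum` turns the cross term with the derivative on `φ` into
    -- the one with the derivative on `u`; together they give the factor `2`.
    rw [e2, e3, Finset.sum_congr rfl fun k _ => e1 k, Finset.sum_add_distrib,
      Finset.sum_add_distrib, Finset.sum_add_distrib, hY φ hφ, hsum φ hφ]
    ring

end Main





/-! ### The operator `H_ε M` as an integral operator -/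

section Main

variable {B₀ ε b G Q : ℝ} {B V : Plane → ℝ} {g : Plane → ℂ} {d : Fin 2 → Plane → ℂ}

lemma weakDeriv_zero_ae_eq {f : Plane → ℝ} (hf : LocallyIntegrable f volume)
    (θ : Fin 0 → Fin 2) : weakDeriv θ f =ᵐ[volume] f := by
  have h : IsWeakDeriv θ f f := ⟨hf, hf, fun φ _ => by simp⟩
  exact (isWeakDeriv_weakDeriv ⟨f, h⟩).ae_eq h

/-- The operator `H_ε M` is bounded, with Schatten norm controlled by the kernel bounds. -/
lemma exists_heps (hε : 0 ≤ ε) (hB : 0 < B₀) {I : Set ℕ} (hI : Iᶜ.Finite) {ζ : ℂ}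
    (hζ : ζ ∉ levels B₀ I) (hb : 0 < b) (h : IsMagKer B₀ b G g d) (hg : twOp B₀ g = M B₀ I ζ)
    (hG : 0 ≤ G) (hQ : 0 ≤ Q) (hA : ∀ k x, 2 * |bsConv k B x| ≤ Q * wt ε x)
    (hdiv : DivFree fun k => bsConv k B) (hW : WtBdd ε Q (pseudoPot B V)) :
    ∃ (S : L2 ℂ →L[ℂ] L2 ℂ) (K : Plane → Plane → ℂ), HasKer S K ∧
      StronglyMeasurable (Function.uncurry K) ∧
      (∀ x y, ‖K x y‖ ≤ 3 * Q * G * wt ε x * singGauss b (x - y)) ∧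
      ∀ f, IsHeps B₀ B V (M B₀ I ζ f) (S f) := by
  obtain ⟨W, hWm, hWe, hWb⟩ := hW.exists_measurable hQ
  have hm := hdiv.1
  set α : Fin 2 → Plane → ℂ := fun k x => 2 * (bsConv k B x : ℂ) with hα
  set β : Plane → ℂ := fun x => (W x : ℂ) with hβ
  have hαm : ∀ k, Measurable (α k) := fun k => (Complex.measurable_ofReal.comp (hm k)).const_mul 2
  have hβm : Measurable β := Complex.measurable_ofReal.comp hWm
  have hαb : ∀ k x, ‖α k x‖ ≤ Q * wt ε (x + 0) := fun k x => by
    simpa only [hα, norm_mul, Complex.norm_real, Real.norm_eq_abs, add_zero, Complex.norm_ofNat]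
      using hA k x
  have hβb : ∀ x, ‖β x‖ ≤ Q * wt ε (x + 0) := fun x => by
    simpa only [hβ, Complex.norm_real, Real.norm_eq_abs, add_zero] using hWb x
  obtain ⟨S, hS, hSf⟩ := exists_combOp hε hb h hG hQ hαm hβm hαb hβb
  refine ⟨S, _, hS, stronglyMeasurable_combKer h hαm hβm, fun x y => ?_, fun f => ?_⟩
  · simpa only [add_zero] using norm_combKer_le h hG hQ hαb hβb x y
  have hv : ∀ f, IsMagGrad (gauge0 B₀) (M B₀ I ζ f) fun k => twOp B₀ (d k) f := fun f => by
    rw [← hg]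
    exact h.isMagGrad hb f
  obtain ⟨Y, hY⟩ := exists_isH0_M hB hI hζ hv
  have hle : ∀ x, Q * wt ε x ≤ Q := fun x => mul_le_of_le_one_right hQ (wt_le_one hε x)
  refine ⟨Y f + S f, Y f, ?_, (hY f).2, (add_sub_cancel_left _ _).symm⟩
  refine isH_of_isMagGrad (A := Q) (fun k x => ?_) hdiv hWm (fun x => (hWb x).trans (hle x)) hWe
    -- The weighted form of `MG`, with `A_ε` itself as the divergence free weight, supplies the
    -- symmetry of the cross terms.
    (hv f) (hY f).1 (fun φ hφ => ?_) ?_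
  · linarith [hA k x, hle x, abs_nonneg (bsConv k B x)]
  · have := h.mg.sum_integral (h.integrable hb) (fun k => h.integrable_d hb k)
      (hasKer_twOp B₀ h.sm (h.integrable hb))
      (fun k => hasKer_twOp B₀ (h.smd k) (h.integrable_d hb k)) f hdiv hφ
    rwa [hg] at this
  · filter_upwards [hSf f] with x hx
    rw [hx, hg]

end Main


end Landau

end

/-! ### Assembly of the estimates -/

theorem mainTheorem7 (B₀ ε : ℝ) (hB₀ : 0 < B₀) (hε₀ : 0 < ε) (hε₁ : ε < 1)
    (γ : ℕ) (I : Set ℕ) (hI : Iᶜ.Finite) (κ : ℝ) (R : NNReal)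
    (n₀ : ℕ) (hn₀ : IsLeast {n : ℕ | 1 < 2 * (n : ℝ) * ε} n₀) :
    ∃ F : ℂ → ℝ, Landau.IsLocBdd (Landau.levels B₀ I)ᶜ F ∧ ∃ lam : ℝ, 0 < lam ∧
      ∀ B V : Landau.Plane → ℝ, Landau.Tame γ ε B V →
        Landau.weightedNorm γ (1 + ε) B ≤ R → Landau.weightedNorm γ ε V ≤ R →
        ∀ ζ : ℂ, ζ ∉ Landau.levels B₀ I →
          HasSum (Landau.resolventTerm B₀ I ζ) (Landau.M B₀ I ζ) ∧
          (∀ d ≤ γ, ∀ x₀ : Landau.Plane,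
            ∃ T : Landau.L2 ℂ →L[ℂ] Landau.L2 (Landau.Tens d),
              (∀ f : Landau.L2 ℂ,
                Landau.IsHepsDeriv κ B₀ B V x₀ d (Landau.M B₀ I ζ f) (T f)) ∧
              ‖T‖ ≤ F ζ ∧
              ∃ t : Landau.Plane → Landau.Plane → Landau.Tens d,
                Landau.HasKernel T t ∧ Landau.IsNice t ∧
                ∀ x y : Landau.Plane, x ≠ y →
                  ‖t x y‖ ≤ F ζ * ((Landau.b1 B₀ x y + Real.exp (-lam * ‖x - y‖ ^ 2)) /
                    (1 + ‖x + x₀‖) ^ ε)) ∧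
          (∃ S : Landau.L2 ℂ →L[ℂ] Landau.L2 ℂ,
            (∀ f : Landau.L2 ℂ, Landau.IsHeps B₀ B V (Landau.M B₀ I ζ f) (S f)) ∧
            Landau.MemSchatten (4 * (n₀ : ℝ)) S ∧
            Landau.schattenNorm (4 * (n₀ : ℝ)) S ≤ ENNReal.ofReal (F ζ)) := by
  open Landau in
  -- Nonemptiness makes the distance from `ζ` to the set of levels positive; for the empty set
  -- `Metric.infDist` is `0`.
  have hI' : I.Nonempty := by
    by_contra h
    rw [Set.not_nonempty_iff_eq_empty] at h
    rw [h, Set.compl_empty] at hI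
    exact Set.infinite_univ hI
  have hn₀' : 1 < 2 * (n₀ : ℝ) * ε := hn₀.1
  have hn₀0 : n₀ ≠ 0 := by
    rintro rfl
    norm_num at hn₀'
  obtain ⟨b, C, hb, hC, hker⟩ := exists_kernel_M hB₀ hI hI'
  obtain ⟨C₁, hC₁, hbs⟩ := exists_abs_bsConv_le hε₀ hε₁
  obtain ⟨C₂, hC₂, hpot⟩ := exists_sobBdd_pseudoPot hε₀ hε₁ γ R
  obtain ⟨D, hD, hsch⟩ := exists_schattenNorm_le hε₀.le hε₁.le hb hn₀0 hn₀'
  have hR : (0 : ℝ) ≤ R := R.2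
  -- A common bound for all coefficients: `|κ|` comes from the first claim, `2` from the first order
  -- part of `H_ε`, and `C₂` from the pseudo potential.
  set Q := (|κ| + 2) * (C₁ * R) + C₂ with hQ
  have hQ0 : 0 ≤ Q := by positivity
  have hJ : 0 ≤ ∫ w, singGauss b w := integral_nonneg fun w => singGauss_nonneg b w
  -- The three summands serve the operator norm, the comparison with `b1`, and the Schatten norm, in
  -- this order.
  set c := (∫ w, singGauss b w) + (1 + √B₀) + D with hc
  have hsB := Real.sqrt_nonneg B₀
  have hF : ∀ ζ, 2 ^ γ * (3 * Q * C) * c * growth B₀ I ζ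
      = 2 ^ γ * (3 * Q * (C * growth B₀ I ζ)) * c := fun ζ => by ring
  refine ⟨fun ζ => 2 ^ γ * (3 * Q * C) * c * growth B₀ I ζ, isLocBdd_growth hB₀ hI' _, b, hb,
    fun B V hT hBR hVR ζ hζ => ⟨hasSum_resolventTerm hB₀ I ζ, fun d hd x₀ => ?_, ?_⟩⟩
  all_goals
    obtain ⟨g, D', hg, hgM⟩ := hker ζ hζ
    have hG : 0 ≤ C * growth B₀ I ζ := mul_nonneg hC (growth_nonneg _ _ _)
    have hW := hpot B V hT hBR hVR
    have hC₂Q : C₂ ≤ Q := by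
      rw [hQ]
      have : 0 ≤ (|κ| + 2) * (C₁ * R) := by positivity
      linarith
    beta_reduce
    rw [hF]
  · have hBb : ∀ (θ : Fin d → Fin 2) k x, |κ| * |bsConv k (weakDeriv θ B) x| ≤ Q * wt ε x :=
      fun θ k x => by
        have h1 := (hbs R _ hR (hT.2.wtBdd hBR hd θ).2 k x).2
        have h2 := (wt_pos ε x).le
        calc _ ≤ |κ| * (C₁ * R * wt ε x) := by gcongr
          _ = |κ| * (C₁ * R) * wt ε x := by ring
          _ ≤ _ := by
            gcongr
            rw [hQ]
            nlinarith [mul_nonneg hC₁ hR]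
    obtain ⟨T, hTf, hTn, t, ht, htn, htb⟩ := exists_hepsDeriv hε₀.le hb hg hG hQ0 x₀
      (fun θ => (hT.2.wtBdd hBR hd θ).2.1) hBb
      (fun θ => (hW.weakDeriv hε₀.le hC₂ hd θ).mono hC₂Q)
    have hpow : (2 : ℝ) ^ d ≤ 2 ^ γ := pow_le_pow_right₀ one_le_two hd
    refine ⟨T, fun f => by rw [← hgM]; exact hTf f, hTn.trans ?_, t, ht, htn, fun x y hxy =>
      (htb x y).trans ?_⟩
    · gcongr
      rw [hc]
      linarith
    · have hw : wt ε (x + x₀) = 1 / (1 + ‖x + x₀‖) ^ ε := by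
        rw [wt, Real.rpow_neg (by positivity), one_div]
      have hw0 := (wt_pos ε (x + x₀)).le
      have hs := singGauss_le_b1 hB₀ hb hxy
      have hs0 := singGauss_nonneg b (x - y)
      have hE : 0 ≤ b1 B₀ x y + Real.exp (-b * ‖x - y‖ ^ 2) := by
        by_contra hneg
        push Not at hneg
        nlinarith
      rw [div_eq_mul_one_div (b1 B₀ x y + _), ← hw]
      calc _ ≤ 2 ^ γ * (3 * Q * (C * growth B₀ I ζ)) * wt ε (x + x₀)
            * (c * (b1 B₀ x y + Real.exp (-b * ‖x - y‖ ^ 2))) := by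
            gcongr
            refine hs.trans ?_
            gcongr
            rw [hc]
            linarith
        _ = _ := by ring
  · have hB0 := hT.2.wtBdd hBR (Nat.zero_le γ) ![]
    have hBw : WtBdd (1 + ε) R B := hB0.2.congr (weakDeriv_zero_ae_eq hB0.1.1 _)
    have hA : ∀ k x, 2 * |bsConv k B x| ≤ Q * wt ε x := fun k x => by
      have h1 := (hbs R B hR hBw k x).2
      have h2 := (wt_pos ε x).le
      calc _ ≤ 2 * (C₁ * R * wt ε x) := by gcongr
        _ = 2 * (C₁ * R) * wt ε x := by ring
        _ ≤ _ := by
          gcongr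
          rw [hQ]
          nlinarith [mul_nonneg hC₁ hR, mul_nonneg (abs_nonneg κ) (mul_nonneg hC₁ hR)]
    obtain ⟨S, K, hS, hK, hKb, hSf⟩ := exists_heps hε₀.le hB₀ hI hζ hb hg hgM hG hQ0 hA
      (divFree_bsConv hε₀ hε₁ hR hBw) (hW.wtBdd.mono hC₂Q)
    obtain ⟨h1, h2⟩ := hsch (3 * Q * (C * growth B₀ I ζ)) K S (by positivity) hS hK hKb
    refine ⟨S, hSf, h1, h2.trans (ENNReal.ofReal_le_ofReal ?_)⟩
    rw [mul_comm D]
    have hγ : (1 : ℝ) ≤ 2 ^ γ := one_le_pow₀ one_le_two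
    have hDc : D ≤ c := by rw [hc]; linarith
    exact mul_le_mul (le_mul_of_one_le_left (by positivity) hγ) hDc hD (by positivity)
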